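/- **Setting.** Let $\mathcal X$ be a data universe. A data tree over $\mathcal X$ is a finite rooted tree $\mathcal T$, chosen independently of the data, in which every $x\in\mathcal X$ is assigned to one leaf. Its height is the largest number of nodes on a root-to-leaf path (both endpoints included), and the root has level $0$. For a dataset $D\in\mathcal X^n$, $\#count(u)$ is the number of points of $D$ whose leaf is $u$ or a descendant of $u$. Two datasets are neighbors if one arises from the other by adding a single record. A mechanism $\mathcal M$ is $(\varepsilon,\delta)$-DP if $\Pr[\mathcal M(D)\in S]\le e^{\varepsilon}\Pr[\mathcal M(D')\in S]+\delta$ for all neighbors $D,D'$ and all sets $S$ of outputs. $\Phi$ is the standard normal distribution function. **GaussianSparseThreshold** with parameters $\sigma>0$, $\tau,\Delta\in\mathbb R$, on a query with true answer $c$: draw a fresh $Z\sim\mathcal N(0,\sigma^2)$ and release $\top$ if $c>\tau-\Delta-1$ and $c+Z>\tau$; otherwise release $\bot$. **MarkHeavyHitters**$(\mathcal T,h)$, for a tree $\mathcal T$ of height (at most) $h$, with mark updates applied to the nodes of the original tree: 1. For every node $u$ of level $\lfloor h/2\rfloor$ that is unmarked, run GaussianSparseThreshold on $\#count(u)$. If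 it releases $\top$, mark $u$ and all its ancestors Heavy; otherwise mark $u$ and all its descendants Light. 2. If $h\ge 3$: for every node $v$ of level $\lfloor h/2\rfloor+1$ that is not marked Light, call MarkHeavyHitters$(\mathcal T_v,\,h-\lfloor h/2\rfloor-1)$, where $\mathcal T_v$ is the subtree of $\mathcal T$ rooted at $v$. 3. If $h\ge 2$: call MarkHeavyHitters$(\hat{\mathcal T},\lfloor h/2\rfloor)$, where $\hat{\mathcal T}$ is $\mathcal T$ restricted to the levels $0,\dots,\lfloor h/2\rfloor-1$. Let $\mathcal A$ be the algorithm that, on $k\ge 1$ data trees of height at most $h$ and a dataset $D$, runs MarkHeavyHitters on each tree (initially unmarked, with its own height) and outputs the marks of all nodes. **Theorem.** (1) *Privacy.* Let $\sigma>0$, $\tau,\Delta\in\mathbb R$, $\varepsilon\ge 0$, $m=k(1+\lfloor\log_2 h\rfloor)$, $p=\Phi(\Delta/\sigma)$, $\gamma(j)=(m-j)\log p$, and $$G_j(s)=\Phi\!\left(\frac{\sqrt j}{2\sigma}-\frac{s\sigma}{\sqrt j}\right)-e^{s}\,\Phi\!\left(-\frac{\sqrt j}{2\sigma}-\frac{s\sigma}{\sqrt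 j}\right),$$ If $$\delta\ \ge\ \max\Big[\,1-p^{m},\ \max_{1\le j\le m}\big(1-p^{m-j}+p^{m-j}\,G_j(\varepsilon-\gamma(j))\big),\ \max_{1\le j\le m}G_j(\varepsilon+\gamma(j))\Big],$$ then $\mathcal A$ (as a function of $D$, for fixed trees) is $(\varepsilon,\delta)$-DP. (2) *Accuracy.* Let $\sigma>0$, $\Delta\ge 0$, $\tau\ge 1+\Delta$, $\beta>0$, $n\ge 1$, and $$\alpha=\sigma\sqrt{2\ln\!\big(2kn\lceil\log_2(h+1)\rceil/\beta\big)}$$ (with the root read as $0$ if the logarithm is negative, which can happen only for $\beta>1$). For every $D\in\mathcal X^n$, with probability at least $1-\beta$, in all $k$ trees simultaneously, $\mathcal A$ marks every node with $\#count\le\tau-\alpha$ Light and every node with $\#count\ge\tau+\alpha$ Heavy. (3) *Running time.* Let the trees be binary (every node has at most a left and a right child). There is one fixed program of a unit-cost random access machine that, for all $k,h,n\ge 1$, all $k$ binary data trees of height at most $h$, all $D\in\mathcal X^n$, all $\sigma>0$ and all $\Delta,\tau$ with $\tau\ge 1+\Delta$, outputs the set of nodes marked Heavy, with exactly the same output distribution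 as the set of nodes marked Heavy by $\mathcal A$, in $O(knh)$ steps and using $O(knh)$ memory and output cells of $O(h+\log(kn))$ bits each. Here one call of GaussianSparseThreshold is one step (a Gaussian is sampled in time $O(1)$), the left/right decision taken at one level of one tree by one data point is read in one step, and a node is output as its tree index and its heap label (the root has label $1$, the children of label $a$ have labels $2a$ and $2a+1$). -/

import Mathlib

open MeasureTheory ProbabilityTheory

noncomputable section

namespace HeavyHitters

/-! ### Hierarchical data -/

/-- A finite rooted tree whose leaves partition the data universe `X`.  A node is the list of
child indices on the path leading to it from the root, so the root is `[]`, the children of `u`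
are the nodes `u ++ [c]`, the level of `u` is `u.length`, and `u` is an ancestor of `w` (or equal
to it) iff `u <+: w`, that is, `u` is a prefix of `w`.  Every data point belongs to one leaf.  The
tree does not depend on the dataset. -/
structure DataTree (X : Type*) where
  nodes : Finset (List ℕ)
  root_mem : [] ∈ nodes
  parent_mem : ∀ (u : List ℕ) (c : ℕ), u ++ [c] ∈ nodes → u ∈ nodes
  leafOf : X → List ℕ
  leafOf_mem : ∀ x, leafOf x ∈ nodes
  leafOf_isLeaf : ∀ x c, leafOf x ++ [c] ∉ nodes

namespace DataTree

variable {X : Type*}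

/-- The height: the largest number of nodes on a root-to-leaf path, both endpoints included. -/
def height (T : DataTree X) : ℕ := T.nodes.sup List.length + 1

/-- `#count(u)`: the number of data points (with multiplicity) whose leaf lies below `u`. -/
def count (T : DataTree X) (D : List X) (u : List ℕ) : ℕ :=
  D.countP fun x => decide (u <+: T.leafOf x)

/-- Every node has at most a left child (index `0`) and a right child (index `1`). -/
def IsBinary (T : DataTree X) : Prop := ∀ u ∈ T.nodes, ∀ c ∈ u, c < 2

/-- The nodes at level `l` of the subtree rooted at `v`, from left to right. -/
def levelBelow (T : DataTree X) (v : List ℕ) (l : ℕ) : List (List ℕ) :=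
  (T.nodes.filter fun u => v <+: u ∧ u.length = v.length + l).sort (· ≤ ·)

end DataTree

/-! ### The algorithms -/

/-- The two marks that a node can receive. -/
inductive Label
  | heavy
  | light

/-- A (partial) marking of the nodes; `none` means unmarked. -/
abbrev Marking := List ℕ → Option Label

variable {X : Type*}

/-- Mark `u` and all its ancestors as heavy. -/
def markHeavy (u : List ℕ) (M : Marking) : Marking :=
  fun w => if w <+: u then some Label.heavy else M w

/-- Mark `u` and all its descendants in `T` as light. -/
def markLight (T : DataTree X) (u : List ℕ) (M : Marking) : Marking :=
  fun w => if w ∈ T.nodes ∧ u <+: w then some Label.light else M w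

open Classical in
/-- Phase 1 at one node `u` of the middle layer: nothing happens if `u` is already marked. -/
def phaseOne (T : DataTree X) (D : List X) (check : ℕ → PMF Bool) (M : Marking) (u : List ℕ) :
    PMF Marking :=
  if M u = none then
    (check (T.count D u)).bind fun answer =>
      PMF.pure (if answer = true then markHeavy u M else markLight T u M)
  else PMF.pure M

open Classical in
/-- `MarkHeavyHitters`, started in the marking `M` on the tree that consists of the `h` topmost
layers of the subtree of `T` rooted at `v`.  The primitive `check` is the randomized threshold
test; every call to it uses fresh, independent randomness. -/
def markHeavyHitters (T : DataTree X) (D : List X) (check : ℕ → PMF Bool)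
    (v : List ℕ) (h : ℕ) (M : Marking) : PMF Marking :=
  -- Phase 1: the middle layer
  ((T.levelBelow v (h / 2)).foldlM (phaseOne T D check) M).bind fun M₁ =>
  -- Phase 2: the subtrees below the middle layer whose root is not marked light
  (if _h3 : 3 ≤ h then
    (T.levelBelow v (h / 2 + 1)).foldlM
      (fun M' w =>
        if M' w = some Label.light then PMF.pure M'
        else markHeavyHitters T D check w (h - h / 2 - 1) M') M₁
  else PMF.pure M₁).bind fun M₂ =>
  -- Phase 3: the layers above the middle layer
  if _h2 : 2 ≤ h then markHeavyHitters T D check v (h / 2) M₂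
  else PMF.pure M₂
termination_by h
decreasing_by all_goals omega

/-- The comparison made for a query with true answer `c` and noise `z`. -/
def thresholdTest (τ Δ : ℝ) (c : ℕ) (z : ℝ) : Prop := τ - Δ - 1 < (c : ℝ) ∧ τ < (c : ℝ) + z

open Classical in
theorem measurable_thresholdTest (τ Δ : ℝ) (c : ℕ) :
    Measurable fun z : ℝ => decide (thresholdTest τ Δ c z) := by
  have hs : MeasurableSet {z : ℝ | thresholdTest τ Δ c z} :=
    (MeasurableSet.const _).inter (measurableSet_lt measurable_const (measurable_const.add measurable_id))
  refine measurable_to_bool ?_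
  have : (fun z : ℝ => decide (thresholdTest τ Δ c z)) ⁻¹' {true} =
      {z : ℝ | thresholdTest τ Δ c z} := by
    ext z; simp
  rw [this]; exact hs

open Classical in
/-- `GaussianSparseThreshold` on one query with true answer `c`: draw `Z ∼ N(0, σ²)` and release
`⊤` iff `c > τ - Δ - 1` and `c + Z > τ`. -/
def gaussianSparseThreshold (σ τ Δ : ℝ) (c : ℕ) : PMF Bool :=
  haveI : IsProbabilityMeasure ((gaussianReal 0 (σ ^ 2).toNNReal).map
      fun z => decide (thresholdTest τ Δ c z)) :=
    Measure.isProbabilityMeasure_map (measurable_thresholdTest τ Δ c).aemeasurable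
  ((gaussianReal 0 (σ ^ 2).toNNReal).map fun z => decide (thresholdTest τ Δ c z)).toPMF

/-- The algorithm `𝒜`: run `MarkHeavyHitters` on each of the `k` trees, one after the other, every
tree starting unmarked and with its own height; the output is the marking of all trees. -/
def buildForest {k : ℕ} (σ τ Δ : ℝ) (T : Fin k → DataTree X) (D : List X) :
    PMF (Fin k → Marking) :=
  (List.finRange k).foldlM
    (fun S i =>
      (markHeavyHitters (T i) D (gaussianSparseThreshold σ τ Δ) [] (T i).height
        (fun _ => none)).bind fun M => PMF.pure (Function.update S i M))
    (fun _ _ => none)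

/-! ### Differential privacy -/

/-- Neighbouring datasets: one arises from the other by adding a single record. -/
def Neighbors (D D' : List X) : Prop :=
  ∃ (l₁ l₂ : List X) (x : X),
    (D = l₁ ++ l₂ ∧ D' = l₁ ++ x :: l₂) ∨ (D' = l₁ ++ l₂ ∧ D = l₁ ++ x :: l₂)

/-- `(ε, δ)`-differential privacy of a mechanism with discrete output distributions. -/
def IsDP {Z : Type*} (mech : List X → PMF Z) (ε δ : ℝ) : Prop :=
  ∀ D D' : List X, Neighbors D D' → ∀ S : Set Z,
    (mech D).toOuterMeasure S ≤
      ENNReal.ofReal (Real.exp ε) * (mech D').toOuterMeasure S + ENNReal.ofReal δ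

/-- The standard normal distribution function `Φ`. -/
def Phi (x : ℝ) : ℝ := cdf (gaussianReal 0 1) x

/-- `Φ(√j/(2σ) - eσ/√j) - exp(e) Φ(-√j/(2σ) - eσ/√j)`. -/
def gaussianProfile (σ : ℝ) (j : ℕ) (e : ℝ) : ℝ :=
  Phi (√(j : ℝ) / (2 * σ) - e * σ / √(j : ℝ))
    - Real.exp e * Phi (-(√(j : ℝ) / (2 * σ)) - e * σ / √(j : ℝ))

/-- `γ(j) = (m - j) log Φ(Δ/σ)`. -/
def gammaTerm (σ Δ : ℝ) (m j : ℕ) : ℝ := ((m : ℝ) - (j : ℝ)) * Real.log (Phi (Δ / σ))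

/-- `δ` is at least the maximum of `1 - Φ(Δ/σ)^m` and, over `1 ≤ j ≤ m`, of the two expressions
below. -/
def DeltaCondition (σ Δ ε δ : ℝ) (m : ℕ) : Prop :=
  1 - Phi (Δ / σ) ^ m ≤ δ ∧
  (∀ j ∈ Finset.Icc 1 m,
    1 - Phi (Δ / σ) ^ (m - j)
      + Phi (Δ / σ) ^ (m - j) * gaussianProfile σ j (ε - gammaTerm σ Δ m j) ≤ δ) ∧
  (∀ j ∈ Finset.Icc 1 m, gaussianProfile σ j (ε + gammaTerm σ Δ m j) ≤ δ)

/-! ### A unit-cost random access machine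

Programs of a small imperative language over a memory of natural-number cells.  Read-only input:
the numbers of trees and of data points, the heights of the trees and, for each tree and each data
point, the successive left/right decisions that lead the point to its leaf, each readable in one
step.  Calls to the threshold test, which draw one Gaussian sample, are single steps too. -/

/-- The input as seen by the machine. -/
structure RamInput where
  numTrees : ℕ
  numPoints : ℕ
  height : ℕ → ℕ
  branch : ℕ → ℕ → ℕ → ℕ

/-- Arithmetic expressions. -/
inductive RamExpr
  | lit (a : ℕ)
  | mem (addr : RamExpr)
  | add (a b : RamExpr)
  | sub (a b : RamExpr)
  | mul (a b : RamExpr)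
  | div (a b : RamExpr)
  | numTrees
  | numPoints
  | height (tree : RamExpr)
  | branch (tree point level : RamExpr)

/-- Value of an expression (natural-number subtraction and division). -/
def RamExpr.eval (I : RamInput) (m : ℕ → ℕ) : RamExpr → ℕ
  | .lit a => a
  | .mem a => m (a.eval I m)
  | .add a b => a.eval I m + b.eval I m
  | .sub a b => a.eval I m - b.eval I m
  | .mul a b => a.eval I m * b.eval I m
  | .div a b => a.eval I m / b.eval I m
  | .numTrees => I.numTrees
  | .numPoints => I.numPoints
  | .height i => I.height (i.eval I m)
  | .branch i j l => I.branch (i.eval I m) (j.eval I m) (l.eval I m)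

/-- Programs.  `store a e` writes the value of `e` to the cell `a`; `check a c` runs the threshold
test on the count `c` and writes `1` (for `⊤`) or `0` (for `⊥`) to the cell `a`; `emit a b` appends
the pair of values of `a` and `b` to the output; conditions hold iff their value is nonzero. -/
inductive RamProg
  | store (addr e : RamExpr)
  | check (addr c : RamExpr)
  | emit (a b : RamExpr)
  | seq (p q : RamProg)
  | ifElse (e : RamExpr) (p q : RamProg)
  | loop (e : RamExpr) (p : RamProg)

/-- A configuration: what is still to be executed, the memory, and the output so far.  As there
are no procedure calls, the length of `todo` is bounded by the size of the program. -/
structure RamConfig where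
  todo : List RamProg
  mem : ℕ → ℕ
  out : List (ℕ × ℕ)

/-- One step.  A configuration with nothing left to execute has halted. -/
def ramStep (check : ℕ → PMF Bool) (I : RamInput) : RamConfig → PMF RamConfig
  | ⟨[], m, o⟩ => PMF.pure ⟨[], m, o⟩
  | ⟨.store a e :: K, m, o⟩ =>
      PMF.pure ⟨K, Function.update m (a.eval I m) (e.eval I m), o⟩
  | ⟨.check a c :: K, m, o⟩ =>
      (check (c.eval I m)).bind fun answer =>
        PMF.pure ⟨K, Function.update m (a.eval I m) (if answer = true then 1 else 0), o⟩
  | ⟨.emit a b :: K, m, o⟩ => PMF.pure ⟨K, m, o ++ [(a.eval I m, b.eval I m)]⟩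
  | ⟨.seq p q :: K, m, o⟩ => PMF.pure ⟨p :: q :: K, m, o⟩
  | ⟨.ifElse e p q :: K, m, o⟩ =>
      PMF.pure ⟨(if e.eval I m ≠ 0 then p else q) :: K, m, o⟩
  | ⟨.loop e p :: K, m, o⟩ =>
      PMF.pure ⟨if e.eval I m ≠ 0 then p :: .loop e p :: K else K, m, o⟩

/-- The distribution of the configuration after `t` steps. -/
def ramRun (check : ℕ → PMF Bool) (I : RamInput) : ℕ → RamConfig → PMF RamConfig
  | 0, c => PMF.pure c
  | t + 1, c => (ramStep check I c).bind (ramRun check I t)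

/-- The start: all memory cells are zero and the output is empty. -/
def ramInit (prog : RamProg) : RamConfig := ⟨[prog], fun _ => 0, []⟩

/-- The machine's view of the trees `T` and the dataset `D`: `branch i j l` is `0` if the leaf of
the `j`-th data point in tree `i` has level at most `l`, and otherwise `c + 1`, where `c` is the
index of the child taken at level `l` on the path to that leaf.  (Trees and points are numbered
from `0`.) -/
def ramInput {k : ℕ} (T : Fin k → DataTree X) (D : List X) : RamInput where
  numTrees := k
  numPoints := D.length
  height i := if hi : i < k then (T ⟨i, hi⟩).height else 0
  branch i j l :=
    if hi : i < k then
      match D[j]? with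
      | none => 0
      | some x =>
        match ((T ⟨i, hi⟩).leafOf x)[l]? with
        | none => 0
        | some c => c + 1
    else 0

/-- The label of a node of a binary tree: the root has label `1`, and the children of a node with
label `a` have the labels `2a` and `2a + 1`. -/
def nodeLabel (u : List ℕ) : ℕ := u.foldl (fun a c => 2 * a + c) 1

/-- The set of all nodes marked heavy, as pairs (tree, label). -/
def heavySet {k : ℕ} (T : Fin k → DataTree X) (M : Fin k → Marking) : Set (ℕ × ℕ) :=
  {p | ∃ (i : Fin k) (u : List ℕ),
    u ∈ (T i).nodes ∧ M i u = some Label.heavy ∧ p = (i.val, nodeLabel u)}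

/-- On the given input the program halts within `time` steps, uses only the memory cells below
`space` and at most `space` output cells, and never stores a number of more than `word` bits. -/
def RunsWithin (prog : RamProg) (check : ℕ → PMF Bool) (I : RamInput)
    (time space word : ℕ) : Prop :=
  (∀ c ∈ (ramRun check I time (ramInit prog)).support, c.todo = []) ∧
  ∀ t, ∀ c ∈ (ramRun check I t (ramInit prog)).support,
    (∀ a, (c.mem a ≠ 0 → a < space) ∧ c.mem a < 2 ^ word) ∧ c.out.length ≤ space

end HeavyHitters

end

open HeavyHitters

/-!
Each node is tested at most once in a run, so the coin of every node may be tossed before the run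
starts (`markHeavyHitters_eq_coins`). Given the coins, the outcome is a function `heavyNodes`
defined by recursion on intervals of levels (`heavyAt`): the middle level of an interval is decided
by its coins and by the two levels adjacent to the interval, and the halves above and below it do
not interact afterwards. If moreover the coins off a root-to-node path are fixed, the run performs a
binary search on that path, of depth at most `n` when the height is less than `2 ^ n`
(`exists_searchTree`).

*Accuracy.* If no test gives an answer that is wrong by `α` or more, every mark is accurate
(`heavyAt_accurate`). Nodes without data points are never released, hence only tests on the paths of
data points can go wrong. A Gaussian tail bound and a union bound over the trees, the data points
and the steps of the binary searches conclude (`measure_inaccurate_le`, `buildForest_accuracy`).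

*Privacy.* An additional record changes only the counts on one path per tree. What an observer can
gain is expressed by the least total error `P(reject) + eᵛ Q(accept)` of a test between the two
output distributions `P` and `Q`. Along the path, the coins with a count too small to be released
are *passive*: the answer is `⊥` without the record, and also `⊥` with probability at least `p =
Φ(Δ/σ)` with the record. The other ones reveal a Gaussian observation whose mean the record shifts
by `1/σ`. Since counts grow towards the root, a negative Gaussian answer is followed by Gaussian
tests only, so that the search is no easier for the observer to exploit than a *spine* in which each
further passive test is answered negatively (`exists_spineValue_le_expect`). In a spine the number
of Gaussian tests is random, but it is an antitone function of the observations. A rotation of the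
Gaussian observations combines the tests that are certainly Gaussian into one
(`Layout.value_rotate`). Error curves for different numbers of Gaussian tests cross at most once
(`testError_crossing`, by total positivity of the Gaussian kernel), and this allows the random
number to be replaced by the best fixed number `j` (`exists_lintegral_le_of_antitone`,
`Mixture.exists_testError_le`). With `j` Gaussian tests and `m - j` passive ones the error is
explicit: `testError_amp_eq` expresses it by `gaussianProfile`, and `buildForest_isDP` treats the
addition and the removal of a record with `v = ε` and `v = -ε`.

*Running time.* For each tree the program builds the trie of the paths of all data points, with
counts, in a table whose rows are indexed by data points: a node is represented by the first data
point that passes through it (`rep`). It tosses one coin for each table entry (`good_coins`);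
entries that represent no node have count `0`, and their coin is `false` because `τ ≥ 1 + Δ`. The
recursion needs no stack, since its intervals of levels can be treated in breadth-first order
(`interval`): the levels next to an interval are then complete (`levelDone_adjacent`), and each
interval costs `O(n)`, as each data point checks whether its node of the middle level is heavy
(`HeavySpec`, `triple_heavy`). The program is verified in continuation-passing style: `Good`
describes the future of a configuration, and `Triple` the effect of a program without random choices
(`forestProg_correct`).
-/

noncomputable section

namespace HeavyHitters

section

/-! ### Drawing all coins in advance -/

/-- Independent coins: the coin of `u ∈ us` has law `κ u`; coins outside `us` are `false`. -/
def coins {ι : Type} [DecidableEq ι] (κ : ι → PMF Bool) : List ι → PMF (ι → Bool)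
  | [] => PMF.pure fun _ => false
  | u :: us => (κ u).bind fun b => (coins κ us).bind fun c => PMF.pure (Function.update c u b)

section Coins

variable {ι : Type} [DecidableEq ι]

theorem coins_congr {κ κ' : ι → PMF Bool} {us : List ι} (h : ∀ u ∈ us, κ u = κ' u) :
    coins κ us = coins κ' us := by
  induction us with
  | nil => rfl
  | cons u us ih =>
    simp only [coins]
    rw [h u (by simp), ih fun w hw => h w (by simp [hw])]

/-- The coin of `u` may be drawn before all the other ones. -/
theorem coins_expose (κ : ι → PMF Bool) {us : List ι} (hus : us.Nodup) (u : ι) :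
    coins κ us = (κ u).bind fun b => coins (Function.update κ u (PMF.pure b)) us := by
  induction us with
  | nil => simp [coins]
  | cons v us ih =>
    obtain ⟨hv, hus⟩ := List.nodup_cons.1 hus
    by_cases huv : u = v
    · subst huv
      simp only [coins, Function.update_self, PMF.pure_bind]
      congr 1; funext b
      rw [coins_congr (κ := Function.update κ u (PMF.pure b)) (κ' := κ)]
      intro w hw
      exact Function.update_of_ne (by rintro rfl; exact hv hw) _ _
    · simp only [coins]
      conv_rhs => enter [2, b]; rw [Function.update_of_ne (Ne.symm huv)]
      refine Eq.trans ?_ (PMF.bind_comm _ _ _)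
      congr 1; funext b
      rw [ih hus, PMF.bind_bind]

theorem coins_support_pure {κ : ι → PMF Bool} {us : List ι} {c : ι → Bool}
    (hc : c ∈ (coins κ us).support) {u : ι} {b : Bool} (hu : u ∈ us) (hb : κ u = PMF.pure b) :
    c u = b := by
  induction us generalizing c with
  | nil => simp at hu
  | cons v us ih =>
    simp only [coins, PMF.mem_support_bind_iff, PMF.mem_support_pure_iff] at hc
    obtain ⟨b', hb', c', hc', rfl⟩ := hc
    by_cases huv : u = v
    · subst huv
      rw [hb, PMF.mem_support_pure_iff] at hb'
      simp [hb']
    · rw [Function.update_of_ne huv]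
      exact ih hc' (by simpa [huv] using hu)

theorem coins_support_of_not_mem {κ : ι → PMF Bool} {us : List ι} {c : ι → Bool}
    (hc : c ∈ (coins κ us).support) {u : ι} (hu : u ∉ us) : c u = false := by
  induction us generalizing c with
  | nil => simp only [coins, PMF.mem_support_pure_iff] at hc; simp [hc]
  | cons v us ih =>
    simp only [coins, PMF.mem_support_bind_iff, PMF.mem_support_pure_iff] at hc
    obtain ⟨b', hb', c', hc', rfl⟩ := hc
    simp only [List.mem_cons, not_or] at hu
    rw [Function.update_of_ne hu.1]
    exact ih hc' hu.2

end Coins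

/-! ### The algorithm with one coin per node -/

variable {X : Type*}

open Classical in
/-- Phase 1 at one node, with a coin that may depend on the node. -/
def phaseOneWith (T : DataTree X) (κ : List ℕ → PMF Bool) (M : Marking) (u : List ℕ) :
    PMF Marking :=
  if M u = none then
    (κ u).bind fun answer =>
      PMF.pure (if answer = true then markHeavy u M else markLight T u M)
  else PMF.pure M

open Classical in
/-- `MarkHeavyHitters` with a coin `κ u` for every node `u`. -/
def markWith (T : DataTree X) (κ : List ℕ → PMF Bool) (v : List ℕ) (h : ℕ) (M : Marking) :
    PMF Marking :=
  ((T.levelBelow v (h / 2)).foldlM (phaseOneWith T κ) M).bind fun M₁ =>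
  (if _h3 : 3 ≤ h then
    (T.levelBelow v (h / 2 + 1)).foldlM
      (fun M' w =>
        if M' w = some Label.light then PMF.pure M'
        else markWith T κ w (h - h / 2 - 1) M') M₁
  else PMF.pure M₁).bind fun M₂ =>
  if _h2 : 2 ≤ h then markWith T κ v (h / 2) M₂
  else PMF.pure M₂
termination_by h
decreasing_by all_goals omega

theorem markHeavyHitters_eq_markWith (T : DataTree X) (D : List X) (check : ℕ → PMF Bool)
    (v : List ℕ) (h : ℕ) (M : Marking) :
    markHeavyHitters T D check v h M = markWith T (fun u => check (T.count D u)) v h M := by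
  induction h using Nat.strong_induction_on generalizing v M with
  | _ h ih =>
    unfold markHeavyHitters markWith
    have h1 : phaseOne T D check = phaseOneWith T (fun u => check (T.count D u)) := rfl
    rw [h1]
    congr 1; funext M₁
    congr 1
    · split_ifs with h3
      · congr 1; funext M' w
        rw [ih _ (by omega)]
      · rfl
    · funext M₂
      split_ifs with h2
      · exact ih _ (by omega) _ _
      · rfl

/-- A continuation `g`, depending on the coin laws and the current marking, uses the coin of `u`
at most once, and not at all if `u` is already marked. -/
def Fresh {Z : Type} (u : List ℕ) (g : (List ℕ → PMF Bool) → Marking → PMF Z) : Prop :=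
  (∀ κ M, g κ M = (κ u).bind fun b => g (Function.update κ u (PMF.pure b)) M) ∧
  (∀ κ M q, M u ≠ none → g (Function.update κ u q) M = g κ M)

theorem markHeavy_ne_none {u w : List ℕ} {M : Marking} (h : M w ≠ none) :
    markHeavy u M w ≠ none := by
  unfold markHeavy; split_ifs <;> simp [h]

theorem markLight_ne_none {T : DataTree X} {u w : List ℕ} {M : Marking} (h : M w ≠ none) :
    markLight T u M w ≠ none := by
  unfold markLight; split_ifs <;> simp [h]

section Fresh

variable {Z : Type} {u : List ℕ} {T : DataTree X}

/-- A test of `w` uses the coin of `w` only, and only if `w` is unmarked; it leaves `w` marked. -/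
theorem Fresh.phaseOneWith {g : (List ℕ → PMF Bool) → Marking → PMF Z} (hg : Fresh u g)
    {w : List ℕ} (hw : w ∈ T.nodes) :
    Fresh u fun κ M => (phaseOneWith T κ M w).bind (g κ) := by
  have hself : ∀ (M : Marking) (b : Bool),
      (if b = true then markHeavy w M else markLight T w M) w ≠ none := by
    intro M b; cases b <;> simp [markHeavy, markLight, hw]
  have hmono : ∀ (M : Marking) (b : Bool), M u ≠ none →
      (if b = true then markHeavy w M else markLight T w M) u ≠ none := by
    intro M b h
    cases b
    · simpa using markLight_ne_none h
    · simpa using markHeavy_ne_none h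
  constructor
  · intro κ M
    by_cases hM : M w = none
    · simp only [HeavyHitters.phaseOneWith, hM, if_true, PMF.bind_bind, PMF.pure_bind]
      by_cases huw : u = w
      · subst huw
        simp only [Function.update_self, PMF.pure_bind]
        congr 1; funext b
        exact (hg.2 _ _ _ (hself M b)).symm
      · conv_rhs => enter [2, b]; rw [Function.update_of_ne (Ne.symm huw)]
        refine Eq.trans ?_ (PMF.bind_comm _ _ _)
        congr 1; funext b
        exact hg.1 _ _
    · simp only [HeavyHitters.phaseOneWith, hM, if_false, PMF.pure_bind]
      exact hg.1 _ _
  · intro κ M q hu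
    by_cases hM : M w = none
    · have huw : w ≠ u := fun h => hu (h ▸ hM)
      simp only [HeavyHitters.phaseOneWith, hM, if_true, PMF.bind_bind, PMF.pure_bind]
      rw [Function.update_of_ne huw]
      congr 1; funext b
      exact hg.2 _ _ _ (hmono M b hu)
    · simp only [HeavyHitters.phaseOneWith, hM, if_false, PMF.pure_bind]
      exact hg.2 _ _ _ hu

/-- Freshness passes through a sequence of operations, each of which preserves it. -/
theorem Fresh.foldlM {α : Type} {f : (List ℕ → PMF Bool) → Marking → α → PMF Marking}
    (l : List α)
    (hf : ∀ a ∈ l, ∀ g : (List ℕ → PMF Bool) → Marking → PMF Z, Fresh u g →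
      Fresh u fun κ M => (f κ M a).bind (g κ))
    {g : (List ℕ → PMF Bool) → Marking → PMF Z} (hg : Fresh u g) :
    Fresh u fun κ M => (l.foldlM (f κ) M).bind (g κ) := by
  induction l with
  | nil =>
    have : (fun (κ : List ℕ → PMF Bool) (M : Marking) =>
        (([] : List α).foldlM (f κ) M).bind (g κ)) = g := by
      funext κ M
      exact PMF.pure_bind _ _
    rw [this]; exact hg
  | cons a l ih =>
    have : (fun (κ : List ℕ → PMF Bool) (M : Marking) =>
        ((a :: l).foldlM (f κ) M).bind (g κ)) =
        fun κ M => (f κ M a).bind ((fun κ M => (l.foldlM (f κ) M).bind (g κ)) κ) := by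
      funext κ M
      exact PMF.bind_bind _ _ _
    rw [this]
    exact hf a (by simp) _ (ih fun b hb => hf b (by simp [hb]))

theorem mem_levelBelow {v w : List ℕ} {l : ℕ} :
    w ∈ T.levelBelow v l ↔ w ∈ T.nodes ∧ v <+: w ∧ w.length = v.length + l := by
  simp [DataTree.levelBelow]

theorem nodup_levelBelow {v : List ℕ} {l : ℕ} : (T.levelBelow v l).Nodup :=
  Finset.sort_nodup _ _

theorem Fresh.ite {g g' : (List ℕ → PMF Bool) → Marking → PMF Z} (hg : Fresh u g)
    (hg' : Fresh u g') (P : Marking → Prop) [DecidablePred P] :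
    Fresh u fun κ M => if P M then g κ M else g' κ M := by
  constructor
  · intro κ M
    by_cases h : P M
    · simpa [h] using hg.1 κ M
    · simpa [h] using hg'.1 κ M
  · intro κ M q hu
    by_cases h : P M
    · simpa [h] using hg.2 κ M q hu
    · simpa [h] using hg'.2 κ M q hu

/-- A whole call uses every coin at most once, because marks are never removed. -/
theorem Fresh.markWith {g : (List ℕ → PMF Bool) → Marking → PMF Z} (hg : Fresh u g)
    (v : List ℕ) (h : ℕ) : Fresh u fun κ M => (markWith T κ v h M).bind (g κ) := by
  classical
  induction h using Nat.strong_induction_on generalizing v g with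
  | _ h ih =>
    have e3 : Fresh u fun κ M =>
        (if 2 ≤ h then HeavyHitters.markWith T κ v (h / 2) M else PMF.pure M).bind (g κ) := by
      by_cases h2 : 2 ≤ h
      · simpa [h2] using ih (h / 2) (by omega) hg v
      · simpa [h2] using hg
    have e2 : Fresh u fun κ M =>
        (if 3 ≤ h then
          (T.levelBelow v (h / 2 + 1)).foldlM
            (fun M' w =>
              if M' w = some Label.light then PMF.pure M'
              else HeavyHitters.markWith T κ w (h - h / 2 - 1) M') M
          else PMF.pure M).bind fun M₂ =>
            (if 2 ≤ h then HeavyHitters.markWith T κ v (h / 2) M₂ else PMF.pure M₂).bind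
              (g κ) := by
      by_cases h3 : 3 ≤ h
      · simp only [h3, if_true]
        refine Fresh.foldlM (f := fun κ M' w => if M' w = some Label.light then PMF.pure M'
              else HeavyHitters.markWith T κ w (h - h / 2 - 1) M') _ ?_ e3
        intro w _ g' hg'
        have := Fresh.ite hg' (ih (h - h / 2 - 1) (by omega) hg' w)
          (fun M => M w = some Label.light)
        convert this using 3 with κ M
        split_ifs <;> simp
      · simpa [h3] using e3
    have e1 := Fresh.foldlM (f := HeavyHitters.phaseOneWith T) (T.levelBelow v (h / 2))
      (fun w hw g' hg' => hg'.phaseOneWith (mem_levelBelow.1 hw).1) e2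
    convert e1 using 3 with κ M
    rw [HeavyHitters.markWith]
    simp only [PMF.bind_bind, dite_eq_ite]

end Fresh

/-- One coin may be drawn before the algorithm starts. -/
theorem markWith_expose (T : DataTree X) (κ : List ℕ → PMF Bool) (v : List ℕ) (h : ℕ)
    (M : Marking) (u : List ℕ) :
    markWith T κ v h M =
      (κ u).bind fun b => markWith T (Function.update κ u (PMF.pure b)) v h M := by
  have h0 : Fresh u fun (_ : List ℕ → PMF Bool) (M : Marking) => PMF.pure M :=
    ⟨fun κ M => by simp, fun _ _ _ _ => rfl⟩
  simpa using (h0.markWith (T := T) v h).1 κ M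

/-- All coins may be drawn before the algorithm starts. -/
theorem markWith_eq_coins (T : DataTree X) (κ : List ℕ → PMF Bool) (v : List ℕ) (h : ℕ)
    (M : Marking) {us : List (List ℕ)} (hus : us.Nodup) :
    markWith T κ v h M = (coins κ us).bind fun c =>
      markWith T (fun u => if u ∈ us then PMF.pure (c u) else κ u) v h M := by
  induction us generalizing κ with
  | nil => simp [coins]
  | cons u us ih =>
    obtain ⟨hu, hus⟩ := List.nodup_cons.1 hus
    rw [markWith_expose T κ v h M u]
    simp only [coins, PMF.bind_bind, PMF.pure_bind]
    congr 1; funext b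
    rw [ih _ hus, coins_congr (κ' := κ)]
    · congr 1; funext c
      congr 1; funext w
      by_cases hw : w = u
      · subst hw; simp [hu]
      · by_cases hw' : w ∈ us <;> simp [hw, hw', Function.update_of_ne]
    · intro w hw
      exact Function.update_of_ne (by rintro rfl; exact hu hw) _ _

end

section

variable {X : Type*}

/-! ### The outcome as a function of the coins -/

theorem DataTree.mem_of_prefix (T : DataTree X) {u w : List ℕ} (hw : w ∈ T.nodes)
    (h : u <+: w) : u ∈ T.nodes := by
  obtain ⟨t, rfl⟩ := h
  induction t using List.reverseRecOn with
  | nil => simpa using hw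
  | append_singleton t c ih =>
    rw [← List.append_assoc] at hw
    exact ih (T.parent_mem _ _ hw)

theorem take_prefix_of_prefix {u w : List ℕ} (h : u <+: w) {n : ℕ} (hn : n ≤ u.length) :
    w.take n = u.take n := by
  obtain ⟨t, rfl⟩ := h
  rw [List.take_append_of_le_length hn]

theorem prefix_take_iff' {u w : List ℕ} {n : ℕ} (h : u <+: w) (hn : u.length ≤ n) :
    u <+: w.take n := by
  rw [List.prefix_iff_eq_take] at h
  rw [h]
  exact List.take_prefix_take_left hn

/-- The heavy nodes of level `mid`, the middle of an interval of levels that starts at `a`.  `A`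
holds for the heavy nodes of the level above the interval (everywhere if there is none), and `B`
for those of the level below it. -/
def midHeavy (T : DataTree X) (c : List ℕ → Bool) (a mid : ℕ) (A B : List ℕ → Prop) :
    List ℕ → Prop :=
  fun w => w ∈ T.nodes ∧ w.length = mid ∧
    ((∃ w', B w' ∧ w <+: w') ∨ (A (w.take (a - 1)) ∧ c w = true))

/-- The heavy nodes in the levels `a, …, a + len - 1`, as a function of the coins `c`; `A` and `B`
describe the heavy nodes of the levels adjacent to this interval.  The middle layer separates the
interval into two halves that do not interact. -/
def heavyAt (T : DataTree X) (c : List ℕ → Bool) (a len : ℕ) (A B : List ℕ → Prop)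
    (u : List ℕ) : Prop :=
  if _h : len = 0 then False
  else if u.length < a + len / 2 then
    heavyAt T c a (len / 2) A (midHeavy T c a (a + len / 2) A B) u
  else if u.length = a + len / 2 then midHeavy T c a (a + len / 2) A B u
  else heavyAt T c (a + len / 2 + 1) (len - len / 2 - 1) (midHeavy T c a (a + len / 2) A B) B u
termination_by len
decreasing_by all_goals omega

/-- A heavy node has a heavy ancestor just above the interval, or a common ancestor there with a
heavy node just below the interval. -/
theorem heavyAt_cases {T : DataTree X} {c : List ℕ → Bool} {a len : ℕ} {A B : List ℕ → Prop}
    {u : List ℕ} (hu : a ≤ u.length) (h : heavyAt T c a len A B u) :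
    A (u.take (a - 1)) ∨ ∃ w, B w ∧ u.take (a - 1) <+: w := by
  induction len using Nat.strong_induction_on generalizing a A B with
  | _ len ih =>
    have key : ∀ w, midHeavy T c a (a + len / 2) A B w → ∀ u' : List ℕ, u' <+: w →
        a - 1 ≤ u'.length → A (u'.take (a - 1)) ∨ ∃ w, B w ∧ u'.take (a - 1) <+: w := by
      rintro w ⟨_, _, ⟨w', hw', hp⟩ | ⟨hA, _⟩⟩ u' hu' hl
      · exact Or.inr ⟨w', hw', ((List.take_prefix _ _).trans hu').trans hp⟩
      · left; rwa [← take_prefix_of_prefix hu' hl]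
    rw [heavyAt] at h
    split_ifs at h with h0 h1 h2
    · rcases ih (len / 2) (by omega) hu h with h | ⟨w, hw, hp⟩
      · exact Or.inl h
      · have := key w hw (u.take (a - 1)) hp (by simp; omega)
        simpa only [List.take_take, min_self] using this
    · exact key u h u List.prefix_rfl (by omega)
    · rcases ih (len - len / 2 - 1) (by omega) (by omega) h with h | ⟨w, hw, hp⟩
      · have := key _ h (u.take (a - 1)) (by
          refine List.take_prefix_take_left (by omega)) (by simp; omega)
        simpa only [List.take_take, min_self] using this
      · refine Or.inr ⟨w, hw, List.IsPrefix.trans ?_ hp⟩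
        exact List.take_prefix_take_left (by omega)

/-- The marking of a set of nodes according to whether they are heavy. -/
def markBy (H : Prop) [Decidable H] : Option Label :=
  if H then some Label.heavy else some Label.light

open Classical in
/-- The marking after the nodes in `P`, which lie in one level, have been processed: `S` holds
for those that became heavy. -/
def stateOne (T : DataTree X) (S : List ℕ → Prop) (M : Marking) (P : List (List ℕ)) : Marking :=
  fun w => if ∃ u ∈ P, S u ∧ w <+: u then some Label.heavy
    else if w ∈ T.nodes ∧ ∃ u ∈ P, ¬ S u ∧ u <+: w then some Label.light else M w

open Classical in
/-- The tests of one level with deterministic coins, when the nodes in `P` have been processed and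
those in `L` remain. `Bl` holds for the nodes above a heavy node found earlier, which are marked
already; `S` is the set of nodes that are heavy in the end. -/
theorem foldlM_phaseOneWith {T : DataTree X} {κ : List ℕ → PMF Bool} {c : List ℕ → Bool}
    {S Bl : List ℕ → Prop} {M : Marking} {mid : ℕ} (L P : List (List ℕ))
    (hκ : ∀ u ∈ T.nodes, κ u = PMF.pure (c u))
    (hnd : (P ++ L).Nodup) (hlen : ∀ u ∈ P ++ L, u.length = mid)
    (hnodes : ∀ u ∈ P ++ L, u ∈ T.nodes)
    (hS : ∀ u ∈ L, S u ↔ Bl u ∨ c u = true)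
    (hM : ∀ u ∈ L, M u = if Bl u then some Label.heavy else none)
    (hMB : ∀ u ∈ L, Bl u → ∀ w, w <+: u → M w = some Label.heavy) :
    L.foldlM (phaseOneWith T κ) (stateOne T S M P) = PMF.pure (stateOne T S M (P ++ L)) := by
  induction L generalizing P with
  | nil => simp; rfl
  | cons u L ih =>
    have huP : ∀ u' ∈ P, u' ≠ u := by
      rintro u' hu' rfl
      rw [List.nodup_append] at hnd
      exact hnd.2.2 u' hu' u' (by simp) rfl
    have hlu : u.length = mid := hlen u (by simp)
    have hlP : ∀ u' ∈ P, u'.length = mid := fun u' h => hlen u' (by simp [h])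
    have hPu : ∀ u' ∈ P, ¬ u <+: u' := fun u' h hp =>
      huP u' h (hp.eq_of_length_le (by rw [hlu, hlP u' h])).symm
    have hPu' : ∀ u' ∈ P, ¬ u' <+: u := fun u' h hp =>
      huP u' h (hp.eq_of_length_le (by rw [hlu, hlP u' h]))
    have hun : u ∈ T.nodes := hnodes u (by simp)
    have hMu : stateOne T S M P u = if Bl u then some Label.heavy else none := by
      rw [← hM u (by simp)]
      unfold stateOne
      rw [if_neg (by rintro ⟨u', h, _, hp⟩; exact hPu u' h hp),
        if_neg (by rintro ⟨_, u', h, _, hp⟩; exact hPu' u' h hp)]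
    have hstep : phaseOneWith T κ (stateOne T S M P) u =
        PMF.pure (stateOne T S M (P ++ [u])) := by
      unfold phaseOneWith
      have hheavy : ∀ w, (∃ u' ∈ P ++ [u], S u' ∧ w <+: u') ↔
          (∃ u' ∈ P, S u' ∧ w <+: u') ∨ (S u ∧ w <+: u) := by
        intro w; simp [or_and_right, exists_or]
      have hlight : ∀ w, (w ∈ T.nodes ∧ ∃ u' ∈ P ++ [u], ¬ S u' ∧ u' <+: w) ↔
          (w ∈ T.nodes ∧ ∃ u' ∈ P, ¬ S u' ∧ u' <+: w) ∨
            (w ∈ T.nodes ∧ ¬ S u ∧ u <+: w) := by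
        intro w; simp only [List.mem_append, List.mem_singleton, or_and_right, exists_or,
          exists_eq_left, and_or_left]
      by_cases hB : Bl u
      · have hSu : S u := (hS u (by simp)).2 (Or.inl hB)
        rw [hMu, if_pos hB, if_neg (by simp)]
        congr 1; funext w
        unfold stateOne
        rw [if_congr (hheavy w) rfl rfl, if_congr (hlight w) rfl rfl]
        by_cases hw : w <+: u
        · rw [if_pos (Or.inr ⟨hSu, hw⟩ : (∃ u' ∈ P, S u' ∧ w <+: u') ∨ (S u ∧ w <+: u))]
          by_cases h1 : ∃ u' ∈ P, S u' ∧ w <+: u'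
          · rw [if_pos h1]
          · rw [if_neg h1, if_neg (by
              rintro ⟨_, u', h, _, hp⟩; exact hPu' u' h (hp.trans hw)),
              hMB u (by simp) hB w hw]
        · simp [hw, hSu]
      · rw [hMu, if_neg hB, if_pos rfl, hκ u hun, PMF.pure_bind]
        congr 1; funext w
        by_cases hc : c u = true
        · have hSu : S u := (hS u (by simp)).2 (Or.inr hc)
          rw [if_pos hc]
          unfold markHeavy stateOne
          rw [if_congr (hheavy w) rfl rfl, if_congr (hlight w) rfl rfl]
          by_cases hw : w <+: u
          · simp [hw, hSu]
          · simp [hw, hSu]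
        · have hSu : ¬ S u := fun h => (hS u (by simp)).1 h |>.elim hB hc
          rw [if_neg hc]
          unfold markLight stateOne
          rw [if_congr (hheavy w) rfl rfl, if_congr (hlight w) rfl rfl]
          by_cases hw : u <+: w
          · by_cases hwn : w ∈ T.nodes
            · rw [if_pos ⟨hwn, hw⟩, if_neg, if_pos (Or.inr ⟨hwn, hSu, hw⟩)]
              rintro (⟨u', h, _, hp⟩ | ⟨h, _⟩)
              · exact hPu u' h (hw.trans hp)
              · exact hSu h
            · simp [hwn, hSu]
          · simp [hw, hSu]
    rw [List.foldlM_cons]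
    have hcat : P ++ u :: L = (P ++ [u]) ++ L := by simp
    rw [hstep, hcat]
    refine (PMF.pure_bind _ _).trans (ih (P ++ [u]) (hcat ▸ hnd) (hcat ▸ hlen) (hcat ▸ hnodes)
      (fun w hw => hS w (by simp [hw])) (fun w hw => hM w (by simp [hw]))
      (fun w hw => hMB w (by simp [hw])))

open Classical in
/-- With deterministic coins, a call marks the unmarked nodes of its layers as described by
`heavyAt` and changes nothing else. -/
theorem markWith_pure {T : DataTree X} {κ : List ℕ → PMF Bool} {c : List ℕ → Bool}
    (hκ : ∀ u ∈ T.nodes, κ u = PMF.pure (c u)) {h : ℕ} (hh : 1 ≤ h) {v : List ℕ}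
    (hv : v ∈ T.nodes) {M : Marking} {A B : List ℕ → Prop}
    (hB : ∀ w, B w → w ∈ T.nodes ∧ w.length = v.length + h)
    (hA : A (v.take (v.length - 1)))
    (h1 : ∀ u ∈ T.nodes, v <+: u → u.length < v.length + h →
      M u = if ∃ w, B w ∧ u <+: w then some Label.heavy else none)
    (h2 : ∀ u ∈ T.nodes, v <+: u → v.length + h ≤ u.length → (∀ w, B w → ¬ w <+: u) →
      M u = some Label.light)
    (h3 : ∀ u, u <+: v → u ≠ v → M u = some Label.heavy) :
    markWith T κ v h M = PMF.pure fun u =>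
      if u ∈ T.nodes ∧ v <+: u ∧ u.length < v.length + h then
        markBy (heavyAt T c v.length h A B u) else M u := by
  induction h using Nat.strong_induction_on generalizing v M A B with
  | _ h ih =>
    set a := v.length with ha
    set mid := a + h / 2 with hmid
    set S := midHeavy T c a mid A B with hS
    set R := heavyAt T c (mid + 1) (h - h / 2 - 1) S B with hR
    set Bl : List ℕ → Prop := fun u => ∃ w, B w ∧ u <+: w with hBl
    have hAu : ∀ u, v <+: u → A (u.take (a - 1)) := by
      intro u hu
      rwa [take_prefix_of_prefix hu (by omega)]
    -- ancestors of a node above a heavy node are already heavy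
    have hpre : ∀ u, v <+: u → u.length < a + h → Bl u → ∀ w, w <+: u →
        M w = some Label.heavy := by
      rintro u hvu hlu ⟨b, hb, hub⟩ w hwu
      rcases List.prefix_or_prefix_of_prefix hwu hvu with hwv | hvw
      · by_cases hne : w = v
        · subst hne
          rw [h1 _ hv List.prefix_rfl (by omega), if_pos ⟨b, hb, hwu.trans hub⟩]
        · exact h3 w hwv hne
      · rw [h1 w (T.mem_of_prefix (hB b hb).1 (hwu.trans hub)) hvw
          (lt_of_le_of_lt hwu.length_le hlu), if_pos ⟨b, hb, hwu.trans hub⟩]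
    have hBS : ∀ u, v <+: u → u.length ≤ mid → Bl u → ∃ w, S w ∧ u <+: w := by
      rintro u hvu hlu ⟨b, hb, hub⟩
      have hlb := (hB b hb).2
      refine ⟨b.take mid, ⟨T.mem_of_prefix (hB b hb).1 (List.take_prefix _ _), ?_, Or.inl ?_⟩,
        prefix_take_iff' hub hlu⟩
      · rw [List.length_take]; omega
      · exact ⟨b, hb, List.take_prefix _ _⟩
    -- the tests of the middle level: above it exactly the ancestors of its heavy nodes are marked
    set M₁ := stateOne T S M (T.levelBelow v (h / 2)) with hM₁
    have hphase1 : (T.levelBelow v (h / 2)).foldlM (phaseOneWith T κ) M = PMF.pure M₁ := by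
      have h0 : stateOne T S M [] = M := by funext w; simp [stateOne]
      have := foldlM_phaseOneWith (S := S) (Bl := Bl) (M := M) (mid := mid)
        (T.levelBelow v (h / 2)) [] hκ (by simpa using nodup_levelBelow)
        (fun u hu => (mem_levelBelow.1 (by simpa using hu)).2.2)
        (fun u hu => (mem_levelBelow.1 (by simpa using hu)).1) ?_ ?_ ?_
      · rw [h0] at this; simpa using this
      · intro u hu
        obtain ⟨hun, hvu, hlu⟩ := mem_levelBelow.1 hu
        constructor
        · rintro ⟨_, _, h | ⟨_, h⟩⟩
          · exact Or.inl h
          · exact Or.inr h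
        · rintro (h | h)
          · exact ⟨hun, hlu, Or.inl h⟩
          · exact ⟨hun, hlu, Or.inr ⟨hAu u hvu, h⟩⟩
      · intro u hu
        obtain ⟨hun, hvu, hlu⟩ := mem_levelBelow.1 hu
        exact h1 u hun hvu (by omega)
      · intro u hu hb
        obtain ⟨hun, hvu, hlu⟩ := mem_levelBelow.1 hu
        exact hpre u hvu (by omega) hb
    have m1_above : ∀ u ∈ T.nodes, v <+: u → u.length < mid →
        M₁ u = if ∃ w, S w ∧ u <+: w then some Label.heavy else none := by
      intro u hun hvu hlu
      rw [hM₁, stateOne, if_neg (c := _ ∧ _)]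
      · by_cases hw : ∃ w, S w ∧ u <+: w
        · rw [if_pos hw, if_pos]
          obtain ⟨w, hw, hp⟩ := hw
          exact ⟨w, mem_levelBelow.2 ⟨hw.1, hvu.trans hp, hw.2.1⟩, hw, hp⟩
        · rw [if_neg hw, if_neg, h1 u hun hvu (by omega), if_neg]
          · exact fun hb => hw (hBS u hvu hlu.le hb)
          · rintro ⟨w, _, hw', hp⟩; exact hw ⟨w, hw', hp⟩
      · rintro ⟨_, w, hw, _, hp⟩
        have := (mem_levelBelow.1 hw).2.2
        have := hp.length_le
        omega
    have m1_mid : ∀ u ∈ T.nodes, v <+: u → u.length = mid → M₁ u = markBy (S u) := by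
      intro u hun hvu hlu
      have hmem : u ∈ T.levelBelow v (h / 2) := mem_levelBelow.2 ⟨hun, hvu, hlu⟩
      rw [hM₁, stateOne, markBy]
      by_cases hs : S u
      · rw [if_pos hs, if_pos ⟨u, hmem, hs, List.prefix_rfl⟩]
      · rw [if_neg hs, if_neg, if_pos ⟨hun, u, hmem, hs, List.prefix_rfl⟩]
        rintro ⟨w, hw, hw', hp⟩
        rw [hp.eq_of_length_le (by rw [(mem_levelBelow.1 hw).2.2, hlu])] at hs
        exact hs hw'
    have m1_below : ∀ u ∈ T.nodes, v <+: u → mid < u.length →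
        M₁ u = if S (u.take mid) then M u else some Label.light := by
      intro u hun hvu hlu
      have hpu : (u.take mid) <+: u := List.take_prefix _ _
      have hmem : u.take mid ∈ T.levelBelow v (h / 2) := mem_levelBelow.2
        ⟨T.mem_of_prefix hun hpu, prefix_take_iff' hvu (by omega), by
          rw [List.length_take]; omega⟩
      rw [hM₁, stateOne, if_neg]
      · by_cases hs : S (u.take mid)
        · rw [if_pos hs, if_neg]
          rintro ⟨_, w, hw, hs', hp⟩
          have hlw : w.length = mid := (mem_levelBelow.1 hw).2.2
          rw [List.prefix_iff_eq_take, hlw] at hp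
          exact hs' (hp ▸ hs)
        · rw [if_neg hs, if_pos ⟨hun, _, hmem, hs, hpu⟩]
      · rintro ⟨w, hw, _, hp⟩
        have := (mem_levelBelow.1 hw).2.2
        have := hp.length_le
        omega
    have m1_out : ∀ u, ¬ (u ∈ T.nodes ∧ v <+: u) → M₁ u = M u := by
      intro u hu
      rw [hM₁, stateOne, if_neg (c := _ ∧ _)]
      · split_ifs with hw
        · obtain ⟨w, hw, _, hp⟩ := hw
          obtain ⟨hwn, hvw, _⟩ := mem_levelBelow.1 hw
          have hun := T.mem_of_prefix hwn hp
          rcases List.prefix_or_prefix_of_prefix hp hvw with h | h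
          · exact (h3 u h (by rintro rfl; exact hu ⟨hun, h⟩)).symm
          · exact absurd ⟨hun, h⟩ hu
        · rfl
      · rintro ⟨hun, w, hw, _, hp⟩
        exact hu ⟨hun, (mem_levelBelow.1 hw).2.1.trans hp⟩
    have hRfalse : ∀ u, mid < u.length → ¬ S (u.take mid) → u ∈ T.nodes → ¬ R u := by
      intro u hlu hs hun hr
      have hl : (u.take mid).length = mid := by rw [List.length_take]; omega
      rcases heavyAt_cases (by omega) hr with h | ⟨w, hw, hp⟩
      · exact hs (by simpa using h)
      · exact hs ⟨T.mem_of_prefix hun (List.take_prefix _ _), hl,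
          Or.inl ⟨w, hw, by simpa using hp⟩⟩
    -- the subtrees below the middle level; those with a light root contain no heavy nodes
    set M₂ : Marking := fun u => if u ∈ T.nodes ∧ v <+: u ∧ mid < u.length ∧ u.length < a + h
      then markBy (R u) else M₁ u with hM₂
    have hphase2 : (if _h3 : 3 ≤ h then
        (T.levelBelow v (h / 2 + 1)).foldlM
          (fun M' w =>
            if M' w = some Label.light then PMF.pure M'
            else markWith T κ w (h - h / 2 - 1) M') M₁
        else PMF.pure M₁) = PMF.pure M₂ := by
      split_ifs with hh3
      swap
      · congr 1; funext u
        rw [hM₂]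
        dsimp only
        rw [if_neg]
        rintro ⟨_, _, _, _⟩
        omega
      set st : List (List ℕ) → Marking := fun P u =>
        if u ∈ T.nodes ∧ u.length < a + h ∧ ∃ w ∈ P, w <+: u then markBy (R u) else M₁ u
        with hst
      have hst0 : st [] = M₁ := by funext u; simp [hst]
      have hst1 : st (T.levelBelow v (h / 2 + 1)) = M₂ := by
        funext u
        rw [hst, hM₂]
        refine if_congr ⟨?_, ?_⟩ rfl rfl
        · rintro ⟨hun, hl, w, hw, hp⟩
          obtain ⟨hwn, hvw, hlw⟩ := mem_levelBelow.1 hw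
          have := hp.length_le
          exact ⟨hun, hvw.trans hp, by omega, hl⟩
        · rintro ⟨hun, hvu, hl, hl'⟩
          exact ⟨hun, hl', u.take (mid + 1), mem_levelBelow.2
            ⟨T.mem_of_prefix hun (List.take_prefix _ _), prefix_take_iff' hvu (by omega), by
              rw [List.length_take]; omega⟩, List.take_prefix _ _⟩
      have hfold : ∀ L P : List (List ℕ), P ++ L = T.levelBelow v (h / 2 + 1) →
          L.foldlM (fun M' w =>
            if M' w = some Label.light then PMF.pure M'
            else markWith T κ w (h - h / 2 - 1) M') (st P) =
          PMF.pure (st (P ++ L)) := by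
        intro L
        induction L with
        | nil => intro P _; simp; rfl
        | cons w L ihL =>
          intro P hPL
          have hcat : P ++ w :: L = (P ++ [w]) ++ L := by simp
          have hmem : ∀ w' ∈ P ++ w :: L, w' ∈ T.nodes ∧ v <+: w' ∧ w'.length = mid + 1 := by
            intro w' hw'; rw [hPL] at hw'; exact mem_levelBelow.1 hw'
          obtain ⟨hwn, hvw, hlw⟩ := hmem w (by simp)
          have hnd : (P ++ w :: L).Nodup := hPL ▸ nodup_levelBelow
          have hPw : ∀ u, w <+: u → ∀ w' ∈ P, ¬ w' <+: u := by
            intro u hwu w' hw' hp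
            have hl' := (hmem w' (by simp [hw'])).2.2
            have : w' = w := by
              rw [List.prefix_iff_eq_take] at hp hwu
              rw [hp, hwu, hl', hlw]
            subst this
            rw [List.nodup_append] at hnd
            exact hnd.2.2 w' hw' w' (by simp) rfl
          have hstw : ∀ u, w <+: u → st P u = M₁ u := by
            intro u hu
            rw [hst]
            dsimp only
            rw [if_neg]
            rintro ⟨_, _, w', hw', hp⟩
            exact hPw u hu w' hw' hp
          have hsucc : st (P ++ [w]) = fun u =>
              if u ∈ T.nodes ∧ w <+: u ∧ u.length < a + h then markBy (R u) else st P u := by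
            funext u
            by_cases hu : u ∈ T.nodes ∧ w <+: u ∧ u.length < a + h
            · rw [if_pos hu, hst]
              dsimp only
              rw [if_pos ⟨hu.1, hu.2.2, w, by simp, hu.2.1⟩]
            · rw [if_neg hu, hst]
              dsimp only
              refine if_congr ⟨?_, ?_⟩ rfl rfl
              · rintro ⟨hun, hl, w', hw', hp⟩
                rcases List.mem_append.1 hw' with h | h
                · exact ⟨hun, hl, w', h, hp⟩
                · rw [List.mem_singleton] at h
                  exact absurd ⟨hun, h ▸ hp, hl⟩ hu
              · rintro ⟨hun, hl, w', hw', hp⟩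
                exact ⟨hun, hl, w', by simp [hw'], hp⟩
          have hstep : (if st P w = some Label.light then PMF.pure (st P)
              else markWith T κ w (h - h / 2 - 1) (st P)) = PMF.pure (st (P ++ [w])) := by
            have hwM : ∀ u ∈ T.nodes, w <+: u →
                st P u = if S (w.take mid) then M u else some Label.light := by
              intro u hun hwu
              rw [hstw u hwu, m1_below u hun (hvw.trans hwu) (by
                have := hwu.length_le; omega), take_prefix_of_prefix hwu (by omega)]
            by_cases hs : S (w.take mid)
            · rw [if_neg, ih (h - h / 2 - 1) (by omega) (by omega) hwn (A := S) (B := B)]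
              · rw [hsucc]
                have e1 : w.length + (h - h / 2 - 1) = a + h := by omega
                rw [e1, hlw]
              · intro b hb
                refine ⟨(hB b hb).1, ?_⟩
                rw [(hB b hb).2]; omega
              · rw [hlw]; simpa using hs
              · intro u hun hwu hlu
                rw [hwM u hun hwu, if_pos hs, h1 u hun (hvw.trans hwu) (by omega)]
              · intro u hun hwu hlu hnb
                rw [hwM u hun hwu, if_pos hs, h2 u hun (hvw.trans hwu) (by omega) hnb]
              · intro u huw hne
                have hlu : u.length ≤ mid := by
                  by_contra hcon
                  exact hne (huw.eq_of_length_le (by omega))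
                have hup : u <+: w.take mid := prefix_take_iff' huw hlu
                have hun := T.mem_of_prefix hwn huw
                have hstu : st P u = M₁ u := by
                  rw [hst]
                  dsimp only
                  rw [if_neg]
                  rintro ⟨_, _, w', hw', hp⟩
                  have h' := (hmem w' (by simp [hw'])).2.2
                  have := hp.length_le
                  omega
                rw [hstu]
                by_cases hvu : v <+: u
                · rcases hlu.lt_or_eq with hlt | heq
                  · rw [m1_above u hun hvu hlt, if_pos ⟨_, hs, hup⟩]
                  · rw [m1_mid u hun hvu heq, markBy, if_pos]
                    rwa [hup.eq_of_length_le (by rw [List.length_take]; omega)]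
                · rw [m1_out u (fun h => hvu h.2)]
                  rcases List.prefix_or_prefix_of_prefix huw hvw with h' | h'
                  · exact h3 u h' (by rintro rfl; exact hvu List.prefix_rfl)
                  · exact absurd h' hvu
              · rw [hwM w hwn List.prefix_rfl, if_pos hs, h1 w hwn hvw (by omega)]
                split_ifs <;> simp
            · rw [if_pos (by rw [hwM w hwn List.prefix_rfl, if_neg hs]), hsucc]
              congr 1; funext u
              by_cases hu : u ∈ T.nodes ∧ w <+: u ∧ u.length < a + h
              · rw [if_pos hu, hwM u hu.1 hu.2.1, if_neg hs, markBy, if_neg]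
                refine hRfalse u ?_ ?_ hu.1
                · have := hu.2.1.length_le; omega
                · rwa [take_prefix_of_prefix hu.2.1 (by omega)]
              · rw [if_neg hu]
          rw [List.foldlM_cons, hstep, hcat]
          exact (PMF.pure_bind _ _).trans (ihL (P ++ [w]) (hcat ▸ hPL))
      rw [← hst1, ← hst0]
      exact hfold _ [] rfl
    have m2_low : ∀ u, u.length ≤ mid → M₂ u = M₁ u := by
      intro u hu
      rw [hM₂]
      dsimp only
      rw [if_neg]
      rintro ⟨_, _, _, _⟩; omega
    -- the levels above the middle one, which is now the level below the interval
    rw [markWith, hphase1, PMF.pure_bind, hphase2, PMF.pure_bind]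
    split_ifs with hh2
    · rw [ih (h / 2) (by omega) (by omega) hv (A := A) (B := S)]
      · congr 1; funext u
        by_cases hu : u ∈ T.nodes ∧ v <+: u ∧ u.length < mid
        · rw [if_pos hu, if_pos ⟨hu.1, hu.2.1, by omega⟩]
          conv_rhs => rw [heavyAt]
          rw [dif_neg (by omega), if_pos hu.2.2]
        · rw [if_neg hu]
          by_cases hu' : u ∈ T.nodes ∧ v <+: u ∧ u.length < a + h
          · rw [if_pos hu']
            have hge : mid ≤ u.length := by
              by_contra hcon; exact hu ⟨hu'.1, hu'.2.1, by omega⟩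
            conv_rhs => rw [heavyAt]
            rw [dif_neg (by omega), if_neg (by omega)]
            rcases hge.eq_or_lt with heq | hlt
            · rw [if_pos heq.symm, m2_low u heq.symm.le, m1_mid u hu'.1 hu'.2.1 heq.symm]
            · rw [if_neg (by omega), hM₂]
              dsimp only
              rw [if_pos ⟨hu'.1, hu'.2.1, hlt, hu'.2.2⟩]
          · rw [if_neg hu', hM₂]
            dsimp only
            rw [if_neg (fun h => hu' ⟨h.1, h.2.1, h.2.2.2⟩)]
            by_cases hun : u ∈ T.nodes ∧ v <+: u
            · have hge : a + h ≤ u.length := by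
                by_contra hcon; exact hu' ⟨hun.1, hun.2, by omega⟩
              rw [m1_below u hun.1 hun.2 (by omega)]
              split_ifs with hs
              · rfl
              · refine (h2 u hun.1 hun.2 hge fun b hb hp => hs ?_).symm
                exact ⟨T.mem_of_prefix hun.1 (List.take_prefix _ _),
                  by rw [List.length_take]; omega, Or.inl ⟨b, hb, by
                    rw [take_prefix_of_prefix hp (by rw [(hB b hb).2]; omega)]
                    exact List.take_prefix _ _⟩⟩
            · exact m1_out u hun
      · exact fun w hw => ⟨hw.1, hw.2.1⟩
      · exact hA
      · intro u hun hvu hlu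
        rw [m2_low u (by omega), m1_above u hun hvu hlu]
      · intro u hun hvu hlu hns
        have hs : ¬ S (u.take mid) := fun h => hns _ h (List.take_prefix _ _)
        rcases hlu.eq_or_lt with heq | hlt
        · rw [m2_low u (by omega), m1_mid u hun hvu heq.symm, markBy, if_neg]
          intro h
          exact hns u h List.prefix_rfl
        · rw [hM₂]
          dsimp only
          split_ifs with hu
          · rw [markBy, if_neg (hRfalse u hlt hs hun)]
          · rw [m1_below u hun hvu hlt, if_neg hs]
      · intro u huv hne
        have hlu := huv.length_le
        rw [m2_low u (by omega), m1_out u, h3 u huv hne]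
        rintro ⟨_, h⟩
        exact hne (huv.eq_of_length_le h.length_le)
    · have hh1 : h = 1 := by omega
      congr 1; funext u
      by_cases hu : u ∈ T.nodes ∧ v <+: u ∧ u.length < a + h
      · rw [if_pos hu]
        have hl : u.length = mid := by have := hu.2.1.length_le; omega
        conv_rhs => rw [heavyAt]
        rw [dif_neg (by omega), if_neg (by omega), if_pos hl, m2_low u hl.le,
          m1_mid u hu.1 hu.2.1 hl]
      · rw [if_neg hu, hM₂]
        dsimp only
        rw [if_neg (fun h => hu ⟨h.1, h.2.1, h.2.2.2⟩)]
        by_cases hun : u ∈ T.nodes ∧ v <+: u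
        · have hge : a + h ≤ u.length := by
            by_contra hcon; exact hu ⟨hun.1, hun.2, by omega⟩
          rw [m1_below u hun.1 hun.2 (by omega)]
          split_ifs with hs
          · rfl
          · refine (h2 u hun.1 hun.2 hge fun b hb hp => hs ?_).symm
            exact ⟨T.mem_of_prefix hun.1 (List.take_prefix _ _),
              by rw [List.length_take]; omega, Or.inl ⟨b, hb, by
                rw [take_prefix_of_prefix hp (by rw [(hB b hb).2]; omega)]
                exact List.take_prefix _ _⟩⟩
        · exact m1_out u hun

/-- The heavy nodes of the whole tree, as a function of the coins. -/
def heavyNodes (T : DataTree X) (c : List ℕ → Bool) : List ℕ → Prop :=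
  heavyAt T c 0 T.height (fun _ => True) (fun _ => False)

open Classical in
/-- The final marking, as a function of the coins. -/
def finalMarking (T : DataTree X) (c : List ℕ → Bool) : Marking :=
  fun u => if u ∈ T.nodes then markBy (heavyNodes T c u) else none

theorem DataTree.length_lt_height (T : DataTree X) {u : List ℕ} (hu : u ∈ T.nodes) :
    u.length < T.height :=
  Nat.lt_succ_of_le (Finset.le_sup (f := List.length) hu)

theorem DataTree.one_le_height (T : DataTree X) : 1 ≤ T.height := Nat.le_add_left _ _

theorem markWith_root_pure {T : DataTree X} {κ : List ℕ → PMF Bool} {c : List ℕ → Bool}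
    (hκ : ∀ u ∈ T.nodes, κ u = PMF.pure (c u)) :
    markWith T κ [] T.height (fun _ => none) = PMF.pure (finalMarking T c) := by
  classical
  rw [markWith_pure hκ T.one_le_height T.root_mem (A := fun _ => True) (B := fun _ => False)
    (by simp) trivial (by simp) ?_ ?_]
  · congr 1; funext u
    unfold finalMarking
    by_cases hu : u ∈ T.nodes
    · have := T.length_lt_height hu
      simp only [hu, this, heavyNodes, List.nil_prefix, List.length_nil, zero_add, and_self,
        if_true]
      congr
    · simp [hu]
  · intro u hu _ hl
    have := T.length_lt_height hu
    simp at hl; omega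
  · intro u hu hne
    exact absurd (List.prefix_nil.1 hu) hne

/-- The nodes of `T` as a list. -/
def nodeList (T : DataTree X) : List (List ℕ) := T.nodes.toList

/-- `MarkHeavyHitters` draws one coin per node and marks the tree accordingly. -/
theorem markHeavyHitters_eq_coins (T : DataTree X) (D : List X) (check : ℕ → PMF Bool) :
    markHeavyHitters T D check [] T.height (fun _ => none) =
      (coins (fun u => check (T.count D u)) (nodeList T)).bind fun c =>
        PMF.pure (finalMarking T c) := by
  rw [markHeavyHitters_eq_markWith, markWith_eq_coins _ _ _ _ _ (us := nodeList T)
    (Finset.nodup_toList _)]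
  congr 1; funext c
  refine markWith_root_pure fun u hu => ?_
  rw [if_pos (by simpa [nodeList] using hu)]

end

section

variable {X : Type*}

/-! ### Binary search along the path of one data point -/

/-- The node `u` is tested by the algorithm: no heavy node below it and no light node above it has
been found before. -/
def testedAt (T : DataTree X) (c : List ℕ → Bool) (a len : ℕ) (A B : List ℕ → Prop)
    (u : List ℕ) : Prop :=
  if _h : len = 0 then False
  else if u.length < a + len / 2 then
    testedAt T c a (len / 2) A (midHeavy T c a (a + len / 2) A B) u
  else if u.length = a + len / 2 then (¬ ∃ w, B w ∧ u <+: w) ∧ A (u.take (a - 1))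
  else testedAt T c (a + len / 2 + 1) (len - len / 2 - 1) (midHeavy T c a (a + len / 2) A B) B u
termination_by len
decreasing_by all_goals omega

/-- A decision tree whose inner nodes query the coin of a level: it goes on with the first subtree
if the coin is `true`, and with the second one otherwise. -/
inductive SearchTree (β : Type)
  | leaf (b : β)
  | test (l : ℕ) (hi lo : SearchTree β)

namespace SearchTree

variable {β γ : Type}

/-- The result for given coins. -/
def eval (c : ℕ → Bool) : SearchTree β → β
  | leaf b => b
  | test l hi lo => if c l = true then hi.eval c else lo.eval c

/-- The level `k` is queried for the coins `c`. -/
def Reads (c : ℕ → Bool) (k : ℕ) : SearchTree β → Prop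
  | leaf _ => False
  | test l hi lo => k = l ∨ if c l = true then hi.Reads c k else lo.Reads c k

/-- A search tree of depth at most `n` in the levels from `a` to `e - 1`: after the answer `true`
only deeper levels are queried, after the answer `false` only levels above. -/
def Valid : SearchTree β → ℕ → ℕ → ℕ → Prop
  | leaf _, _, _, _ => True
  | test l hi lo, n, a, e =>
      0 < n ∧ a ≤ l ∧ l < e ∧ hi.Valid (n - 1) (l + 1) e ∧ lo.Valid (n - 1) a l

/-- Change of the results. -/
def map (f : β → γ) : SearchTree β → SearchTree γ
  | leaf b => leaf (f b)
  | test l hi lo => test l (hi.map f) (lo.map f)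

theorem eval_map (f : β → γ) (c : ℕ → Bool) (t : SearchTree β) :
    (t.map f).eval c = f (t.eval c) := by
  induction t with
  | leaf b => rfl
  | test l hi lo h1 h2 => simp only [map, eval, h1, h2]; split_ifs <;> rfl

theorem reads_map (f : β → γ) (c : ℕ → Bool) (k : ℕ) (t : SearchTree β) :
    (t.map f).Reads c k ↔ t.Reads c k := by
  induction t with
  | leaf b => rfl
  | test l hi lo h1 h2 => simp only [map, Reads, h1, h2]

theorem valid_map {f : β → γ} {t : SearchTree β} {n a e : ℕ} :
    (t.map f).Valid n a e ↔ t.Valid n a e := by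
  induction t generalizing n a e with
  | leaf b => rfl
  | test l hi lo h1 h2 => simp only [map, Valid, h1, h2]

theorem Valid.mono {t : SearchTree β} {n a e n' a' e' : ℕ} (h : t.Valid n a e) (hn : n ≤ n')
    (ha : a' ≤ a) (he : e ≤ e') : t.Valid n' a' e' := by
  induction t generalizing n a e n' a' e' with
  | leaf b => trivial
  | test l hi lo h1 h2 =>
    obtain ⟨h0, hal, hle, hv1, hv2⟩ := h
    exact ⟨by omega, by omega, by omega, h1 hv1 (by omega) le_rfl he,
      h2 hv2 (by omega) ha le_rfl⟩

end SearchTree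

theorem heavyAt_zero (T : DataTree X) (c : List ℕ → Bool) (a : ℕ) (A B : List ℕ → Prop) :
    heavyAt T c a 0 A B = fun _ => False := by
  funext u; rw [heavyAt]; simp

theorem heavyAt_of_ne_zero (T : DataTree X) (c : List ℕ → Bool) (a : ℕ) {len : ℕ}
    (h : len ≠ 0) (A B : List ℕ → Prop) :
    heavyAt T c a len A B = fun u =>
      if u.length < a + len / 2 then
        heavyAt T c a (len / 2) A (midHeavy T c a (a + len / 2) A B) u
      else if u.length = a + len / 2 then midHeavy T c a (a + len / 2) A B u
      else heavyAt T c (a + len / 2 + 1) (len - len / 2 - 1)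
        (midHeavy T c a (a + len / 2) A B) B u := by
  funext u; rw [heavyAt, dif_neg h]

theorem midHeavy_congr {T : DataTree X} {c c' : List ℕ → Bool} {p : List ℕ} {a mid : ℕ}
    {A B : List ℕ → Prop} (hc : ∀ u, ¬ u <+: p → c u = c' u)
    (h : mid ≤ p.length → c (p.take mid) = c' (p.take mid) ∨ (∃ w, B w ∧ p.take mid <+: w) ∨
      ¬ A ((p.take mid).take (a - 1))) :
    midHeavy T c a mid A B = midHeavy T c' a mid A B := by
  funext w
  unfold midHeavy
  refine propext (and_congr_right fun _ => and_congr_right fun hl => ?_)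
  by_cases hw : w <+: p
  · have hwt : w = p.take mid := by rw [← hl]; exact List.prefix_iff_eq_take.1 hw
    rcases h (hl ▸ hw.length_le) with h | h | h <;> rw [← hwt] at h
    · rw [h]
    · simp [h]
    · simp [h]
  · rw [hc w hw]

/-- If all nodes of the path in an interval of levels lie above a heavy node, or if they lie below a
light node, then the coins of the path in this interval are not used. -/
theorem heavyAt_const {T : DataTree X} {c c' : List ℕ → Bool} {p : List ℕ} {a len : ℕ}
    {A B : List ℕ → Prop} (hc : ∀ u, ¬ u <+: p → c u = c' u)
    (hB : ∀ w, B w → w ∈ T.nodes ∧ w.length = a + len)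
    (hdead : (∀ l, a ≤ l → l < a + len → l ≤ p.length → ∃ w, B w ∧ p.take l <+: w) ∨
      (a - 1 ≤ p.length ∧ ¬ A (p.take (a - 1)) ∧ ∀ w, B w → ¬ p.take (a - 1) <+: w)) :
    heavyAt T c a len A B = heavyAt T c' a len A B ∧
      ∀ l, a ≤ l → l < a + len → l ≤ p.length → ¬ testedAt T c a len A B (p.take l) := by
  induction len using Nat.strong_induction_on generalizing a A B with
  | _ len ih =>
    by_cases h0 : len = 0
    · subst h0
      refine ⟨?_, fun l _ _ _ => by omega⟩
      rw [heavyAt_zero, heavyAt_zero]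
    set mid := a + len / 2 with hmid
    have htake : a ≤ mid → (p.take mid).take (a - 1) = p.take (a - 1) := by
      intro _; rw [List.take_take, min_eq_left (by omega)]
    have hmidc : midHeavy T c a mid A B = midHeavy T c' a mid A B := by
      refine midHeavy_congr hc fun hl => ?_
      rcases hdead with h | ⟨_, h, _⟩
      · exact Or.inr (Or.inl (h mid (by omega) (by omega) hl))
      · rw [htake (by omega)]; exact Or.inr (Or.inr h)
    set S := midHeavy T c a mid A B with hS
    have hSn : ∀ w, S w → w ∈ T.nodes ∧ w.length = a + len / 2 := fun w hw => ⟨hw.1, hw.2.1⟩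
    have hleft := ih (len / 2) (by omega) (a := a) (A := A) (B := S) hSn (by
      rcases hdead with h | ⟨h1, h2, h3⟩
      · left
        intro l hal hl hlp
        obtain ⟨w, hw, hp⟩ := h l hal (by omega) hlp
        have hlw := (hB w hw).2
        refine ⟨w.take mid, ⟨T.mem_of_prefix (hB w hw).1 (List.take_prefix _ _), ?_,
          Or.inl ⟨w, hw, List.take_prefix _ _⟩⟩, prefix_take_iff' hp ?_⟩
        · rw [List.length_take]; omega
        · rw [List.length_take]; omega
      · right
        refine ⟨h1, h2, ?_⟩
        rintro w ⟨_, hlw, ⟨w', hw', hp'⟩ | ⟨hA, _⟩⟩ hp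
        · exact h3 w' hw' (hp.trans hp')
        · rw [List.prefix_iff_eq_take, List.length_take, min_eq_left h1] at hp
          exact h2 (hp ▸ hA))
    have hright := ih (len - len / 2 - 1) (by omega) (a := mid + 1) (A := S) (B := B)
      (fun w hw => ⟨(hB w hw).1, by rw [(hB w hw).2]; omega⟩) (by
      rcases hdead with h | ⟨h1, h2, h3⟩
      · left
        intro l hal hl hlp
        exact h l (by omega) (by omega) hlp
      · by_cases hmp : mid ≤ p.length
        · right
          refine ⟨by omega, ?_, ?_⟩
          · rintro ⟨_, hlw, ⟨w', hw', hp'⟩ | ⟨hA, _⟩⟩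
            · exact h3 w' hw' (List.IsPrefix.trans (List.take_prefix_take_left (by omega)) hp')
            · simp only [Nat.add_sub_cancel] at hA
              rw [htake (by omega)] at hA; exact h2 hA
          · intro w hw hp
            exact h3 w hw (List.IsPrefix.trans (List.take_prefix_take_left (by omega)) hp)
        · left
          intro l _ _ _; omega)
    constructor
    · rw [heavyAt_of_ne_zero _ _ _ h0, heavyAt_of_ne_zero _ _ _ h0, ← hmid, ← hmidc, ← hS,
        hleft.1, hright.1]
    · intro l hal hl hlp htest
      rw [testedAt] at htest
      have hll : (p.take l).length = l := by rw [List.length_take]; omega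
      simp only [h0, dif_neg, not_false_eq_true, hll] at htest
      split_ifs at htest with h1 h2
      · exact hleft.2 l hal h1 hlp htest
      · rcases hdead with h | ⟨_, h, _⟩
        · exact htest.1 (h l hal hl hlp)
        · apply h
          have := htest.2
          rwa [h2, htake (by omega)] at this
      · exact hright.2 l (by omega) (by omega) hlp htest

/-- Once the coins off a path are fixed, the algorithm performs a binary search on the path. -/
theorem exists_searchTree {T : DataTree X} {p : List ℕ} (hp : p ∈ T.nodes) (c₀ : List ℕ → Bool)
    {n a len : ℕ} {A B : List ℕ → Prop} (hn : len < 2 ^ n)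
    (hB : ∀ w, B w → w ∈ T.nodes ∧ w.length = a + len) :
    ∃ t : SearchTree (List ℕ → Prop), t.Valid n a (min (a + len) (p.length + 1)) ∧
      ∀ c : List ℕ → Bool, (∀ u, ¬ u <+: p → c u = c₀ u) →
        heavyAt T c a len A B = t.eval (fun l => c (p.take l)) ∧
        ∀ l, a ≤ l → l < a + len → l ≤ p.length → testedAt T c a len A B (p.take l) →
          t.Reads (fun l => c (p.take l)) l := by
  induction len using Nat.strong_induction_on generalizing n a A B with
  | _ len ih =>
    by_cases h0 : len = 0
    · subst h0
      refine ⟨.leaf fun _ => False, trivial, fun c _ => ⟨?_, fun l _ _ _ => by omega⟩⟩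
      rw [heavyAt_zero]; rfl
    obtain ⟨n, rfl⟩ : ∃ n', n = n' + 1 := ⟨n - 1, by
      rcases n with _ | n
      · simp at hn; omega
      · rfl⟩
    rw [pow_succ] at hn
    set mid := a + len / 2 with hmid
    have htake : (p.take mid).take (a - 1) = p.take (a - 1) := by
      rw [List.take_take, min_eq_left (by omega)]
    -- the left and the right half when the heavy nodes of the middle layer are `S`
    have left : ∀ S : List ℕ → Prop, (∀ w, S w → w ∈ T.nodes ∧ w.length = a + len / 2) → _ :=
      fun S hS => ih (len / 2) (by omega) (n := n) (a := a) (A := A) (B := S) (by omega) hS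
    have right : ∀ S : List ℕ → Prop, _ := fun S =>
      ih (len - len / 2 - 1) (by omega) (n := n) (a := mid + 1) (A := S) (B := B) (by omega)
        (fun w hw => ⟨(hB w hw).1, by rw [(hB w hw).2]; omega⟩)
    have e1 : mid + 1 + (len - len / 2 - 1) = a + len := by omega
    have leftConst : ∀ (S : List ℕ → Prop) (c : List ℕ → Bool),
        (∀ w, S w → w ∈ T.nodes ∧ w.length = a + len / 2) →
        (∀ u, ¬ u <+: p → c u = c₀ u) → S (p.take mid) → _ :=
      fun S c hS hc hs => heavyAt_const (a := a) (len := len / 2) (A := A) (B := S) hc hS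
        (Or.inl fun l _ hl _ => ⟨_, hs, List.take_prefix_take_left hl.le⟩)
    have rightConst : ∀ (S : List ℕ → Prop) (c : List ℕ → Bool),
        (∀ u, ¬ u <+: p → c u = c₀ u) → (mid ≤ p.length → ¬ S (p.take mid)) →
        (mid ≤ p.length → ∀ w, B w → ¬ p.take mid <+: w) → _ :=
      fun S c hc hs hb => heavyAt_const (a := mid + 1) (len := len - len / 2 - 1) (A := S) (B := B)
        hc (fun w hw => ⟨(hB w hw).1, by rw [(hB w hw).2]; omega⟩) (by
          by_cases hmp : mid ≤ p.length
          · exact Or.inr ⟨by omega, hs hmp, hb hmp⟩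
          · exact Or.inl fun l _ _ _ => by omega)
    have eqs : ∀ (c : List ℕ → Bool) (S L R : List ℕ → Prop),
        midHeavy T c a mid A B = S → heavyAt T c a (len / 2) A S = L →
        heavyAt T c (mid + 1) (len - len / 2 - 1) S B = R →
        heavyAt T c a len A B = fun u =>
          if u.length < mid then L u else if u.length = mid then S u else R u := by
      rintro c S L R rfl rfl rfl
      exact heavyAt_of_ne_zero _ _ _ h0 _ _
    have teqs : ∀ (c : List ℕ → Bool) (S : List ℕ → Prop) (l : ℕ),
        midHeavy T c a mid A B = S → l ≤ p.length → testedAt T c a len A B (p.take l) →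
        (l < mid ∧ testedAt T c a (len / 2) A S (p.take l)) ∨
        (l = mid ∧ (¬ ∃ w, B w ∧ p.take mid <+: w) ∧ A (p.take (a - 1))) ∨
        (mid < l ∧ testedAt T c (mid + 1) (len - len / 2 - 1) S B (p.take l)) := by
      rintro c S l rfl hlp ht
      have hll : (p.take l).length = l := by rw [List.length_take]; omega
      rw [testedAt] at ht
      simp only [h0, dif_neg, not_false_eq_true, hll] at ht
      split_ifs at ht with h1 h2
      · exact Or.inl ⟨h1, ht⟩
      · have ht2 := ht.2
        rw [h2, htake] at ht2
        have ht1 := ht.1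
        rw [h2] at ht1
        exact Or.inr (Or.inl ⟨h2, ht1, ht2⟩)
      · exact Or.inr (Or.inr ⟨by omega, ht⟩)
    -- the middle layer does not use a coin of the path and its path node is not heavy
    have caseLeft : (mid ≤ p.length → (¬ ∃ w, B w ∧ p.take mid <+: w) ∧ ¬ A (p.take (a - 1))) →
        ∃ t : SearchTree (List ℕ → Prop),
          t.Valid (n + 1) a (min (a + len) (p.length + 1)) ∧
          ∀ c : List ℕ → Bool, (∀ u, ¬ u <+: p → c u = c₀ u) →
            heavyAt T c a len A B = t.eval (fun l => c (p.take l)) ∧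
            ∀ l, a ≤ l → l < a + len → l ≤ p.length → testedAt T c a len A B (p.take l) →
              t.Reads (fun l => c (p.take l)) l := by
      intro hm
      set S := midHeavy T c₀ a mid A B with hS
      obtain ⟨t, ht, hte⟩ := left S fun w hw => ⟨hw.1, hw.2.1⟩
      refine ⟨t.map fun L u => if u.length < mid then L u else if u.length = mid then S u
        else heavyAt T c₀ (mid + 1) (len - len / 2 - 1) S B u,
        SearchTree.valid_map.2 (ht.mono (by omega) le_rfl (by omega)), fun c hc => ?_⟩
      have hSc : midHeavy T c a mid A B = S := midHeavy_congr hc fun hmp =>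
        Or.inr (Or.inr (by rw [htake]; exact (hm hmp).2))
      have hr := rightConst S c hc (fun hmp => by
          rintro ⟨_, _, h | ⟨h, _⟩⟩
          · exact (hm hmp).1 h
          · rw [htake] at h; exact (hm hmp).2 h)
        (fun hmp w hw hpw => (hm hmp).1 ⟨w, hw, hpw⟩)
      refine ⟨?_, ?_⟩
      · rw [SearchTree.eval_map]
        exact eqs c S _ _ hSc (hte c hc).1 hr.1
      · intro l hal hl hlp htest
        rw [SearchTree.reads_map]
        rcases teqs c S l hSc hlp htest with ⟨h, h'⟩ | ⟨h, _, h'⟩ | ⟨h, h'⟩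
        · exact (hte c hc).2 l hal h hlp h'
        · exact absurd h' (hm (h ▸ hlp)).2
        · exact absurd h' (hr.2 l (by omega) (by omega) hlp)
    by_cases hmp : mid ≤ p.length
    swap
    · exact caseLeft fun h => absurd h hmp
    by_cases hBl : ∃ w, B w ∧ p.take mid <+: w
    · -- the path node of the middle layer is heavy without being tested
      set S := midHeavy T c₀ a mid A B with hS
      have hs : S (p.take mid) := ⟨T.mem_of_prefix hp (List.take_prefix _ _), by
        rw [List.length_take]; omega, Or.inl hBl⟩
      obtain ⟨t, ht, hte⟩ := right S
      rw [e1] at ht hte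
      refine ⟨t.map fun R u => if u.length < mid then heavyAt T c₀ a (len / 2) A S u
        else if u.length = mid then S u else R u,
        SearchTree.valid_map.2 (ht.mono (by omega) (by omega) (by omega)), fun c hc => ?_⟩
      have hSc : midHeavy T c a mid A B = S := midHeavy_congr hc fun _ => Or.inr (Or.inl hBl)
      have hl' := leftConst S c (fun w hw => ⟨hw.1, hw.2.1⟩) hc hs
      refine ⟨?_, ?_⟩
      · rw [SearchTree.eval_map]
        exact eqs c S _ _ hSc hl'.1 (hte c hc).1
      · intro l hal hl hlp htest
        rw [SearchTree.reads_map]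
        rcases teqs c S l hSc hlp htest with ⟨h, h'⟩ | ⟨_, h', _⟩ | ⟨h, h'⟩
        · exact absurd h' (hl'.2 l (by omega) (by omega) hlp)
        · exact absurd hBl h'
        · exact (hte c hc).2 l (by omega) (by omega) hlp h'
    by_cases hA : A (p.take (a - 1))
    swap
    · exact caseLeft fun _ => ⟨hBl, hA⟩
    -- the path node of the middle layer is tested
    set S : Bool → List ℕ → Prop :=
      fun b => midHeavy T (Function.update c₀ (p.take mid) b) a mid A B with hS
    have hSn : ∀ b w, S b w → w ∈ T.nodes ∧ w.length = a + len / 2 :=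
      fun b w hw => ⟨hw.1, hw.2.1⟩
    have hs1 : S true (p.take mid) := ⟨T.mem_of_prefix hp (List.take_prefix _ _), by
      rw [List.length_take]; omega, Or.inr ⟨by rw [htake]; exact hA, by simp⟩⟩
    have hs0 : ¬ S false (p.take mid) := by
      rintro ⟨_, _, h | ⟨_, h⟩⟩
      · exact hBl h
      · simp at h
    obtain ⟨t1, ht1, hte1⟩ := right (S true)
    obtain ⟨t0, ht0, hte0⟩ := left (S false) (hSn false)
    rw [e1] at ht1 hte1
    refine ⟨.test mid
      (t1.map fun R u => if u.length < mid then heavyAt T c₀ a (len / 2) A (S true) u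
        else if u.length = mid then S true u else R u)
      (t0.map fun L u => if u.length < mid then L u else if u.length = mid then S false u
        else heavyAt T c₀ (mid + 1) (len - len / 2 - 1) (S false) B u),
      ⟨by omega, by omega, by omega, SearchTree.valid_map.2 (ht1.mono (by omega) le_rfl (by omega)),
        SearchTree.valid_map.2 (ht0.mono (by omega) le_rfl (by omega))⟩, fun c hc => ?_⟩
    have hSc : midHeavy T c a mid A B = S (c (p.take mid)) := by
      refine midHeavy_congr (p := p) (fun u hu => ?_) fun _ => Or.inl (by simp)
      rw [Function.update_of_ne (by rintro rfl; exact hu (List.take_prefix _ _)), hc u hu]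
    cases hcb : c (p.take mid) with
    | true =>
      rw [hcb] at hSc
      have hl' := leftConst (S true) c (hSn true) hc hs1
      refine ⟨?_, ?_⟩
      · simp only [SearchTree.eval, hcb, if_true]
        rw [SearchTree.eval_map]
        exact eqs c (S true) _ _ hSc hl'.1 (hte1 c hc).1
      · intro l hal hl hlp htest
        simp only [SearchTree.Reads, hcb, if_true, SearchTree.reads_map]
        rcases teqs c (S true) l hSc hlp htest with ⟨h, h'⟩ | ⟨h, _⟩ | ⟨h, h'⟩
        · exact absurd h' (hl'.2 l (by omega) (by omega) hlp)
        · exact Or.inl h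
        · exact Or.inr ((hte1 c hc).2 l (by omega) (by omega) hlp h')
    | false =>
      rw [hcb] at hSc
      have hr := rightConst (S false) c hc (fun _ => hs0) fun _ w hw hpw => hBl ⟨w, hw, hpw⟩
      refine ⟨?_, ?_⟩
      · simp only [SearchTree.eval, hcb, if_false, Bool.false_eq_true]
        rw [SearchTree.eval_map]
        exact eqs c (S false) _ _ hSc (hte0 c hc).1 hr.1
      · intro l hal hl hlp htest
        simp only [SearchTree.Reads, hcb, if_false, Bool.false_eq_true, SearchTree.reads_map]
        rcases teqs c (S false) l hSc hlp htest with ⟨h, h'⟩ | ⟨h, _⟩ | ⟨h, h'⟩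
        · exact Or.inr ((hte0 c hc).2 l (by omega) (by omega) hlp h')
        · exact Or.inl h
        · exact absurd h' (hr.2 l (by omega) (by omega) hlp)

end

section

variable {X : Type*}

/-! ### Accuracy -/

section Freeze

variable {ι : Type} [DecidableEq ι]

/-- To prove a statement about two families of coin laws that agree on `s`, the coins of `s` may be
replaced by deterministic ones, one at a time. -/
theorem freeze_induction {P : (ι → PMF Bool) → (ι → PMF Bool) → Prop}
    (s : List ι) (hstep : ∀ κ κ', ∀ u ∈ s, κ u = κ' u →
      (∀ b, P (Function.update κ u (PMF.pure b)) (Function.update κ' u (PMF.pure b))) → P κ κ')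
    (κ κ' : ι → PMF Bool) (hs : ∀ u ∈ s, κ u = κ' u)
    (hbase : ∀ θ θ' : ι → PMF Bool, (∀ u ∉ s, θ u = κ u ∧ θ' u = κ' u) →
      (∀ u ∈ s, ∃ b, θ u = PMF.pure b ∧ θ' u = PMF.pure b) → P θ θ') : P κ κ' := by
  induction s generalizing κ κ' with
  | nil => exact hbase κ κ' (fun u _ => ⟨rfl, rfl⟩) (by simp)
  | cons v s ih =>
    refine hstep κ κ' v (by simp) (hs v (by simp)) fun b =>
      ih (fun κ κ' u hu => hstep κ κ' u (by simp [hu])) _ _ (fun u hu => ?_) fun θ θ' h1 h2 => ?_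
    · by_cases huv : u = v
      · subst huv; simp
      · rw [Function.update_of_ne huv, Function.update_of_ne huv]
        exact hs u (by simp [hu])
    · refine hbase θ θ' (fun u hu => ?_) fun u hu => ?_
      · simp only [List.mem_cons, not_or] at hu
        have := h1 u hu.2
        rwa [Function.update_of_ne hu.1, Function.update_of_ne hu.1] at this
      · by_cases hus : u ∈ s
        · exact h2 u hus
        · obtain rfl : u = v := by simpa [hus] using hu
          have := h1 u hus
          simp only [Function.update_self] at this
          exact ⟨b, this⟩

end Freeze

theorem toOuterMeasure_bind_bool {β : Type} (p : PMF Bool) (f : Bool → PMF β) (s : Set β) :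
    (p.bind f).toOuterMeasure s =
      p true * (f true).toOuterMeasure s + p false * (f false).toOuterMeasure s := by
  rw [PMF.toOuterMeasure_bind_apply, tsum_bool, add_comm]

theorem pmf_bool_add (p : PMF Bool) : p true + p false = 1 := by
  have := p.tsum_coe
  rwa [tsum_bool, add_comm] at this

theorem toOuterMeasure_le_one {α : Type*} (p : PMF α) (s : Set α) : p.toOuterMeasure s ≤ 1 := by
  calc p.toOuterMeasure s ≤ p.toOuterMeasure Set.univ := measure_mono (Set.subset_univ _)
    _ = 1 := (p.toOuterMeasure_apply_eq_one_iff _).2 (Set.subset_univ _)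

theorem toOuterMeasure_bool (p : PMF Bool) (s : Set Bool) [DecidablePred (· ∈ s)] :
    p.toOuterMeasure s =
      p true * (if true ∈ s then 1 else 0) + p false * (if false ∈ s then 1 else 0) := by
  rw [PMF.toOuterMeasure_apply, tsum_bool, add_comm]
  congr 1 <;> simp [Set.indicator]

theorem take_ne_take {p : List ℕ} {l l' : ℕ} (hl : l ≤ p.length) (hl' : l' ≤ p.length)
    (h : l ≠ l') : p.take l ≠ p.take l' := by
  intro he
  have := congrArg List.length he
  rw [List.length_take, List.length_take] at this
  omega

open Classical in
/-- A search tree of depth `n` meets a bad coin with probability at most `n q`. -/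
theorem SearchTree.measure_reads_bad_le {β : Type} {p : List ℕ} {us : List (List ℕ)}
    (hus : us.Nodup) (hp : ∀ l ≤ p.length, p.take l ∈ us) (bad : ℕ → Bool → Prop) (q : ENNReal)
    (t : SearchTree β) {n a e : ℕ} (ht : t.Valid n a e) (he : e ≤ p.length + 1)
    (κ : List ℕ → PMF Bool)
    (hq : ∀ l, a ≤ l → l < e → (κ (p.take l)).toOuterMeasure {b | bad l b} ≤ q) :
    (coins κ us).toOuterMeasure
      {c | ∃ l, t.Reads (fun l => c (p.take l)) l ∧ bad l (c (p.take l))} ≤ n * q := by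
  induction t generalizing n a e κ with
  | leaf b => simp [Reads]
  | test l hi lo ih1 ih0 =>
    obtain ⟨h0, hal, hle, hv1, hv0⟩ := ht
    obtain ⟨n, rfl⟩ : ∃ n', n = n' + 1 := ⟨n - 1, by omega⟩
    simp only [Nat.add_sub_cancel] at hv1 hv0
    have hκ : ∀ b l', l' ≠ l → l' < e →
        Function.update κ (p.take l) (PMF.pure b) (p.take l') = κ (p.take l') := by
      intro b l' hne hl'
      exact Function.update_of_ne (take_ne_take (by omega) (by omega) hne) _ _
    have hb : ∀ b, (coins (Function.update κ (p.take l) (PMF.pure b)) us).toOuterMeasure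
        {c | ∃ k, (test l hi lo).Reads (fun l => c (p.take l)) k ∧ bad k (c (p.take k))} ≤
        (if bad l b then 1 else 0) + n * q := by
      intro b
      by_cases hbad : bad l b
      · rw [if_pos hbad]
        exact (toOuterMeasure_le_one _ _).trans le_self_add
      · rw [if_neg hbad, zero_add]
        have hsupp : ∀ c ∈ (coins (Function.update κ (p.take l) (PMF.pure b)) us).support,
            c (p.take l) = b := fun c hc =>
          coins_support_pure hc (hp l (by omega)) (by simp)
        cases b with
        | true =>
          refine le_trans (PMF.toOuterMeasure_mono _ ?_) (ih1 hv1 he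
            (Function.update κ (p.take l) (PMF.pure true)) fun l' h1 h2 => ?_)
          · rintro c ⟨⟨k, hk, hbk⟩, hc⟩
            have hcl := hsupp c hc
            simp only [Reads, hcl, if_true] at hk
            rcases hk with rfl | hk
            · rw [hcl] at hbk; exact absurd hbk hbad
            · exact ⟨k, hk, hbk⟩
          · rw [hκ true l' (by omega) h2]; exact hq l' (by omega) h2
        | false =>
          refine le_trans (PMF.toOuterMeasure_mono _ ?_) (ih0 hv0 (by omega)
            (Function.update κ (p.take l) (PMF.pure false)) fun l' h1 h2 => ?_)
          · rintro c ⟨⟨k, hk, hbk⟩, hc⟩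
            have hcl := hsupp c hc
            simp only [Reads, hcl, Bool.false_eq_true, if_false] at hk
            rcases hk with rfl | hk
            · rw [hcl] at hbk; exact absurd hbk hbad
            · exact ⟨k, hk, hbk⟩
          · rw [hκ false l' (by omega) (by omega)]; exact hq l' h1 (by omega)
    rw [coins_expose κ hus (p.take l), toOuterMeasure_bind_bool]
    calc _ ≤ κ (p.take l) true * ((if bad l true then 1 else 0) + n * q) +
          κ (p.take l) false * ((if bad l false then 1 else 0) + n * q) := by
          gcongr
          · exact hb true
          · exact hb false
      _ = (κ (p.take l)).toOuterMeasure {b | bad l b} +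
          (κ (p.take l) true + κ (p.take l) false) * (n * q) := by
          rw [toOuterMeasure_bool]
          simp only [Set.mem_ofPred_eq]
          ring
      _ ≤ q + 1 * (n * q) := by
          rw [pmf_bool_add]
          gcongr
          exact hq l hal hle
      _ = ((n + 1 : ℕ) : ENNReal) * q := by push_cast; ring

/-- The node `u` is tested in the run on the whole tree. -/
def Tested (T : DataTree X) (c : List ℕ → Bool) : List ℕ → Prop :=
  testedAt T c 0 T.height (fun _ => True) (fun _ => False)

theorem take_leafOf_mem (T : DataTree X) {p : List ℕ} (hp : p ∈ T.nodes) (l : ℕ) :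
    p.take l ∈ nodeList T := by
  rw [nodeList, Finset.mem_toList]
  exact T.mem_of_prefix hp (List.take_prefix _ _)

theorem nodup_nodeList (T : DataTree X) : (nodeList T).Nodup := Finset.nodup_toList _

theorem mem_nodeList {T : DataTree X} {u : List ℕ} : u ∈ nodeList T ↔ u ∈ T.nodes :=
  Finset.mem_toList

/-- The probability that the algorithm tests a node with a bad coin on a given path. -/
theorem measure_tested_bad_le (T : DataTree X) {p : List ℕ} (hp : p ∈ T.nodes)
    (κ : List ℕ → PMF Bool) {n : ℕ} (hn : T.height < 2 ^ n) (bad : ℕ → Bool → Prop) (q : ENNReal)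
    (hq : ∀ l ≤ p.length, (κ (p.take l)).toOuterMeasure {b | bad l b} ≤ q) :
    (coins κ (nodeList T)).toOuterMeasure
      {c | ∃ l ≤ p.length, Tested T c (p.take l) ∧ bad l (c (p.take l))} ≤ n * q := by
  classical
  refine freeze_induction (P := fun κ _ =>
      (∀ l ≤ p.length, (κ (p.take l)).toOuterMeasure {b | bad l b} ≤ q) →
      (coins κ (nodeList T)).toOuterMeasure
      {c | ∃ l ≤ p.length, Tested T c (p.take l) ∧ bad l (c (p.take l))} ≤ n * q)
    ((nodeList T).filter fun u => ¬ u <+: p) ?_ κ κ (fun _ _ => rfl) ?_ hq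
  · intro κ _ u hu _ h hq
    have hup : ¬ u <+: p := by simpa using (List.mem_filter.1 hu).2
    rw [coins_expose κ (nodup_nodeList T) u, toOuterMeasure_bind_bool]
    have h' : ∀ b, _ := fun b => h b fun l hl => by
      rw [Function.update_of_ne (by rintro rfl; exact hup (List.take_prefix _ _))]
      exact hq l hl
    calc _ ≤ κ u true * (n * q) + κ u false * (n * q) := by
          gcongr
          · exact h' true
          · exact h' false
      _ = n * q := by rw [← add_mul, pmf_bool_add, one_mul]
  · intro θ _ h1 h2 hq
    have hpure : ∀ u, ∃ b, u ∈ nodeList T → ¬ u <+: p → θ u = PMF.pure b := by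
      intro u
      by_cases hu : u ∈ nodeList T ∧ ¬ u <+: p
      · obtain ⟨b, hb, _⟩ := h2 u (List.mem_filter.2 ⟨hu.1, by simpa using hu.2⟩)
        exact ⟨b, fun _ _ => hb⟩
      · exact ⟨false, fun h h' => absurd ⟨h, h'⟩ hu⟩
    choose d hd using hpure
    obtain ⟨t, ht, hte⟩ := exists_searchTree hp (fun u => if u ∈ nodeList T then d u else false)
      (n := n) (a := 0) (len := T.height) (A := fun _ => True) (B := fun _ => False) hn
      (fun _ h => h.elim)
    refine le_trans (PMF.toOuterMeasure_mono _ ?_) (t.measure_reads_bad_le (nodup_nodeList T)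
      (fun l _ => take_leafOf_mem T hp l) bad q ht (by omega) θ fun l _ hl => hq l (by omega))
    rintro c ⟨⟨l, hl, htest, hbad⟩, hc⟩
    refine ⟨l, (hte c fun u hu => ?_).2 l (by omega) ?_ hl htest, hbad⟩
    · by_cases hun : u ∈ nodeList T
      · rw [if_pos hun]
        exact coins_support_pure hc hun (hd u hun hu)
      · rw [if_neg hun]
        exact coins_support_of_not_mem hc hun
    · have := T.length_lt_height hp
      omega

/-- If no tested coin is bad then heavy nodes have large counts and light nodes small ones. -/
theorem heavyAt_accurate {T : DataTree X} {c : List ℕ → Bool} {cnt : List ℕ → ℝ} {lo hi : ℝ}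
    (hcnt : ∀ u w, u <+: w → cnt w ≤ cnt u) {a len : ℕ} {A B : List ℕ → Prop}
    (hB : ∀ w, B w → w ∈ T.nodes ∧ w.length = a + len) (hBc : ∀ w, B w → lo < cnt w)
    (hA : ∀ u ∈ T.nodes, a ≤ u.length → ¬ A (u.take (a - 1)) → cnt u < hi)
    (hgood : ∀ u ∈ T.nodes, a ≤ u.length → u.length < a + len → testedAt T c a len A B u →
      (c u = true → lo < cnt u) ∧ (c u = false → cnt u < hi))
    {u : List ℕ} (hu : u ∈ T.nodes) (hau : a ≤ u.length) (hul : u.length < a + len) :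
    (heavyAt T c a len A B u → lo < cnt u) ∧ (¬ heavyAt T c a len A B u → cnt u < hi) := by
  induction len using Nat.strong_induction_on generalizing a A B u with
  | _ len ih =>
    have h0 : len ≠ 0 := by omega
    set mid := a + len / 2 with hmid
    set S := midHeavy T c a mid A B with hS
    have hmidgood : ∀ w ∈ T.nodes, w.length = mid →
        (S w → lo < cnt w) ∧ (¬ S w → cnt w < hi) := by
      intro w hw hlw
      have htest : (¬ ∃ w', B w' ∧ w <+: w') → A (w.take (a - 1)) → testedAt T c a len A B w := by
        intro h1 h2
        rw [testedAt, dif_neg h0, if_neg (by omega), if_pos hlw]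
        exact ⟨h1, h2⟩
      constructor
      · intro hSw
        by_cases hb : ∃ w', B w' ∧ w <+: w'
        · obtain ⟨w', hw', hp⟩ := hb
          exact (hBc w' hw').trans_le (hcnt _ _ hp)
        · obtain ⟨_, _, h | ⟨h1, h2⟩⟩ := hSw
          · exact absurd h hb
          · exact (hgood w hw (by omega) (by omega) (htest hb h1)).1 h2
      · intro hSw
        have hb : ¬ ∃ w', B w' ∧ w <+: w' := fun h => hSw ⟨hw, hlw, Or.inl h⟩
        by_cases hAw : A (w.take (a - 1))
        · refine (hgood w hw (by omega) (by omega) (htest hb hAw)).2 ?_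
          by_contra hcw
          exact hSw ⟨hw, hlw, Or.inr ⟨hAw, by simpa using hcw⟩⟩
        · exact hA w hw (by omega) hAw
    rw [heavyAt_of_ne_zero _ _ _ h0]
    dsimp only
    rw [← hmid, ← hS]
    split_ifs with h1 h2
    · refine ih (len / 2) (by omega) (fun w hw => ⟨hw.1, hw.2.1⟩)
        (fun w hw => (hmidgood w hw.1 hw.2.1).1 hw) hA (fun w hw hal hl ht => ?_) hu hau h1
      refine hgood w hw hal (by omega) ?_
      rwa [testedAt, dif_neg h0, if_pos hl]
    · exact hmidgood u hu h2
    · refine ih (len - len / 2 - 1) (by omega)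
        (fun w hw => ⟨(hB w hw).1, by rw [(hB w hw).2]; omega⟩) hBc (fun w hw hal hA' => ?_)
        (fun w hw hal hl ht => ?_) hu (by omega) (by omega)
      · refine lt_of_le_of_lt (hcnt _ _ (List.take_prefix _ _))
          ((hmidgood (w.take (mid + 1 - 1)) (T.mem_of_prefix hw (List.take_prefix _ _)) ?_).2 hA')
        rw [List.length_take]; omega
      · refine hgood w hw (by omega) (by omega) ?_
        rwa [testedAt, dif_neg h0, if_neg (by omega), if_neg (by omega)]

theorem DataTree.count_le_of_prefix (T : DataTree X) (D : List X) {u w : List ℕ} (h : u <+: w) :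
    T.count D w ≤ T.count D u := by
  refine List.countP_mono_left fun x _ hx => ?_
  simp only [decide_eq_true_eq] at hx ⊢
  exact h.trans hx

/-- The probability that the threshold test releases `⊤`. -/
theorem gaussianSparseThreshold_true (σ τ Δ : ℝ) (c : ℕ) :
    gaussianSparseThreshold σ τ Δ c true =
      gaussianReal 0 (σ ^ 2).toNNReal {z | thresholdTest τ Δ c z} := by
  classical
  rw [gaussianSparseThreshold, Measure.toPMF_apply, Measure.map_apply
      (measurable_thresholdTest τ Δ c) (by simp)]
  congr 1; ext z; simp

theorem gaussianSparseThreshold_false (σ τ Δ : ℝ) (c : ℕ) :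
    gaussianSparseThreshold σ τ Δ c false =
      gaussianReal 0 (σ ^ 2).toNNReal {z | ¬ thresholdTest τ Δ c z} := by
  classical
  rw [gaussianSparseThreshold, Measure.toPMF_apply, Measure.map_apply
      (measurable_thresholdTest τ Δ c) (by simp)]
  congr 1; ext z; simp

theorem gaussianSparseThreshold_of_le {σ τ Δ : ℝ} {c : ℕ} (h : (c : ℝ) ≤ τ - Δ - 1) :
    gaussianSparseThreshold σ τ Δ c = PMF.pure false := by
  have h1 : gaussianSparseThreshold σ τ Δ c true = 0 := by
    rw [gaussianSparseThreshold_true]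
    convert measure_empty
    · ext z
      simp only [thresholdTest, Set.mem_ofPred_eq, Set.mem_empty_iff_false, iff_false, not_and]
      intro h'; linarith
    all_goals infer_instance
  have h2 := pmf_bool_add (gaussianSparseThreshold σ τ Δ c)
  rw [h1, zero_add] at h2
  ext b
  cases b <;> simp [h1, h2]

theorem gaussianReal_tail_le {σ α : ℝ} (hα : 0 ≤ α) :
    gaussianReal 0 (σ ^ 2).toNNReal {z | α ≤ z} ≤
      ENNReal.ofReal (Real.exp (-α ^ 2 / (2 * σ ^ 2))) := by
  have hsub : HasSubgaussianMGF id (σ ^ 2).toNNReal (gaussianReal 0 (σ ^ 2).toNNReal) := by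
    refine ⟨fun t => integrable_exp_mul_gaussianReal t, fun t => ?_⟩
    rw [mgf_id_gaussianReal]
    simp
  have := hsub.measure_ge_le hα
  rw [Real.coe_toNNReal _ (sq_nonneg σ)] at this
  rw [← ENNReal.ofReal_toReal (measure_ne_top (gaussianReal 0 (σ ^ 2).toNNReal) {z | α ≤ z})]
  exact ENNReal.ofReal_le_ofReal this

theorem gaussianReal_tail_le' {σ α : ℝ} (hα : 0 ≤ α) :
    gaussianReal 0 (σ ^ 2).toNNReal {z | z ≤ -α} ≤
      ENNReal.ofReal (Real.exp (-α ^ 2 / (2 * σ ^ 2))) := by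
  have h := gaussianReal_map_neg (μ := 0) (v := (σ ^ 2).toNNReal)
  rw [neg_zero] at h
  rw [show {z : ℝ | z ≤ -α} = Set.Iic (-α) from rfl, ← h,
    Measure.map_apply (by fun_prop) measurableSet_Iic]
  refine le_trans (measure_mono ?_) (gaussianReal_tail_le hα)
  intro z hz
  simp only [Set.mem_preimage, Set.mem_Iic, Set.mem_ofPred_eq] at hz ⊢
  linarith

/-- A single threshold test gives a wrong answer on a count that is off by at least `α` only with
small probability. -/
theorem gaussianSparseThreshold_bad_le {σ τ Δ α : ℝ} (hα : 0 < α) (hΔ : 0 ≤ Δ)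
    (c : ℕ) :
    (gaussianSparseThreshold σ τ Δ c).toOuterMeasure
      {b | (b = true ∧ (c : ℝ) ≤ τ - α) ∨ (b = false ∧ τ + α ≤ c)} ≤
      ENNReal.ofReal (Real.exp (-α ^ 2 / (2 * σ ^ 2))) := by
  classical
  rw [toOuterMeasure_bool]
  simp only [Set.mem_ofPred_eq, true_and, Bool.true_eq_false, false_and, or_false,
    Bool.false_eq_true, false_or]
  by_cases h1 : (c : ℝ) ≤ τ - α
  · rw [if_pos h1, if_neg (by linarith), mul_one, mul_zero, add_zero, gaussianSparseThreshold_true]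
    refine le_trans (measure_mono ?_) (gaussianReal_tail_le hα.le)
    rintro z ⟨_, hz⟩
    simp only [Set.mem_ofPred_eq]
    linarith
  · rw [if_neg h1, mul_zero, zero_add]
    by_cases h2 : τ + α ≤ c
    · rw [if_pos h2, mul_one, gaussianSparseThreshold_false]
      refine le_trans (measure_mono ?_) (gaussianReal_tail_le' hα.le)
      intro z hz
      simp only [thresholdTest, Set.mem_ofPred_eq, not_and, not_lt] at hz ⊢
      have := hz (by linarith)
      linarith
    · rw [if_neg h2, mul_zero]; exact zero_le

/-- One tree is marked inaccurately with probability at most (number of points) times (depth of the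
binary search) times (error probability of one test). -/
theorem measure_inaccurate_le (T : DataTree X) (D : List X) {σ τ Δ α : ℝ}
    (hα : 0 < α) (hΔ : 0 ≤ Δ) (hτ : 1 + Δ ≤ τ) {n : ℕ} (hn : T.height < 2 ^ n) :
    (markHeavyHitters T D (gaussianSparseThreshold σ τ Δ) [] T.height
      (fun _ => none)).toOuterMeasure
      {M | ∀ u ∈ T.nodes, ((T.count D u : ℝ) ≤ τ - α → M u = some Label.light) ∧
          (τ + α ≤ (T.count D u : ℝ) → M u = some Label.heavy)}ᶜ ≤
      D.length * (n * ENNReal.ofReal (Real.exp (-α ^ 2 / (2 * σ ^ 2)))) := by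
  classical
  set q := ENNReal.ofReal (Real.exp (-α ^ 2 / (2 * σ ^ 2))) with hq
  set κ : List ℕ → PMF Bool := fun u => gaussianSparseThreshold σ τ Δ (T.count D u) with hκ
  set bad : List ℕ → Bool → Prop := fun u b => (b = true ∧ (T.count D u : ℝ) ≤ τ - α) ∨
    (b = false ∧ τ + α ≤ (T.count D u : ℝ)) with hbad
  set E : X → Set (List ℕ → Bool) := fun x => {c | ∃ l ≤ (T.leafOf x).length,
    Tested T c ((T.leafOf x).take l) ∧ bad ((T.leafOf x).take l) (c ((T.leafOf x).take l))} with hE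
  rw [markHeavyHitters_eq_coins]
  have hmap : ∀ s : Set Marking, ((coins κ (nodeList T)).bind fun c =>
      PMF.pure (finalMarking T c)).toOuterMeasure s =
      (coins κ (nodeList T)).toOuterMeasure (finalMarking T ⁻¹' s) := by
    intro s
    exact PMF.toOuterMeasure_map_apply _ _ _
  rw [hmap]
  have hunion : ∀ L : List X, (coins κ (nodeList T)).toOuterMeasure {c | ∃ x ∈ L, c ∈ E x} ≤
      L.length * (n * q) := by
    intro L
    induction L with
    | nil => simp
    | cons x L ih =>
      have : {c | ∃ y ∈ x :: L, c ∈ E y} = E x ∪ {c | ∃ y ∈ L, c ∈ E y} := by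
        ext c; simp
      rw [this]
      refine (measure_union_le _ _).trans ?_
      rw [List.length_cons, Nat.cast_add, Nat.cast_one, add_mul, one_mul, add_comm]
      refine add_le_add ih (measure_tested_bad_le T (T.leafOf_mem x) κ hn
        (fun l => bad ((T.leafOf x).take l)) q fun l _ => ?_)
      exact gaussianSparseThreshold_bad_le hα hΔ _
  refine le_trans (PMF.toOuterMeasure_mono _ ?_) (hunion D)
  rintro c ⟨hc, hcs⟩
  by_contra hno
  apply hc
  -- nodes with a data point are tested on its path, and the other ones are never released
  have hgood : ∀ u ∈ T.nodes, 0 ≤ u.length → u.length < 0 + T.height →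
      testedAt T c 0 T.height (fun _ => True) (fun _ => False) u →
      (c u = true → τ - α < T.count D u) ∧ (c u = false → (T.count D u : ℝ) < τ + α) := by
    intro u hu _ _ ht
    by_cases hpos : 0 < T.count D u
    · obtain ⟨x, hx, hux⟩ := List.countP_pos_iff.1 hpos
      simp only [decide_eq_true_eq] at hux
      have hut : (T.leafOf x).take u.length = u := (List.prefix_iff_eq_take.1 hux).symm
      have hnb : ¬ bad u (c u) := by
        intro hb
        refine hno ⟨x, hx, u.length, hux.length_le, ?_, ?_⟩ <;> rw [hut]
        · exact ht
        · exact hb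
      constructor
      · intro h; by_contra hcon
        exact hnb (Or.inl ⟨h, not_lt.1 hcon⟩)
      · intro h; by_contra hcon
        exact hnb (Or.inr ⟨h, not_lt.1 hcon⟩)
    · have h0 : T.count D u = 0 := by omega
      have hκu : κ u = PMF.pure false := by
        rw [hκ]
        dsimp only
        rw [h0]
        exact gaussianSparseThreshold_of_le (by push_cast; linarith)
      rw [coins_support_pure hcs (mem_nodeList.2 hu) hκu, h0]
      refine ⟨by simp, fun _ => ?_⟩
      push_cast; linarith
  intro u hu
  have : (heavyNodes T c u → τ - α < (T.count D u : ℝ)) ∧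
      (¬ heavyNodes T c u → (T.count D u : ℝ) < τ + α) :=
    heavyAt_accurate (T := T) (c := c) (cnt := fun u => (T.count D u : ℝ))
    (lo := τ - α) (hi := τ + α) (fun u w h => by exact_mod_cast T.count_le_of_prefix D h)
    (a := 0) (len := T.height) (A := fun _ => True) (B := fun _ => False)
    (fun _ h => h.elim) (fun _ h => h.elim) (fun _ _ _ h => absurd trivial h) hgood hu
    (Nat.zero_le _) (by simpa using T.length_lt_height hu)
  simp only [finalMarking, if_pos hu, markBy]
  constructor
  · intro h
    rw [if_neg fun hh => ?_]
    have := this.1 hh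
    linarith
  · intro h
    rw [if_pos]
    by_contra hh
    have := this.2 hh
    linarith

/-- The components of a family with index in `l` are drawn independently, one after the other, and
replace those of `S`. -/
def sampleAll {k : ℕ} {β : Type} (μ : Fin k → PMF β) (l : List (Fin k)) (S : Fin k → β) :
    PMF (Fin k → β) :=
  l.foldlM (fun S i => (μ i).bind fun b => PMF.pure (Function.update S i b)) S

theorem sampleAll_nil {k : ℕ} {β : Type} (μ : Fin k → PMF β) (S : Fin k → β) :
    sampleAll μ [] S = PMF.pure S := rfl

theorem sampleAll_cons {k : ℕ} {β : Type} (μ : Fin k → PMF β) (i : Fin k) (l : List (Fin k))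
    (S : Fin k → β) :
    sampleAll μ (i :: l) S = (μ i).bind fun b => sampleAll μ l (Function.update S i b) := by
  unfold sampleAll
  rw [List.foldlM_cons]
  refine (PMF.bind_bind _ _ _).trans ?_
  simp only [PMF.pure_bind]

theorem buildForest_eq_sampleAll {k : ℕ} (σ τ Δ : ℝ) (T : Fin k → DataTree X) (D : List X) :
    buildForest σ τ Δ T D = sampleAll (fun i => markHeavyHitters (T i) D
      (gaussianSparseThreshold σ τ Δ) [] (T i).height (fun _ => none)) (List.finRange k)
      (fun _ _ => none) := rfl

theorem sampleAll_support_of_not_mem {k : ℕ} {β : Type} {μ : Fin k → PMF β} {l : List (Fin k)}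
    {S M : Fin k → β} (hM : M ∈ (sampleAll μ l S).support) {i : Fin k} (hi : i ∉ l) :
    M i = S i := by
  induction l generalizing S with
  | nil => rw [sampleAll_nil, PMF.mem_support_pure_iff] at hM; rw [hM]
  | cons j l ih =>
    rw [sampleAll_cons, PMF.mem_support_bind_iff] at hM
    obtain ⟨b, _, hM⟩ := hM
    simp only [List.mem_cons, not_or] at hi
    rw [ih hM hi.2, Function.update_of_ne hi.1]

/-- A union bound over the independent components. -/
theorem measure_sampleAll_le {k : ℕ} {β : Type} {μ : Fin k → PMF β} {P : Fin k → Set β}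
    {r : ENNReal} (hr : ∀ i, (μ i).toOuterMeasure (P i)ᶜ ≤ r) {l : List (Fin k)} (hl : l.Nodup)
    (S : Fin k → β) :
    (sampleAll μ l S).toOuterMeasure {M | ∃ i ∈ l, M i ∉ P i} ≤ l.length * r := by
  classical
  induction l generalizing S with
  | nil => simp
  | cons i l ih =>
    obtain ⟨hi, hl⟩ := List.nodup_cons.1 hl
    rw [sampleAll_cons, PMF.toOuterMeasure_bind_apply]
    have hb : ∀ b, (sampleAll μ l (Function.update S i b)).toOuterMeasure
        {M | ∃ j ∈ i :: l, M j ∉ P j} ≤ (if b ∈ (P i)ᶜ then 1 else 0) + l.length * r := by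
      intro b
      by_cases hbP : b ∈ P i
      · refine le_trans (PMF.toOuterMeasure_mono _ ?_) ((ih hl _).trans le_add_self)
        rintro M ⟨⟨j, hj, hjP⟩, hM⟩
        have hMi := sampleAll_support_of_not_mem hM hi
        rw [Function.update_self] at hMi
        rcases List.mem_cons.1 hj with rfl | hj
        · rw [hMi] at hjP; exact absurd hbP hjP
        · exact ⟨j, hj, hjP⟩
      · refine (toOuterMeasure_le_one _ _).trans ?_
        rw [if_pos (show b ∈ (P i)ᶜ from hbP)]; exact le_self_add
    calc _ ≤ ∑' b, μ i b * ((if b ∈ (P i)ᶜ then 1 else 0) + l.length * r) :=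
          ENNReal.tsum_le_tsum fun b => by gcongr; exact hb b
      _ = (μ i).toOuterMeasure (P i)ᶜ + l.length * r := by
          simp only [mul_add]
          rw [ENNReal.tsum_add, ENNReal.tsum_mul_right, PMF.tsum_coe, one_mul,
            PMF.toOuterMeasure_apply]
          congr 1
          refine tsum_congr fun b => ?_
          simp [Set.indicator]
      _ ≤ ((i :: l).length : ENNReal) * r := by
          rw [List.length_cons, Nat.cast_add, Nat.cast_one, add_mul, one_mul, add_comm]
          gcongr
          exact hr i

theorem buildForest_accuracy (k h : ℕ) (T : Fin k → DataTree X) (D : List X) (σ τ Δ β α : ℝ)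
    (hk : 1 ≤ k) (hh : ∀ i, (T i).height ≤ h) (hD : D ≠ []) (hσ : 0 < σ) (hΔ : 0 ≤ Δ) (hβ : 0 < β)
    (hτ : 1 + Δ ≤ τ)
    (hα : α = σ * √(2 * Real.log (2 * k * D.length * (Nat.clog 2 (h + 1) : ℕ) / β))) :
    ENNReal.ofReal (1 - β) ≤ (buildForest σ τ Δ T D).toOuterMeasure
        {M | ∀ i, ∀ u ∈ (T i).nodes,
          (((T i).count D u : ℝ) ≤ τ - α → M i u = some Label.light) ∧
          (τ + α ≤ ((T i).count D u : ℝ) → M i u = some Label.heavy)} := by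
  classical
  -- for `β ≥ 1` there is nothing to prove, and for `β < 1` the logarithm is positive
  by_cases hβ1 : 1 ≤ β
  · rw [ENNReal.ofReal_of_nonpos (by linarith)]; exact zero_le
  push Not at hβ1
  set n := Nat.clog 2 (h + 1) with hn
  have hheight : ∀ i, (T i).height < 2 ^ n := fun i => by
    have h1 : h + 1 ≤ 2 ^ n := Nat.le_pow_clog (by norm_num) (h + 1)
    have := hh i
    omega
  have hn1 : 1 ≤ n := by
    have h1 := hheight ⟨0, hk⟩
    have h2 := (T ⟨0, hk⟩).one_le_height
    by_contra hcon
    have : n = 0 := by omega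
    rw [this] at h1; omega
  have hlen : 1 ≤ D.length := List.length_pos_iff.2 hD
  set N : ℝ := k * D.length * (n : ℕ) with hN
  have hN1 : 1 ≤ N := by
    have : 1 ≤ k * D.length * n := Nat.one_le_iff_ne_zero.2 (by positivity)
    rw [hN]; exact_mod_cast this
  have hx : 1 < 2 * N / β := by
    rw [lt_div_iff₀ hβ]; linarith
  have hα' : α = σ * √(2 * Real.log (2 * N / β)) := by
    rw [hα, hN]; congr 5; ring
  have hlog : 0 < Real.log (2 * N / β) := Real.log_pos hx
  have hαpos : 0 < α := by rw [hα']; positivity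
  have hexp : Real.exp (-α ^ 2 / (2 * σ ^ 2)) = β / (2 * N) := by
    have : -α ^ 2 / (2 * σ ^ 2) = - Real.log (2 * N / β) := by
      rw [hα', mul_pow, Real.sq_sqrt (by positivity)]
      field_simp
    rw [this, Real.exp_neg, Real.exp_log (by linarith), inv_div]
  set P : Fin k → Set Marking := fun i => {M | ∀ u ∈ (T i).nodes,
    (((T i).count D u : ℝ) ≤ τ - α → M u = some Label.light) ∧
    (τ + α ≤ ((T i).count D u : ℝ) → M u = some Label.heavy)} with hP
  have hbound := measure_sampleAll_le (P := P)
    (fun i => measure_inaccurate_le (T i) D (σ := σ) hαpos hΔ hτ (hheight i))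
    (List.nodup_finRange k) (fun _ _ => none)
  rw [← buildForest_eq_sampleAll, List.length_finRange, hexp] at hbound
  have hle : (k : ENNReal) * (D.length * (n * ENNReal.ofReal (β / (2 * N)))) ≤
      ENNReal.ofReal β := by
    rw [← ENNReal.ofReal_natCast k, ← ENNReal.ofReal_natCast D.length, ← ENNReal.ofReal_natCast n,
      ← ENNReal.ofReal_mul (by positivity), ← ENNReal.ofReal_mul (by positivity),
      ← ENNReal.ofReal_mul (by positivity)]
    refine ENNReal.ofReal_le_ofReal ?_
    have : (k : ℝ) * (D.length * (n * (β / (2 * N)))) = N * (β / (2 * N)) := by rw [hN]; ring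
    rw [this]
    have : N * (β / (2 * N)) = β / 2 := by field_simp
    rw [this]; linarith
  set G := {M : Fin k → Marking | ∀ i, ∀ u ∈ (T i).nodes,
          (((T i).count D u : ℝ) ≤ τ - α → M i u = some Label.light) ∧
          (τ + α ≤ ((T i).count D u : ℝ) → M i u = some Label.heavy)} with hG
  have hcompl : {M : Fin k → Marking | ∃ i ∈ List.finRange k, M i ∉ P i} = Gᶜ := by
    ext M
    simp only [List.mem_finRange, true_and, Set.mem_ofPred_eq, Set.mem_compl_iff, hG, hP]
    push Not
    rfl
  rw [hcompl] at hbound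
  have htot : 1 ≤ (buildForest σ τ Δ T D).toOuterMeasure G +
      (buildForest σ τ Δ T D).toOuterMeasure Gᶜ := by
    rw [← ((buildForest σ τ Δ T D).toOuterMeasure_apply_eq_one_iff Set.univ).2
      (Set.subset_univ _), ← Set.union_compl_self G]
    exact measure_union_le _ _
  rw [ENNReal.ofReal_sub _ hβ.le, ENNReal.ofReal_one]
  exact tsub_le_iff_right.2 (htot.trans (add_le_add le_rfl (hbound.trans hle)))

end

section

/-! ### Gaussian tests and the likelihood ratio -/

/-- The standard normal distribution. -/
abbrev stdNormal : Measure ℝ := gaussianReal 0 1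

/-- Invariance of a pair of independent standard normal variables under rotations. -/
theorem lintegral_stdNormal_rotate {c d : ℝ} (h : c ^ 2 + d ^ 2 = 1) {F : ℝ → ℝ → ENNReal}
    (hF : Measurable (Function.uncurry F)) :
    ∫⁻ z, ∫⁻ s, F z s ∂stdNormal ∂stdNormal =
      ∫⁻ t, ∫⁻ s, F (d * t + c * s) (d * s - c * t) ∂stdNormal ∂stdNormal := by
  have hn : ‖(⟨d, c⟩ : ℂ)‖ = 1 := by
    rw [Complex.norm_def, Complex.normSq_mk, Real.sqrt_eq_one]; nlinarith
  have hne : (⟨d, c⟩ : ℂ) ≠ 0 := by rw [← norm_ne_zero_iff, hn]; exact one_ne_zero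
  have hcos : Real.cos (Complex.arg ⟨d, c⟩) = d := by rw [Complex.cos_arg hne, hn, div_one]
  have hsin : Real.sin (Complex.arg ⟨d, c⟩) = c := by rw [Complex.sin_arg, hn, div_one]
  have hrot := IsGaussian.map_rotation_eq_self (μ := stdNormal)
    (by simp) (Complex.arg ⟨d, c⟩)
  have h1 : ∫⁻ p, Function.uncurry F p ∂(stdNormal.prod stdNormal) =
      ∫⁻ z, ∫⁻ s, F z s ∂stdNormal ∂stdNormal := lintegral_prod _ hF.aemeasurable
  rw [← h1, ← hrot, lintegral_map hF (ContinuousLinearMap.measurable _), lintegral_prod]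
  · refine lintegral_congr fun t => lintegral_congr fun s => ?_
    simp only [ContinuousLinearMap.rotation_apply, hcos, hsin, smul_eq_mul, Function.uncurry]
    congr 1; ring
  · exact (hF.comp (ContinuousLinearMap.measurable _)).aemeasurable

/-- Translating a standard normal variable multiplies its law by an exponential density. -/
theorem lintegral_stdNormal_shift (c : ℝ) {f : ℝ → ENNReal} (hf : Measurable f) :
    ∫⁻ s, f s * ENNReal.ofReal (Real.exp (c * s - c ^ 2 / 2)) ∂stdNormal =
      ∫⁻ s, f (s + c) ∂stdNormal := by
  have h1 : ∫⁻ s, f (s + c) ∂stdNormal = ∫⁻ s, f s ∂(gaussianReal c 1) := by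
    have h2 := gaussianReal_map_add_const (μ := 0) (v := 1) c
    rw [zero_add] at h2
    rw [← h2, lintegral_map hf (by fun_prop)]
  have hm : Measurable fun s : ℝ => ENNReal.ofReal (Real.exp (c * s - c ^ 2 / 2)) := by fun_prop
  have hfm : Measurable fun s => f s * ENNReal.ofReal (Real.exp (c * s - c ^ 2 / 2)) := hf.mul hm
  rw [h1, stdNormal, gaussianReal_of_var_ne_zero _ one_ne_zero,
    gaussianReal_of_var_ne_zero _ one_ne_zero,
    lintegral_withDensity_eq_lintegral_mul _ (measurable_gaussianPDF _ _) hfm,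
    lintegral_withDensity_eq_lintegral_mul _ (measurable_gaussianPDF _ _) hf]
  refine lintegral_congr fun s => ?_
  have : gaussianPDF c 1 s =
      gaussianPDF 0 1 s * ENNReal.ofReal (Real.exp (c * s - c ^ 2 / 2)) := by
    rw [gaussianPDF, gaussianPDF, ← ENNReal.ofReal_mul (gaussianPDFReal_nonneg _ _ _),
      gaussianPDFReal_def, gaussianPDFReal_def]
    dsimp only
    rw [mul_assoc _ (Real.exp _) (Real.exp _), ← Real.exp_add]
    congr 3
    push_cast; ring
  simp only [Pi.mul_apply]
  rw [this]; ring

/-- The expectation of `g` at the log-likelihood ratio `v` after observing a Gaussian of variance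
`1` whose mean is `0` under the first hypothesis and `ρ` under the second one; the observation is
drawn under the first hypothesis. -/
def gaussStep (ρ : ℝ) (g : ℝ → ENNReal) (v : ℝ) : ENNReal :=
  ∫⁻ s, g (v + (ρ * s - ρ ^ 2 / 2)) ∂stdNormal

theorem measurable_gaussStep_comp {Ω : Type*} [MeasurableSpace Ω] {ρ v : Ω → ℝ}
    {g : Ω → ℝ → ENNReal} (hρ : Measurable ρ) (hv : Measurable v)
    (hg : Measurable (Function.uncurry g)) :
    Measurable fun u => gaussStep (ρ u) (g u) (v u) := by
  have : Measurable fun p : Ω × ℝ => g p.1 (v p.1 + (ρ p.1 * p.2 - ρ p.1 ^ 2 / 2)) := by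
    have h2 : Measurable fun p : Ω × ℝ => (p.1, v p.1 + (ρ p.1 * p.2 - ρ p.1 ^ 2 / 2)) := by
      fun_prop
    exact hg.comp h2
  exact this.lintegral_prod_right'

theorem gaussStep_zero (g : ℝ → ENNReal) : gaussStep 0 g = g := by
  funext v; simp [gaussStep]

/-- Independent Gaussian observations combine into one. -/
theorem gaussStep_gaussStep {a b r : ℝ} (h : a ^ 2 + b ^ 2 = r ^ 2) {g : ℝ → ENNReal}
    (hg : Measurable g) : gaussStep a (gaussStep b g) = gaussStep r g := by
  funext v
  by_cases hr : r = 0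
  · have ha : a = 0 := by nlinarith [sq_nonneg a, sq_nonneg b]
    have hb : b = 0 := by nlinarith [sq_nonneg a, sq_nonneg b]
    rw [ha, hb, hr, gaussStep_zero, gaussStep_zero]
  · have hcd : (a / r) ^ 2 + (b / r) ^ 2 = 1 := by
      rw [div_pow, div_pow, ← add_div, h, div_self (pow_ne_zero 2 hr)]
    have := lintegral_stdNormal_rotate hcd
      (F := fun z s => g (v + (a * z - a ^ 2 / 2) + (b * s - b ^ 2 / 2)))
      (hg.comp (f := fun p : ℝ × ℝ =>
        v + (a * p.1 - a ^ 2 / 2) + (b * p.2 - b ^ 2 / 2)) (by fun_prop))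
    simp only [gaussStep]
    rw [this]
    have hin : ∀ t s : ℝ, v + (a * (b / r * t + a / r * s) - a ^ 2 / 2) +
        (b * (b / r * s - a / r * t) - b ^ 2 / 2) = v + (r * s - r ^ 2 / 2) := by
      intro t s
      have : (a ^ 2 + b ^ 2) / r * s = r * s := by rw [h]; field_simp
      linear_combination this - h / 2
    simp only [hin, lintegral_const, measure_univ, mul_one]

/-- The least total error `P(reject) + eᵛ Q(accept)` in testing `P = N(0, 1)` against
`Q = N(ρ, 1)`. -/
def testError (ρ : ℝ) : ℝ → ENNReal := gaussStep ρ fun v => ENNReal.ofReal (min 1 (Real.exp v))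

theorem measurable_testError_comp {Ω : Type*} [MeasurableSpace Ω] {ρ v : Ω → ℝ}
    (hρ : Measurable ρ) (hv : Measurable v) : Measurable fun u => testError (ρ u) (v u) :=
  measurable_gaussStep_comp (g := fun _ v => ENNReal.ofReal (min 1 (Real.exp v))) hρ hv
    (show Measurable fun p : Ω × ℝ => ENNReal.ofReal (min 1 (Real.exp p.2)) by fun_prop)

theorem measurable_testError (ρ : ℝ) : Measurable (testError ρ) :=
  measurable_testError_comp (ρ := fun _ : ℝ => ρ) measurable_const measurable_id

theorem gaussStep_testError {a b r : ℝ} (h : a ^ 2 + b ^ 2 = r ^ 2) :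
    gaussStep a (testError b) = testError r :=
  gaussStep_gaussStep h (by fun_prop)

theorem testError_le_one (ρ v : ℝ) : testError ρ v ≤ 1 := by
  calc testError ρ v ≤ ∫⁻ _, 1 ∂stdNormal := lintegral_mono fun s => by
        rw [← ENNReal.ofReal_one]; exact ENNReal.ofReal_le_ofReal (min_le_left _ _)
    _ = 1 := by simp

/-- The error grows at most like `eᶜ`, as it is an infimum of functions `A + eᵛ B`. -/
theorem testError_add_le (ρ v : ℝ) {c : ℝ} (hc : 0 ≤ c) :
    testError ρ (v + c) ≤ ENNReal.ofReal (Real.exp c) * testError ρ v := by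
  rw [testError, gaussStep, gaussStep, ← lintegral_const_mul _ (by fun_prop)]
  refine lintegral_mono fun s => ?_
  rw [← ENNReal.ofReal_mul (Real.exp_nonneg _)]
  refine ENNReal.ofReal_le_ofReal ?_
  rw [mul_min_of_nonneg _ _ (Real.exp_nonneg _), ← Real.exp_add, mul_one]
  refine min_le_min (Real.one_le_exp hc) (Real.exp_le_exp.2 (by linarith))

/-- A single sign change is preserved by Gaussian smoothing: the Gaussian kernel is totally
positive. -/
theorem gaussStep_crossing {A B : ℝ → ENNReal} (hA : Measurable A) (hB : Measurable B)
    (hB1 : ∀ v, B v ≤ 1)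
    (hcross : ∀ v c, 0 ≤ c → A v ≤ B v → A (v + c) ≤ B (v + c))
    (hev : ∃ v, ∀ w, v ≤ w → A w ≤ B w)
    {ρ : ℝ} (hρ : 0 < ρ) {v c : ℝ} (hc : 0 ≤ c) (h : gaussStep ρ A v ≤ gaussStep ρ B v) :
    gaussStep ρ A (v + c) ≤ gaussStep ρ B (v + c) := by
  obtain ⟨v₀, hv₀⟩ := hev
  by_cases hall : ∀ w, A w ≤ B w
  · exact lintegral_mono fun s => hall _
  push Not at hall
  obtain ⟨w₁, hw₁⟩ := hall
  have hw₁' : ∀ w ≤ w₁, B w < A w := fun w hw => by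
    by_contra hcon
    have := hcross w (w₁ - w) (by linarith) (not_lt.1 hcon)
    rw [add_sub_cancel] at this
    exact absurd hw₁ (not_lt.2 this)
  -- the crossing point
  set x : ℝ := sInf {w | A w ≤ B w} with hx
  have hbdd : BddBelow {w | A w ≤ B w} := ⟨w₁, fun w hw => by
    by_contra hcon
    exact absurd (hw₁' w (not_le.1 hcon).le) (not_lt.2 hw)⟩
  have hlow : ∀ w < x, B w ≤ A w := fun w hw => by
    by_contra hcon
    exact absurd (csInf_le hbdd (not_le.1 hcon).le) (not_le.2 hw)
  have hhigh : ∀ w, x < w → A w ≤ B w := fun w hw => by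
    obtain ⟨w', hw', hlt⟩ := exists_lt_of_csInf_lt ⟨v₀, hv₀ v₀ le_rfl⟩ hw
    have := hcross w' (w - w') (by linarith) hw'
    rwa [add_sub_cancel] at this
  obtain ⟨d, hd⟩ : ∃ d, ρ * d = c := ⟨c / ρ, by field_simp⟩
  have hd0 : 0 ≤ d := by
    by_contra hneg
    have := mul_neg_of_pos_of_neg hρ (not_le.1 hneg)
    linarith
  obtain ⟨s₀, hs₀⟩ : ∃ s₀, ρ * s₀ = x - v + ρ ^ 2 / 2 := ⟨(x - v + ρ ^ 2 / 2) / ρ, by field_simp⟩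
  set k : ℝ → ENNReal := fun s => ENNReal.ofReal (Real.exp (d * s - d ^ 2 / 2)) with hk
  have hkmono : Monotone k := fun s t hst => ENNReal.ofReal_le_ofReal (Real.exp_le_exp.2 (by
    have := mul_le_mul_of_nonneg_left hst hd0; linarith))
  have hshift : ∀ g : ℝ → ENNReal, Measurable g → gaussStep ρ g (v + c) =
      ∫⁻ s, g (v + (ρ * s - ρ ^ 2 / 2)) * k s ∂stdNormal := fun g hg => by
    rw [hk, lintegral_stdNormal_shift d (f := fun s => g (v + (ρ * s - ρ ^ 2 / 2)))
      (hg.comp (by fun_prop)), gaussStep]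
    refine lintegral_congr fun s => ?_
    congr 1
    linear_combination -hd
  have hpt : ∀ s, A (v + (ρ * s - ρ ^ 2 / 2)) * k s + k s₀ * B (v + (ρ * s - ρ ^ 2 / 2)) ≤
      k s₀ * A (v + (ρ * s - ρ ^ 2 / 2)) + B (v + (ρ * s - ρ ^ 2 / 2)) * k s := by
    intro s
    set a := A (v + (ρ * s - ρ ^ 2 / 2)) with ha
    set b := B (v + (ρ * s - ρ ^ 2 / 2)) with hb
    have hs : v + (ρ * s - ρ ^ 2 / 2) = x + ρ * (s - s₀) := by linear_combination hs₀
    have key : ∀ {a b k r : ENNReal}, b ≤ a → k ≤ r → a * k + r * b ≤ r * a + b * k := by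
      intro a b k r hba hkr
      obtain ⟨e, rfl⟩ := exists_add_of_le hba
      obtain ⟨q, rfl⟩ := exists_add_of_le hkr
      calc (b + e) * k + (k + q) * b ≤ (b + e) * k + (k + q) * b + q * e := le_self_add
        _ = _ := by ring
    rcases lt_trichotomy s s₀ with hlt | heq | hgt
    · refine key (hlow _ ?_) (hkmono hlt.le)
      rw [hs]
      have := mul_pos hρ (sub_pos.2 hlt)
      linarith
    · rw [heq]; exact le_of_eq (by ring)
    · have hab : a ≤ b := hhigh _ (by
        rw [hs]
        have := mul_pos hρ (sub_pos.2 hgt)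
        linarith)
      have := key hab (hkmono hgt.le)
      calc a * k s + k s₀ * b = b * k s₀ + k s * a := by ring
        _ ≤ k s * b + a * k s₀ := this
        _ = _ := by ring
  have hm : Measurable k := by rw [hk]; fun_prop
  have hAm : Measurable fun s => A (v + (ρ * s - ρ ^ 2 / 2)) := hA.comp (by fun_prop)
  have hBm : Measurable fun s => B (v + (ρ * s - ρ ^ 2 / 2)) := hB.comp (by fun_prop)
  have hint := lintegral_mono (μ := stdNormal) hpt
  have hAk : Measurable fun s => A (v + (ρ * s - ρ ^ 2 / 2)) * k s := hAm.mul hm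
  rw [lintegral_add_left hAk, lintegral_add_left (hAm.const_mul _),
    lintegral_const_mul _ hBm, lintegral_const_mul _ hAm, ← hshift A hA, ← hshift B hB] at hint
  change _ + k s₀ * gaussStep ρ B v ≤ k s₀ * gaussStep ρ A v + _ at hint
  have hfin : k s₀ * gaussStep ρ B v ≠ ⊤ := by
    refine ENNReal.mul_ne_top ENNReal.ofReal_ne_top
        (ne_of_lt (lt_of_le_of_lt ?_ ENNReal.one_lt_top))
    calc gaussStep ρ B v ≤ ∫⁻ _, 1 ∂stdNormal := lintegral_mono fun s => hB1 _
      _ = 1 := by simp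
  have h3 : gaussStep ρ A (v + c) + k s₀ * gaussStep ρ B v ≤
      gaussStep ρ B (v + c) + k s₀ * gaussStep ρ B v :=
    hint.trans (by rw [add_comm]; gcongr)
  exact (ENNReal.add_le_add_iff_right hfin).1 h3

/-- Once the curve with the larger parameter lies below a translate to the left of the curve with
the smaller parameter, it stays below. -/
theorem testError_crossing {a b l : ℝ} (ha : 0 ≤ a) (hab : a ≤ b) {v c : ℝ} (hc : 0 ≤ c)
    (h : testError b v ≤ testError a (v + l)) : testError b (v + c) ≤ testError a (v + c + l) := by
  set r : ℝ := √(b ^ 2 - a ^ 2) with hr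
  have hsq : a ^ 2 + r ^ 2 = b ^ 2 := by
    rw [hr, Real.sq_sqrt (by nlinarith)]; ring
  set B : ℝ → ENNReal := fun v => ENNReal.ofReal (min 1 (Real.exp (v + l))) with hB
  have hBstep : ∀ v, testError a (v + l) = gaussStep a B v := fun v => by
    rw [testError, gaussStep, gaussStep]
    refine lintegral_congr fun s => ?_
    rw [hB]; dsimp only; congr 3; ring
  rw [← gaussStep_testError hsq, hBstep] at *
  have hiff : ∀ w, testError r w ≤ B w ↔
      testError r w ≤ ENNReal.ofReal (Real.exp (w + l)) := fun w => by
    rw [hB]; dsimp only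
    rw [ENNReal.ofReal_min, ENNReal.ofReal_one, le_min_iff]
    exact and_iff_right (testError_le_one _ _)
  have hcross : ∀ v c, 0 ≤ c → testError r v ≤ B v → testError r (v + c) ≤ B (v + c) := by
    intro v c hc h
    rw [hiff] at h ⊢
    refine (testError_add_le r v hc).trans ?_
    calc _ ≤ ENNReal.ofReal (Real.exp c) * ENNReal.ofReal (Real.exp (v + l)) := by gcongr
      _ = _ := by rw [← ENNReal.ofReal_mul (Real.exp_nonneg _), ← Real.exp_add]; congr 2; ring
  have hBm : Measurable B := by rw [hB]; fun_prop
  rcases ha.eq_or_lt with rfl | hpos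
  · rw [gaussStep_zero, gaussStep_zero] at *
    exact hcross v c hc h
  refine gaussStep_crossing (measurable_testError r) hBm (fun w => ?_)
    hcross ⟨-l, fun w hw => ?_⟩ hpos hc h
  · rw [hB]; dsimp only; rw [← ENNReal.ofReal_one]; exact ENNReal.ofReal_le_ofReal (min_le_left _ _)
  · rw [hiff]
    refine (testError_le_one _ _).trans ?_
    rw [← ENNReal.ofReal_one]
    exact ENNReal.ofReal_le_ofReal (Real.one_le_exp (by linarith))

end

section

/-! ### Mixtures of Gaussian tests -/

/-- If the number of the curve that is followed decreases along the line, and two curves cross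
at most once, then following a single curve is at least as good. -/
theorem exists_lintegral_le_of_antitone {ν : Measure ℝ} {F : ℕ → ℝ → ENNReal}
    (hF : ∀ i j, i < j → ∀ s t, s ≤ t → F j s ≤ F i s → F j t ≤ F i t) (n : ℕ) (V : Finset ℕ)
    (hn : V.card = n) (N : ℝ → ℕ) (hN : Antitone N) (hV : ∀ s, N s ∈ V) :
    ∃ e ∈ V, ∫⁻ s, F e s ∂ν ≤ ∫⁻ s, F (N s) s ∂ν := by
  induction n generalizing V N with
  | zero =>
    rw [Finset.card_eq_zero] at hn
    have := hV 0
    rw [hn] at this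
    simp at this
  | succ n ih =>
    have hne : V.Nonempty := ⟨N 0, hV 0⟩
    set M := V.max' hne with hM
    have hMV : M ∈ V := V.max'_mem hne
    have hle : ∀ x ∈ V, x ≤ M := fun x hx => V.le_max' x hx
    by_cases hne' : (V.erase M).Nonempty
    · set K := (V.erase M).max' hne' with hK
      have hKV' : K ∈ V.erase M := (V.erase M).max'_mem hne'
      have hKV : K ∈ V := Finset.mem_of_mem_erase hKV'
      have hKM : K < M := lt_of_le_of_ne (hle K hKV) (Finset.ne_of_mem_erase hKV')
      have hbelow : ∀ x ∈ V, x ≠ M → x ≤ K := fun x hx hxM =>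
        (V.erase M).le_max' x (Finset.mem_erase.2 ⟨hxM, hx⟩)
      by_cases hcase : ∃ s, N s = M ∧ F M s ≤ F K s
      -- the curve `M` is better wherever `K` is followed
      · obtain ⟨s₀, hs₀, hs₀F⟩ := hcase
        have hanti : Antitone fun s => if N s < K then N s else M := fun s t hst => by
          have := hN hst
          have := hle _ (hV t)
          dsimp only
          split_ifs <;> omega
        have hmem : ∀ s, (if N s < K then N s else M) ∈ V.erase K := fun s => by
          split_ifs with h
          · exact Finset.mem_erase.2 ⟨h.ne, hV s⟩
          · exact Finset.mem_erase.2 ⟨hKM.ne', hMV⟩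
        obtain ⟨e, he, hint⟩ := ih (V.erase K) (by rw [Finset.card_erase_of_mem hKV, hn]; rfl)
          _ hanti hmem
        refine ⟨e, Finset.mem_of_mem_erase he, hint.trans (lintegral_mono fun s => ?_)⟩
        dsimp only
        split_ifs with h
        · exact le_rfl
        · by_cases hsM : N s = M
          · rw [hsM]
          · have hsK : N s = K := le_antisymm (hbelow _ (hV s) hsM) (not_lt.1 h)
            have hss : s₀ ≤ s := by
              by_contra hlt
              have := hN (not_le.1 hlt).le
              omega
            rw [hsK]
            exact hF K M hKM s₀ s hss hs₀F
      -- the curve `K` is better wherever `M` is followed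
      · push Not at hcase
        have hmem : ∀ s, min (N s) K ∈ V.erase M := fun s => by
          by_cases hsM : N s = M
          · rw [hsM, min_eq_right hKM.le]; exact hKV'
          · rw [min_eq_left (hbelow _ (hV s) hsM)]
            exact Finset.mem_erase.2 ⟨hsM, hV s⟩
        obtain ⟨e, he, hint⟩ := ih (V.erase M) (by rw [Finset.card_erase_of_mem hMV, hn]; rfl)
          (fun s => min (N s) K) (fun s t hst => min_le_min_right K (hN hst)) hmem
        refine ⟨e, Finset.mem_of_mem_erase he, hint.trans (lintegral_mono fun s => ?_)⟩
        dsimp only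
        by_cases hsM : N s = M
        · rw [hsM, min_eq_right hKM.le]; exact (hcase s hsM).le
        · rw [min_eq_left (hbelow _ (hV s) hsM)]
    · have hall : ∀ s, N s = M := fun s => by
        by_contra hsM
        exact hne' ⟨N s, Finset.mem_erase.2 ⟨hsM, hV s⟩⟩
      exact ⟨M, hMV, le_of_eq (lintegral_congr fun s => by rw [hall])⟩

/-- The amplitude of `n` observations of amplitude `μ`. -/
def amp (μ : ℝ) (n : ℕ) : ℝ := √(n : ℝ) * μ

theorem amp_sq_add (μ : ℝ) (i j : ℕ) : amp μ i ^ 2 + amp μ j ^ 2 = amp μ (i + j) ^ 2 := by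
  simp only [amp, mul_pow]
  rw [Real.sq_sqrt (Nat.cast_nonneg _), Real.sq_sqrt (Nat.cast_nonneg _),
    Real.sq_sqrt (Nat.cast_nonneg _)]
  push_cast; ring

theorem amp_zero (μ : ℝ) : amp μ 0 = 0 := by simp [amp]

theorem amp_one (μ : ℝ) : amp μ 1 = μ := by simp [amp]

theorem amp_nonneg {μ : ℝ} (hμ : 0 ≤ μ) (n : ℕ) : 0 ≤ amp μ n := mul_nonneg (Real.sqrt_nonneg _) hμ

theorem amp_mono {μ : ℝ} (hμ : 0 ≤ μ) {i j : ℕ} (h : i ≤ j) : amp μ i ≤ amp μ j :=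
  mul_le_mul_of_nonneg_right (Real.sqrt_le_sqrt (by exact_mod_cast h)) hμ

theorem measurable_amp (μ : ℝ) : Measurable (amp μ) := measurable_of_countable _

/-- The randomness behind a sequence of `m` tests: auxiliary randomness `Ω`, which determines that
`passive` of the tests may be passive; the remaining `m - passive` tests are always Gaussian.  Their
observations enter only through one standard normal combination, which is not part of `Ω`. -/
structure Layout (m : ℕ) where
  Ω : Type
  [mΩ : MeasurableSpace Ω]
  ν : Measure Ω
  [prob : IsProbabilityMeasure ν]
  passive : Ω → ℕ
  measurable_passive : Measurable passive
  passive_le : ∀ u, passive u ≤ m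

attribute [instance] Layout.mΩ Layout.prob

namespace Layout

/-- `N u s` is the number of those among the `passive u` tests that turn out to be Gaussian. -/
structure Admissible {m : ℕ} (P : Layout m) (N : P.Ω → ℝ → ℕ) : Prop where
  measurable : Measurable (Function.uncurry N)
  antitone : ∀ u, Antitone (N u)
  le : ∀ u s, N u s ≤ P.passive u

/-- The test error at log-likelihood ratio `v`, when `s` is the combined observation from the
`m - M` tests that are always Gaussian, of the remaining `M` tests `n` are Gaussian, and each of
the other ones shifts the log-likelihood ratio by `l`. -/
def kernel (μ l : ℝ) (m M n : ℕ) (v s : ℝ) : ENNReal :=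
  testError (amp μ n) (v + ((M : ℝ) - n) * l + (amp μ (m - M) * s - amp μ (m - M) ^ 2 / 2))

theorem measurable_kernel_comp (μ l : ℝ) (m : ℕ) {Ω : Type*} [MeasurableSpace Ω] {M n : Ω → ℕ}
    {v s : Ω → ℝ} (hM : Measurable M) (hn : Measurable n) (hv : Measurable v)
    (hs : Measurable s) : Measurable fun u => kernel μ l m (M u) (n u) (v u) (s u) := by
  have h1 : Measurable fun u => amp μ (m - M u) :=
    (measurable_of_countable fun M : ℕ => amp μ (m - M)).comp hM
  have h2 : Measurable fun u => (M u : ℝ) := (measurable_of_countable _).comp hM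
  have h3 : Measurable fun u => (n u : ℝ) := (measurable_of_countable _).comp hn
  refine measurable_testError_comp ((measurable_amp μ).comp hn) ?_
  fun_prop

/-- The expected test error. -/
def value (μ l : ℝ) {m : ℕ} (P : Layout m) (N : P.Ω → ℝ → ℕ) (v : ℝ) : ENNReal :=
  ∫⁻ u, ∫⁻ s, kernel μ l m (P.passive u) (N u s) v s ∂stdNormal ∂P.ν

/-- A random number of Gaussian tests is no worse for the error than the best fixed number `j` of
Gaussian tests together with `m - j` passive ones. -/
theorem exists_testError_le_value {μ : ℝ} (hμ : 0 ≤ μ) (l : ℝ) {m : ℕ} (P : Layout m)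
    {N : P.Ω → ℝ → ℕ} (hN : P.Admissible N) (v : ℝ) :
    ∃ j ≤ m, testError (amp μ j) (v + ((m : ℝ) - j) * l) ≤ P.value μ l N v := by
  obtain ⟨j, hj, hmin⟩ := Finset.exists_min_image (Finset.range (m + 1))
    (fun j : ℕ => testError (amp μ j) (v + ((m : ℝ) - j) * l)) ⟨0, by simp⟩
  refine ⟨j, by simpa [Nat.lt_succ_iff] using hj, ?_⟩
  have hinner : ∀ u, testError (amp μ j) (v + ((m : ℝ) - j) * l) ≤
      ∫⁻ s, kernel μ l m (P.passive u) (N u s) v s ∂stdNormal := by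
    intro u
    set r := m - P.passive u with hr
    have hcross : ∀ i j, i < j → ∀ s t, s ≤ t →
        kernel μ l m (P.passive u) j v s ≤ kernel μ l m (P.passive u) i v s →
        kernel μ l m (P.passive u) j v t ≤ kernel μ l m (P.passive u) i v t := by
      intro i j hij s t hst h
      have := testError_crossing (l := ((j : ℝ) - i) * l) (amp_nonneg hμ i) (amp_mono hμ hij.le)
        (v := v + ((P.passive u : ℝ) - j) * l + (amp μ r * s - amp μ r ^ 2 / 2))
        (c := amp μ r * (t - s)) (mul_nonneg (amp_nonneg hμ _) (sub_nonneg.2 hst))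
        (h.trans (le_of_eq (by rw [kernel]; congr 1; ring)))
      refine le_trans (le_of_eq ?_) (this.trans (le_of_eq ?_))
      · rw [kernel]; congr 1; ring
      · rw [kernel]; congr 1; ring
    obtain ⟨e, he, hle⟩ := exists_lintegral_le_of_antitone (ν := stdNormal) hcross _
      (Finset.range (P.passive u + 1)) rfl (N u) (hN.antitone u)
      (fun s => by have := hN.le u s; simp; omega)
    refine le_trans ?_ hle
    have hpm := P.passive_le u
    have hem : e ≤ P.passive u := by simpa [Nat.lt_succ_iff] using he
    have hval : ∫⁻ s, kernel μ l m (P.passive u) e v s ∂stdNormal =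
        testError (amp μ (r + e)) (v + ((m : ℝ) - (r + e : ℕ)) * l) := by
      rw [← gaussStep_testError (amp_sq_add μ r e), gaussStep]
      have : (m : ℝ) - (r + e : ℕ) = (P.passive u : ℝ) - e := by
        have : (m : ℝ) = r + P.passive u := by exact_mod_cast (by omega : m = r + P.passive u)
        rw [this]; push_cast; ring
      rw [this]
      rfl
    rw [hval]
    exact hmin (r + e) (by simp; omega)
  calc testError (amp μ j) (v + ((m : ℝ) - j) * l)
      = ∫⁻ _, testError (amp μ j) (v + ((m : ℝ) - j) * l) ∂P.ν := by simp
    _ ≤ P.value μ l N v := lintegral_mono hinner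

/-- No tests. -/
def nil : Layout 0 where
  Ω := Unit
  ν := Measure.dirac ()
  passive _ := 0
  measurable_passive := measurable_const
  passive_le _ := le_rfl

theorem value_nil (μ l : ℝ) : nil.value μ l (fun _ _ => 0) = testError 0 := by
  funext v
  refine (lintegral_dirac () _).trans ?_
  simp [nil, kernel, amp_zero]

theorem admissible_nil : nil.Admissible fun _ _ => 0 :=
  ⟨measurable_const, fun _ => antitone_const, fun _ _ => le_rfl⟩

/-- One more test, which may be passive. -/
def addPassive {m : ℕ} (P : Layout m) : Layout (m + 1) where
  Ω := P.Ω
  ν := P.ν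
  passive u := P.passive u + 1
  measurable_passive := P.measurable_passive.add_const 1
  passive_le u := Nat.succ_le_succ (P.passive_le u)

/-- A passive test that remains passive shifts the log-likelihood ratio. -/
theorem value_addPassive (μ l : ℝ) {m : ℕ} (P : Layout m) (N : P.Ω → ℝ → ℕ) (v : ℝ) :
    P.addPassive.value μ l N v = P.value μ l N (v + l) := by
  refine lintegral_congr fun u => lintegral_congr fun s => ?_
  simp only [kernel, addPassive, Nat.add_sub_add_right]
  congr 1
  push_cast; ring

theorem measurable_integrand (μ l : ℝ) {m : ℕ} (P : Layout m) {N : ℝ → P.Ω → ℝ → ℕ}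
    (hN : Measurable fun p : (ℝ × P.Ω) × ℝ => N p.1.1 p.1.2 p.2) {v : ℝ → ℝ} (hv : Measurable v) :
    Measurable fun p : ℝ × P.Ω =>
      ∫⁻ s, kernel μ l m (P.passive p.2) (N p.1 p.2 s) (v p.1) s ∂stdNormal := by
  have : Measurable fun p : (ℝ × P.Ω) × ℝ =>
      kernel μ l m (P.passive p.1.2) (N p.1.1 p.1.2 p.2) (v p.1.1) p.2 :=
    measurable_kernel_comp μ l m (P.measurable_passive.comp (by fun_prop)) hN
      (hv.comp (by fun_prop)) (by fun_prop)
  exact this.lintegral_prod_right'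

/-- A potentially passive test that turns out to be Gaussian, independently of the others. -/
theorem value_addPassive_succ (μ l : ℝ) {m : ℕ} (P : Layout m) {N : P.Ω → ℝ → ℕ}
    (hN : P.Admissible N) :
    P.addPassive.value μ l (fun u s => N u s + 1) = gaussStep μ (P.value μ l N) := by
  funext v
  have hm : Measurable fun p : (ℝ × P.Ω) × ℝ => N p.1.2 p.2 :=
    hN.measurable.comp (f := fun p : (ℝ × P.Ω) × ℝ => (p.1.2, p.2)) (by fun_prop)
  have hstep : ∀ u s, kernel μ l (m + 1) (P.passive u + 1) (N u s + 1) v s =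
      ∫⁻ z, kernel μ l m (P.passive u) (N u s) (v + (μ * z - μ ^ 2 / 2)) s ∂stdNormal := by
    intro u s
    have h1 : amp μ 1 ^ 2 + amp μ (N u s) ^ 2 = amp μ (N u s + 1) ^ 2 := by
      rw [amp_sq_add, add_comm]
    rw [amp_one] at h1
    simp only [kernel, Nat.add_sub_add_right]
    rw [← gaussStep_testError h1, gaussStep]
    refine lintegral_congr fun z => ?_
    congr 1
    push_cast; ring
  have hmu : ∀ u, Measurable fun p : ℝ × ℝ =>
      kernel μ l m (P.passive u) (N u p.2) (v + (μ * p.1 - μ ^ 2 / 2)) p.2 := fun u =>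
    measurable_kernel_comp μ l m measurable_const
      (hN.measurable.comp (f := fun p : ℝ × ℝ => (u, p.2)) (by fun_prop)) (by fun_prop)
      (by fun_prop)
  calc P.addPassive.value μ l (fun u s => N u s + 1) v
      = ∫⁻ u, ∫⁻ s, kernel μ l (m + 1) (P.passive u + 1) (N u s + 1) v s ∂stdNormal ∂P.ν := rfl
    _ = ∫⁻ u, ∫⁻ s, ∫⁻ z, kernel μ l m (P.passive u) (N u s) (v + (μ * z - μ ^ 2 / 2)) s
          ∂stdNormal ∂stdNormal ∂P.ν := by simp only [hstep]
    _ = ∫⁻ u, ∫⁻ z, ∫⁻ s, kernel μ l m (P.passive u) (N u s) (v + (μ * z - μ ^ 2 / 2)) s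
          ∂stdNormal ∂stdNormal ∂P.ν :=
        lintegral_congr fun u => (lintegral_lintegral_swap (hmu u).aemeasurable).symm
    _ = ∫⁻ z, ∫⁻ u, ∫⁻ s, kernel μ l m (P.passive u) (N u s) (v + (μ * z - μ ^ 2 / 2)) s
          ∂stdNormal ∂P.ν ∂stdNormal :=
        (lintegral_lintegral_swap (measurable_integrand μ l P (N := fun _ => N) hm
          (v := fun z => v + (μ * z - μ ^ 2 / 2)) (by fun_prop)).aemeasurable).symm
    _ = gaussStep μ (P.value μ l N) v := rfl

/-- One more test, which is always Gaussian. -/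
def addActive {m : ℕ} (P : Layout m) : Layout (m + 1) where
  Ω := P.Ω × ℝ
  ν := P.ν.prod stdNormal
  passive u := P.passive u.1
  measurable_passive := P.measurable_passive.comp measurable_fst
  passive_le u := Nat.le_succ_of_le (P.passive_le u.1)

/-- The cosine of the angle between the new observation and the combination of all observations. -/
def rotC {m : ℕ} (P : Layout m) (u : P.Ω) : ℝ := 1 / √((m - P.passive u : ℕ) + 1 : ℝ)

/-- The sine of the angle between the new observation and the combination of all observations. -/
def rotD {m : ℕ} (P : Layout m) (u : P.Ω) : ℝ :=
  √((m - P.passive u : ℕ) : ℝ) / √((m - P.passive u : ℕ) + 1 : ℝ)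

/-- A quantity that depends on the new observation `z` and the combination `s` of the earlier ones,
in terms of the combination of all observations. -/
def rotate {m : ℕ} (P : Layout m) (E : P.Ω → ℝ → ℝ → ℕ) : P.addActive.Ω → ℝ → ℕ :=
  fun p s => E p.1 (P.rotD p.1 * p.2 + P.rotC p.1 * s) (P.rotD p.1 * s - P.rotC p.1 * p.2)

theorem measurable_rotC {m : ℕ} (P : Layout m) : Measurable P.rotC :=
  (measurable_of_countable fun M : ℕ => 1 / √((m - M : ℕ) + 1 : ℝ)).comp P.measurable_passive

theorem measurable_rotD {m : ℕ} (P : Layout m) : Measurable P.rotD :=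
  (measurable_of_countable fun M : ℕ => √((m - M : ℕ) : ℝ) / √((m - M : ℕ) + 1 : ℝ)).comp
    P.measurable_passive

/-- The coefficients of the rotation are nonnegative, hence it preserves monotonicity. -/
theorem admissible_rotate {m : ℕ} (P : Layout m) {E : P.Ω → ℝ → ℝ → ℕ}
    (hE : Measurable fun p : (P.Ω × ℝ) × ℝ => E p.1.1 p.1.2 p.2)
    (hz : ∀ u s, Antitone fun z => E u z s) (hs : ∀ u z, Antitone (E u z))
    (hle : ∀ u z s, E u z s ≤ P.passive u) : P.addActive.Admissible (P.rotate E) where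
  measurable := by
    have hC := P.measurable_rotC
    have hD := P.measurable_rotD
    have : Measurable fun p : (P.Ω × ℝ) × ℝ =>
        ((p.1.1, P.rotD p.1.1 * p.1.2 + P.rotC p.1.1 * p.2),
          P.rotD p.1.1 * p.2 - P.rotC p.1.1 * p.1.2) := by fun_prop
    exact hE.comp this
  antitone p s t hst := by
    have hc : 0 ≤ P.rotC p.1 := by unfold rotC; positivity
    have hd : 0 ≤ P.rotD p.1 := by unfold rotD; positivity
    refine (hz p.1 _ ?_).trans (hs p.1 _ ?_)
    · have := mul_le_mul_of_nonneg_left hst hc; linarith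
    · have := mul_le_mul_of_nonneg_left hst hd; linarith
  le p s := hle _ _ _

/-- The new observation and the combination of the earlier ones may be rotated to the combination of
all observations and an independent variable, which becomes auxiliary randomness. -/
theorem value_rotate (μ l : ℝ) {m : ℕ} (P : Layout m) {E : P.Ω → ℝ → ℝ → ℕ}
    (hE : Measurable fun p : (P.Ω × ℝ) × ℝ => E p.1.1 p.1.2 p.2) (v : ℝ) :
    P.addActive.value μ l (P.rotate E) v =
      ∫⁻ z, P.value μ l (fun u s => E u z s) (v + (μ * z - μ ^ 2 / 2)) ∂stdNormal := by
  have hE' : Measurable fun p : (ℝ × P.Ω) × ℝ => E p.1.2 p.1.1 p.2 :=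
    hE.comp (f := fun p : (ℝ × P.Ω) × ℝ => ((p.1.2, p.1.1), p.2)) (by fun_prop)
  have hk : Measurable fun p : P.addActive.Ω × ℝ => kernel μ l (m + 1)
      (P.addActive.passive p.1) (P.rotate E p.1 p.2) v p.2 := by
    have hC := P.measurable_rotC
    have hD := P.measurable_rotD
    refine measurable_kernel_comp μ l (m + 1) (P.addActive.measurable_passive.comp measurable_fst)
      ?_ measurable_const measurable_snd
    have : Measurable fun p : (P.Ω × ℝ) × ℝ =>
        ((p.1.1, P.rotD p.1.1 * p.1.2 + P.rotC p.1.1 * p.2),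
          P.rotD p.1.1 * p.2 - P.rotC p.1.1 * p.1.2) := by fun_prop
    exact hE.comp this
  have h1 : ∫⁻ p, ∫⁻ s, kernel μ l (m + 1) (P.addActive.passive p) (P.rotate E p s) v s
      ∂stdNormal ∂P.addActive.ν = ∫⁻ u, ∫⁻ t, ∫⁻ s, kernel μ l (m + 1)
        (P.passive u) (P.rotate E (u, t) s) v s ∂stdNormal ∂stdNormal ∂P.ν :=
    lintegral_prod _ hk.lintegral_prod_right'.aemeasurable
  have hinner : ∀ u, ∫⁻ t, ∫⁻ s, kernel μ l (m + 1) (P.passive u) (P.rotate E (u, t) s) v s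
      ∂stdNormal ∂stdNormal = ∫⁻ z, ∫⁻ s, kernel μ l m (P.passive u) (E u z s)
        (v + (μ * z - μ ^ 2 / 2)) s ∂stdNormal ∂stdNormal := by
    intro u
    set r := m - P.passive u with hr
    have hpos : (0 : ℝ) < √((r : ℝ) + 1) := Real.sqrt_pos.2 (by positivity)
    have hsq1 : √((r : ℝ) + 1) ^ 2 = (r : ℝ) + 1 := Real.sq_sqrt (by positivity)
    have hsq0 : √(r : ℝ) ^ 2 = (r : ℝ) := Real.sq_sqrt (by positivity)
    have hC : P.rotC u * √((r : ℝ) + 1) = 1 := by rw [rotC, ← hr]; field_simp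
    have hD : P.rotD u * √((r : ℝ) + 1) = √(r : ℝ) := by rw [rotD, ← hr]; field_simp
    have hcd : P.rotC u ^ 2 + P.rotD u ^ 2 = 1 := by
      have : (P.rotC u ^ 2 + P.rotD u ^ 2) * √((r : ℝ) + 1) ^ 2 = 1 * √((r : ℝ) + 1) ^ 2 := by
        calc _ = (P.rotC u * √((r : ℝ) + 1)) ^ 2 + (P.rotD u * √((r : ℝ) + 1)) ^ 2 := by ring
          _ = _ := by rw [hC, hD, hsq0, hsq1]; ring
      exact mul_right_cancel₀ (pow_ne_zero 2 hpos.ne') this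
    have hmeas : Measurable (Function.uncurry fun z s =>
        kernel μ l m (P.passive u) (E u z s) (v + (μ * z - μ ^ 2 / 2)) s) := by
      refine measurable_kernel_comp μ l m (M := fun _ : ℝ × ℝ => P.passive u)
        (n := fun p : ℝ × ℝ => E u p.1 p.2) measurable_const ?_ (by fun_prop) (by fun_prop)
      exact hE.comp (f := fun p : ℝ × ℝ => ((u, p.1), p.2)) (by fun_prop)
    rw [lintegral_stdNormal_rotate hcd hmeas]
    refine lintegral_congr fun t => lintegral_congr fun s => ?_
    have hm1 : m + 1 - P.passive u = r + 1 := by have := P.passive_le u; omega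
    have hc' : P.rotC u + √(r : ℝ) * P.rotD u = √((r : ℝ) + 1) := by
      refine mul_right_cancel₀ hpos.ne' ?_
      rw [add_mul, mul_assoc, hC, hD]
      nlinarith
    have hd' : P.rotD u = √(r : ℝ) * P.rotC u := by
      refine mul_right_cancel₀ hpos.ne' ?_
      rw [hD, mul_assoc, hC, mul_one]
    simp only [kernel, rotate, hm1, ← hr]
    congr 1
    simp only [amp, mul_pow]
    push_cast
    rw [hsq0, hsq1]
    linear_combination (-μ * s) * hc' - μ * t * hd'
  calc P.addActive.value μ l (P.rotate E) v
      = ∫⁻ u, ∫⁻ t, ∫⁻ s, kernel μ l (m + 1) (P.passive u) (P.rotate E (u, t) s) v s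
          ∂stdNormal ∂stdNormal ∂P.ν := h1
    _ = ∫⁻ u, ∫⁻ z, ∫⁻ s, kernel μ l m (P.passive u) (E u z s) (v + (μ * z - μ ^ 2 / 2)) s
          ∂stdNormal ∂stdNormal ∂P.ν := lintegral_congr hinner
    _ = ∫⁻ z, ∫⁻ u, ∫⁻ s, kernel μ l m (P.passive u) (E u z s) (v + (μ * z - μ ^ 2 / 2)) s
          ∂stdNormal ∂P.ν ∂stdNormal :=
        (lintegral_lintegral_swap (measurable_integrand μ l P (N := fun z u s => E u z s) hE'
          (v := fun z => v + (μ * z - μ ^ 2 / 2)) (by fun_prop)).aemeasurable).symm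
    _ = ∫⁻ z, P.value μ l (fun u s => E u z s) (v + (μ * z - μ ^ 2 / 2)) ∂stdNormal := rfl

/-- A mixture of two families of tests, chosen at random before everything else. -/
def mix {m : ℕ} (P Q : Layout m) (a b : ENNReal) (hab : a + b = 1) : Layout m where
  Ω := P.Ω ⊕ Q.Ω
  ν := a • P.ν.map Sum.inl + b • Q.ν.map Sum.inr
  prob := ⟨by
    rw [Measure.add_apply, Measure.smul_apply, Measure.smul_apply,
      Measure.map_apply measurable_inl MeasurableSet.univ,
      Measure.map_apply measurable_inr MeasurableSet.univ]
    simp [hab]⟩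
  passive := Sum.elim P.passive Q.passive
  measurable_passive := P.measurable_passive.sumElim Q.measurable_passive
  passive_le := by rintro (u | u); exacts [P.passive_le u, Q.passive_le u]

theorem admissible_mix {m : ℕ} {P Q : Layout m} {a b : ENNReal} (hab : a + b = 1)
    {N : P.Ω → ℝ → ℕ} {N' : Q.Ω → ℝ → ℕ} (hN : P.Admissible N) (hN' : Q.Admissible N') :
    (P.mix Q a b hab).Admissible (Sum.elim N N') where
  measurable := by
    have h : Measurable (Sum.elim (Function.uncurry N) (Function.uncurry N')) :=
      hN.measurable.sumElim hN'.measurable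
    have he : Measurable fun p : (P.Ω ⊕ Q.Ω) × ℝ =>
        (Sum.map (fun u => (u, p.2)) (fun u => (u, p.2)) p.1 : P.Ω × ℝ ⊕ Q.Ω × ℝ) := by
      have := (MeasurableEquiv.sumProdDistrib P.Ω Q.Ω ℝ).measurable
      convert this using 1
      funext ⟨u, s⟩
      cases u <;> rfl
    have h2 : Function.uncurry (Sum.elim N N') =
        Sum.elim (Function.uncurry N) (Function.uncurry N') ∘ fun p : (P.Ω ⊕ Q.Ω) × ℝ =>
          (Sum.map (fun u => (u, p.2)) (fun u => (u, p.2)) p.1 : P.Ω × ℝ ⊕ Q.Ω × ℝ) := by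
      funext ⟨u, s⟩
      cases u <;> rfl
    exact h2 ▸ h.comp he
  antitone := by rintro (u | u); exacts [hN.antitone u, hN'.antitone u]
  le := by rintro (u | u) s; exacts [hN.le u s, hN'.le u s]

theorem value_mix (μ l : ℝ) {m : ℕ} {P Q : Layout m} {a b : ENNReal} (hab : a + b = 1)
    {N : P.Ω → ℝ → ℕ} {N' : Q.Ω → ℝ → ℕ} (hN : P.Admissible N) (hN' : Q.Admissible N') (v : ℝ) :
    (P.mix Q a b hab).value μ l (Sum.elim N N') v =
      a * P.value μ l N v + b * Q.value μ l N' v := by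
  have hm : Measurable fun u : (P.mix Q a b hab).Ω => ∫⁻ s, kernel μ l m
      ((P.mix Q a b hab).passive u) (Sum.elim N N' u s) v s ∂stdNormal := by
    have : Measurable fun p : (P.mix Q a b hab).Ω × ℝ => kernel μ l m
      ((P.mix Q a b hab).passive p.1) (Sum.elim N N' p.1 p.2) v p.2 :=
      measurable_kernel_comp μ l m ((P.mix Q a b hab).measurable_passive.comp measurable_fst)
        (admissible_mix hab hN hN').measurable measurable_const measurable_snd
    exact this.lintegral_prod_right'
  have hsum : ∀ f : P.Ω ⊕ Q.Ω → ENNReal, Measurable f →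
      ∫⁻ u, f u ∂(a • P.ν.map Sum.inl + b • Q.ν.map Sum.inr) =
        a * ∫⁻ u, f (Sum.inl u) ∂P.ν + b * ∫⁻ u, f (Sum.inr u) ∂Q.ν := fun f hf => by
    rw [lintegral_add_measure, lintegral_smul_measure, lintegral_smul_measure,
      lintegral_map hf measurable_inl, lintegral_map hf measurable_inr]
    rfl
  exact hsum _ hm

end Layout

end

section

/-- `g` is the error of a randomly chosen sequence of `m` tests of amplitude `μ`, a passive test
shifting the log-likelihood ratio by `l`. -/
def Mixture (μ l : ℝ) (m : ℕ) (g : ℝ → ENNReal) : Prop :=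
  ∃ (P : Layout m) (N : P.Ω → ℝ → ℕ), P.Admissible N ∧ g = P.value μ l N

theorem Mixture.nil (μ l : ℝ) : Mixture μ l 0 (testError 0) :=
  ⟨Layout.nil, _, Layout.admissible_nil, (Layout.value_nil μ l).symm⟩

theorem Mixture.mix {μ l : ℝ} {m : ℕ} {f g : ℝ → ENNReal} (hf : Mixture μ l m f)
    (hg : Mixture μ l m g) {a b : ENNReal} (hab : a + b = 1) :
    Mixture μ l m fun v => a * f v + b * g v := by
  obtain ⟨P, N, hN, rfl⟩ := hf
  obtain ⟨Q, N', hN', rfl⟩ := hg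
  exact ⟨P.mix Q a b hab, _, Layout.admissible_mix hab hN hN',
    funext fun v => (Layout.value_mix μ l hab hN hN' v).symm⟩

/-- The value of a search along a root-to-leaf path.  The list holds the tests that are made as
long as the Gaussian tests (`some b`, with threshold `b`) are answered positively and the passive
ones (`none`) negatively.  After the first negative answer of a Gaussian test all tests are
Gaussian.  The function `g` is the value of the continuation. -/
def spineValue (μ l : ℝ) : List (Option ℝ) → (ℝ → ENNReal) → ℝ → ENNReal
  | [], g => g
  | none :: s, g => fun v => spineValue μ l s g (v + l)
  | some b :: s, g => fun v => ∫⁻ z, (if z ≤ b then (gaussStep μ)^[s.length] g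
      (v + (μ * z - μ ^ 2 / 2)) else spineValue μ l s g (v + (μ * z - μ ^ 2 / 2))) ∂stdNormal

/-- Along a search, the number of Gaussian tests is an antitone function of the observations: a
negative answer, which means a small observation, turns the later passive tests into Gaussian
ones. -/
theorem exists_layout_spineValue (μ l : ℝ) {m : ℕ} (P : Layout m) {N : P.Ω → ℝ → ℕ}
    (hN : P.Admissible N) (s : List (Option ℝ)) :
    ∃ (Q : Layout (m + s.length)) (E E' : Q.Ω → ℝ → ℕ), Q.Admissible E ∧ Q.Admissible E' ∧
      (∀ u x, E u x ≤ E' u x) ∧ spineValue μ l s (P.value μ l N) = Q.value μ l E ∧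
      (gaussStep μ)^[s.length] (P.value μ l N) = Q.value μ l E' := by
  induction s with
  | nil => exact ⟨P, N, N, hN, hN, fun _ _ => le_rfl, rfl, rfl⟩
  | cons o s ih =>
    obtain ⟨Q, E, E', hE, hE', hle, h1, h2⟩ := ih
    cases o with
    | none =>
      refine ⟨Q.addPassive, E, fun u x => E' u x + 1,
        ⟨hE.measurable, hE.antitone, fun u x => Nat.le_succ_of_le (hE.le u x)⟩,
        ⟨hE'.measurable.add_const 1, fun u x y hxy => Nat.succ_le_succ (hE'.antitone u hxy),
          fun u x => Nat.succ_le_succ (hE'.le u x)⟩,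
        fun u x => Nat.le_succ_of_le (hle u x), ?_, ?_⟩
      · funext v
        rw [Layout.value_addPassive, ← h1]; rfl
      · rw [Layout.value_addPassive_succ μ l Q hE', List.length_cons, Function.iterate_succ_apply',
          h2]
    | some b =>
      have hm : Measurable fun p : (Q.Ω × ℝ) × ℝ =>
          if p.1.2 ≤ b then E' p.1.1 p.2 else E p.1.1 p.2 :=
        Measurable.ite (measurableSet_le (by fun_prop) measurable_const)
          (hE'.measurable.comp (f := fun p : (Q.Ω × ℝ) × ℝ => (p.1.1, p.2)) (by fun_prop))
          (hE.measurable.comp (f := fun p : (Q.Ω × ℝ) × ℝ => (p.1.1, p.2)) (by fun_prop))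
      have hm' : Measurable fun p : (Q.Ω × ℝ) × ℝ => E' p.1.1 p.2 :=
        hE'.measurable.comp (f := fun p : (Q.Ω × ℝ) × ℝ => (p.1.1, p.2)) (by fun_prop)
      refine ⟨Q.addActive, Q.rotate fun u z x => if z ≤ b then E' u x else E u x,
        Q.rotate fun u _ x => E' u x,
        Q.admissible_rotate hm ?_ ?_ ?_,
        Q.admissible_rotate hm' (fun _ _ _ _ _ => le_rfl) (fun u _ => hE'.antitone u)
          (fun u _ x => hE'.le u x), ?_, ?_, ?_⟩
      · intro u x z z' hz
        dsimp only
        split_ifs with h h'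
        · exact le_rfl
        · linarith
        · exact hle u x
        · exact le_rfl
      · intro u z
        split_ifs
        · exact hE'.antitone u
        · exact hE.antitone u
      · intro u z x
        split_ifs
        · exact hE'.le u x
        · exact hE.le u x
      · intro p x
        simp only [Layout.rotate]
        split_ifs
        · exact le_rfl
        · exact hle _ _
      · funext v
        refine Eq.trans ?_ (Q.value_rotate μ l hm v).symm
        refine lintegral_congr fun z => ?_
        split_ifs
        · rw [h2]
        · rw [h1]
      · change (gaussStep μ)^[s.length + 1] _ = _
        rw [Function.iterate_succ_apply', h2]
        funext v
        exact (Q.value_rotate μ l hm' v).symm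

theorem Mixture.spine {μ l : ℝ} {m : ℕ} {g : ℝ → ENNReal} (hg : Mixture μ l m g)
    (s : List (Option ℝ)) : Mixture μ l (m + s.length) (spineValue μ l s g) := by
  obtain ⟨P, N, hN, rfl⟩ := hg
  obtain ⟨Q, E, _, hE, _, _, h, _⟩ := exists_layout_spineValue μ l P hN s
  exact ⟨Q, E, hE, h⟩

theorem Mixture.exists_testError_le {μ l : ℝ} (hμ : 0 ≤ μ) {m : ℕ} {g : ℝ → ENNReal}
    (hg : Mixture μ l m g) (v : ℝ) :
    ∃ j ≤ m, testError (amp μ j) (v + ((m : ℝ) - j) * l) ≤ g v := by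
  obtain ⟨P, N, hN, rfl⟩ := hg
  exact P.exists_testError_le_value hμ l hN v

/-! ### Test errors and the normal distribution function -/

theorem stdNormal_Iic (x : ℝ) : stdNormal (Set.Iic x) = ENNReal.ofReal (Phi x) := by
  rw [Phi, ofReal_cdf]

theorem Phi_nonneg (x : ℝ) : 0 ≤ Phi x := cdf_nonneg _ x

theorem Phi_le_one (x : ℝ) : Phi x ≤ 1 := cdf_le_one _ x

theorem Phi_pos (x : ℝ) : 0 < Phi x := by
  have h1 : stdNormal (Set.Iic x) ≠ 0 := by
    intro h
    have h2 := gaussianReal_absolutelyContinuous' 0 (one_ne_zero (α := NNReal)) h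
    simp at h2
  rw [stdNormal_Iic] at h1
  exact (ENNReal.ofReal_pos).1 (pos_iff_ne_zero.2 h1)

theorem Phi_neg (x : ℝ) : Phi (-x) = 1 - Phi x := by
  have : NullSingletonClass stdNormal := nullSingletonClass_gaussianReal one_ne_zero
  have h1 : stdNormal (Set.Iic (-x)) = stdNormal (Set.Ici x) := by
    have h := gaussianReal_map_neg (μ := 0) (v := 1)
    rw [neg_zero] at h
    conv_lhs => rw [stdNormal, ← h, Measure.map_apply (by fun_prop) measurableSet_Iic]
    congr 1
    ext z; simp
  have h2 : stdNormal (Set.Ici x) = 1 - stdNormal (Set.Iic x) := by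
    rw [← measure_univ (μ := stdNormal), ← measure_compl measurableSet_Iic (measure_ne_top _ _),
      Set.compl_Iic]
    exact (Ioi_ae_eq_Ici.measure_eq).symm
  rw [h2, stdNormal_Iic, stdNormal_Iic, ← ENNReal.ofReal_one,
    ← ENNReal.ofReal_sub _ (Phi_nonneg x)] at h1
  exact ((ENNReal.ofReal_eq_ofReal_iff (by linarith [Phi_le_one x]) (Phi_nonneg _)).1 h1.symm).symm

/-- The likelihood ratio is monotone in the observation, so the optimal test is a threshold test. -/
theorem testError_eq {ρ : ℝ} (hρ : 0 < ρ) (v : ℝ) : testError ρ v =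
    ENNReal.ofReal (1 - Phi (ρ / 2 - v / ρ) + Real.exp v * Phi (-(ρ / 2) - v / ρ)) := by
  obtain ⟨t, ht⟩ : ∃ t, t = ρ / 2 - v / ρ := ⟨_, rfl⟩
  rw [← ht]
  have hρt : ρ * t = ρ ^ 2 / 2 - v := by rw [ht]; field_simp
  have hpt : ∀ s, ENNReal.ofReal (min 1 (Real.exp (v + (ρ * s - ρ ^ 2 / 2)))) =
      (Set.Ioi t).indicator 1 s + ENNReal.ofReal (Real.exp v) *
        ((Set.Iic t).indicator 1 s * ENNReal.ofReal (Real.exp (ρ * s - ρ ^ 2 / 2))) := by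
    intro s
    have hs : v + (ρ * s - ρ ^ 2 / 2) = ρ * (s - t) := by linear_combination hρt
    by_cases h : s ≤ t
    · have h1 : v + (ρ * s - ρ ^ 2 / 2) ≤ 0 := by
        rw [hs]; exact mul_nonpos_of_nonneg_of_nonpos hρ.le (by linarith)
      rw [Set.indicator_of_notMem (by simpa using h), Set.indicator_of_mem (by simpa using h),
        min_eq_right (Real.exp_le_one_iff.2 h1), zero_add, Pi.one_apply, one_mul,
        ← ENNReal.ofReal_mul (Real.exp_nonneg _), ← Real.exp_add]
    · push Not at h
      have h1 : 0 ≤ v + (ρ * s - ρ ^ 2 / 2) := by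
        rw [hs]; exact mul_nonneg hρ.le (by linarith)
      rw [Set.indicator_of_mem (by simpa using h), Set.indicator_of_notMem (by simpa using h),
        min_eq_left (Real.one_le_exp h1)]
      simp
  have hmI : Measurable ((Set.Iic t).indicator (1 : ℝ → ENNReal)) :=
    measurable_one.indicator measurableSet_Iic
  have hmI' : Measurable fun s => (Set.Iic t).indicator (1 : ℝ → ENNReal) s *
      ENNReal.ofReal (Real.exp (ρ * s - ρ ^ 2 / 2)) := hmI.mul (by fun_prop)
  rw [testError, gaussStep]
  simp only [hpt]
  rw [lintegral_add_left (measurable_one.indicator measurableSet_Ioi),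
    lintegral_indicator_one measurableSet_Ioi, lintegral_const_mul _ hmI',
    lintegral_stdNormal_shift ρ hmI]
  have h1 : ∫⁻ s, (Set.Iic t).indicator (1 : ℝ → ENNReal) (s + ρ) ∂stdNormal =
      ENNReal.ofReal (Phi (-(ρ / 2) - v / ρ)) := by
    rw [← stdNormal_Iic, ← lintegral_indicator_one measurableSet_Iic]
    refine lintegral_congr fun s => ?_
    simp only [Set.indicator, Set.mem_Iic]
    congr 1
    rw [ht, eq_iff_iff]
    constructor <;> intro h <;> linarith
  have h2 : stdNormal (Set.Ioi t) = ENNReal.ofReal (1 - Phi t) := by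
    rw [ENNReal.ofReal_sub _ (Phi_nonneg t), ENNReal.ofReal_one, ← stdNormal_Iic,
      ← measure_univ (μ := stdNormal), ← measure_compl measurableSet_Iic (measure_ne_top _ _),
      Set.compl_Iic]
  rw [h1, h2, ← ENNReal.ofReal_mul (Real.exp_nonneg _), ← ENNReal.ofReal_add
    (by linarith [Phi_le_one t]) (mul_nonneg (Real.exp_nonneg _) (Phi_nonneg _))]

theorem testError_amp_eq {σ : ℝ} (hσ : 0 < σ) {j : ℕ} (hj : 1 ≤ j) (v : ℝ) :
    testError (amp (1 / σ) j) v = ENNReal.ofReal (1 - gaussianProfile σ j v) := by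
  have hs : 0 < √(j : ℝ) := Real.sqrt_pos.2 (by exact_mod_cast hj)
  have hρ : 0 < amp (1 / σ) j := by unfold amp; positivity
  rw [testError_eq hρ, gaussianProfile]
  have h1 : amp (1 / σ) j / 2 = √(j : ℝ) / (2 * σ) := by unfold amp; field_simp
  have h2 : v / amp (1 / σ) j = v * σ / √(j : ℝ) := by unfold amp; field_simp
  rw [h1, h2]
  congr 1; ring

/-- The roles of the two hypotheses can be exchanged. -/
theorem gaussianProfile_neg (σ : ℝ) (j : ℕ) (v : ℝ) :
    Real.exp v * (1 - gaussianProfile σ j (-v)) = 1 - gaussianProfile σ j v := by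
  have h1 := Phi_neg (√(j : ℝ) / (2 * σ) - -v * σ / √(j : ℝ))
  have h2 := Phi_neg (√(j : ℝ) / (2 * σ) - v * σ / √(j : ℝ))
  have e1 : -(√(j : ℝ) / (2 * σ) - -v * σ / √(j : ℝ)) =
    -(√(j : ℝ) / (2 * σ)) - v * σ / √(j : ℝ) := by ring
  have e2 : -(√(j : ℝ) / (2 * σ) - v * σ / √(j : ℝ)) =
    -(√(j : ℝ) / (2 * σ)) - -v * σ / √(j : ℝ) := by ring
  rw [e1] at h1
  rw [e2] at h2
  have h3 : Real.exp v * Real.exp (-v) = 1 := by rw [← Real.exp_add]; simp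
  rw [gaussianProfile, gaussianProfile, h1, h2]
  linear_combination (1 - Phi (√(j : ℝ) / (2 * σ) - v * σ / √(j : ℝ))) * h3

end

section

variable {X : Type*}

/-! ### Privacy -/

/-- The expectation of a nonnegative function. -/
def expect {β : Type*} (p : PMF β) (f : β → ENNReal) : ENNReal := ∑' b, p b * f b

theorem expect_bind {β γ : Type*} (p : PMF β) (q : β → PMF γ) (f : γ → ENNReal) :
    expect (p.bind q) f = expect p fun b => expect (q b) f := by
  simp only [expect, PMF.bind_apply, ← ENNReal.tsum_mul_right, ← ENNReal.tsum_mul_left]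
  rw [ENNReal.tsum_comm]
  simp only [mul_assoc]

theorem expect_pure {β : Type*} (b : β) (f : β → ENNReal) : expect (PMF.pure b) f = f b := by
  rw [expect, tsum_eq_single b fun b' hb' => by rw [PMF.pure_apply, if_neg hb', zero_mul]]
  simp

theorem expect_bool (p : PMF Bool) (f : Bool → ENNReal) :
    expect p f = p true * f true + p false * f false := by
  rw [expect, tsum_bool, add_comm]

theorem expect_const {β : Type*} (p : PMF β) (a : ENNReal) : expect p (fun _ => a) = a := by
  rw [expect, ENNReal.tsum_mul_right, PMF.tsum_coe, one_mul]

theorem expect_congr {β : Type*} {p : PMF β} {f g : β → ENNReal}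
    (h : ∀ b ∈ p.support, f b = g b) : expect p f = expect p g := by
  refine tsum_congr fun b => ?_
  by_cases hb : p b = 0
  · rw [hb, zero_mul, zero_mul]
  · rw [h b hb]

theorem toOuterMeasure_bind_eq_expect {β γ : Type*} (p : PMF β) (q : β → PMF γ) (s : Set γ) :
    (p.bind q).toOuterMeasure s = expect p fun b => (q b).toOuterMeasure s :=
  PMF.toOuterMeasure_bind_apply _ _ _

namespace SearchTree

/-- The expectation of `f` of the result, when the coin of level `l` has distribution `q l`. -/
def expect {β : Type} (q : ℕ → PMF Bool) (f : β → ENNReal) : SearchTree β → ENNReal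
  | leaf b => f b
  | test l hi lo => q l true * hi.expect q f + q l false * lo.expect q f

theorem expect_congr {β : Type} {q q' : ℕ → PMF Bool} (f : β → ENNReal) {t : SearchTree β}
    {n a e : ℕ} (ht : t.Valid n a e) (h : ∀ l, a ≤ l → l < e → q l = q' l) :
    t.expect q f = t.expect q' f := by
  induction t generalizing n a e with
  | leaf b => rfl
  | test l hi lo ih1 ih0 =>
    obtain ⟨_, hal, hle, hv1, hv0⟩ := ht
    rw [expect, expect, h l hal hle, ih1 hv1 fun l' h1 h2 => h l' (by omega) h2,
      ih0 hv0 fun l' h1 h2 => h l' h1 (by omega)]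

/-- Only the coins on the path matter for a search on the path. -/
theorem expect_coins {β : Type} {p : List ℕ} {us : List (List ℕ)} (hus : us.Nodup)
    (hp : ∀ l ≤ p.length, p.take l ∈ us) (f : β → ENNReal) {t : SearchTree β} {n a e : ℕ}
    (ht : t.Valid n a e) (he : e ≤ p.length + 1) (κ : List ℕ → PMF Bool) :
    HeavyHitters.expect (coins κ us) (fun c => f (t.eval fun l => c (p.take l))) =
      t.expect (fun l => κ (p.take l)) f := by
  induction t generalizing n a e κ with
  | leaf b => simp only [eval, expect_const, expect]
  | test l hi lo ih1 ih0 =>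
    obtain ⟨_, hal, hle, hv1, hv0⟩ := ht
    have hκ : ∀ b l', l' ≠ l → l' < e →
        Function.update κ (p.take l) (PMF.pure b) (p.take l') = κ (p.take l') :=
      fun b l' hne hl' => Function.update_of_ne (take_ne_take (by omega) (by omega) hne) _ _
    have hcoin : ∀ b, ∀ c ∈ (coins (Function.update κ (p.take l) (PMF.pure b)) us).support,
        c (p.take l) = b := fun b c hc => coins_support_pure hc (hp l (by omega)) (by simp)
    rw [coins_expose κ hus (p.take l), expect_bind, expect_bool, expect]
    congr 2
    · rw [← expect_congr (q := fun l' => Function.update κ (p.take l) (PMF.pure true) (p.take l'))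
        f hv1 fun l' h1 h2 => hκ true l' (by omega) h2, ← ih1 hv1 he]
      refine HeavyHitters.expect_congr fun c hc => ?_
      rw [eval, if_pos (hcoin true c hc)]
    · rw [← expect_congr (q := fun l' => Function.update κ (p.take l) (PMF.pure false) (p.take l'))
        f hv0 fun l' h1 h2 => hκ false l' (by omega) (by omega), ← ih0 hv0 (by omega)]
      refine HeavyHitters.expect_congr fun c hc => ?_
      rw [eval, if_neg (by rw [hcoin false c hc]; simp)]

end SearchTree

/-- The distributions of the answers of a threshold test under two hypotheses.  A passive test
(`none`) is answered negatively under the first hypothesis, and also under the second one with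
probability at least `exp l`.  A Gaussian test (`some b`) compares a normal variable with `b`; the
two hypotheses differ in its mean. -/
def TestPair (μ l : ℝ) (q q' : PMF Bool) : Option ℝ → Prop
  | none => q = PMF.pure false ∧ ENNReal.ofReal (Real.exp l) ≤ q' false
  | some b => q false = stdNormal (Set.Iic b) ∧ q' false = stdNormal (Set.Iic (b - μ))

/-- The value of a Gaussian test is affine in the likelihood ratio. -/
theorem lintegral_gaussianTest_le {μ l b v : ℝ} {q q' : PMF Bool}
    (h : TestPair μ l q q' (some b)) {f₀ f₁ : ℝ → ENNReal} {A₀ B₀ A₁ B₁ : ENNReal}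
    (h₀ : ∀ w, f₀ w ≤ A₀ + ENNReal.ofReal (Real.exp w) * B₀)
    (h₁ : ∀ w, f₁ w ≤ A₁ + ENNReal.ofReal (Real.exp w) * B₁) :
    ∫⁻ z, (if z ≤ b then f₀ (v + (μ * z - μ ^ 2 / 2)) else f₁ (v + (μ * z - μ ^ 2 / 2)))
      ∂stdNormal ≤ (q true * A₁ + q false * A₀) +
        ENNReal.ofReal (Real.exp v) * (q' true * B₁ + q' false * B₀) := by
  obtain ⟨hq, hq'⟩ := h
  have htrue : ∀ (p : PMF Bool) (x : ℝ), p false = stdNormal (Set.Iic x) →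
      p true = stdNormal (Set.Ioi x) := by
    intro p x hp
    rw [← Set.compl_Iic, measure_compl measurableSet_Iic (measure_ne_top _ _), measure_univ, ← hp,
      ← pmf_bool_add p, ENNReal.add_sub_cancel_right (p.apply_ne_top _)]
  have hL : ∀ s : Set ℝ, MeasurableSet s → ∫⁻ z, s.indicator 1 z *
      ENNReal.ofReal (Real.exp (μ * z - μ ^ 2 / 2)) ∂stdNormal =
        stdNormal ((fun z => z + μ) ⁻¹' s) := fun s hs => by
    rw [lintegral_stdNormal_shift μ (measurable_one.indicator hs),
      ← lintegral_indicator_one (hs.preimage (by fun_prop))]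
    rfl
  have hm : ∀ s : Set ℝ, MeasurableSet s → Measurable fun z =>
      s.indicator (1 : ℝ → ENNReal) z := fun s hs => measurable_one.indicator hs
  have hmL : Measurable fun z : ℝ => ENNReal.ofReal (Real.exp (μ * z - μ ^ 2 / 2)) := by fun_prop
  have hml : ∀ s : Set ℝ, MeasurableSet s → Measurable fun z =>
      s.indicator (1 : ℝ → ENNReal) z * ENNReal.ofReal (Real.exp (μ * z - μ ^ 2 / 2)) :=
    fun s hs => (hm s hs).mul hmL
  have hlin : ∀ I J K L : ℝ → ENNReal, Measurable I → Measurable J → Measurable K →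
      Measurable L → ∫⁻ z, ((I z * A₁ + J z * A₀) + ENNReal.ofReal (Real.exp v) *
        (K z * B₁ + L z * B₀)) ∂stdNormal =
      ((∫⁻ z, I z ∂stdNormal) * A₁ + (∫⁻ z, J z ∂stdNormal) * A₀) +
        ENNReal.ofReal (Real.exp v) *
          ((∫⁻ z, K z ∂stdNormal) * B₁ + (∫⁻ z, L z ∂stdNormal) * B₀) := by
    intro I J K L hI hJ hK hL
    rw [lintegral_add_left (by fun_prop), lintegral_add_left (by fun_prop),
      lintegral_mul_const _ hI, lintegral_mul_const _ hJ, lintegral_const_mul _ (by fun_prop),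
      lintegral_add_left (by fun_prop), lintegral_mul_const _ hK, lintegral_mul_const _ hL]
  calc _ ≤ ∫⁻ z, (((Set.Ioi b).indicator 1 z * A₁ + (Set.Iic b).indicator 1 z * A₀) +
        ENNReal.ofReal (Real.exp v) *
          ((Set.Ioi b).indicator 1 z * ENNReal.ofReal (Real.exp (μ * z - μ ^ 2 / 2)) * B₁ +
            (Set.Iic b).indicator 1 z * ENNReal.ofReal (Real.exp (μ * z - μ ^ 2 / 2)) * B₀))
          ∂stdNormal := by
        refine lintegral_mono fun z => ?_
        dsimp only
        by_cases hz : z ≤ b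
        · rw [if_pos hz, Set.indicator_of_notMem (by simpa using hz),
            Set.indicator_of_mem (by simpa using hz)]
          refine (h₀ _).trans (le_of_eq ?_)
          rw [Real.exp_add, ENNReal.ofReal_mul (Real.exp_nonneg _)]
          simp only [Pi.one_apply]; ring
        · rw [if_neg hz, Set.indicator_of_mem (by simpa using hz),
            Set.indicator_of_notMem (by simpa using hz)]
          refine (h₁ _).trans (le_of_eq ?_)
          rw [Real.exp_add, ENNReal.ofReal_mul (Real.exp_nonneg _)]
          simp only [Pi.one_apply]; ring
    _ = _ := by
        rw [hlin _ _ _ _ (hm _ measurableSet_Ioi) (hm _ measurableSet_Iic)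
            (hml _ measurableSet_Ioi) (hml _ measurableSet_Iic),
          hL _ measurableSet_Ioi, hL _ measurableSet_Iic,
          lintegral_indicator_one measurableSet_Ioi, lintegral_indicator_one measurableSet_Iic,
          htrue q b hq, htrue q' _ hq', hq, hq', Set.preimage_add_const_Ioi,
          Set.preimage_add_const_Iic]

/-- The expectation of the likelihood ratio is `1`. -/
theorem gaussStep_le {μ v : ℝ} {f : ℝ → ENNReal} {A B : ENNReal}
    (h : ∀ w, f w ≤ A + ENNReal.ofReal (Real.exp w) * B) :
    gaussStep μ f v ≤ A + ENNReal.ofReal (Real.exp v) * B := by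
  have hmL : Measurable fun z : ℝ => ENNReal.ofReal (Real.exp (μ * z - μ ^ 2 / 2)) := by fun_prop
  have h1 := lintegral_stdNormal_shift μ (f := fun _ => 1) measurable_const
  simp only [one_mul, lintegral_const, measure_univ, mul_one] at h1
  calc gaussStep μ f v ≤ ∫⁻ z, (A + ENNReal.ofReal (Real.exp v) * B *
        ENNReal.ofReal (Real.exp (μ * z - μ ^ 2 / 2))) ∂stdNormal := by
        refine lintegral_mono fun z => (h _).trans (le_of_eq ?_)
        rw [Real.exp_add, ENNReal.ofReal_mul (Real.exp_nonneg _)]; ring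
    _ = _ := by
        rw [lintegral_add_left measurable_const, lintegral_const_mul _ hmL, h1, lintegral_const,
          measure_univ, mul_one, mul_one]

section

variable {μ l : ℝ} {β : Type} {q q' : ℕ → PMF Bool} {b : ℕ → Option ℝ} {g : ℝ → ENNReal}

/-- The value of a search in which every test is Gaussian. -/
theorem gaussStep_iterate_le_expect {t : SearchTree β} {n a e : ℕ} (ht : t.Valid n a e)
    (hq : ∀ k, a ≤ k → k < e → TestPair μ l (q k) (q' k) (b k))
    (hb : ∀ k, a ≤ k → k < e → (b k).isSome) {α α' : β → ENNReal}
    (hg : ∀ x v, g v ≤ α x + ENNReal.ofReal (Real.exp v) * α' x) (v : ℝ) :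
    (gaussStep μ)^[n] g v ≤ t.expect q α + ENNReal.ofReal (Real.exp v) * t.expect q' α' := by
  induction t generalizing n a e v with
  | leaf x =>
    simp only [SearchTree.expect]
    induction n generalizing v with
    | zero => exact hg x v
    | succ n ih => rw [Function.iterate_succ_apply']; exact gaussStep_le (ih trivial)
  | test k hi lo ih1 ih0 =>
    obtain ⟨h0, hak, hke, hv1, hv0⟩ := ht
    obtain ⟨n, rfl⟩ : ∃ n', n = n' + 1 := ⟨n - 1, by omega⟩
    rw [Nat.add_sub_cancel] at hv1 hv0
    obtain ⟨x, hx⟩ := Option.isSome_iff_exists.1 (hb k hak hke)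
    have htest := hq k hak hke
    rw [hx] at htest
    rw [Function.iterate_succ_apply', gaussStep]
    have := lintegral_gaussianTest_le (v := v) htest
      (ih0 hv0 (fun j h1 h2 => hq j h1 (by omega)) fun j h1 h2 => hb j h1 (by omega))
      (ih1 hv1 (fun j h1 h2 => hq j (by omega) h2) fun j h1 h2 => hb j (by omega) h2)
    simpa only [ite_self, SearchTree.expect] using this

/-- Every search is bounded by a spine: passive tests are answered negatively, and once a Gaussian
test has been answered negatively all further tests are Gaussian, because the counts increase
towards the root. -/
theorem exists_spineValue_le_expect (hl : l ≤ 0) {t : SearchTree β} {n a e : ℕ}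
    (ht : t.Valid n a e)
    (hq : ∀ k, a ≤ k → k < e → TestPair μ l (q k) (q' k) (b k))
    (hb : ∀ j k, a ≤ j → j ≤ k → k < e → (b k).isSome → (b j).isSome) :
    ∃ s : List (Option ℝ), s.length = n ∧ ∀ α α' : β → ENNReal,
      (∀ x v, g v ≤ α x + ENNReal.ofReal (Real.exp v) * α' x) → ∀ v,
      spineValue μ l s g v ≤ t.expect q α + ENNReal.ofReal (Real.exp v) * t.expect q' α' := by
  induction t generalizing n a e with
  | leaf x =>
    refine ⟨List.replicate n none, List.length_replicate, fun α α' hg v => ?_⟩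
    simp only [SearchTree.expect]
    clear ht
    induction n generalizing v with
    | zero => exact hg x v
    | succ n ih =>
      refine (ih (v + l)).trans ?_
      gcongr
      linarith
  | test k hi lo ih1 ih0 =>
    obtain ⟨h0, hak, hke, hv1, hv0⟩ := ht
    obtain ⟨n, rfl⟩ : ∃ n', n = n' + 1 := ⟨n - 1, by omega⟩
    rw [Nat.add_sub_cancel] at hv1 hv0
    have htest := hq k hak hke
    rcases hx : b k with _ | x
    · obtain ⟨s, hs, hle⟩ := ih0 hv0 (fun j h1 h2 => hq j h1 (by omega))
        fun i j h1 h2 h3 => hb i j h1 h2 (by omega)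
      refine ⟨none :: s, by rw [List.length_cons, hs], fun α α' hg v => ?_⟩
      rw [hx] at htest
      refine (hle α α' hg (v + l)).trans ?_
      simp only [SearchTree.expect]
      rw [htest.1, PMF.pure_apply, PMF.pure_apply, if_neg (by simp), if_pos rfl, zero_mul,
        zero_add, one_mul, Real.exp_add, ENNReal.ofReal_mul (Real.exp_nonneg _), mul_assoc]
      gcongr
      calc ENNReal.ofReal (Real.exp l) * lo.expect q' α' ≤ q' k false * lo.expect q' α' := by
            gcongr; exact htest.2
        _ ≤ _ := le_add_self
    · obtain ⟨s, hs, hle⟩ := ih1 hv1 (fun j h1 h2 => hq j (by omega) h2)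
        fun i j h1 h2 h3 => hb i j (by omega) h2 h3
      refine ⟨some x :: s, by rw [List.length_cons, hs], fun α α' hg v => ?_⟩
      rw [hx] at htest
      have hsome : (b k).isSome := by rw [hx]; rfl
      exact lintegral_gaussianTest_le (v := v) htest
        (by
          rw [hs]
          exact gaussStep_iterate_le_expect hv0 (fun j h1 h2 => hq j h1 (by omega))
            (fun j h1 h2 => hb j k h1 h2.le hke hsome) hg)
        (hle α α' hg)

end

end

section

variable {X : Type*}

/-- Running the algorithm on one tree, in terms of expectations: the error of the continuation is
turned into a mixture of searches.  The coins away from the path to the additional record have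
the same distributions under both hypotheses and are fixed first. -/
theorem exists_mixture_coins {μ l : ℝ} (hl : l ≤ 0) (T : DataTree X) {p : List ℕ} (hp : p ∈ T.nodes)
    {n m : ℕ} (hn : T.height < 2 ^ n) {κ κ' : List ℕ → PMF Bool} {b : ℕ → Option ℝ}
    (hoff : ∀ u, ¬ u <+: p → κ u = κ' u)
    (hpair : ∀ k ≤ p.length, TestPair μ l (κ (p.take k)) (κ' (p.take k)) (b k))
    (hb : ∀ j k, j ≤ k → k ≤ p.length → (b k).isSome → (b j).isSome)
    {g : ℝ → ENNReal} (hg : Mixture μ l m g) :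
    ∃ g', Mixture μ l (m + n) g' ∧ ∀ α α' : Marking → ENNReal,
      (∀ M v, g v ≤ α M + ENNReal.ofReal (Real.exp v) * α' M) → ∀ v,
      g' v ≤ expect (coins κ (nodeList T)) (fun c => α (finalMarking T c)) +
        ENNReal.ofReal (Real.exp v) *
          expect (coins κ' (nodeList T)) (fun c => α' (finalMarking T c)) := by
  classical
  refine freeze_induction (P := fun κ κ' =>
      (∀ k ≤ p.length, TestPair μ l (κ (p.take k)) (κ' (p.take k)) (b k)) →
      ∃ g', Mixture μ l (m + n) g' ∧ ∀ α α' : Marking → ENNReal,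
      (∀ M v, g v ≤ α M + ENNReal.ofReal (Real.exp v) * α' M) → ∀ v,
      g' v ≤ expect (coins κ (nodeList T)) (fun c => α (finalMarking T c)) +
        ENNReal.ofReal (Real.exp v) *
          expect (coins κ' (nodeList T)) (fun c => α' (finalMarking T c)))
    ((nodeList T).filter fun u => ¬ u <+: p) ?_ κ κ' ?_ ?_ hpair
  · intro κ κ' u hu huu h hpair
    have hup : ¬ u <+: p := by simpa using (List.mem_filter.1 hu).2
    have hne : ∀ k, p.take k ≠ u := by rintro k rfl; exact hup (List.take_prefix _ _)
    have h' : ∀ b, _ := fun b => h b fun k hk => by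
      rw [Function.update_of_ne (hne k), Function.update_of_ne (hne k)]
      exact hpair k hk
    obtain ⟨g₁, hg₁, hle₁⟩ := h' true
    obtain ⟨g₀, hg₀, hle₀⟩ := h' false
    refine ⟨_, hg₁.mix hg₀ (pmf_bool_add (κ u)), fun α α' hα v => ?_⟩
    rw [coins_expose κ (nodup_nodeList T) u, coins_expose κ' (nodup_nodeList T) u, expect_bind,
      expect_bind, expect_bool, expect_bool, ← huu]
    calc _ ≤ κ u true * (_ + ENNReal.ofReal (Real.exp v) * _) +
          κ u false * (_ + ENNReal.ofReal (Real.exp v) * _) := by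
            gcongr
            · exact hle₁ α α' hα v
            · exact hle₀ α α' hα v
      _ = _ := by ring
  · intro u hu
    exact hoff u (by simpa using (List.mem_filter.1 hu).2)
  · intro θ θ' h1 h2 hpair
    have hpure : ∀ u, ∃ b, u ∈ nodeList T → ¬ u <+: p → θ u = PMF.pure b ∧ θ' u = PMF.pure b := by
      intro u
      by_cases hu : u ∈ nodeList T ∧ ¬ u <+: p
      · obtain ⟨b, hb⟩ := h2 u (List.mem_filter.2 ⟨hu.1, by simpa using hu.2⟩)
        exact ⟨b, fun _ _ => hb⟩
      · exact ⟨false, fun h h' => absurd ⟨h, h'⟩ hu⟩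
    choose d hd using hpure
    obtain ⟨t, ht, hte⟩ := exists_searchTree hp (fun u => if u ∈ nodeList T then d u else false)
      (n := n) (a := 0) (len := T.height) (A := fun _ => True) (B := fun _ => False) hn
      (fun _ h => h.elim)
    set F : (List ℕ → Prop) → Marking := fun S u => if u ∈ T.nodes then markBy (S u) else none
      with hF
    have hfinal : ∀ c : List ℕ → Bool,
        (∀ u, ¬ u <+: p → c u = if u ∈ nodeList T then d u else false) →
        finalMarking T c = F (t.eval fun k => c (p.take k)) := fun c hc => by
      rw [← (hte c hc).1]; rfl
    have hagree : ∀ η : List ℕ → PMF Bool,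
        (∀ u ∈ nodeList T, ¬ u <+: p → η u = PMF.pure (d u)) →
        ∀ c ∈ (coins η (nodeList T)).support,
          finalMarking T c = F (t.eval fun k => c (p.take k)) := fun η hη c hc => by
      refine hfinal c fun u hu => ?_
      by_cases hun : u ∈ nodeList T
      · rw [if_pos hun]; exact coins_support_pure hc hun (hη u hun hu)
      · rw [if_neg hun]; exact coins_support_of_not_mem hc hun
    have he : min (0 + T.height) (p.length + 1) ≤ p.length + 1 := min_le_right _ _
    obtain ⟨s, hs, hle⟩ := exists_spineValue_le_expect (g := g) hl ht
      (q := fun k => θ (p.take k)) (q' := fun k => θ' (p.take k))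
      (fun k _ hk => hpair k (by omega)) (fun j k _ hjk hk => hb j k hjk (by omega))
    refine ⟨spineValue μ l s g, hs ▸ hg.spine s, fun α α' hα v => ?_⟩
    rw [expect_congr (p := coins θ (nodeList T))
        (g := fun c => α (F (t.eval fun k => c (p.take k))))
        fun c hc => by rw [hagree θ (fun u hu hup => (hd u hu hup).1) c hc],
      expect_congr (p := coins θ' (nodeList T))
        (g := fun c => α' (F (t.eval fun k => c (p.take k))))
        fun c hc => by rw [hagree θ' (fun u hu hup => (hd u hu hup).2) c hc],
      SearchTree.expect_coins (nodup_nodeList T) (fun k _ => take_leafOf_mem T hp k)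
        (fun S => α (F S)) ht he,
      SearchTree.expect_coins (nodup_nodeList T) (fun k _ => take_leafOf_mem T hp k)
        (fun S => α' (F S)) ht he]
    exact hle _ _ (fun S v => hα (F S) v) v

theorem stdNormal_map_mul {σ : ℝ} (hσ : 0 < σ) (x : ℝ) :
    gaussianReal 0 (σ ^ 2).toNNReal (Set.Iic x) = stdNormal (Set.Iic (x / σ)) := by
  have h := gaussianReal_map_const_mul (μ := 0) (v := 1) σ
  rw [mul_zero, mul_one, show NNReal.mk (σ ^ 2) _ = (σ ^ 2).toNNReal from
    (Real.toNNReal_of_nonneg (sq_nonneg σ)).symm] at h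
  rw [← h, Measure.map_apply (by fun_prop) measurableSet_Iic]
  congr 1
  ext z
  simp only [Set.mem_preimage, Set.mem_Iic]
  rw [le_div_iff₀ hσ, mul_comm]

theorem gaussianSparseThreshold_false_of_lt {σ τ Δ : ℝ} (hσ : 0 < σ) {c : ℕ}
    (h : τ - Δ - 1 < (c : ℝ)) :
    gaussianSparseThreshold σ τ Δ c false = stdNormal (Set.Iic ((τ - c) / σ)) := by
  rw [gaussianSparseThreshold_false, ← stdNormal_map_mul hσ]
  congr 1
  ext z
  simp only [thresholdTest, Set.mem_ofPred_eq, Set.mem_Iic, h, true_and, not_lt]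
  constructor <;> intro h <;> linarith

/-- The answers to the tests on two counts that differ by one.  The test is passive if the smaller
count is not released; then the larger count is released with probability at most
`1 - Φ(Δ/σ)`. -/
theorem testPair_gaussianSparseThreshold {σ : ℝ} (τ Δ : ℝ) (hσ : 0 < σ) (c : ℕ) :
    TestPair (1 / σ) (Real.log (Phi (Δ / σ))) (gaussianSparseThreshold σ τ Δ c)
      (gaussianSparseThreshold σ τ Δ (c + 1))
      (if τ - Δ - 1 < (c : ℝ) then some ((τ - c) / σ) else none) := by
  split_ifs with h
  · refine ⟨gaussianSparseThreshold_false_of_lt hσ h, ?_⟩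
    rw [gaussianSparseThreshold_false_of_lt hσ (by push_cast; linarith)]
    congr 2
    push_cast; ring
  · refine ⟨gaussianSparseThreshold_of_le (not_lt.1 h), ?_⟩
    rw [Real.exp_log (Phi_pos _)]
    by_cases h' : τ - Δ - 1 < ((c + 1 : ℕ) : ℝ)
    · rw [gaussianSparseThreshold_false_of_lt hσ h', ← stdNormal_Iic]
      refine measure_mono (Set.Iic_subset_Iic.2 ?_)
      push_cast
      gcongr
      push Not at h
      linarith
    · rw [gaussianSparseThreshold_of_le (not_lt.1 h'), PMF.pure_apply, if_pos rfl,
        ← ENNReal.ofReal_one]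
      exact ENNReal.ofReal_le_ofReal (Phi_le_one _)

theorem DataTree.count_insert (T : DataTree X) (l₁ l₂ : List X) (x : X) (u : List ℕ) :
    T.count (l₁ ++ x :: l₂) u = T.count (l₁ ++ l₂) u + if u <+: T.leafOf x then 1 else 0 := by
  simp only [count, List.countP_append, List.countP_cons]
  by_cases h : u <+: T.leafOf x <;> simp [h]; omega

/-- The testing problem for the whole forest is at least as hard as a mixture. -/
theorem exists_mixture_sampleAll {k : ℕ} {σ τ Δ : ℝ} (hσ : 0 < σ) (T : Fin k → DataTree X)
    (l₁ l₂ : List X) (x : X) {n : ℕ} (hn : ∀ i, (T i).height < 2 ^ n) (A B : Set (Fin k → Marking))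
    (hAB : ∀ S, S ∈ A ∨ S ∈ B) (is : List (Fin k)) :
    ∃ g, Mixture (1 / σ) (Real.log (Phi (Δ / σ))) (is.length * n) g ∧ ∀ S v,
      g v ≤ (sampleAll (fun i => markHeavyHitters (T i) (l₁ ++ l₂)
          (gaussianSparseThreshold σ τ Δ) [] (T i).height (fun _ => none)) is S).toOuterMeasure A +
        ENNReal.ofReal (Real.exp v) * (sampleAll (fun i => markHeavyHitters (T i) (l₁ ++ x :: l₂)
          (gaussianSparseThreshold σ τ Δ) [] (T i).height (fun _ => none)) is S).toOuterMeasure B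
      := by
  classical
  induction is with
  | nil =>
    refine ⟨testError 0, by simpa using Mixture.nil _ _, fun S v => ?_⟩
    simp only [sampleAll_nil, PMF.toOuterMeasure_pure_apply]
    rw [testError, gaussStep_zero]
    rcases hAB S with h | h
    · rw [if_pos h]
      refine le_trans ?_ le_self_add
      rw [← ENNReal.ofReal_one]
      exact ENNReal.ofReal_le_ofReal (min_le_left _ _)
    · rw [if_pos h, mul_one]
      exact le_trans (ENNReal.ofReal_le_ofReal (min_le_right _ _)) le_add_self
  | cons i is ih =>
    obtain ⟨g, hg, hle⟩ := ih
    have hcount := (T i).count_insert l₁ l₂ x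
    obtain ⟨g', hg', hle'⟩ := exists_mixture_coins (μ := 1 / σ) (l := Real.log (Phi (Δ / σ)))
      (Real.log_nonpos (Phi_nonneg _) (Phi_le_one _)) (T i) ((T i).leafOf_mem x) (hn i)
      (κ := fun u => gaussianSparseThreshold σ τ Δ ((T i).count (l₁ ++ l₂) u))
      (κ' := fun u => gaussianSparseThreshold σ τ Δ ((T i).count (l₁ ++ x :: l₂) u))
      (b := fun j => if τ - Δ - 1 < ((T i).count (l₁ ++ l₂) (((T i).leafOf x).take j) : ℝ) then
        some ((τ - ((T i).count (l₁ ++ l₂) (((T i).leafOf x).take j) : ℝ)) / σ) else none)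
      (fun u hu => by rw [hcount, if_neg hu, add_zero])
      (fun j _ => by
        rw [hcount, if_pos (List.take_prefix _ _)]
        exact testPair_gaussianSparseThreshold τ Δ hσ _)
      (fun j j' hj _ h => by
        have hmono : ((T i).count (l₁ ++ l₂) (((T i).leafOf x).take j') : ℝ) ≤
            (T i).count (l₁ ++ l₂) (((T i).leafOf x).take j) := by
          exact_mod_cast (T i).count_le_of_prefix _ (List.take_prefix_take_left hj)
        by_cases h' : τ - Δ - 1 < ((T i).count (l₁ ++ l₂) (((T i).leafOf x).take j') : ℝ)
        · rw [if_pos (h'.trans_le hmono)]; rfl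
        · rw [if_neg h'] at h; simp at h) hg
    refine ⟨g', by rw [List.length_cons, add_mul, one_mul]; exact hg', fun S v => ?_⟩
    rw [sampleAll_cons, sampleAll_cons, toOuterMeasure_bind_eq_expect,
      toOuterMeasure_bind_eq_expect, markHeavyHitters_eq_coins, markHeavyHitters_eq_coins,
      expect_bind, expect_bind]
    simp only [expect_pure]
    exact hle' _ _ (fun M v => hle (Function.update S i M) v) v

theorem toOuterMeasure_add_compl {β : Type*} (p : PMF β) (s : Set β) :
    p.toOuterMeasure s + p.toOuterMeasure sᶜ = 1 := by
  classical
  rw [PMF.toOuterMeasure_apply, PMF.toOuterMeasure_apply, ← ENNReal.tsum_add]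
  rw [← p.tsum_coe]
  refine tsum_congr fun b => ?_
  by_cases hb : b ∈ s
  · rw [Set.indicator_of_mem hb, Set.indicator_of_notMem (by simpa using hb), add_zero]
  · rw [Set.indicator_of_notMem hb, Set.indicator_of_mem (by simpa using hb), zero_add]

/-- The testing problem in one order, at `v = ε`, gives the inequality for an added record, and at
`v = -ε`, after multiplication by `e^ε`, the one for a removed record. -/
theorem buildForest_isDP (k h : ℕ) (T : Fin k → DataTree X) (σ τ Δ ε δ : ℝ)
    (hh : ∀ i, (T i).height ≤ h) (hσ : 0 < σ) (hε : 0 ≤ ε)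
    (hδ : DeltaCondition σ Δ ε δ (k * (1 + Nat.log 2 h))) :
    IsDP (buildForest σ τ Δ T) ε δ := by
  set n := 1 + Nat.log 2 h with hn
  have hheight : ∀ i, (T i).height < 2 ^ n := fun i => by
    have h1 : h < 2 ^ (Nat.log 2 h + 1) := Nat.lt_pow_succ_log_self (by norm_num) h
    rw [hn, add_comm]
    exact (hh i).trans_lt h1
  have hp0 : 0 < Phi (Δ / σ) := Phi_pos _
  have hp1 : Phi (Δ / σ) ≤ 1 := Phi_le_one _
  obtain ⟨hδ0, hδ1, hδ2⟩ := hδ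
  have hexp : ∀ j : ℕ, j ≤ k * n → Real.exp (gammaTerm σ Δ (k * n) j) =
      Phi (Δ / σ) ^ (k * n - j) := fun j hj => by
    rw [gammaTerm, ← Nat.cast_sub hj, Real.exp_nat_mul, Real.exp_log hp0]
  have hmain : ∀ (l₁ l₂ : List X) (x : X) (A B : Set (Fin k → Marking)),
      (∀ S, S ∈ A ∨ S ∈ B) → ∀ v, ∃ j ≤ k * n,
        testError (amp (1 / σ) j) (v + gammaTerm σ Δ (k * n) j) ≤
          (buildForest σ τ Δ T (l₁ ++ l₂)).toOuterMeasure A + ENNReal.ofReal (Real.exp v) *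
            (buildForest σ τ Δ T (l₁ ++ x :: l₂)).toOuterMeasure B := by
    intro l₁ l₂ x A B hAB v
    obtain ⟨g, hg, hle⟩ := exists_mixture_sampleAll (τ := τ) (Δ := Δ) hσ T l₁ l₂ x hheight A B hAB
      (List.finRange k)
    rw [List.length_finRange] at hg
    obtain ⟨j, hj, hjle⟩ := hg.exists_testError_le (by positivity) v
    refine ⟨j, hj, le_trans (le_of_eq ?_) (hjle.trans (hle _ v))⟩
    rw [gammaTerm]
  have hzero : ∀ v, testError (amp (1 / σ) 0) v = ENNReal.ofReal (min 1 (Real.exp v)) := fun v => by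
    rw [amp_zero, testError, gaussStep_zero]
  -- adding a record
  have hadd : ∀ (l₁ l₂ : List X) (x : X) (A B : Set (Fin k → Marking)), (∀ S, S ∈ A ∨ S ∈ B) →
      ENNReal.ofReal (1 - δ) ≤ (buildForest σ τ Δ T (l₁ ++ l₂)).toOuterMeasure A +
        ENNReal.ofReal (Real.exp ε) *
          (buildForest σ τ Δ T (l₁ ++ x :: l₂)).toOuterMeasure B := by
    intro l₁ l₂ x A B hAB
    obtain ⟨j, hj, hle⟩ := hmain l₁ l₂ x A B hAB ε
    refine le_trans ?_ hle
    rcases Nat.eq_zero_or_pos j with rfl | hjpos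
    · rw [hzero, Real.exp_add, hexp 0 hj]
      refine ENNReal.ofReal_le_ofReal (le_min ?_ ?_)
      · have : Phi (Δ / σ) ^ (k * n) ≤ 1 := pow_le_one₀ hp0.le hp1
        linarith
      · have := le_mul_of_one_le_left (pow_pos hp0 (k * n)).le (Real.one_le_exp hε)
        simp only [Nat.sub_zero]
        linarith
    · rw [testError_amp_eq hσ hjpos]
      refine ENNReal.ofReal_le_ofReal ?_
      have := hδ2 j (Finset.mem_Icc.2 ⟨hjpos, hj⟩)
      linarith
  -- removing a record
  have hrem : ∀ (l₁ l₂ : List X) (x : X) (A B : Set (Fin k → Marking)), (∀ S, S ∈ A ∨ S ∈ B) →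
      ENNReal.ofReal (1 - δ) ≤ ENNReal.ofReal (Real.exp ε) *
          (buildForest σ τ Δ T (l₁ ++ l₂)).toOuterMeasure A +
        (buildForest σ τ Δ T (l₁ ++ x :: l₂)).toOuterMeasure B := by
    intro l₁ l₂ x A B hAB
    obtain ⟨j, hj, hle⟩ := hmain l₁ l₂ x A B hAB (-ε)
    have hee : ENNReal.ofReal (Real.exp ε) * ENNReal.ofReal (Real.exp (-ε)) = 1 := by
      rw [← ENNReal.ofReal_mul (Real.exp_nonneg _), ← Real.exp_add]; simp
    have hle' := mul_le_mul_right hle (ENNReal.ofReal (Real.exp ε))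
    rw [mul_add (ENNReal.ofReal _), ← mul_assoc, hee, one_mul] at hle'
    refine le_trans ?_ hle'
    rcases Nat.eq_zero_or_pos j with rfl | hjpos
    · rw [hzero, ← ENNReal.ofReal_mul (Real.exp_nonneg _)]
      refine ENNReal.ofReal_le_ofReal ?_
      rw [mul_min_of_nonneg _ _ (Real.exp_nonneg _), ← Real.exp_add, mul_one,
        add_neg_cancel_left, hexp 0 hj]
      refine le_min ?_ (by simp only [Nat.sub_zero]; linarith)
      have h1 : Phi (Δ / σ) ^ (k * n) ≤ 1 := pow_le_one₀ hp0.le hp1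
      have h2 := Real.one_le_exp hε
      linarith
    · rw [testError_amp_eq hσ hjpos, ← ENNReal.ofReal_mul (Real.exp_nonneg _)]
      refine ENNReal.ofReal_le_ofReal ?_
      have h1 := gaussianProfile_neg σ j (-ε + gammaTerm σ Δ (k * n) j)
      rw [← h1, ← mul_assoc, ← Real.exp_add, add_neg_cancel_left, hexp j hj,
        show -(-ε + gammaTerm σ Δ (k * n) j) = ε - gammaTerm σ Δ (k * n) j by ring]
      have := hδ1 j (Finset.mem_Icc.2 ⟨hjpos, hj⟩)
      linarith
  have hfinish : ∀ a b c : ENNReal, b + c = 1 → ENNReal.ofReal (1 - δ) ≤ a + c →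
      b ≤ a + ENNReal.ofReal δ := by
    intro a b c hbc h
    have hc : c ≠ ⊤ := fun hc => by rw [hc] at hbc; simp at hbc
    have h1 : (1 : ENNReal) ≤ ENNReal.ofReal (1 - δ) + ENNReal.ofReal δ := by
      rw [← ENNReal.ofReal_one]
      refine le_trans (ENNReal.ofReal_le_ofReal ?_) ENNReal.ofReal_add_le
      linarith
    have h2 : b + c ≤ a + ENNReal.ofReal δ + c := by
      rw [hbc]
      refine h1.trans ((add_le_add_left h _).trans (le_of_eq (by ring)))
    exact (ENNReal.add_le_add_iff_right hc).1 h2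
  rintro D D' ⟨l₁, l₂, x, ⟨rfl, rfl⟩ | ⟨rfl, rfl⟩⟩ S
  · refine hfinish _ _ _ (toOuterMeasure_add_compl _ S) ?_
    rw [add_comm]
    exact hadd l₁ l₂ x Sᶜ S fun M => (em (M ∈ S)).symm
  · refine hfinish _ _ _ (toOuterMeasure_add_compl _ S) ?_
    exact hrem l₁ l₂ x S Sᶜ fun M => em (M ∈ S)

end

section

/-! ### Reasoning about the random access machine -/

/-- The output of a configuration as a set. -/
def outSet (c : RamConfig) : Set (ℕ × ℕ) := {p | p ∈ c.out}

/-- Only cells below `S` are in use, and they hold numbers below `V`. -/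
def MemOk (S V : ℕ) (m : ℕ → ℕ) : Prop := ∀ a, (m a ≠ 0 → a < S) ∧ m a < V

/-- From the configuration `c` the machine halts within `T` steps, its output set then has
distribution `ν`, and the memory bounds are never violated. -/
structure Good (check : ℕ → PMF Bool) (I : RamInput) (S V : ℕ) (T : ℕ) (ν : PMF (Set (ℕ × ℕ)))
    (c : RamConfig) : Prop where
  law : ∀ t, T ≤ t → (ramRun check I t c).map outSet = ν
  halt : ∀ t, T ≤ t → ∀ c' ∈ (ramRun check I t c).support, c'.todo = []
  ok : ∀ t, ∀ c' ∈ (ramRun check I t c).support, MemOk S V c'.mem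

variable {check : ℕ → PMF Bool} {I : RamInput} {S V T : ℕ} {ν : PMF (Set (ℕ × ℕ))}

theorem ramRun_halted (m : ℕ → ℕ) (o : List (ℕ × ℕ)) (t : ℕ) :
    ramRun check I t ⟨[], m, o⟩ = PMF.pure ⟨[], m, o⟩ := by
  induction t with
  | zero => rfl
  | succ t ih => rw [ramRun, ramStep, PMF.pure_bind, ih]

theorem Good.mono {c : RamConfig} (h : Good check I S V T ν c) {T' : ℕ} (hT : T ≤ T') :
    Good check I S V T' ν c :=
  ⟨fun t ht => h.law t (hT.trans ht), fun t ht => h.halt t (hT.trans ht), h.ok⟩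

theorem Good.memOk {c : RamConfig} (h : Good check I S V T ν c) : MemOk S V c.mem :=
  h.ok 0 c (by simp [ramRun])

theorem Good.of_halted {m : ℕ → ℕ} {o : List (ℕ × ℕ)} (hm : MemOk S V m) :
    Good check I S V 0 (PMF.pure {p | p ∈ o}) ⟨[], m, o⟩ where
  law t _ := by rw [ramRun_halted, PMF.pure_map]; rfl
  halt t _ c' hc' := by
    rw [ramRun_halted, PMF.mem_support_pure_iff] at hc'
    rw [hc']
  ok t c' hc' := by
    rw [ramRun_halted, PMF.mem_support_pure_iff] at hc'
    rw [hc']; exact hm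

/-- One random step. -/
theorem Good.of_step_bind {c : RamConfig} {p : PMF Bool} {f : Bool → RamConfig}
    {ν : Bool → PMF (Set (ℕ × ℕ))} (hm : MemOk S V c.mem)
    (hstep : ramStep check I c = p.bind fun b => PMF.pure (f b))
    (h : ∀ b ∈ p.support, Good check I S V T (ν b) (f b)) :
    Good check I S V (T + 1) (p.bind ν) c := by
  have hrun : ∀ t, ramRun check I (t + 1) c = p.bind fun b => ramRun check I t (f b) := fun t => by
    rw [ramRun, hstep, PMF.bind_bind]
    simp only [PMF.pure_bind]
  refine ⟨fun t ht => ?_, fun t ht => ?_, fun t => ?_⟩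
  · obtain ⟨t, rfl⟩ : ∃ t', t = t' + 1 := ⟨t - 1, by omega⟩
    rw [hrun, PMF.map_bind]
    ext s
    rw [PMF.bind_apply, PMF.bind_apply]
    refine tsum_congr fun b => ?_
    by_cases hb : p b = 0
    · rw [hb, zero_mul, zero_mul]
    · rw [(h b hb).law t (by omega)]
  · obtain ⟨t, rfl⟩ : ∃ t', t = t' + 1 := ⟨t - 1, by omega⟩
    rw [hrun]
    intro c' hc'
    obtain ⟨b, hb, hc'⟩ := (PMF.mem_support_bind_iff _ _ _).1 hc'
    exact (h b hb).halt t (by omega) c' hc'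
  · intro c' hc'
    rcases t with _ | t
    · rw [ramRun, PMF.mem_support_pure_iff] at hc'
      rw [hc']; exact hm
    · rw [hrun] at hc'
      obtain ⟨b, hb, hc'⟩ := (PMF.mem_support_bind_iff _ _ _).1 hc'
      exact (h b hb).ok t c' hc'

/-- One deterministic step. -/
theorem Good.of_step {c c' : RamConfig} (hm : MemOk S V c.mem)
    (hstep : ramStep check I c = PMF.pure c') (h : Good check I S V T ν c') :
    Good check I S V (T + 1) ν c := by
  have := Good.of_step_bind (check := check) (I := I) (p := PMF.pure true) (f := fun _ => c')
    (ν := fun _ => ν) hm (by rw [hstep, PMF.pure_bind]) fun _ _ => h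
  rwa [PMF.pure_bind] at this

variable {m : ℕ → ℕ} {o : List (ℕ × ℕ)} {K : List RamProg}

theorem good_seq {p q : RamProg} (h : Good check I S V T ν ⟨p :: q :: K, m, o⟩) :
    Good check I S V (T + 1) ν ⟨.seq p q :: K, m, o⟩ :=
  Good.of_step h.memOk (c := ⟨.seq p q :: K, m, o⟩) rfl h

theorem good_if_pos {e : RamExpr} {p q : RamProg} (he : e.eval I m ≠ 0)
    (h : Good check I S V T ν ⟨p :: K, m, o⟩) :
    Good check I S V (T + 1) ν ⟨.ifElse e p q :: K, m, o⟩ :=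
  Good.of_step h.memOk (c := ⟨.ifElse e p q :: K, m, o⟩) (by rw [ramStep, if_pos he]) h

theorem good_if_neg {e : RamExpr} {p q : RamProg} (he : e.eval I m = 0)
    (h : Good check I S V T ν ⟨q :: K, m, o⟩) :
    Good check I S V (T + 1) ν ⟨.ifElse e p q :: K, m, o⟩ :=
  Good.of_step h.memOk (c := ⟨.ifElse e p q :: K, m, o⟩) (by rw [ramStep, if_neg (not_not.2 he)]) h

theorem good_loop_pos {e : RamExpr} {p : RamProg} (he : e.eval I m ≠ 0)
    (h : Good check I S V T ν ⟨p :: .loop e p :: K, m, o⟩) :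
    Good check I S V (T + 1) ν ⟨.loop e p :: K, m, o⟩ :=
  Good.of_step h.memOk (c := ⟨.loop e p :: K, m, o⟩) (by rw [ramStep, if_pos he]) h

theorem good_loop_neg {e : RamExpr} {p : RamProg} (he : e.eval I m = 0)
    (h : Good check I S V T ν ⟨K, m, o⟩) :
    Good check I S V (T + 1) ν ⟨.loop e p :: K, m, o⟩ :=
  Good.of_step h.memOk (c := ⟨.loop e p :: K, m, o⟩) (by rw [ramStep, if_neg (not_not.2 he)]) h

theorem good_emit {a b : RamExpr} {i j : ℕ} (ha : a.eval I m = i) (hb : b.eval I m = j)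
    (h : Good check I S V T ν ⟨K, m, o ++ [(i, j)]⟩) :
    Good check I S V (T + 1) ν ⟨.emit a b :: K, m, o⟩ :=
  Good.of_step h.memOk (c := ⟨.emit a b :: K, m, o⟩) (by rw [ramStep, ha, hb]) h

/-- `p` is a program without random choices that leads from states satisfying `P` to states
satisfying `Q` in at most `c` steps. -/
def Triple (check : ℕ → PMF Bool) (I : RamInput) (S V : ℕ) (p : RamProg)
    (P Q : (ℕ → ℕ) → List (ℕ × ℕ) → Prop) (c : ℕ) : Prop :=
  ∀ m o, P m o → ∀ K T ν, (∀ m' o', Q m' o' → Good check I S V T ν ⟨K, m', o'⟩) →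
    Good check I S V (T + c) ν ⟨p :: K, m, o⟩

theorem Triple.mono {p : RamProg} {P Q P' Q' : (ℕ → ℕ) → List (ℕ × ℕ) → Prop} {c c' : ℕ}
    (h : Triple check I S V p P Q c) (hP : ∀ m o, P' m o → P m o) (hQ : ∀ m o, Q m o → Q' m o)
    (hc : c ≤ c') : Triple check I S V p P' Q' c' := fun m o hm K T ν hK =>
  (h m o (hP m o hm) K T ν fun m' o' hm' => hK m' o' (hQ m' o' hm')).mono (by omega)

theorem Triple.ifElse {e : RamExpr} {p q : RamProg} {P Q : (ℕ → ℕ) → List (ℕ × ℕ) → Prop} {c : ℕ}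
    (hp : Triple check I S V p (fun m o => P m o ∧ e.eval I m ≠ 0) Q c)
    (hq : Triple check I S V q (fun m o => P m o ∧ e.eval I m = 0) Q c) :
    Triple check I S V (.ifElse e p q) P Q (c + 1) := by
  intro m o hm K T ν h
  by_cases he : e.eval I m = 0
  · have h1 := hq m o ⟨hm, he⟩ K T ν h
    exact good_if_neg he h1
  · have h1 := hp m o ⟨hm, he⟩ K T ν h
    exact good_if_pos he h1

/-- A loop that is executed `N` times. -/
theorem Triple.loop {e : RamExpr} {p : RamProg} (Inv : ℕ → (ℕ → ℕ) → List (ℕ × ℕ) → Prop) {c : ℕ}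
    (N : ℕ) (hcond : ∀ x ≤ N, ∀ m o, Inv x m o → (e.eval I m ≠ 0 ↔ x < N))
    (hp : ∀ x < N, Triple check I S V p (Inv x) (Inv (x + 1)) c) :
    Triple check I S V (.loop e p) (Inv 0) (Inv N) (N * (c + 1) + 1) := by
  suffices h : ∀ d x, x + d = N →
      Triple check I S V (.loop e p) (Inv x) (Inv N) (d * (c + 1) + 1) by
    exact h N 0 (by omega)
  intro d
  induction d with
  | zero =>
    intro x hx m o hm K T ν h
    have he := hcond x (by omega) m o hm
    have h1 := h m o ((show x = N by omega) ▸ hm)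
    refine (good_loop_neg (not_not.1 (he.not.2 (by omega))) h1).mono (by omega)
  | succ d ih =>
    intro x hx m o hm K T ν h
    have he := hcond x (by omega) m o hm
    have h1 := hp x (by omega) m o hm (.loop e p :: K) (T + (d * (c + 1) + 1)) ν
      fun m' o' hm' => ih (x + 1) (by omega) m' o' hm' K T ν h
    refine (good_loop_pos (he.2 (by omega)) h1).mono ?_
    rw [Nat.succ_mul]; omega

/-! ### Memory layout -/

/-- The part of the memory that is used for one tree: a table with `rows` rows and `W` columns,
whose entries have eight fields.  The registers are the cells below `16`: `0` the tree, `1` the base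
address, `2` the height, `3` the number of columns, `4` the point (counted from `1`), `5` the level,
`6` the row of the current node, `7` a child index, `8` a position in the table or the number of an
interval of levels, `9` and `10` that interval, `11` a node label, `15` scratch.  The
fields of an entry are `0` the row that represents the node of the point, `1` and `2` the rows of
the children, `3` the count, `4` the coin, and `5` the mark.  Row `0` represents no node; its
fields `6` and `7` hold the intervals of levels. -/
structure Shape where
  base : ℕ
  W : ℕ
  rows : ℕ

/-- The address of a field of an entry of the table. -/
def Shape.cell (sh : Shape) (f r l : ℕ) : ℕ := sh.base + (8 * (r * sh.W + l) + f)

theorem Shape.cell_inj {sh : Shape} {f r l f' r' l' : ℕ} (hf : f < 8) (hf' : f' < 8)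
    (hl : l < sh.W) (hl' : l' < sh.W) (h : sh.cell f r l = sh.cell f' r' l') :
    f = f' ∧ r = r' ∧ l = l' := by
  unfold cell at h
  have h1 : r * sh.W + l = r' * sh.W + l' := by omega
  have h2 : f = f' := by omega
  have hW : 0 < sh.W := by omega
  have hr : r = r' := by
    have := congrArg (· / sh.W) h1
    simpa [Nat.add_div_of_dvd_right, Nat.mul_div_cancel _ hW, Nat.div_eq_of_lt hl,
      Nat.div_eq_of_lt hl', Nat.mul_add_div, mul_comm _ sh.W, Nat.mul_add_div hW] using this
  subst hr
  exact ⟨h2, rfl, by omega⟩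

theorem Shape.cell_lt {sh : Shape} {f r l : ℕ} (hf : f < 8) (hr : r < sh.rows) (hl : l < sh.W) :
    sh.cell f r l < sh.base + 8 * (sh.rows * sh.W) := by
  have : r * sh.W + l + 1 ≤ sh.rows * sh.W := by
    calc r * sh.W + l + 1 ≤ r * sh.W + sh.W := by omega
      _ = (r + 1) * sh.W := by ring
      _ ≤ _ := Nat.mul_le_mul_right _ hr
  unfold cell; omega

/-- Replace one entry. -/
def setF (F : ℕ → ℕ → ℕ → ℕ) (f r l v : ℕ) : ℕ → ℕ → ℕ → ℕ :=
  fun f' r' l' => if f' = f ∧ r' = r ∧ l' = l then v else F f' r' l'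

/-- The registers hold `R`, the table holds `F`, and the memory behind the table is untouched. -/
structure Holds (S V : ℕ) (sh : Shape) (R : ℕ → ℕ) (F : ℕ → ℕ → ℕ → ℕ) (m : ℕ → ℕ) : Prop where
  reg : ∀ a < 16, m a = R a
  cells : ∀ f < 8, ∀ r < sh.rows, ∀ l < sh.W, m (sh.cell f r l) = F f r l
  fresh : ∀ a, sh.base + 8 * (sh.rows * sh.W) ≤ a → m a = 0
  ok : MemOk S V m
  base_le : 16 ≤ sh.base
  end_le : sh.base + 8 * (sh.rows * sh.W) ≤ S
  reg_base : R 1 = sh.base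
  reg_W : R 3 = sh.W

theorem MemOk.update {m : ℕ → ℕ} (h : MemOk S V m) {a v : ℕ} (ha : a < S) (hv : v < V) :
    MemOk S V (Function.update m a v) := fun b => by
  by_cases hb : b = a
  · subst hb; rw [Function.update_self]; exact ⟨fun _ => ha, hv⟩
  · rw [Function.update_of_ne hb]; exact h b

variable {sh : Shape} {R : ℕ → ℕ} {F : ℕ → ℕ → ℕ → ℕ}

theorem Holds.set_reg (h : Holds S V sh R F m) {a v : ℕ} (ha : a < 16) (h1 : a ≠ 1) (h3 : a ≠ 3)
    (hv : v < V) : Holds S V sh (Function.update R a v) F (Function.update m a v) where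
  reg b hb := by
    by_cases hba : b = a
    · subst hba; simp
    · rw [Function.update_of_ne hba, Function.update_of_ne hba, h.reg b hb]
  cells f hf r hr l hl := by
    rw [Function.update_of_ne, h.cells f hf r hr l hl]
    have := h.base_le
    unfold Shape.cell; omega
  fresh b hb := by
    have := h.base_le
    rw [Function.update_of_ne (by omega), h.fresh b hb]
  ok := h.ok.update (by have := h.base_le; have := h.end_le; omega) hv
  base_le := h.base_le
  end_le := h.end_le
  reg_base := by rw [Function.update_of_ne h1.symm, h.reg_base]
  reg_W := by rw [Function.update_of_ne h3.symm, h.reg_W]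

theorem Holds.set_cell (h : Holds S V sh R F m) {f r l v : ℕ} (hf : f < 8) (hr : r < sh.rows)
    (hl : l < sh.W) (hv : v < V) :
    Holds S V sh R (setF F f r l v) (Function.update m (sh.cell f r l) v) where
  reg b hb := by
    have := h.base_le
    rw [Function.update_of_ne, h.reg b hb]
    unfold Shape.cell; omega
  cells f' hf' r' hr' l' hl' := by
    unfold setF
    split_ifs with heq
    · obtain ⟨rfl, rfl, rfl⟩ := heq; simp
    · rw [Function.update_of_ne, h.cells f' hf' r' hr' l' hl']
      intro hc
      exact heq (Shape.cell_inj hf' hf hl' hl hc)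
  fresh b hb := by
    have := Shape.cell_lt hf hr hl
    rw [Function.update_of_ne (by omega), h.fresh b hb]
  ok := h.ok.update ((Shape.cell_lt hf hr hl).trans_le h.end_le) hv
  base_le := h.base_le
  end_le := h.end_le
  reg_base := h.reg_base
  reg_W := h.reg_W

/-- The content of a register. -/
abbrev rg (a : ℕ) : RamExpr := .mem (.lit a)

/-- The address of a field of an entry of the table. -/
def cellE (f r l : RamExpr) : RamExpr :=
  .add (rg 1) (.add (.mul (.lit 8) (.add (.mul r (rg 3)) l)) f)

theorem Holds.eval_rg (h : Holds S V sh R F m) {a : ℕ} (ha : a < 16) : (rg a).eval I m = R a :=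
  h.reg a ha

theorem Holds.eval_cellE (h : Holds S V sh R F m) (f r l : RamExpr) :
    (cellE f r l).eval I m = sh.cell (f.eval I m) (r.eval I m) (l.eval I m) := by
  simp only [cellE, RamExpr.eval, h.reg 1 (by norm_num), h.reg 3 (by norm_num), h.reg_base, h.reg_W,
    Shape.cell]

theorem Holds.eval_mem (h : Holds S V sh R F m) {ef er el : RamExpr} {f r l : ℕ}
    (hf : ef.eval I m = f) (hr : er.eval I m = r) (hl : el.eval I m = l) (hf8 : f < 8)
    (hr' : r < sh.rows) (hl' : l < sh.W) : (RamExpr.mem (cellE ef er el)).eval I m = F f r l := by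
  rw [RamExpr.eval, h.eval_cellE, hf, hr, hl, h.cells f hf8 r hr' l hl']

/-- A step that writes to a register. -/
theorem good_reg (h : Holds S V sh R F m) {a v : ℕ} {e : RamExpr} (ha : a < 16) (h1 : a ≠ 1)
    (h3 : a ≠ 3) (he : e.eval I m = v) (hv : v < V)
    (hK : ∀ m', Holds S V sh (Function.update R a v) F m' → Good check I S V T ν ⟨K, m', o⟩) :
    Good check I S V (T + 1) ν ⟨.store (.lit a) e :: K, m, o⟩ :=
  Good.of_step h.ok (by simp only [ramStep, RamExpr.eval, he]) (hK _ (h.set_reg ha h1 h3 hv))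

/-- A step that writes to the table. -/
theorem good_cell (h : Holds S V sh R F m) {ef er el e : RamExpr} {f r l v : ℕ}
    (hf : ef.eval I m = f) (hr : er.eval I m = r) (hl : el.eval I m = l) (hf8 : f < 8)
    (hr' : r < sh.rows) (hl' : l < sh.W) (he : e.eval I m = v) (hv : v < V)
    (hK : ∀ m', Holds S V sh R (setF F f r l v) m' → Good check I S V T ν ⟨K, m', o⟩) :
    Good check I S V (T + 1) ν ⟨.store (cellE ef er el) e :: K, m, o⟩ :=
  Good.of_step h.ok (by simp only [ramStep, h.eval_cellE, hf, hr, hl, he])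
    (hK _ (h.set_cell hf8 hr' hl' hv))

/-- Execute several programs in a row. -/
def progs : List RamProg → RamProg
  | [] => .store (.lit 15) (.lit 0)
  | [p] => p
  | p :: q :: l => .seq p (progs (q :: l))

/-- A program without effect. -/
def skip : RamProg := .store (.lit 15) (.lit 0)

end

section

/-! ### The trie of the paths of all data points -/

/-- What the machine reads at level `l` of the path `p`: `0` at its end, and otherwise one more
than the next child index. -/
def pathBranch (p : List ℕ) (l : ℕ) : ℕ :=
  match p[l]? with
  | none => 0
  | some c => c + 1

theorem pathBranch_ne_zero {p : List ℕ} {l : ℕ} : pathBranch p l ≠ 0 ↔ l < p.length := by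
  unfold pathBranch
  by_cases h : l < p.length
  · rw [List.getElem?_eq_getElem h]; simp [h]
  · rw [List.getElem?_eq_none (not_lt.1 h)]; simp [h]

theorem take_succ_eq_iff {p q : List ℕ} {l : ℕ} (hp : l < p.length) :
    (l + 1 ≤ q.length ∧ q.take (l + 1) = p.take (l + 1)) ↔
      (l ≤ q.length ∧ q.take l = p.take l) ∧ pathBranch q l = pathBranch p l := by
  constructor
  · rintro ⟨h1, h2⟩
    have h3 : q[l]? = p[l]? := by
      have := congrArg (fun s => s[l]?) h2
      simpa [List.getElem?_take] using this
    refine ⟨⟨by omega, ?_⟩, by unfold pathBranch; rw [h3]⟩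
    have := congrArg (List.take l) h2
    simpa [List.take_take] using this
  · rintro ⟨⟨_, h2⟩, h3⟩
    have hq : l < q.length := pathBranch_ne_zero.1 (h3 ▸ pathBranch_ne_zero.2 hp)
    refine ⟨hq, ?_⟩
    unfold pathBranch at h3
    rw [List.getElem?_eq_getElem hp, List.getElem?_eq_getElem hq] at h3
    rw [← List.take_append_getElem hq, ← List.take_append_getElem hp, h2]
    simp only [Nat.add_right_cancel_iff] at h3
    rw [h3]

/-- The first of the paths `pth 1, pth 2, …` that passes through the node at level `l` of the
path `pth x`; it represents that node.  The value is `0` if there is no such node. -/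
def rep (pth : ℕ → List ℕ) (x l : ℕ) : ℕ := by
  classical
  exact if l ≤ (pth x).length then
    sInf {y | 1 ≤ y ∧ l ≤ (pth y).length ∧ (pth y).take l = (pth x).take l} else 0

variable {pth : ℕ → List ℕ}

theorem rep_of_lt {x l : ℕ} (h : (pth x).length < l) : rep pth x l = 0 := by
  rw [rep, if_neg (by omega)]

theorem rep_spec {x l : ℕ} (hx : 1 ≤ x) (hl : l ≤ (pth x).length) :
    1 ≤ rep pth x l ∧ rep pth x l ≤ x ∧ l ≤ (pth (rep pth x l)).length ∧
      (pth (rep pth x l)).take l = (pth x).take l := by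
  rw [rep, if_pos hl]
  have hmem : x ∈ {y | 1 ≤ y ∧ l ≤ (pth y).length ∧ (pth y).take l = (pth x).take l} :=
    ⟨hx, hl, rfl⟩
  have h := Nat.sInf_mem ⟨x, hmem⟩
  exact ⟨h.1, Nat.sInf_le hmem, h.2.1, h.2.2⟩

theorem rep_le {x l : ℕ} (hx : 1 ≤ x) : rep pth x l ≤ x := by
  by_cases hl : l ≤ (pth x).length
  · exact (rep_spec hx hl).2.1
  · rw [rep_of_lt (not_le.1 hl)]; omega

theorem rep_ne_zero {x l : ℕ} (hx : 1 ≤ x) : rep pth x l ≠ 0 ↔ l ≤ (pth x).length := by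
  constructor
  · intro h
    by_contra hl
    exact h (rep_of_lt (not_le.1 hl))
  · intro h
    have := (rep_spec hx h).1
    omega

theorem rep_eq_rep_iff {x y l : ℕ} (hx : 1 ≤ x) (hy : 1 ≤ y) (hl : l ≤ (pth x).length) :
    rep pth y l = rep pth x l ↔ l ≤ (pth y).length ∧ (pth y).take l = (pth x).take l := by
  constructor
  · intro h
    have hyl : l ≤ (pth y).length := (rep_ne_zero hy).1 (h ▸ (rep_ne_zero hx).2 hl)
    refine ⟨hyl, ?_⟩
    rw [← (rep_spec hy hyl).2.2.2, h, (rep_spec hx hl).2.2.2]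
  · rintro ⟨hyl, h⟩
    rw [rep, rep, if_pos hyl, if_pos hl, h]

theorem rep_zero {x : ℕ} (hx : 1 ≤ x) : rep pth x 0 = 1 := by
  have h1 := rep_spec (pth := pth) hx (Nat.zero_le _)
  have h2 := (rep_eq_rep_iff (pth := pth) (x := x) (y := 1) hx le_rfl (Nat.zero_le _)).2
    ⟨Nat.zero_le _, by simp⟩
  have h3 := rep_le (pth := pth) (x := 1) (l := 0) le_rfl
  omega

/-- Number of the paths `pth 1, …, pth M` through the node represented by `r` at level `l`. -/
def repCount (pth : ℕ → List ℕ) (M r l : ℕ) : ℕ :=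
  if r = 0 then 0 else ((Finset.Icc 1 M).filter fun y => rep pth y l = r).card

/-- The representative of a child of the node represented by `r` at level `l`, if one of the paths
`pth 1, …, pth M` goes there, and otherwise `0`. -/
def repChild (pth : ℕ → List ℕ) (M r l b : ℕ) : ℕ :=
  sInf {y | 1 ≤ y ∧ y ≤ M ∧ rep pth y l = r ∧ pathBranch (pth y) l = b}

theorem repCount_succ (M r l : ℕ) : repCount pth (M + 1) r l =
    repCount pth M r l + if r ≠ 0 ∧ rep pth (M + 1) l = r then 1 else 0 := by
  unfold repCount
  by_cases hr : r = 0
  · simp [hr]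
  · have hins : Finset.Icc 1 (M + 1) = insert (M + 1) (Finset.Icc 1 M) := by
      ext y; simp only [Finset.mem_insert, Finset.mem_Icc]; omega
    rw [if_neg hr, if_neg hr, hins, Finset.filter_insert]
    by_cases h : rep pth (M + 1) l = r
    · rw [if_pos h, if_pos ⟨hr, h⟩, Finset.card_insert_of_notMem (by simp)]
    · rw [if_neg h, if_neg (fun h' => h h'.2), add_zero]

theorem repChild_zero (r l b : ℕ) : repChild pth 0 r l b = 0 := by
  rw [repChild, Nat.sInf_eq_zero]
  right
  ext y
  simp only [Set.mem_ofPred_eq, Set.mem_empty_iff_false, iff_false]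
  omega

theorem repChild_le (M r l b : ℕ) : repChild pth M r l b ≤ M := by
  rcases Set.eq_empty_or_nonempty
    {y | 1 ≤ y ∧ y ≤ M ∧ rep pth y l = r ∧ pathBranch (pth y) l = b} with h | h
  · rw [repChild, h, Nat.sInf_empty]; omega
  · exact (Nat.sInf_mem h).2.1

theorem repChild_succ (M r l b : ℕ) : repChild pth (M + 1) r l b =
    if repChild pth M r l b ≠ 0 then repChild pth M r l b
    else if rep pth (M + 1) l = r ∧ pathBranch (pth (M + 1)) l = b then M + 1 else 0 := by
  have hsub : ∀ y, (1 ≤ y ∧ y ≤ M ∧ rep pth y l = r ∧ pathBranch (pth y) l = b) →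
      (1 ≤ y ∧ y ≤ M + 1 ∧ rep pth y l = r ∧ pathBranch (pth y) l = b) :=
    fun y hy => ⟨hy.1, by omega, hy.2.2⟩
  rcases Set.eq_empty_or_nonempty
    {y | 1 ≤ y ∧ y ≤ M ∧ rep pth y l = r ∧ pathBranch (pth y) l = b} with h | h
  · have h0 : repChild pth M r l b = 0 := by rw [repChild, h, Nat.sInf_empty]
    rw [h0, if_neg (by simp)]
    have hne : ∀ y, 1 ≤ y → y ≤ M → rep pth y l = r → pathBranch (pth y) l ≠ b :=
      fun y h1 h2 h3 h4 => by
        have : y ∈ (∅ : Set ℕ) := h ▸ ⟨h1, h2, h3, h4⟩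
        exact this
    split_ifs with hc
    · have hmem : M + 1 ∈ {y | 1 ≤ y ∧ y ≤ M + 1 ∧ rep pth y l = r ∧ pathBranch (pth y) l = b} :=
        ⟨by omega, le_rfl, hc⟩
      have h1 := Nat.sInf_mem ⟨_, hmem⟩
      have h2 := Nat.sInf_le hmem
      rw [repChild]
      by_contra hlt
      exact hne _ h1.1 (by omega) h1.2.2.1 h1.2.2.2
    · rw [repChild, Nat.sInf_eq_zero]
      right
      ext y
      simp only [Set.mem_ofPred_eq, Set.mem_empty_iff_false, iff_false]
      rintro ⟨h1, h2, h3, h4⟩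
      rcases Nat.lt_or_ge M y with hy | hy
      · obtain rfl : y = M + 1 := by omega
        exact hc ⟨h3, h4⟩
      · exact hne y h1 hy h3 h4
  · have h1 := Nat.sInf_mem h
    have hne : repChild pth M r l b ≠ 0 := by
      have := h1.1
      unfold repChild; omega
    rw [if_pos hne]
    refine le_antisymm (Nat.sInf_le (hsub _ h1)) ?_
    have h2 := Nat.sInf_mem (Set.Nonempty.mono (fun y => hsub y) h)
    rcases Nat.lt_or_ge M (repChild pth (M + 1) r l b) with hy | hy
    · exact (repChild_le M r l b).trans hy.le
    · exact Nat.sInf_le ⟨h2.1, hy, h2.2.2⟩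

/-- The child of the node at level `l` in the direction of the path `pth x`. -/
theorem repChild_self {x l : ℕ} (hx : 1 ≤ x) (hl : l < (pth x).length) :
    repChild pth x (rep pth x l) l (pathBranch (pth x) l) = rep pth x (l + 1) := by
  have hiff : ∀ y, 1 ≤ y → ((rep pth y l = rep pth x l ∧
      pathBranch (pth y) l = pathBranch (pth x) l) ↔
      (l + 1 ≤ (pth y).length ∧ (pth y).take (l + 1) = (pth x).take (l + 1))) := fun y hy => by
    rw [take_succ_eq_iff hl, rep_eq_rep_iff hx hy hl.le]
  have hrep := rep_spec (pth := pth) hx (Nat.succ_le_of_lt hl)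
  have h1 := (hiff _ hrep.1).2 ⟨hrep.2.2.1, hrep.2.2.2⟩
  refine le_antisymm (Nat.sInf_le ⟨hrep.1, hrep.2.1, h1⟩) ?_
  have hmem : rep pth x (l + 1) ∈ {y | 1 ≤ y ∧ y ≤ x ∧ rep pth y l = rep pth x l ∧
    pathBranch (pth y) l = pathBranch (pth x) l} := ⟨hrep.1, hrep.2.1, h1⟩
  have h2 := Nat.sInf_mem ⟨_, hmem⟩
  have h3 := (hiff _ h2.1).1 h2.2.2
  rw [rep, if_pos (Nat.succ_le_of_lt hl)]
  exact Nat.sInf_le ⟨h2.1, h3⟩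

/-- The table while the trie is being built: at level `l` the first `M l` paths have been counted,
and the edges below level `l` have been entered for the first `M' l` paths.  The fields are:
`0` the representative, `1` and `2` the children, `3` the count. -/
def trieF (pth : ℕ → List ℕ) (M M' : ℕ → ℕ) : ℕ → ℕ → ℕ → ℕ := fun f r l =>
  if f = 0 then (if 1 ≤ r ∧ r ≤ M l then rep pth r l else 0)
  else if f = 1 ∨ f = 2 then repChild pth (M' l) r l f
  else if f = 3 then repCount pth (M l) r l
  else 0

theorem trieF_zero : trieF pth (fun _ => 0) (fun _ => 0) = fun _ _ _ => 0 := by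
  funext f r l
  unfold trieF
  simp only [repChild_zero, repCount]
  simp
  intros; omega

/-- The effect of visiting a node on the table. -/
theorem trieF_visit {M M' : ℕ → ℕ} {J l : ℕ} (hM : M l = J) (hl : l ≤ (pth (J + 1)).length) :
    setF (setF (trieF pth M M') 0 (J + 1) l (rep pth (J + 1) l)) 3 (rep pth (J + 1) l) l
      (repCount pth J (rep pth (J + 1) l) l + 1) =
    trieF pth (Function.update M l (J + 1)) M' := by
  have hrep := (rep_ne_zero (pth := pth) (x := J + 1) (l := l) (by omega)).2 hl
  funext f r l'
  unfold setF trieF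
  by_cases hl' : l' = l
  · subst hl'
    rw [Function.update_self, hM]
    by_cases hf : f = 0
    · subst hf
      by_cases hr : r = J + 1
      · subst hr; simp
      · have : r ≤ J ↔ r ≤ J + 1 := by omega
        simp [hr, this]
    · by_cases hf3 : f = 3
      · subst hf3
        rw [repCount_succ]
        by_cases hr : r = rep pth (J + 1) l'
        · rw [← hr] at hrep ⊢; simp [hrep]
        · simp [hr, Ne.symm hr]
      · simp [hf, hf3]
  · rw [Function.update_of_ne hl']
    simp [hl']

/-- The effect of following an edge on the table: the edge gets a new child index if it has none. -/
theorem trieF_child {M M' : ℕ → ℕ} {J l : ℕ} (hM : M' l = J) (hl : l < (pth (J + 1)).length)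
    (hbin : pathBranch (pth (J + 1)) l ≤ 2) :
    setF (trieF pth M M') (pathBranch (pth (J + 1)) l) (rep pth (J + 1) l) l
      (repChild pth J (rep pth (J + 1) l) l (pathBranch (pth (J + 1)) l) +
        (1 - repChild pth J (rep pth (J + 1) l) l (pathBranch (pth (J + 1)) l)) * (J + 1)) =
    trieF pth M (Function.update M' l (J + 1)) := by
  have hb := pathBranch_ne_zero.2 hl
  funext f r l'
  unfold setF trieF
  by_cases hl' : l' = l
  · subst hl'
    rw [Function.update_self, hM]
    by_cases hf : f = pathBranch (pth (J + 1)) l'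
    · rw [← hf] at hb hbin ⊢
      have hf12 : f = 1 ∨ f = 2 := by omega
      simp only [hb, hf12, if_true, if_false, true_and, and_true]
      rw [repChild_succ, ← hf]
      by_cases hr : r = rep pth (J + 1) l'
      · rw [← hr]
        by_cases h0 : repChild pth J r l' f = 0
        · simp [h0]
        · rw [Nat.sub_eq_zero_of_le (by omega)]; simp [h0]
      · simp only [hr, Ne.symm hr, false_and, if_false]
        by_cases h0 : repChild pth J r l' f = 0 <;> simp [h0]
    · simp only [hf, false_and, if_false]
      rw [repChild_succ]
      simp only [Ne.symm hf, and_false, if_false]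
      by_cases h0 : repChild pth J r l' f = 0 <;> simp [h0]
  · rw [Function.update_of_ne hl']
    simp [hl']

/-- A path has no entries beyond its end. -/
theorem trieF_end {J : ℕ} : trieF pth
      (fun l => if l ≤ (pth (J + 1)).length then J + 1 else J)
      (fun l => if l < (pth (J + 1)).length then J + 1 else J) =
    trieF pth (fun _ => J + 1) (fun _ => J + 1) := by
  funext f r l
  unfold trieF
  by_cases hf : f = 0
  · simp only [hf, if_true]
    by_cases hl : l ≤ (pth (J + 1)).length
    · simp only [hl, if_true]
    · simp only [hl, if_false]
      by_cases hr : r = J + 1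
      · subst hr; rw [rep_of_lt (not_le.1 hl)]; simp
      · have : r ≤ J ↔ r ≤ J + 1 := by omega
        simp only [this]
  · simp only [hf, if_false]
    by_cases h12 : f = 1 ∨ f = 2
    · simp only [h12, if_true]
      by_cases h2 : l < (pth (J + 1)).length
      · simp only [h2, if_true]
      · have hb : pathBranch (pth (J + 1)) l ≠ f :=
          fun h => pathBranch_ne_zero.not.2 h2 (by omega)
        simp only [h2, if_false]
        rw [repChild_succ]
        simp only [hb, and_false, if_false]
        by_cases h0 : repChild pth J r l f = 0 <;> simp [h0]
    · simp only [h12, if_false]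
      by_cases h4 : l ≤ (pth (J + 1)).length
      · simp only [h4, if_true]
      · simp only [h4, if_false]
        have h0 : ¬(r ≠ 0 ∧ 0 = r) := fun h => h.1 h.2.symm
        simp only [repCount_succ, rep_of_lt (not_le.1 h4), h0, if_false, add_zero]

/-! ### Building the trie -/

/-- Enter the node represented by register `6` at level (register `5`) of the path of the current
point (register `4`). -/
def visitProg : RamProg := progs
  [.store (cellE (.lit 0) (rg 4) (rg 5)) (rg 6),
   .store (cellE (.lit 3) (rg 6) (rg 5)) (.add (.mem (cellE (.lit 3) (rg 6) (rg 5))) (.lit 1))]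

/-- The next child index on the path of the current point. -/
def branchE : RamExpr := .branch (rg 0) (.sub (rg 4) (.lit 1)) (rg 5)

/-- Descend along one edge. -/
def descendProg : RamProg := progs
  [.store (.lit 7) branchE,
   -- `a + (1 - a) * x` is `a`, or `x` if there is no child `a` yet
   .store (cellE (rg 7) (rg 6) (rg 5)) (.add (.mem (cellE (rg 7) (rg 6) (rg 5)))
     (.mul (.sub (.lit 1) (.mem (cellE (rg 7) (rg 6) (rg 5)))) (rg 4))),
   .store (.lit 6) (.mem (cellE (rg 7) (rg 6) (rg 5))),
   .store (.lit 5) (.add (rg 5) (.lit 1)),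
   visitProg]

/-- Run `p` for all points. -/
def forPoints (p : RamProg) : RamProg := progs
  [.store (.lit 4) (.lit 1),
   .loop (.sub (.add .numPoints (.lit 1)) (rg 4)) (.seq p (.store (.lit 4) (.add (rg 4) (.lit 1))))]

/-- Insert the path of the current point (register `4`) into the trie. -/
def insertProg : RamProg := progs
  [.store (.lit 5) (.lit 0), .store (.lit 6) (.lit 1), visitProg, .loop branchE descendProg]

/-- Build the trie of the paths of all points. -/
def trieProg : RamProg := forPoints insertProg

/-- The data of one tree as the machine sees it. -/
structure TreeInput (I : RamInput) (i H n : ℕ) (pth : ℕ → List ℕ) : Prop where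
  numPoints : I.numPoints = n
  height : I.height i = H
  branch : ∀ x, 1 ≤ x → x ≤ n → ∀ l, I.branch i (x - 1) l = pathBranch (pth x) l
  binary : ∀ x, 1 ≤ x → x ≤ n → ∀ l, pathBranch (pth x) l ≤ 2
  length_lt : ∀ x, 1 ≤ x → x ≤ n → (pth x).length < H

/-- States with table `F` in which the registers satisfy `C`, besides the constants of the tree. -/
def At (S V : ℕ) (sh : Shape) (i H : ℕ) (F : ℕ → ℕ → ℕ → ℕ) (C : (ℕ → ℕ) → Prop)
    (o₀ : List (ℕ × ℕ)) : (ℕ → ℕ) → List (ℕ × ℕ) → Prop :=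
  fun m o => ∃ R, Holds S V sh R F m ∧ R 0 = i ∧ R 2 = H ∧ C R ∧ o = o₀

variable {check : ℕ → PMF Bool} {I : RamInput} {S V T : ℕ} {sh : Shape} {i H n : ℕ}

theorem Holds.rows_lt {R : ℕ → ℕ} {F : ℕ → ℕ → ℕ → ℕ} {m : ℕ → ℕ} (h : Holds S V sh R F m)
    (hW : 0 < sh.W) : sh.rows < S := by
  have h1 := h.base_le
  have h2 := h.end_le
  have h3 : sh.rows ≤ sh.rows * sh.W := Nat.le_mul_of_pos_right _ hW
  omega

theorem Holds.W_lt {R : ℕ → ℕ} {F : ℕ → ℕ → ℕ → ℕ} {m : ℕ → ℕ} (h : Holds S V sh R F m)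
    (hr : 0 < sh.rows) : sh.W < S := by
  have h1 := h.base_le
  have h2 := h.end_le
  have h3 : sh.W ≤ sh.rows * sh.W := Nat.le_mul_of_pos_left _ hr
  omega

/-- A loop over all points. -/
theorem triple_forPoints (hI : I.numPoints = n) (hrows : sh.rows = n + 1) (hW : 0 < sh.W)
    (hSV : S ≤ V) {p : RamProg} (F : ℕ → ℕ → ℕ → ℕ → ℕ) (C : (ℕ → ℕ) → Prop)
    (hC : ∀ R v, C R → C (Function.update R 4 v)) (out : ℕ → List (ℕ × ℕ)) {c : ℕ}
    (hp : ∀ x < n, Triple check I S V p (At S V sh i H (F x) (fun R => C R ∧ R 4 = x + 1) (out x))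
      (At S V sh i H (F (x + 1)) (fun R => C R ∧ R 4 = x + 1) (out (x + 1))) c) :
    Triple check I S V (forPoints p) (At S V sh i H (F 0) C (out 0)) (At S V sh i H (F n) C (out n))
      (n * (c + 3) + 3) := by
  have hloop := Triple.loop (check := check) (I := I) (S := S) (V := V)
    (e := .sub (.add .numPoints (.lit 1)) (rg 4))
    (p := .seq p (.store (.lit 4) (.add (rg 4) (.lit 1))))
    (fun x => At S V sh i H (F x) (fun R => C R ∧ R 4 = x + 1) (out x)) (c := c + 2) n
    (by
      rintro x hx m o ⟨R, hR, _, _, ⟨_, h4⟩, _⟩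
      simp only [RamExpr.eval, hR.reg 4 (by norm_num), h4, hI]
      omega)
    (by
      intro x hx m o hm K T ν hK
      refine (good_seq (T := T + 1 + c) ?_).mono (by omega)
      refine hp x hx m o hm _ (T + 1) ν ?_
      rintro m' o' ⟨R, hR, h0, h2, ⟨hCR, h4⟩, ho⟩
      have := hR.rows_lt hW
      refine good_reg hR (by norm_num) (by norm_num) (by norm_num) (v := x + 1 + 1)
        (by simp only [RamExpr.eval, hR.reg 4 (by norm_num), h4]) (by omega) fun m'' hR' => ?_
      exact hK _ _ ⟨_, hR', by simpa using h0, by simpa using h2, ⟨hC _ _ hCR, by simp⟩, ho⟩)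
  rintro m o ⟨R, hR, h0, h2, hCR, ho⟩ K T ν hK
  have := hR.rows_lt hW
  have hmul : n * (c + 2 + 1) = n * (c + 3) := rfl
  refine (good_seq (T := T + (n * (c + 2 + 1) + 1) + 1) ?_).mono (by omega)
  refine good_reg hR (by norm_num) (by norm_num) (by norm_num) (v := 1)
    (by simp only [RamExpr.eval]) (by omega) fun m' hR' => ?_
  refine hloop m' o ⟨_, hR', by simpa using h0, by simpa using h2, ⟨hC _ _ hCR, by simp⟩, ho⟩
    K T ν ?_
  rintro m'' o' ⟨R', hR'', h0', h2', ⟨hCR', _⟩, ho'⟩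
  exact hK _ _ ⟨R', hR'', h0', h2', hCR', ho'⟩

theorem triple_visit (hI : TreeInput I i H n pth) (hrows : sh.rows = n + 1) (hHW : H ≤ sh.W)
    (hSV : S ≤ V) {J l : ℕ} (hJ : J < n) (hl : l ≤ (pth (J + 1)).length) {M M' : ℕ → ℕ}
    (hM : M l = J) (o₀ : List (ℕ × ℕ)) :
    Triple check I S V visitProg
      (At S V sh i H (trieF pth M M')
        (fun R => R 4 = J + 1 ∧ R 5 = l ∧ R 6 = rep pth (J + 1) l) o₀)
      (At S V sh i H (trieF pth (Function.update M l (J + 1)) M')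
        (fun R => R 4 = J + 1 ∧ R 5 = l ∧ R 6 = rep pth (J + 1) l) o₀) 3 := by
  rintro m o ⟨R, hR, h0, h2, ⟨h4, h5, h6⟩, ho⟩ K T ν hK
  have hlen := hI.length_lt (J + 1) (by omega) (by omega)
  have hrs := hR.rows_lt (by omega)
  have hrep := rep_le (pth := pth) (x := J + 1) (l := l) (by omega)
  have hrep0 := (rep_ne_zero (pth := pth) (x := J + 1) (l := l) (by omega)).2 hl
  refine good_seq ?_
  refine good_cell hR (f := 0) (r := J + 1) (l := l) (v := rep pth (J + 1) l) rfl
    ((hR.eval_rg (by norm_num)).trans h4) ((hR.eval_rg (by norm_num)).trans h5) (by norm_num)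
    (by omega) (by omega) ((hR.eval_rg (by norm_num)).trans h6) (by omega) fun m' hR' => ?_
  have e5 := (hR'.eval_rg (I := I) (a := 5) (by norm_num)).trans h5
  have e6 := (hR'.eval_rg (I := I) (a := 6) (by norm_num)).trans h6
  have hcnt : repCount pth J (rep pth (J + 1) l) l ≤ n := by
    unfold repCount
    split_ifs
    · omega
    · refine (Finset.card_filter_le _ _).trans ?_
      simp; omega
  have hval : (RamExpr.mem (cellE (.lit 3) (rg 6) (rg 5))).eval I m' =
      repCount pth J (rep pth (J + 1) l) l := by
    rw [hR'.eval_mem (f := 3) rfl e6 e5 (by norm_num) (by omega) (by omega)]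
    simp only [setF, trieF, hM]
    simp
  refine good_cell hR' (f := 3) (r := rep pth (J + 1) l) (l := l)
    (v := repCount pth J (rep pth (J + 1) l) l + 1) rfl e6 e5 (by norm_num)
    (by omega) (by omega) (by rw [RamExpr.eval, hval]; rfl) (by omega) fun m'' hR'' => ?_
  rw [trieF_visit hM hl] at hR''
  exact hK _ _ ⟨R, hR'', h0, h2, ⟨h4, h5, h6⟩, ho⟩

theorem eval_branchE (hI : TreeInput I i H n pth) {R : ℕ → ℕ} {F : ℕ → ℕ → ℕ → ℕ} {m : ℕ → ℕ}
    (hR : Holds S V sh R F m) {x l : ℕ} (h0 : R 0 = i) (h4 : R 4 = x) (h5 : R 5 = l) (hx1 : 1 ≤ x)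
    (hxn : x ≤ n) : branchE.eval I m = pathBranch (pth x) l := by
  simp only [branchE, RamExpr.eval, hR.reg 0 (by norm_num), hR.reg 4 (by norm_num),
    hR.reg 5 (by norm_num), h0, h4, h5]
  exact hI.branch x hx1 hxn l

theorem triple_descend (hI : TreeInput I i H n pth) (hrows : sh.rows = n + 1) (hHW : H ≤ sh.W)
    (hSV : S ≤ V) (hS : 3 ≤ S) {J l : ℕ} (hJ : J < n) (hl : l < (pth (J + 1)).length)
    {M M' : ℕ → ℕ} (hM : M (l + 1) = J) (hM' : M' l = J) (o₀ : List (ℕ × ℕ)) :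
    Triple check I S V descendProg
      (At S V sh i H (trieF pth M M')
        (fun R => R 4 = J + 1 ∧ R 5 = l ∧ R 6 = rep pth (J + 1) l) o₀)
      (At S V sh i H (trieF pth (Function.update M (l + 1) (J + 1))
          (Function.update M' l (J + 1)))
        (fun R => R 4 = J + 1 ∧ R 5 = l + 1 ∧ R 6 = rep pth (J + 1) (l + 1)) o₀) 11 := by
  rintro m o ⟨R, hR, h0, h2, ⟨h4, h5, h6⟩, ho⟩ K T ν hK
  have hlen := hI.length_lt (J + 1) (by omega) (by omega)
  have hrs := hR.rows_lt (by omega)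
  have hWs := hR.W_lt (by omega)
  have hrep := rep_le (pth := pth) (x := J + 1) (l := l) (by omega)
  have hrep' := rep_le (pth := pth) (x := J + 1) (l := l + 1) (by omega)
  have hb0 := pathBranch_ne_zero.2 hl
  have hb2 := hI.binary (J + 1) (by omega) (by omega) l
  set b := pathBranch (pth (J + 1)) l with hb
  set r := rep pth (J + 1) l with hr
  refine good_seq ?_
  refine good_reg hR (by norm_num) (by norm_num) (by norm_num)
    (eval_branchE hI hR h0 h4 h5 (by omega) (by omega)) (by omega) fun m₁ hR₁ => ?_
  have e4 : (rg 4).eval I m₁ = J + 1 := (hR₁.eval_rg (by norm_num)).trans (by simpa using h4)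
  have e5 : (rg 5).eval I m₁ = l := (hR₁.eval_rg (by norm_num)).trans (by simpa using h5)
  have e6 : (rg 6).eval I m₁ = r := (hR₁.eval_rg (by norm_num)).trans (by simpa using h6)
  have e7 : (rg 7).eval I m₁ = b := (hR₁.eval_rg (by norm_num)).trans (by simp [hb])
  have hval : (RamExpr.mem (cellE (rg 7) (rg 6) (rg 5))).eval I m₁ = repChild pth J r l b := by
    rw [hR₁.eval_mem e7 e6 e5 (by omega) (by omega) (by omega)]
    unfold trieF
    rw [if_neg hb0, if_pos (by omega), hM']
  have hchild := repChild_le (pth := pth) J r l b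
  have hnew : repChild pth J r l b + (1 - repChild pth J r l b) * (J + 1) ≤ J + 1 := by
    rcases Nat.eq_zero_or_pos (repChild pth J r l b) with h | h
    · rw [h]; simp
    · rw [Nat.sub_eq_zero_of_le h]; omega
  refine good_seq ?_
  refine good_cell hR₁ (v := repChild pth J r l b + (1 - repChild pth J r l b) * (J + 1)) e7 e6 e5
    (by omega) (by omega) (by omega)
    (by
      change RamExpr.eval I m₁ _ + (1 - RamExpr.eval I m₁ _) * RamExpr.eval I m₁ _ = _
      rw [hval, e4]) (by omega)
    fun m₂ hR₂ => ?_
  rw [hb, hr, trieF_child hM' hl (by omega)] at hR₂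
  have e5' : (rg 5).eval I m₂ = l := (hR₂.eval_rg (by norm_num)).trans (by simpa using h5)
  have e6' : (rg 6).eval I m₂ = r := (hR₂.eval_rg (by norm_num)).trans (by simpa using h6)
  have e7' : (rg 7).eval I m₂ = b := (hR₂.eval_rg (by norm_num)).trans (by simp [hb])
  have hval' : (RamExpr.mem (cellE (rg 7) (rg 6) (rg 5))).eval I m₂ = rep pth (J + 1) (l + 1) := by
    rw [hR₂.eval_mem e7' e6' e5' (by omega) (by omega) (by omega)]
    unfold trieF
    rw [if_neg hb0, if_pos (by omega), Function.update_self, hr, hb, repChild_self (by omega) hl]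
  refine good_seq ?_
  refine good_reg hR₂ (by norm_num) (by norm_num) (by norm_num) hval' (by omega) fun m₃ hR₃ => ?_
  refine good_seq ?_
  refine good_reg hR₃ (by norm_num) (by norm_num) (by norm_num) (v := l + 1)
    (by rw [RamExpr.eval, hR₃.eval_rg (by norm_num)]; simp [RamExpr.eval, h5]) (by omega)
    fun m₄ hR₄ => ?_
  refine triple_visit (check := check) (ν := ν) (K := K) (T := T) hI hrows hHW hSV hJ
    (l := l + 1) hl hM o₀ m₄ o
    ⟨_, hR₄, by simpa using h0, by simpa using h2, ⟨by simpa using h4, by simp, by simp⟩, ho⟩ ?_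
  exact fun m' o' h => hK m' o' h

theorem triple_insert (hI : TreeInput I i H n pth) (hrows : sh.rows = n + 1) (hHW : H ≤ sh.W)
    (hSV : S ≤ V) (hS : 3 ≤ S) {J : ℕ} (hJ : J < n) (o₀ : List (ℕ × ℕ)) :
    Triple check I S V insertProg
      (At S V sh i H (trieF pth (fun _ => J) (fun _ => J)) (fun R => True ∧ R 4 = J + 1) o₀)
      (At S V sh i H (trieF pth (fun _ => J + 1) (fun _ => J + 1)) (fun R => True ∧ R 4 = J + 1) o₀)
      (12 * H + 10) := by
  have hlen := hI.length_lt (J + 1) (by omega) (by omega)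
  have hloop := Triple.loop (check := check) (I := I) (S := S) (V := V) (e := branchE)
    (p := descendProg)
    (fun l => At S V sh i H
      (trieF pth (fun l' => if l' ≤ l then J + 1 else J) (fun l' => if l' < l then J + 1 else J))
      (fun R => R 4 = J + 1 ∧ R 5 = l ∧ R 6 = rep pth (J + 1) l) o₀) (c := 11)
    (pth (J + 1)).length
    (by
      rintro l hl m o ⟨R, hR, h0, h2, ⟨h4, h5, h6⟩, ho⟩
      rw [eval_branchE hI hR h0 h4 h5 (by omega) (by omega)]
      exact pathBranch_ne_zero)
    (fun l hl => by
      have h := triple_descend (check := check) hI hrows hHW hSV hS hJ hl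
        (M := fun l' => if l' ≤ l then J + 1 else J) (M' := fun l' => if l' < l then J + 1 else J)
        (by simp) (by simp) o₀
      have e1 : Function.update (fun l' => if l' ≤ l then J + 1 else J) (l + 1) (J + 1) =
          fun l' => if l' ≤ l + 1 then J + 1 else J := by
        funext l'
        by_cases hl' : l' = l + 1
        · simp [hl']
        · rw [Function.update_of_ne hl']
          have : l' ≤ l ↔ l' ≤ l + 1 := by omega
          simp only [this]
      have e2 : Function.update (fun l' => if l' < l then J + 1 else J) l (J + 1) =
          fun l' => if l' < l + 1 then J + 1 else J := by
        funext l'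
        by_cases hl' : l' = l
        · simp [hl']
        · rw [Function.update_of_ne hl']
          have : l' < l ↔ l' < l + 1 := by omega
          simp only [this]
      rw [e1, e2] at h
      exact h)
  rw [trieF_end] at hloop
  rintro m o ⟨R, hR, h0, h2, ⟨_, h4⟩, ho⟩ K T ν hK
  have hrs := hR.rows_lt (by omega)
  have hmul : (pth (J + 1)).length * (11 + 1) ≤ H * 12 := Nat.mul_le_mul hlen.le le_rfl
  refine (good_seq (T := T + ((pth (J + 1)).length * (11 + 1) + 1) + 3 + 1 + 1 + 1 + 1) ?_).mono
    (by omega)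
  refine good_reg hR (by norm_num) (by norm_num) (by norm_num) (v := 0) rfl (by omega)
    fun m₁ hR₁ => ?_
  refine good_seq ?_
  refine good_reg hR₁ (by norm_num) (by norm_num) (by norm_num) (v := 1) rfl (by omega)
    fun m₂ hR₂ => ?_
  refine good_seq ?_
  refine triple_visit (check := check) hI hrows hHW hSV hJ (l := 0) (Nat.zero_le _)
    (M := fun _ => J) (M' := fun _ => J) rfl o₀ m₂ o
    ⟨_, hR₂, by simpa using h0, by simpa using h2,
      ⟨by simpa using h4, by simp, by simp [rep_zero]⟩, ho⟩ _ _ ν ?_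
  have e1 : Function.update (fun _ => J) 0 (J + 1) = fun l' => if l' ≤ 0 then J + 1 else J := by
    funext l'
    by_cases hl' : l' = 0 <;> simp [hl']
  rw [e1]
  intro m' o' h
  refine hloop m' o' (by simpa using h) K T ν ?_
  rintro m'' o'' ⟨R', hR', h0', h2', ⟨h4', _⟩, ho'⟩
  exact hK _ _ ⟨R', hR', h0', h2', ⟨trivial, h4'⟩, ho'⟩

theorem triple_trie (hI : TreeInput I i H n pth) (hrows : sh.rows = n + 1) (hHW : H ≤ sh.W)
    (hH : 0 < H) (hSV : S ≤ V) (hS : 3 ≤ S) (o₀ : List (ℕ × ℕ)) :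
    Triple check I S V trieProg (At S V sh i H (fun _ _ _ => 0) (fun _ => True) o₀)
      (At S V sh i H (trieF pth (fun _ => n) (fun _ => n)) (fun _ => True) o₀)
      (n * (12 * H + 13) + 3) := by
  have := triple_forPoints (check := check) (i := i) (H := H) hI.numPoints hrows (by omega) hSV
    (fun J => trieF pth (fun _ => J) (fun _ => J)) (fun _ => True) (fun _ _ _ => trivial)
    (fun _ => o₀) (c := 12 * H + 10)
    (fun J hJ => triple_insert hI hrows hHW hSV hS hJ o₀)
  rwa [trieF_zero] at this

end

section

/-! ### Tossing the coins of all visited nodes -/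

/-- The row `r` represents the node at level `l` of its path. -/
def IsRep (pth : ℕ → List ℕ) (n r l : ℕ) : Prop :=
  1 ≤ r ∧ r ≤ n ∧ l ≤ (pth r).length ∧ rep pth r l = r

variable {pth : ℕ → List ℕ} {n : ℕ}

theorem isRep_rep {x l : ℕ} (hx : 1 ≤ x) (hxn : x ≤ n) (hl : l ≤ (pth x).length) :
    IsRep pth n (rep pth x l) l := by
  have h := rep_spec hx hl
  exact ⟨h.1, h.2.1.trans hxn, h.2.2.1, (rep_eq_rep_iff hx h.1 hl).2 h.2.2⟩

theorem IsRep.unique {r l r' l' : ℕ} (h : IsRep pth n r l) (h' : IsRep pth n r' l')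
    (he : (pth r).take l = (pth r').take l') : r = r' ∧ l = l' := by
  have hl : l = l' := by
    have := congrArg List.length he
    rwa [List.length_take, List.length_take, min_eq_left h.2.2.1, min_eq_left h'.2.2.1] at this
  subst hl
  refine ⟨?_, rfl⟩
  rw [← h.2.2.2, ← h'.2.2.2]
  exact (rep_eq_rep_iff h'.1 h.1 h'.2.2.1).2 ⟨h.2.2.1, he⟩

/-- The number of the paths `pth 1, …, pth n` through the node `u`. -/
def pathCount (pth : ℕ → List ℕ) (n : ℕ) (u : List ℕ) : ℕ := by
  classical
  exact ((Finset.Icc 1 n).filter fun y => u <+: pth y).card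

theorem pathCount_ne_zero {u : List ℕ} :
    pathCount pth n u ≠ 0 ↔ ∃ x, 1 ≤ x ∧ x ≤ n ∧ u <+: pth x := by
  classical
  rw [pathCount, Finset.card_ne_zero, Finset.filter_nonempty_iff]
  simp [and_assoc]

theorem IsRep.repCount_eq {r l : ℕ} (h : IsRep pth n r l) :
    repCount pth n r l = pathCount pth n ((pth r).take l) := by
  classical
  obtain ⟨h1, h2, h3, h4⟩ := h
  rw [repCount, if_neg (by omega), pathCount]
  congr 1
  refine Finset.filter_congr fun y hy => ?_
  rw [Finset.mem_Icc] at hy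
  have := rep_eq_rep_iff (pth := pth) h1 hy.1 h3
  rw [h4] at this
  rw [this]
  constructor
  · rintro ⟨_, h⟩
    exact h ▸ List.take_prefix _ _
  · intro h
    have hlen : ((pth r).take l).length = l := by simp [h3]
    have := List.prefix_iff_eq_take.1 h
    rw [hlen] at this
    exact ⟨hlen ▸ h.length_le, this.symm⟩

theorem repCount_eq_zero {r l : ℕ} (h : ¬ IsRep pth n r l) : repCount pth n r l = 0 := by
  classical
  unfold repCount
  split_ifs with hr
  · rfl
  · rw [Finset.card_eq_zero, Finset.filter_eq_empty_iff]
    intro y hy hyr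
    rw [Finset.mem_Icc] at hy
    refine h (hyr ▸ isRep_rep hy.1 hy.2 ((rep_ne_zero hy.1).1 (hyr ▸ hr)))

/-- A table with the fields `0`, …, `3` of `F` and the remaining fields of `G`. -/
def overlay (F G : ℕ → ℕ → ℕ → ℕ) : ℕ → ℕ → ℕ → ℕ := fun f r l => if f < 4 then F f r l else G f r l

theorem setF_overlay {F G : ℕ → ℕ → ℕ → ℕ} {f r l v : ℕ} (hf : 4 ≤ f) :
    setF (overlay F G) f r l v = overlay F (setF G f r l v) := by
  funext f' r' l'
  unfold setF overlay
  by_cases h4 : f' < 4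
  · have : f' ≠ f := by omega
    simp [h4, this]
  · simp [h4]

theorem overlay_of_lt {F G : ℕ → ℕ → ℕ → ℕ} {f : ℕ} (hf : f < 4) (r l : ℕ) :
    overlay F G f r l = F f r l := by
  rw [overlay, if_pos hf]

theorem overlay_of_le {F G : ℕ → ℕ → ℕ → ℕ} {f : ℕ} (hf : 4 ≤ f) (r l : ℕ) :
    overlay F G f r l = G f r l := by
  rw [overlay, if_neg (by omega)]

theorem trieF_eq_overlay (M M' : ℕ → ℕ) : trieF pth M M' = overlay (trieF pth M M') fun _ _ _ => 0
    := by
  funext f r l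
  unfold overlay
  split_ifs with h
  · rfl
  · unfold trieF
    rw [if_neg (by omega), if_neg (by omega), if_neg (by omega)]

/-- A field with value `1` in the entries that represent nodes satisfying `P`. -/
def nodeF (pth : ℕ → List ℕ) (n : ℕ) (P : List ℕ → Prop) (r l : ℕ) : ℕ := by
  classical
  exact if IsRep pth n r l ∧ P ((pth r).take l) then 1 else 0

theorem nodeF_rep_ne_zero {P : List ℕ → Prop} {x l : ℕ} (hx : 1 ≤ x) (hxn : x ≤ n) :
    nodeF pth n P (rep pth x l) l ≠ 0 ↔ l ≤ (pth x).length ∧ P ((pth x).take l) := by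
  classical
  unfold nodeF
  constructor
  · intro h
    have h' : IsRep pth n (rep pth x l) l ∧ P ((pth (rep pth x l)).take l) := by
      by_contra hc
      rw [if_neg hc] at h
      exact h rfl
    have hl : l ≤ (pth x).length := (rep_ne_zero hx).1 (by have := h'.1.1; omega)
    rw [(rep_spec hx hl).2.2.2] at h'
    exact ⟨hl, h'.2⟩
  · rintro ⟨hl, hP⟩
    rw [if_pos]
    · simp
    · rw [(rep_spec hx hl).2.2.2]
      exact ⟨isRep_rep hx hxn hl, hP⟩

/-- The coins of the entries before position `s`. -/
def coinF (pth : ℕ → List ℕ) (n W s : ℕ) (c : List ℕ → Bool) : ℕ → ℕ → ℕ → ℕ := fun f r l => by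
  classical
  exact if f = 4 ∧ IsRep pth n r l ∧ r * W + l < s ∧ c ((pth r).take l) = true then 1 else 0

/-- The address of a field of the entry whose position is in register `8`. -/
def slotE (f : ℕ) : RamExpr := .add (rg 1) (.add (.mul (.lit 8) (rg 8)) (.lit f))

/-- Run the threshold test for all entries from the position in register `8` on. -/
def coinsLoop : RamProg :=
  .loop (.sub (.mul (.add .numPoints (.lit 1)) (rg 3)) (rg 8))
    (.seq (.check (slotE 4) (.mem (slotE 3))) (.store (.lit 8) (.add (rg 8) (.lit 1))))

/-- Run the threshold test for every entry of the table. -/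
def coinsProg : RamProg := progs [.store (.lit 8) (.lit 0), coinsLoop]

theorem Shape.cell_slot (sh : Shape) (f s : ℕ) :
    sh.cell f (s / sh.W) (s % sh.W) = sh.base + (8 * s + f) := by
  rw [Shape.cell, Nat.div_add_mod']

theorem coinF_succ {W s : ℕ} (hW : 0 < W) (hlen : ∀ x, 1 ≤ x → x ≤ n → (pth x).length < W)
    {c c' : List ℕ → Bool} {v : ℕ}
    (hc : ∀ r l, IsRep pth n r l → r * W + l < s → c' ((pth r).take l) = c ((pth r).take l))
    (hv : v = nodeF pth n (fun u => c' u = true) (s / W) (s % W)) :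
    setF (coinF pth n W s c) 4 (s / W) (s % W) v = coinF pth n W (s + 1) c' := by
  classical
  funext f r l
  unfold setF
  split_ifs with h
  · obtain ⟨rfl, rfl, rfl⟩ := h
    rw [hv, nodeF, coinF, Nat.div_add_mod']
    simp
  · unfold coinF
    by_cases h4 : f = 4
    · by_cases hr : IsRep pth n r l
      · have hl := hlen r hr.1 hr.2.1
        have hl' := hr.2.2.1
        have hne : r * W + l ≠ s := by
          rintro rfl
          refine h ⟨h4, ?_, ?_⟩
          · rw [mul_comm, Nat.mul_add_div hW, Nat.div_eq_of_lt (by omega), add_zero]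
          · rw [mul_comm, Nat.mul_add_mod, Nat.mod_eq_of_lt (by omega)]
        by_cases hs : r * W + l < s
        · have hs' : r * W + l < s + 1 := by omega
          simp only [h4, hr, hs, hs', hc r l hr hs, true_and]
        · have hs' : ¬ r * W + l < s + 1 := by omega
          simp only [hs, hs', false_and, and_false, if_false]
      · simp only [hr, false_and, and_false, if_false]
    · simp only [h4, false_and, if_false]

variable {check : ℕ → PMF Bool} {I : RamInput} {S V T : ℕ} {sh : Shape} {i H : ℕ}

theorem good_check {ν : Bool → PMF (Set (ℕ × ℕ))} {m : ℕ → ℕ} {o : List (ℕ × ℕ)} {K : List RamProg}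
    {a e : RamExpr} {addr v : ℕ} (hm : MemOk S V m) (ha : a.eval I m = addr) (he : e.eval I m = v)
    (h : ∀ b ∈ (check v).support,
      Good check I S V T (ν b) ⟨K, Function.update m addr (if b = true then 1 else 0), o⟩) :
    Good check I S V (T + 1) ((check v).bind ν) ⟨.check a e :: K, m, o⟩ :=
  Good.of_step_bind (c := ⟨.check a e :: K, m, o⟩) hm
    (f := fun b => ⟨K, Function.update m addr (if b = true then 1 else 0), o⟩)
    (by rw [ramStep, ha, he]) h

/-- The invariant of the loop: the coins of the entries before position `s` have been tossed and are
given by `c`, which makes their laws `κ` deterministic, and the other coins still have their laws.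
An entry that represents no node has count `0`, and its test is negative. -/
theorem good_coins_loop (hI : TreeInput I i H n pth) (hrows : sh.rows = n + 1) (hHW : H ≤ sh.W)
    (hH : 0 < H) (hV : 8 * ((n + 1) * sh.W) < V) (h2V : 2 ≤ V) (h0 : check 0 = PMF.pure false)
    {us : List (List ℕ)} (hus : us.Nodup) (o₀ : List (ℕ × ℕ)) {K : List RamProg}
    {rest : (List ℕ → Bool) → PMF (Set (ℕ × ℕ))}
    (hmem : ∀ x, 1 ≤ x → x ≤ n → ∀ l, (pth x).take l ∈ us)
    (hK : ∀ c : List ℕ → Bool, (∀ u, pathCount pth n u = 0 → c u = false) → ∀ m o,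
      At S V sh i H (overlay (trieF pth (fun _ => n) (fun _ => n))
        (coinF pth n sh.W ((n + 1) * sh.W) c)) (fun _ => True) o₀ m o →
      Good check I S V T (rest c) ⟨K, m, o⟩)
    (d : ℕ) : ∀ (s : ℕ), s + d = (n + 1) * sh.W → ∀ (c : List ℕ → Bool) (κ : List ℕ → PMF Bool),
      (∀ r l, IsRep pth n r l → r * sh.W + l < s →
        κ ((pth r).take l) = PMF.pure (c ((pth r).take l))) →
      (∀ u, (∀ r l, IsRep pth n r l → r * sh.W + l < s → u ≠ (pth r).take l) →
        κ u = check (pathCount pth n u)) → ∀ m o,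
      At S V sh i H (overlay (trieF pth (fun _ => n) (fun _ => n)) (coinF pth n sh.W s c))
        (fun R => R 8 = s) o₀ m o →
      Good check I S V (T + (d * 4 + 1)) ((coins κ us).bind rest)
        ⟨coinsLoop :: K, m, o⟩ := by
  have hlen : ∀ x, 1 ≤ x → x ≤ n → (pth x).length < sh.W := fun x h1 h2 =>
    (hI.length_lt x h1 h2).trans_le hHW
  have hW : 0 < sh.W := by omega
  induction d with
  | zero =>
    intro s hs c κ hκ hκ' m o hm
    obtain rfl : s = (n + 1) * sh.W := by omega
    have hslot : ∀ r l, IsRep pth n r l → r * sh.W + l < (n + 1) * sh.W := fun r l h => by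
      have h1 := hlen r h.1 h.2.1
      have h2 := h.2.2.1
      calc r * sh.W + l < r * sh.W + sh.W := by omega
        _ = (r + 1) * sh.W := by ring
        _ ≤ _ := Nat.mul_le_mul_right _ (by have := h.2.1; omega)
    -- the coins of all nodes are now known; unvisited nodes have the coin `false`
    obtain ⟨c', hc'⟩ : ∃ c' : List ℕ → Bool, c' = fun u =>
        if pathCount pth n u = 0 then false else c u := ⟨_, rfl⟩
    have hcc : ∀ r l, IsRep pth n r l → c' ((pth r).take l) = c ((pth r).take l) := fun r l h => by
      have : pathCount pth n ((pth r).take l) ≠ 0 :=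
        pathCount_ne_zero.2 ⟨r, h.1, h.2.1, List.take_prefix _ _⟩
      simp only [hc', this, if_false]
    have hpure : ∀ u, κ u = PMF.pure (c' u) := fun u => by
      by_cases hu : pathCount pth n u = 0
      · rw [hκ' u, hu, h0, hc']
        · simp [hu]
        · rintro r l h _ rfl
          exact pathCount_ne_zero.2 ⟨r, h.1, h.2.1, List.take_prefix _ _⟩ hu
      · obtain ⟨x, hx1, hxn, hx⟩ := pathCount_ne_zero.1 hu
        have hlx := hx.length_le
        have hr := isRep_rep (n := n) hx1 hxn hlx
        have hsp := rep_spec hx1 hlx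
        have hue : u = (pth (rep pth x u.length)).take u.length := by
          rw [hsp.2.2.2]; exact List.prefix_iff_eq_take.1 hx
        have h1 := hκ _ _ hr (hslot _ _ hr)
        have h2 := hcc _ _ hr
        rw [← hue] at h1 h2
        rw [h1, h2]
    have hF : coinF pth n sh.W ((n + 1) * sh.W) c = coinF pth n sh.W ((n + 1) * sh.W) fun u =>
        if u ∈ us then c' u else false := by
      classical
      funext f r l
      unfold coinF
      by_cases hr : IsRep pth n r l
      · simp only [hmem r hr.1 hr.2.1 l, if_true, hcc r l hr]
      · simp only [hr, false_and, and_false, if_false]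
    have hbind : (coins κ us).bind rest = rest fun u => if u ∈ us then c' u else false := by
      have hc : ∀ x ∈ (coins κ us).support, x = fun u => if u ∈ us then c' u else false := by
        intro x hx
        funext u
        split_ifs with hu
        · exact coins_support_pure hx hu (hpure u)
        · exact coins_support_of_not_mem hx hu
      have hp : coins κ us = PMF.pure fun u => if u ∈ us then c' u else false := by
        have hsupp := (coins κ us).support_nonempty
        obtain ⟨x, hx⟩ := hsupp
        have hone := ((coins κ us).apply_eq_one_iff fun u => if u ∈ us then c' u else false).2
          (Set.eq_singleton_iff_unique_mem.2 ⟨hc x hx ▸ hx, hc⟩)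
        ext y
        by_cases hy : y = fun u => if u ∈ us then c' u else false
        · rw [hy, hone, PMF.pure_apply_self]
        · rw [PMF.pure_apply_of_ne _ _ hy, PMF.apply_eq_zero_iff]
          exact fun h => hy (hc y h)
      rw [hp, PMF.pure_bind]
    obtain ⟨R, hR, hR0, hR2, hR8, ho⟩ := hm
    rw [hbind]
    refine (good_loop_neg ?_ (hK _ ?_ m o ⟨R, hF ▸ hR, hR0, hR2, trivial, ho⟩)).mono (by omega)
    · simp only [RamExpr.eval, hR.reg 3 (by norm_num), hR.reg 8 (by norm_num), hR.reg_W,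
          hI.numPoints,
        hR8]
      omega
    · intro u hu
      simp [hc', hu]
  | succ d ih =>
    intro s hs c κ hκ hκ' m o ⟨R, hR, hR0, hR2, hR8, ho⟩
    have hsr : s / sh.W < n + 1 := (Nat.div_lt_iff_lt_mul hW).2 (by omega)
    have hsl : s % sh.W < sh.W := Nat.mod_lt _ hW
    have eaddr : ∀ f, (slotE f).eval I m =
        sh.cell f (s / sh.W) (s % sh.W) := fun f => by
      rw [Shape.cell_slot]
      simp only [slotE, RamExpr.eval, hR.reg 1 (by norm_num), hR.reg 8 (by norm_num), hR.reg_base,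
        hR8]
    have ecnt : (RamExpr.mem (slotE 3)).eval I m =
        repCount pth n (s / sh.W) (s % sh.W) := by
      rw [RamExpr.eval, eaddr, hR.cells 3 (by norm_num) _ (by omega) _ hsl, overlay_of_lt
          (by norm_num)]
      simp [trieF]
    -- the step after the test
    have hnext : ∀ (b : Bool) (c' : List ℕ → Bool) (κ' : List ℕ → PMF Bool),
        (∀ r l, IsRep pth n r l → r * sh.W + l < s →
          c' ((pth r).take l) = c ((pth r).take l)) →
        (if b = true then 1 else 0) =
          nodeF pth n (fun u => c' u = true) (s / sh.W) (s % sh.W) →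
        (∀ r l, IsRep pth n r l → r * sh.W + l < s + 1 →
          κ' ((pth r).take l) = PMF.pure (c' ((pth r).take l))) →
        (∀ u, (∀ r l, IsRep pth n r l → r * sh.W + l < s + 1 → u ≠ (pth r).take l) →
          κ' u = check (pathCount pth n u)) →
        Good check I S V (T + (d * 4 + 1) + 1) ((coins κ' us).bind rest)
          ⟨.store (.lit 8) (.add (rg 8) (.lit 1)) :: coinsLoop :: K,
            Function.update m (sh.cell 4 (s / sh.W) (s % sh.W)) (if b = true then 1 else 0), o⟩
              := by
      intro b c' κ' h1 h2 h3 h4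
      have hR' := hR.set_cell (f := 4) (r := s / sh.W) (l := s % sh.W)
        (v := if b = true then 1 else 0) (by norm_num) (by omega) hsl (by split_ifs <;> omega)
      rw [setF_overlay le_rfl, coinF_succ hW hlen h1 h2] at hR'
      refine good_reg hR' (by norm_num) (by norm_num) (by norm_num) (v := s + 1)
        (by simp only [RamExpr.eval, hR'.reg 8 (by norm_num), hR8]) (by omega) fun m' hR'' => ?_
      exact ih (s + 1) (by omega) c' κ' h3 h4 m' o
        ⟨_, hR'', by simpa using hR0, by simpa using hR2, by simp, ho⟩
    refine (good_loop_pos (T := T + (d * 4 + 1) + 1 + 1 + 1) ?_ (good_seq ?_)).mono (by omega)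
    · simp only [RamExpr.eval, hR.reg 3 (by norm_num), hR.reg 8 (by norm_num), hR.reg_W,
          hI.numPoints,
        hR8]
      omega
    by_cases hrep : IsRep pth n (s / sh.W) (s % sh.W)
    · obtain ⟨u, hu⟩ : ∃ u, u = (pth (s / sh.W)).take (s % sh.W) := ⟨_, rfl⟩
      have hnew : ∀ r l, IsRep pth n r l → r * sh.W + l < s → (pth r).take l ≠ u := by
        intro r l hr hlt heq
        obtain ⟨rfl, rfl⟩ := hr.unique hrep (heq.trans hu)
        rw [Nat.div_add_mod'] at hlt
        omega
      have hκu : κ u = check (pathCount pth n u) := hκ' u fun r l hr hlt => (hnew r l hr hlt).symm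
      rw [coins_expose κ hus u, hκu, PMF.bind_bind]
      refine good_check hR.ok (eaddr 4) (ecnt.trans (by rw [hrep.repCount_eq, ← hu])) fun b _ => ?_
      · refine hnext b (Function.update c u b) _ (fun r l hr hlt =>
          Function.update_of_ne (hnew r l hr hlt) _ _) ?_ (fun r l hr hlt => ?_) fun w hw => ?_
        · unfold nodeF
          rw [← hu]
          simp [hrep]
        · by_cases heq : (pth r).take l = u
          · rw [heq, Function.update_self, Function.update_self]
          · rw [Function.update_of_ne heq, Function.update_of_ne heq]
            refine hκ r l hr (lt_of_le_of_ne (by omega) fun hs' => heq ?_)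
            have hl := hlen r hr.1 hr.2.1
            have hl' := hr.2.2.1
            rw [hu, ← hs', mul_comm, Nat.mul_add_div hW, Nat.div_eq_of_lt (by omega), add_zero,
              Nat.mul_add_mod, Nat.mod_eq_of_lt (by omega)]
        · have hwu : w ≠ u := hu ▸ hw _ _ hrep (by rw [Nat.div_add_mod']; omega)
          rw [Function.update_of_ne hwu]
          exact hκ' w fun r l hr hlt => hw r l hr (by omega)
    · have hcases : ∀ r l, IsRep pth n r l → r * sh.W + l < s + 1 → r * sh.W + l < s := by
        intro r l hr hlt
        refine lt_of_le_of_ne (by omega) fun hs' => hrep ?_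
        have hl := hlen r hr.1 hr.2.1
        have hl' := hr.2.2.1
        rw [← hs', mul_comm, Nat.mul_add_div hW, Nat.div_eq_of_lt (by omega), add_zero,
              Nat.mul_add_mod, Nat.mod_eq_of_lt (by omega)]
        exact hr
      have hν : (check 0).bind (fun _ => (coins κ us).bind rest) = (coins κ us).bind rest := by
        rw [h0, PMF.pure_bind]
      rw [← hν]
      refine good_check hR.ok (eaddr 4) (ecnt.trans (repCount_eq_zero hrep)) fun b hb => ?_
      rw [h0, PMF.mem_support_pure_iff] at hb
      subst hb
      refine (hnext false c κ (fun _ _ _ _ => rfl) ?_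
          (fun r l hr hlt => hκ r l hr (hcases r l hr hlt))
          fun u hu => hκ' u fun r l hr hlt => hu r l hr (by omega))
      · unfold nodeF
        simp [hrep]

/-- Tossing the coins: the only random part of the computation. -/
theorem good_coins (hI : TreeInput I i H n pth) (hrows : sh.rows = n + 1) (hHW : H ≤ sh.W)
    (hH : 0 < H) (hV : 8 * ((n + 1) * sh.W) < V) (h2V : 2 ≤ V) (h0 : check 0 = PMF.pure false)
    {us : List (List ℕ)} (hus : us.Nodup) (o₀ : List (ℕ × ℕ)) {K : List RamProg}
    {rest : (List ℕ → Bool) → PMF (Set (ℕ × ℕ))}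
    (hmem : ∀ x, 1 ≤ x → x ≤ n → ∀ l, (pth x).take l ∈ us)
    (hK : ∀ c : List ℕ → Bool, (∀ u, pathCount pth n u = 0 → c u = false) → ∀ m o,
      At S V sh i H (overlay (trieF pth (fun _ => n) (fun _ => n)) fun f r l =>
        if f = 4 then nodeF pth n (fun u => c u = true) r l else 0) (fun _ => True) o₀ m o →
      Good check I S V T (rest c) ⟨K, m, o⟩) {m : ℕ → ℕ} {o : List (ℕ × ℕ)}
    (hm : At S V sh i H (trieF pth (fun _ => n) (fun _ => n)) (fun _ => True) o₀ m o) :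
    Good check I S V (T + ((n + 1) * sh.W * 4 + 3))
      ((coins (fun u => check (pathCount pth n u)) us).bind rest) ⟨coinsProg :: K, m, o⟩ := by
  classical
  have hfin : ∀ c, coinF pth n sh.W ((n + 1) * sh.W) c = fun f r l =>
      if f = 4 then nodeF pth n (fun u => c u = true) r l else 0 := fun c => by
    funext f r l
    unfold coinF nodeF
    by_cases h4 : f = 4
    · by_cases hr : IsRep pth n r l
      · have : r * sh.W + l < (n + 1) * sh.W := by
          have h1 := hI.length_lt r hr.1 hr.2.1
          have h2 := hr.2.2.1
          calc r * sh.W + l < r * sh.W + sh.W := by omega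
            _ = (r + 1) * sh.W := by ring
            _ ≤ _ := Nat.mul_le_mul_right _ (by have := hr.2.1; omega)
        simp [h4, hr, this]
      · simp [hr]
    · simp [h4]
  have hstart : coinF pth n sh.W 0 (fun _ => false) = fun _ _ _ => 0 := by
    funext f r l
    simp [coinF]
  obtain ⟨R, hR, hR0, hR2, _, ho⟩ := hm
  refine good_seq ?_
  refine good_reg hR (by norm_num) (by norm_num) (by norm_num) (v := 0) rfl (by omega)
    fun m₁ hR₁ => ?_
  rw [trieF_eq_overlay, ← hstart] at hR₁
  refine good_coins_loop hI hrows hHW hH hV h2V h0 hus o₀ hmem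
    (fun c hc m o h => hK c hc m o (by rwa [hfin] at h)) _ 0 (by omega) (fun _ => false) _
    (by intro r l _ h; omega) (fun u _ => rfl) m₁ o
    ⟨_, hR₁, by simpa using hR0, by simpa using hR2, by simp, ho⟩

end

section

/-! ### The recursion on level intervals without a stack -/

/-- The `q`-th interval `(a, len)` of levels that the recursion visits, in breadth-first order:
the two halves of the `q`-th interval have the numbers `2q` and `2q + 1`. -/
def interval (H : ℕ) (q : ℕ) : ℕ × ℕ :=
  if _h : q ≤ 1 then (0, H)
  else if q % 2 = 0 then ((interval H (q / 2)).1, (interval H (q / 2)).2 / 2)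
  else ((interval H (q / 2)).1 + (interval H (q / 2)).2 / 2 + 1,
    (interval H (q / 2)).2 - (interval H (q / 2)).2 / 2 - 1)
termination_by q
decreasing_by all_goals omega

/-- The middle level of an interval. -/
def midLevel (H q : ℕ) : ℕ := (interval H q).1 + (interval H q).2 / 2

theorem interval_one (H : ℕ) : interval H 1 = (0, H) := by
  rw [interval, dif_pos le_rfl]

theorem interval_left (H : ℕ) {q : ℕ} (hq : 1 ≤ q) :
    interval H (2 * q) = ((interval H q).1, (interval H q).2 / 2) := by
  rw [interval, dif_neg (by omega), if_pos (by omega), Nat.mul_div_cancel_left _ (by norm_num)]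

theorem interval_right (H : ℕ) {q : ℕ} (hq : 1 ≤ q) :
    interval H (2 * q + 1) = ((interval H q).1 + (interval H q).2 / 2 + 1,
      (interval H q).2 - (interval H q).2 / 2 - 1) := by
  have h : (2 * q + 1) / 2 = q := by omega
  rw [interval, dif_neg (by omega), if_neg (by omega), h]

/-- Induction along the numbering of the intervals. -/
theorem interval_induction {P : ℕ → Prop} (h1 : P 1) (hl : ∀ q, 1 ≤ q → P q → P (2 * q))
    (hr : ∀ q, 1 ≤ q → P q → P (2 * q + 1)) (q : ℕ) (hq : 1 ≤ q) : P q := by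
  induction q using Nat.strong_induction_on with
  | _ q ih =>
    rcases Nat.lt_or_ge 1 q with h | h
    · rcases Nat.even_or_odd' q with ⟨p, rfl | rfl⟩
      · exact hl p (by omega) (ih p (by omega) (by omega))
      · exact hr p (by omega) (ih p (by omega) (by omega))
    · obtain rfl : q = 1 := by omega
      exact h1

theorem interval_sum_le (H : ℕ) (q : ℕ) (hq : 1 ≤ q) :
    (interval H q).1 + (interval H q).2 ≤ H + q := by
  refine interval_induction (P := fun q => (interval H q).1 + (interval H q).2 ≤ H + q) ?_
    (fun q hq ih => ?_) (fun q hq ih => ?_) q hq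
  · rw [interval_one]; simp
  · rw [interval_left H hq]; dsimp only; omega
  · rw [interval_right H hq]; dsimp only; omega

theorem interval_end_le (H : ℕ) (q : ℕ) (hq : 1 ≤ q) :
    (interval H q).2 ≠ 0 → (interval H q).1 + (interval H q).2 ≤ H := by
  refine interval_induction
    (P := fun q => (interval H q).2 ≠ 0 → (interval H q).1 + (interval H q).2 ≤ H) ?_
    (fun q hq ih => ?_) (fun q hq ih => ?_) q hq
  · rw [interval_one]; simp
  · rw [interval_left H hq]; dsimp only; omega
  · rw [interval_right H hq]; dsimp only; omega

/-- Only the first `2 * H` intervals can be nonempty. -/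
theorem interval_index_le (H : ℕ) (q : ℕ) (hq : 1 ≤ q) : (q + 1) * (interval H q).2 ≤ 2 * H := by
  refine interval_induction (P := fun q => (q + 1) * (interval H q).2 ≤ 2 * H) ?_
    (fun q hq ih => ?_) (fun q hq ih => ?_) q hq
  · rw [interval_one]
  · rw [interval_left H hq]; dsimp only
    calc (2 * q + 1) * ((interval H q).2 / 2) ≤ (q + 1) * (2 * ((interval H q).2 / 2)) := by
          nlinarith [Nat.zero_le ((interval H q).2 / 2)]
      _ ≤ (q + 1) * (interval H q).2 := Nat.mul_le_mul_left _ (by omega)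
      _ ≤ _ := ih
  · rw [interval_right H hq]; dsimp only
    calc (2 * q + 1 + 1) * ((interval H q).2 - (interval H q).2 / 2 - 1) =
          (q + 1) * (2 * ((interval H q).2 - (interval H q).2 / 2 - 1)) := by ring
      _ ≤ (q + 1) * (interval H q).2 := Nat.mul_le_mul_left _ (by omega)
      _ ≤ _ := ih

/-- The level `l` is the middle of one of the intervals before number `q`. -/
def LevelDone (H q l : ℕ) : Prop :=
  ∃ q', 1 ≤ q' ∧ q' < q ∧ (interval H q').2 ≠ 0 ∧ midLevel H q' = l

/-- The levels next to an interval are finished before the interval is treated. -/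
theorem levelDone_adjacent (H : ℕ) (q : ℕ) (hq : 1 ≤ q) : (interval H q).2 ≠ 0 →
    ((interval H q).1 = 0 ∨ LevelDone H q ((interval H q).1 - 1)) ∧
    ((interval H q).1 + (interval H q).2 = H ∨
      LevelDone H q ((interval H q).1 + (interval H q).2)) := by
  have hmono : ∀ {q q' l}, q ≤ q' → LevelDone H q l → LevelDone H q' l :=
    fun h ⟨p, h1, h2, h3⟩ => ⟨p, h1, by omega, h3⟩
  refine interval_induction (P := fun q => (interval H q).2 ≠ 0 →
    ((interval H q).1 = 0 ∨ LevelDone H q ((interval H q).1 - 1)) ∧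
    ((interval H q).1 + (interval H q).2 = H ∨
      LevelDone H q ((interval H q).1 + (interval H q).2))) ?_
    (fun q hq ih => ?_) (fun q hq ih => ?_) q hq
  · rw [interval_one]; simp
  · rw [interval_left H hq]; dsimp only
    intro h
    have hne : (interval H q).2 ≠ 0 := by omega
    exact ⟨(ih hne).1.imp_right (hmono (by omega)),
      Or.inr ⟨q, hq, by omega, hne, rfl⟩⟩
  · rw [interval_right H hq]; dsimp only
    intro h
    have hne : (interval H q).2 ≠ 0 := by omega
    refine ⟨Or.inr ⟨q, hq, by omega, hne, rfl⟩, ?_⟩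
    have he : (interval H q).1 + (interval H q).2 / 2 + 1 +
        ((interval H q).2 - (interval H q).2 / 2 - 1) = (interval H q).1 + (interval H q).2 := by
      omega
    rw [he]
    exact (ih hne).2.imp_right (hmono (by omega))

/-- After `2 * H` intervals all levels are finished. -/
theorem levelDone_all {H l : ℕ} (hl : l < H) : LevelDone H (2 * H + 1) l := by
  suffices h : ∀ len q, 1 ≤ q → (interval H q).2 = len → (interval H q).1 ≤ l →
      l < (interval H q).1 + len →
      ∃ q', 1 ≤ q' ∧ (interval H q').2 ≠ 0 ∧ midLevel H q' = l by
    obtain ⟨q, hq, h0, hm⟩ := h H 1 le_rfl (by rw [interval_one]) (by rw [interval_one]; simp)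
      (by rw [interval_one]; simpa using hl)
    have h1 := interval_index_le H q hq
    have h2 : (q + 1) * 1 ≤ (q + 1) * (interval H q).2 := Nat.mul_le_mul_left _ (by omega)
    exact ⟨q, hq, by omega, h0, hm⟩
  intro len
  induction len using Nat.strong_induction_on with
  | _ len ih =>
    intro q hq hlen ha hb
    have hL := interval_left H hq
    have hR := interval_right H hq
    rcases lt_trichotomy l ((interval H q).1 + (interval H q).2 / 2) with h | h | h
    · exact ih (len / 2) (by omega) (2 * q) (by omega) (by rw [hL]; simp [hlen])
        (by rw [hL]; exact ha) (by rw [hL, ← hlen]; exact h)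
    · exact ⟨q, hq, by omega, h.symm⟩
    · exact ih (len - len / 2 - 1) (by omega) (2 * q + 1) (by omega) (by rw [hR]; simp [hlen])
        (by rw [hR]; exact h) (by rw [hR]; dsimp only; omega)

/-- The equations between the heavy nodes of the middle level of each interval and those of the
levels next to the interval.  They determine the heavy nodes among the visited ones. -/
structure HeavySpec (pth : ℕ → List ℕ) (n H : ℕ) (c : List ℕ → Bool) (h : List ℕ → Prop) :
    Prop where
  visited : ∀ w, h w → ∃ x, 1 ≤ x ∧ x ≤ n ∧ w <+: pth x
  eq : ∀ q, 1 ≤ q → (interval H q).2 ≠ 0 → ∀ x, 1 ≤ x → x ≤ n → midLevel H q ≤ (pth x).length →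
    (h ((pth x).take (midLevel H q)) ↔
      (∃ w, w.length = (interval H q).1 + (interval H q).2 ∧ h w ∧
        (pth x).take (midLevel H q) <+: w) ∨
      (((interval H q).1 = 0 ∨ h ((pth x).take ((interval H q).1 - 1))) ∧
        c ((pth x).take (midLevel H q)) = true))

variable {pth : ℕ → List ℕ} {n H : ℕ} {c : List ℕ → Bool} {h : List ℕ → Prop}

/-- The path `pth x` shows that its node at the middle level of the `q`-th interval is heavy. -/
def ShowsHeavy (pth : ℕ → List ℕ) (H : ℕ) (c : List ℕ → Bool) (h : List ℕ → Prop) (q x : ℕ) :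
    Prop :=
  ((interval H q).1 + (interval H q).2 ≤ (pth x).length ∧
    h ((pth x).take ((interval H q).1 + (interval H q).2))) ∨
  (((interval H q).1 = 0 ∨ ((interval H q).1 - 1 ≤ (pth x).length ∧
      h ((pth x).take ((interval H q).1 - 1)))) ∧
    midLevel H q ≤ (pth x).length ∧ c ((pth x).take (midLevel H q)) = true)

theorem ShowsHeavy.le {q x : ℕ} (hs : ShowsHeavy pth H c h q x) : midLevel H q ≤ (pth x).length
    := by
  unfold midLevel
  rcases hs with ⟨h1, _⟩ | ⟨_, h1, _⟩
  · omega
  · exact h1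

/-- A node of the middle level is heavy if and only if one of the paths through it shows this. -/
theorem HeavySpec.exists_showsHeavy_iff (hs : HeavySpec pth n H c h) {q : ℕ} (hq : 1 ≤ q)
    (h0 : (interval H q).2 ≠ 0) (r : ℕ) :
    (∃ x, 1 ≤ x ∧ x ≤ n ∧ ShowsHeavy pth H c h q x ∧ rep pth x (midLevel H q) = r) ↔
      IsRep pth n r (midLevel H q) ∧ h ((pth r).take (midLevel H q)) := by
  constructor
  · rintro ⟨x, hx, hxn, hsh, rfl⟩
    have hle := hsh.le
    refine ⟨isRep_rep hx hxn hle, ?_⟩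
    rw [(rep_spec hx hle).2.2.2]
    refine (hs.eq q hq h0 x hx hxn hle).2 ?_
    rcases hsh with ⟨h1, h2⟩ | ⟨h1, h2, h3⟩
    · refine Or.inl ⟨_, by simp [h1], h2, ?_⟩
      exact List.take_prefix_take_left (by unfold midLevel; omega)
    · exact Or.inr ⟨h1.imp_right And.right, h3⟩
  · rintro ⟨hr, hh⟩
    rcases (hs.eq q hq h0 r hr.1 hr.2.1 hr.2.2.1).1 hh with ⟨w, hw, hhw, hp⟩ | ⟨h1, h2⟩
    · obtain ⟨x, hx, hxn, hwx⟩ := hs.visited w hhw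
      have hlen := hwx.length_le
      have hwt := List.prefix_iff_eq_take.1 hwx
      refine ⟨x, hx, hxn, Or.inl ⟨by omega, by rw [← hw, ← hwt]; exact hhw⟩, ?_⟩
      rw [← hr.2.2.2]
      refine (rep_eq_rep_iff hr.1 hx hr.2.2.1).2 ⟨by unfold midLevel; omega, ?_⟩
      have := List.prefix_iff_eq_take.1 (hp.trans hwx)
      rw [List.length_take, min_eq_left hr.2.2.1] at this
      exact this.symm
    · refine ⟨r, hr.1, hr.2.1, Or.inr ⟨h1.imp_right fun h1 => ⟨?_, h1⟩, hr.2.2.1, h2⟩, hr.2.2.2⟩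
      have := hr.2.2.1
      unfold midLevel at this; omega

/-! ### Computing the heavy nodes -/

/-- The entry of field `f` for the current point (register `4`) and its node at level `l`. -/
def nodeE (f : ℕ) (l : RamExpr) : RamExpr :=
  .mem (cellE (.lit f) (.mem (cellE (.lit 0) (rg 4) l)) l)

/-- Whether the path of the current point shows that its node at the middle level (register `5`)
of the interval in the registers `9` and `10` is heavy.  The difference `1 - a` is nonzero only
for the first level `a = 0`. -/
def showsE : RamExpr :=
  .add (nodeE 5 (.add (rg 9) (rg 10)))
    (.mul (.add (.sub (.lit 1) (rg 9)) (nodeE 5 (.sub (rg 9) (.lit 1)))) (nodeE 4 (rg 5)))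

/-- Update the mark of the middle node of the current point. -/
def markProg : RamProg :=
  .ifElse showsE (.store (cellE (.lit 5) (.mem (cellE (.lit 0) (rg 4) (rg 5))) (rg 5)) (.lit 1))
      skip

/-- Treat the interval whose number is in register `8`. -/
def intervalProg : RamProg := progs
  [.store (.lit 9) (.mem (cellE (.lit 6) (.lit 0) (rg 8))),
   .store (.lit 10) (.mem (cellE (.lit 7) (.lit 0) (rg 8))),
   .store (cellE (.lit 6) (.lit 0) (.mul (.lit 2) (rg 8))) (rg 9),
   .store (cellE (.lit 7) (.lit 0) (.mul (.lit 2) (rg 8))) (.div (rg 10) (.lit 2)),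
   .store (cellE (.lit 6) (.lit 0) (.add (.mul (.lit 2) (rg 8)) (.lit 1)))
     (.add (.add (rg 9) (.div (rg 10) (.lit 2))) (.lit 1)),
   .store (cellE (.lit 7) (.lit 0) (.add (.mul (.lit 2) (rg 8)) (.lit 1)))
     (.sub (.sub (rg 10) (.div (rg 10) (.lit 2))) (.lit 1)),
   .ifElse (rg 10)
     (.seq (.store (.lit 5) (.add (rg 9) (.div (rg 10) (.lit 2)))) (forPoints markProg)) skip,
   .store (.lit 8) (.add (rg 8) (.lit 1))]

/-- Treat all intervals. -/
def heavyProg : RamProg := progs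
  [.store (cellE (.lit 7) (.lit 0) (.lit 1)) (rg 2),
   .store (.lit 8) (.lit 1),
   .loop (.sub (.add (.mul (.lit 2) (rg 2)) (.lit 1)) (rg 8)) intervalProg]

/-- The table while the heavy nodes are being computed: field `4` has the coins, field `5` the
marks `G`, and the fields `6` and `7` of row `0` have the first intervals. -/
def heavyF (pth : ℕ → List ℕ) (n H : ℕ) (c : List ℕ → Bool) (G : ℕ → ℕ → ℕ) (Q : ℕ) :
    ℕ → ℕ → ℕ → ℕ :=
  overlay (trieF pth (fun _ => n) (fun _ => n)) fun f r l =>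
    if f = 4 then nodeF pth n (fun u => c u = true) r l
    else if f = 5 then G r l
    else if f = 6 then (if r = 0 ∧ 1 ≤ l ∧ l < Q then (interval H l).1 else 0)
    else if f = 7 then (if r = 0 ∧ 1 ≤ l ∧ l < Q then (interval H l).2 else 0)
    else 0

theorem heavyF_children {G : ℕ → ℕ → ℕ} {q : ℕ} (hq : 1 ≤ q) :
    setF (setF (setF (setF (heavyF pth n H c G (2 * q)) 6 0 (2 * q) (interval H q).1)
      7 0 (2 * q) ((interval H q).2 / 2))
      6 0 (2 * q + 1) ((interval H q).1 + (interval H q).2 / 2 + 1))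
      7 0 (2 * q + 1) ((interval H q).2 - (interval H q).2 / 2 - 1) =
    heavyF pth n H c G (2 * (q + 1)) := by
  have hL := interval_left H hq
  have hR := interval_right H hq
  unfold heavyF
  rw [setF_overlay (by norm_num), setF_overlay (by norm_num), setF_overlay (by norm_num),
    setF_overlay (by norm_num)]
  congr 1
  funext f r l
  have hlt : l ≠ 2 * q → l ≠ 2 * q + 1 → (l < 2 * q ↔ l < 2 * (q + 1)) := by omega
  have h1 : 2 * q < 2 * (q + 1) := by omega
  have h2 : 2 * q + 1 < 2 * (q + 1) := by omega
  have h3 : 1 ≤ 2 * q := by omega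
  unfold setF
  by_cases h6 : f = 6
  · subst h6
    by_cases hr : r = 0
    · by_cases hl : l = 2 * q
      · subst hl; simp [hr, hL, h3]
      · by_cases hl' : l = 2 * q + 1
        · subst hl'; simp [hr, hR, h2]
        · simp [hr, hl, hl', hlt hl hl']
    · simp [hr]
  · by_cases h7 : f = 7
    · subst h7
      by_cases hr : r = 0
      · by_cases hl : l = 2 * q
        · subst hl; simp [hr, hL, h3]
        · by_cases hl' : l = 2 * q + 1
          · subst hl'; simp [hr, hR, h2]
          · simp [hr, hl, hl', hlt hl hl']
      · simp [hr]
    · simp [h6, h7]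

theorem heavyF_mark {G : ℕ → ℕ → ℕ} {Q r l : ℕ} :
    setF (heavyF pth n H c G Q) 5 r l 1 =
      heavyF pth n H c (fun r' l' => if r' = r ∧ l' = l then 1 else G r' l') Q := by
  unfold heavyF
  rw [setF_overlay (by norm_num)]
  congr 1
  funext f r' l'
  unfold setF
  by_cases h5 : f = 5
  · simp [h5]
  · simp [h5]

/-- The marks after the intervals before number `q`. -/
def marks (pth : ℕ → List ℕ) (n H : ℕ) (h : List ℕ → Prop) (q : ℕ) : ℕ → ℕ → ℕ :=
  fun r l => nodeF pth n (fun u => h u ∧ LevelDone H q u.length) r l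

/-- The marks after the intervals before number `q` and, for this interval, the first `J` points. -/
def marksPartial (pth : ℕ → List ℕ) (n H : ℕ) (c : List ℕ → Bool) (h : List ℕ → Prop) (q J : ℕ) :
    ℕ → ℕ → ℕ := fun r l => by
  classical
  exact if l = midLevel H q ∧ ∃ x, 1 ≤ x ∧ x ≤ J ∧ ShowsHeavy pth H c h q x ∧ rep pth x l = r
    then 1 else marks pth n H h q r l

theorem marksPartial_zero (q : ℕ) : marksPartial pth n H c h q 0 = marks pth n H h q := by
  funext r l
  unfold marksPartial
  rw [if_neg]
  rintro ⟨_, x, h1, h2, _⟩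
  omega

theorem marksPartial_succ_of_shows {q J : ℕ} (hs : ShowsHeavy pth H c h q (J + 1)) :
    (fun r' l' => if r' = rep pth (J + 1) (midLevel H q) ∧ l' = midLevel H q then 1
      else marksPartial pth n H c h q J r' l') = marksPartial pth n H c h q (J + 1) := by
  classical
  funext r l
  unfold marksPartial
  split_ifs with h1 h2 h2 h3 h3
  · rfl
  · exact absurd ⟨h1.2, J + 1, by omega, le_rfl, hs, by rw [h1.2, h1.1]⟩ h2
  · rfl
  · obtain ⟨hl, x, hx1, hx2, hx3⟩ := h2
    exact absurd ⟨hl, x, hx1, by omega, hx3⟩ h3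
  · obtain ⟨hl, x, hx1, hx2, hx3⟩ := h3
    rcases Nat.lt_or_ge J x with hx | hx
    · obtain rfl : x = J + 1 := by omega
      exact absurd ⟨by rw [← hx3.2, hl], hl⟩ h1
    · exact absurd ⟨hl, x, hx1, hx, hx3⟩ h2
  · rfl

theorem marksPartial_succ_of_not {q J : ℕ} (hs : ¬ ShowsHeavy pth H c h q (J + 1)) :
    marksPartial pth n H c h q (J + 1) = marksPartial pth n H c h q J := by
  classical
  funext r l
  unfold marksPartial
  have : ∀ x, (1 ≤ x ∧ x ≤ J + 1 ∧ ShowsHeavy pth H c h q x ∧ rep pth x l = r) ↔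
      (1 ≤ x ∧ x ≤ J ∧ ShowsHeavy pth H c h q x ∧ rep pth x l = r) := fun x => by
    constructor
    · rintro ⟨h1, h2, h3, h4⟩
      refine ⟨h1, ?_, h3, h4⟩
      rcases Nat.lt_or_ge J x with hx | hx
      · obtain rfl : x = J + 1 := by omega
        exact absurd h3 hs
      · exact hx
    · rintro ⟨h1, h2, h3⟩
      exact ⟨h1, by omega, h3⟩
  simp only [this]

theorem levelDone_succ {q l : ℕ} (hq : 1 ≤ q) : LevelDone H (q + 1) l ↔
    LevelDone H q l ∨ ((interval H q).2 ≠ 0 ∧ midLevel H q = l) := by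
  constructor
  · rintro ⟨q', h1, h2, h3, h4⟩
    rcases Nat.lt_or_ge q' q with hlt | hge
    · exact Or.inl ⟨q', h1, hlt, h3, h4⟩
    · obtain rfl : q' = q := by omega
      exact Or.inr ⟨h3, h4⟩
  · rintro (⟨q', h1, h2, h3⟩ | ⟨h1, h2⟩)
    · exact ⟨q', h1, by omega, h3⟩
    · exact ⟨q, hq, by omega, h1, h2⟩

theorem marks_succ_of_eq_zero {q : ℕ} (hq : 1 ≤ q) (h0 : (interval H q).2 = 0) :
    marks pth n H h (q + 1) = marks pth n H h q := by
  unfold marks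
  simp only [levelDone_succ hq, h0, ne_eq, not_true_eq_false, false_and, or_false]

theorem HeavySpec.marks_succ (hs : HeavySpec pth n H c h) {q : ℕ} (hq : 1 ≤ q)
    (h0 : (interval H q).2 ≠ 0) : marksPartial pth n H c h q n = marks pth n H h (q + 1) := by
  classical
  funext r l
  unfold marksPartial marks nodeF
  have hlen : IsRep pth n r l → ((pth r).take l).length = l := fun hr => by simp [hr.2.2.1]
  have hiff := hs.exists_showsHeavy_iff hq h0 r
  by_cases hl : l = midLevel H q
  · subst hl
    simp only [hiff, true_and, levelDone_succ hq, h0, ne_eq, not_false_eq_true]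
    by_cases hr : IsRep pth n r (midLevel H q)
    · simp only [hlen hr]
      by_cases hh : h ((pth r).take (midLevel H q)) <;> simp [hr, hh]
    · simp [hr]
  · simp only [hl, false_and, if_false, levelDone_succ hq]
    by_cases hr : IsRep pth n r l
    · simp only [hlen hr]
      simp [hr, Ne.symm hl]
    · simp [hr]

theorem marks_end
    (hlen : ∀ x, 1 ≤ x → x ≤ n → (pth x).length < H) :
    marks pth n H h (2 * H + 1) = nodeF pth n h := by
  classical
  funext r l
  unfold marks nodeF
  by_cases hr : IsRep pth n r l
  · have h1 : ((pth r).take l).length < H := by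
      have := hlen r hr.1 hr.2.1
      simp; omega
    have h2 := levelDone_all h1
    simp only [h2, and_true]
  · simp [hr]

theorem marks_one : marks pth n H h 1 = fun _ _ => 0 := by
  classical
  funext r l
  unfold marks nodeF
  rw [if_neg]
  rintro ⟨_, _, q, h1, h2, _⟩
  omega

end

section

/-! ### Correctness of the computation of the heavy nodes -/

variable {pth : ℕ → List ℕ} {n H : ℕ} {c : List ℕ → Bool} {h : List ℕ → Prop}
variable {check : ℕ → PMF Bool} {I : RamInput} {S V T : ℕ} {sh : Shape} {i : ℕ}

theorem rep_le_n {x l : ℕ} (hx : 1 ≤ x) (hxn : x ≤ n) : rep pth x l < n + 1 :=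
  Nat.lt_succ_of_le ((rep_le hx).trans hxn)

/-- Reading the representative of the node of the current point at some level. -/
theorem Holds.eval_rep {R : ℕ → ℕ} {G : ℕ → ℕ → ℕ → ℕ} {m : ℕ → ℕ}
    (hR : Holds S V sh R (overlay (trieF pth (fun _ => n) (fun _ => n)) G) m)
    (hrows : sh.rows = n + 1) {x l : ℕ} {e : RamExpr} (h4 : R 4 = x) (hx : 1 ≤ x) (hxn : x ≤ n)
    (hl : l < sh.W) (he : e.eval I m = l) :
    (RamExpr.mem (cellE (.lit 0) (rg 4) e)).eval I m = rep pth x l := by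
  rw [hR.eval_mem (f := 0) rfl ((hR.eval_rg (by norm_num)).trans h4) he (by norm_num) (by omega) hl,
    overlay_of_lt (by norm_num)]
  simp [trieF, hx, hxn]

theorem Holds.eval_nodeE {R : ℕ → ℕ} {G : ℕ → ℕ → ℕ → ℕ} {m : ℕ → ℕ}
    (hR : Holds S V sh R (overlay (trieF pth (fun _ => n) (fun _ => n)) G) m)
    (hrows : sh.rows = n + 1) {x l f : ℕ} {e : RamExpr} (h4 : R 4 = x) (hx : 1 ≤ x) (hxn : x ≤ n)
    (hl : l < sh.W) (he : e.eval I m = l) (hf : 4 ≤ f) (hf8 : f < 8) :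
    (nodeE f e).eval I m = G f (rep pth x l) l := by
  unfold nodeE
  rw [hR.eval_mem (f := f) rfl (hR.eval_rep hrows h4 hx hxn hl he) he hf8
    (hrows ▸ rep_le_n hx hxn) hl, overlay_of_le hf]

/-- What the condition of `markProg` says. -/
theorem eval_showsE (hI : TreeInput I i H n pth)
    (hrows : sh.rows = n + 1) (hHW : H < sh.W) {q J : ℕ} (hq : 1 ≤ q) (h0 : (interval H q).2 ≠ 0)
    (hJ : J < n) {R : ℕ → ℕ} {m : ℕ → ℕ} {Q : ℕ}
    (hR : Holds S V sh R (heavyF pth n H c (marksPartial pth n H c h q J) Q) m)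
    (h4 : R 4 = J + 1) (h5 : R 5 = midLevel H q) (h9 : R 9 = (interval H q).1)
    (h10 : R 10 = (interval H q).2) :
    showsE.eval I m ≠ 0 ↔ ShowsHeavy pth H c h q (J + 1) := by
  classical
  obtain ⟨a, ha⟩ : ∃ a, a = (interval H q).1 := ⟨_, rfl⟩
  obtain ⟨len, hlen⟩ : ∃ len, len = (interval H q).2 := ⟨_, rfl⟩
  have hend := interval_end_le H q hq h0
  have hadj := levelDone_adjacent H q hq h0
  have hlx := hI.length_lt (J + 1) (by omega) (by omega)
  have hmid : midLevel H q = a + len / 2 := by rw [midLevel, ha, hlen]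
  have e5 : (rg 5).eval I m = midLevel H q := (hR.eval_rg (by norm_num)).trans h5
  have e9 : (rg 9).eval I m = a := (hR.eval_rg (by norm_num)).trans (h9.trans ha.symm)
  have e10 : (rg 10).eval I m = len := (hR.eval_rg (by norm_num)).trans (h10.trans hlen.symm)
  rw [← ha, ← hlen] at hend hadj
  have hcoin : (nodeE 4 (rg 5)).eval I m ≠ 0 ↔ midLevel H q ≤ (pth (J + 1)).length ∧
      c ((pth (J + 1)).take (midLevel H q)) = true := by
    rw [hR.eval_nodeE hrows h4 (by omega) (by omega) (by omega) e5 (by norm_num) (by norm_num)]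
    simp only [if_true]
    exact nodeF_rep_ne_zero (by omega) (by omega)
  -- at the levels next to the interval the marks are final
  have hmark : ∀ l e, e.eval I m = l → l < sh.W → l ≠ midLevel H q → LevelDone H q l →
      ((nodeE 5 e).eval I m ≠ 0 ↔ l ≤ (pth (J + 1)).length ∧ h ((pth (J + 1)).take l)) := by
    intro l e he hl hne hd
    rw [hR.eval_nodeE hrows h4 (by omega) (by omega) hl he (by norm_num) (by norm_num)]
    simp only [marksPartial, hne, false_and, if_false, marks]
    rw [if_neg (by norm_num), if_pos trivial]
    refine (nodeF_rep_ne_zero (n := n) (x := J + 1) (by omega) (by omega)).trans ?_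
    refine and_congr_right fun hle => ?_
    simp [hle, hd]
  have habove : ((.sub (.lit 1) (rg 9) : RamExpr).eval I m +
      (nodeE 5 (.sub (rg 9) (.lit 1))).eval I m ≠ 0 ↔
      (a = 0 ∨ (a - 1 ≤ (pth (J + 1)).length ∧ h ((pth (J + 1)).take (a - 1))))) := by
    have e1 : (.sub (.lit 1) (rg 9) : RamExpr).eval I m = 1 - a := by
      rw [RamExpr.eval, e9]; rfl
    have e2 : (.sub (rg 9) (.lit 1) : RamExpr).eval I m = a - 1 := by
      rw [RamExpr.eval, e9]; rfl
    rw [e1]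
    rcases Nat.eq_zero_or_pos a with h | h
    · simp [h]
    · have h1 := hmark (a - 1) _ e2 (by omega) (by omega) (hadj.1.resolve_left (by omega))
      rw [Nat.sub_eq_zero_of_le h, zero_add, h1]
      simp [h.ne']
  have hbelow : (nodeE 5 (.add (rg 9) (rg 10))).eval I m ≠ 0 ↔
      a + len ≤ (pth (J + 1)).length ∧ h ((pth (J + 1)).take (a + len)) := by
    have e1 : (.add (rg 9) (rg 10) : RamExpr).eval I m = a + len := by
      rw [RamExpr.eval, e9, e10]
    rcases hadj.2 with h | h
    · rw [hR.eval_nodeE hrows h4 (by omega) (by omega) (by omega) e1 (by norm_num) (by norm_num),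
        rep_of_lt (by omega)]
      have hne : a + len ≠ midLevel H q := by omega
      simp only [marksPartial, hne, false_and, if_false, marks, nodeF, IsRep]
      simp
      omega
    · exact hmark _ _ e1 (by omega) (by omega) h
  unfold ShowsHeavy
  rw [← ha, ← hlen, ← habove, ← hbelow, ← hcoin]
  change _ + (_ + _) * _ ≠ 0 ↔ _
  rw [Ne, Nat.add_eq_zero_iff, mul_eq_zero, not_and_or, not_or]

theorem triple_skip {F : ℕ → ℕ → ℕ → ℕ} {C : (ℕ → ℕ) → Prop} {o₀ : List (ℕ × ℕ)} (hV : 0 < V)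
    (hC : ∀ R v, C R → C (Function.update R 15 v)) :
    Triple check I S V skip (At S V sh i H F C o₀) (At S V sh i H F C o₀) 1 := by
  rintro m o ⟨R, hR, h0, h2, hCR, ho⟩ K T ν hK
  refine good_reg hR (by norm_num) (by norm_num) (by norm_num) rfl hV fun m' hR' => ?_
  exact hK _ _ ⟨_, hR', by simpa using h0, by simpa using h2, hC _ _ hCR, ho⟩

/-- The registers while the interval with number `q` is treated. -/
def IntervalRegs (H q : ℕ) (R : ℕ → ℕ) : Prop :=
  R 8 = q ∧ R 5 = midLevel H q ∧ R 9 = (interval H q).1 ∧ R 10 = (interval H q).2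

/-- One point of one interval. -/
theorem triple_mark (hI : TreeInput I i H n pth)
    (hrows : sh.rows = n + 1) (hHW : H < sh.W) (hV : 1 < V) {q J Q : ℕ} (hq : 1 ≤ q)
    (h0 : (interval H q).2 ≠ 0) (hJ : J < n) (o₀ : List (ℕ × ℕ)) :
    Triple check I S V markProg
      (At S V sh i H (heavyF pth n H c (marksPartial pth n H c h q J) Q)
        (fun R => IntervalRegs H q R ∧ R 4 = J + 1) o₀)
      (At S V sh i H (heavyF pth n H c (marksPartial pth n H c h q (J + 1)) Q)
        (fun R => IntervalRegs H q R ∧ R 4 = J + 1) o₀) 2 := by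
  refine Triple.ifElse ?_ ?_
  · rintro m o ⟨⟨R, hR, hR0, hR2, ⟨hIR, h4⟩, ho⟩, he⟩ K T ν hK
    have hsh := (eval_showsE hI hrows hHW hq h0 hJ hR h4 hIR.2.1 hIR.2.2.1 hIR.2.2.2).1 he
    have e5 : (rg 5).eval I m = midLevel H q := (hR.eval_rg (by norm_num)).trans hIR.2.1
    have hl := hsh.le
    have hlen := hI.length_lt (J + 1) (by omega) (by omega)
    refine good_cell hR (f := 5) (v := 1) rfl
      (hR.eval_rep hrows h4 (by omega) (by omega) (by omega) e5) e5 (by norm_num)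
      (hrows ▸ rep_le_n (by omega) (by omega)) (by omega) rfl hV fun m' hR' => ?_
    rw [heavyF_mark, marksPartial_succ_of_shows hsh] at hR'
    exact hK _ _ ⟨R, hR', hR0, hR2, ⟨hIR, h4⟩, ho⟩
  · rintro m o ⟨⟨R, hR, hR0, hR2, ⟨hIR, h4⟩, ho⟩, he⟩ K T ν hK
    have hsh := (eval_showsE hI hrows hHW hq h0 hJ hR h4 hIR.2.1 hIR.2.2.1 hIR.2.2.2).not.1
      (not_not.2 he)
    rw [← marksPartial_succ_of_not hsh] at hR
    refine triple_skip (C := fun R => IntervalRegs H q R ∧ R 4 = J + 1) (by omega) ?_ m o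
      ⟨R, hR, hR0, hR2, ⟨hIR, h4⟩, ho⟩ K T ν hK
    rintro R v ⟨h1, h2⟩
    exact ⟨by simpa [IntervalRegs] using h1, by simpa using h2⟩

/-- One interval: its halves are entered into the table, and its middle level is marked. -/
theorem triple_interval (hs : HeavySpec pth n H c h) (hI : TreeInput I i H n pth)
    (hrows : sh.rows = n + 1) (hHW : 4 * H + 4 ≤ sh.W) (hSV : S ≤ V) {q : ℕ}
    (hq : 1 ≤ q) (hqH : q ≤ 2 * H) (o₀ : List (ℕ × ℕ)) :
    Triple check I S V intervalProg
      (At S V sh i H (heavyF pth n H c (marks pth n H h q) (2 * q)) (fun R => R 8 = q) o₀)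
      (At S V sh i H (heavyF pth n H c (marks pth n H h (q + 1)) (2 * (q + 1)))
        (fun R => R 8 = q + 1) o₀) (n * 5 + 20) := by
  rintro m o ⟨R, hR, hR0, hR2, h8, ho⟩ K T ν hK
  have hW := hR.W_lt (by omega)
  have hsum := interval_sum_le H q hq
  obtain ⟨a, ha⟩ : ∃ a, a = (interval H q).1 := ⟨_, rfl⟩
  obtain ⟨len, hlen⟩ : ∃ len, len = (interval H q).2 := ⟨_, rfl⟩
  rw [← ha, ← hlen] at hsum
  -- read the interval
  refine (good_seq (T := T + (n * 5 + 18) + 1) ?_).mono (by omega)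
  refine good_reg hR (v := a) (by norm_num) (by norm_num) (by norm_num) ?_ (by omega)
    fun m₁ hR₁ => ?_
  · rw [hR.eval_mem (f := 6) (r := 0) rfl rfl ((hR.eval_rg (by norm_num)).trans h8) (by norm_num)
      (by omega) (by omega)]
    simp [heavyF, overlay, ha, hq]
    omega
  refine (good_seq (T := T + (n * 5 + 16) + 1) ?_).mono (by omega)
  refine good_reg hR₁ (v := len) (by norm_num) (by norm_num) (by norm_num) ?_ (by omega)
    fun m₂ hR₂ => ?_
  · rw [hR₁.eval_mem (f := 7) (r := 0) rfl rfl
        ((hR₁.eval_rg (by norm_num)).trans (by simpa using h8))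
      (by norm_num) (by omega) (by omega)]
    simp [heavyF, overlay, hlen, hq]
    omega
  -- write its two halves
  obtain ⟨R₂, hR₂'⟩ : ∃ R₂, R₂ = Function.update (Function.update R 9 a) 10 len := ⟨_, rfl⟩
  rw [← hR₂'] at hR₂
  have h8' : R₂ 8 = q := by simpa [hR₂'] using h8
  have h9' : R₂ 9 = a := by simp [hR₂']
  have h10' : R₂ 10 = len := by simp [hR₂']
  have h0' : R₂ 0 = i := by simpa [hR₂'] using hR0
  have h2' : R₂ 2 = H := by simpa [hR₂'] using hR2
  clear hR₂'
  refine (good_seq (T := T + (n * 5 + 14) + 1) ?_).mono (by omega)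
  refine good_cell hR₂ (f := 6) (r := 0) (l := 2 * q) (v := a) rfl rfl
    (by simp only [RamExpr.eval, hR₂.reg 8 (by norm_num), h8']) (by norm_num) (by omega) (by omega)
    ((hR₂.eval_rg (by norm_num)).trans h9') (by omega) fun m₃ hR₃ => ?_
  refine (good_seq (T := T + (n * 5 + 12) + 1) ?_).mono (by omega)
  refine good_cell hR₃ (f := 7) (r := 0) (l := 2 * q) (v := len / 2) rfl rfl
    (by simp only [RamExpr.eval, hR₃.reg 8 (by norm_num), h8']) (by norm_num) (by omega) (by omega)
    (by simp only [RamExpr.eval, hR₃.reg 10 (by norm_num), h10']) (by omega) fun m₄ hR₄ => ?_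
  refine (good_seq (T := T + (n * 5 + 10) + 1) ?_).mono (by omega)
  refine good_cell hR₄ (f := 6) (r := 0) (l := 2 * q + 1) (v := a + len / 2 + 1) rfl rfl
    (by simp only [RamExpr.eval, hR₄.reg 8 (by norm_num), h8']) (by norm_num) (by omega) (by omega)
    (by simp only [RamExpr.eval, hR₄.reg 10 (by norm_num), hR₄.reg 9 (by norm_num), h10', h9'])
    (by omega) fun m₅ hR₅ => ?_
  refine (good_seq (T := T + (n * 5 + 8) + 1) ?_).mono (by omega)
  refine good_cell hR₅ (f := 7) (r := 0) (l := 2 * q + 1) (v := len - len / 2 - 1) rfl rfl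
    (by simp only [RamExpr.eval, hR₅.reg 8 (by norm_num), h8']) (by norm_num) (by omega) (by omega)
    (by simp only [RamExpr.eval, hR₅.reg 10 (by norm_num), h10'])
    (by omega) fun m₆ hR₆ => ?_
  rw [ha, hlen, heavyF_children hq] at hR₆
  -- update the marks
  refine (good_seq (T := T + (n * 5 + 7)) ?_).mono (by omega)
  have hnext : ∀ m' o', At S V sh i H (heavyF pth n H c (marks pth n H h (q + 1)) (2 * (q + 1)))
      (fun R => R 8 = q) o₀ m' o' →
      Good check I S V (T + 1) ν ⟨.store (.lit 8) (.add (rg 8) (.lit 1)) :: K, m', o'⟩ := by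
    rintro m' o' ⟨R', hR', h0, h2, h8, ho'⟩
    refine good_reg hR' (v := q + 1) (by norm_num) (by norm_num) (by norm_num)
      (by simp only [RamExpr.eval, hR'.reg 8 (by norm_num), h8]) (by omega) fun m'' hR'' => ?_
    exact hK _ _ ⟨_, hR'', by simpa using h0, by simpa using h2, by simp, ho'⟩
  have e10 : (rg 10).eval I m₆ = len := (hR₆.eval_rg (by norm_num)).trans h10'
  by_cases hz : len = 0
  · rw [← marks_succ_of_eq_zero hq (hlen ▸ hz)] at hR₆
    refine (good_if_neg (T := T + 1 + 1) (e10.trans hz) ?_).mono (by omega)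
    exact triple_skip (C := fun R => R 8 = q) (by omega) (fun R v hv => by simpa using hv) m₆ o
      ⟨R₂, hR₆, h0', h2', h8', ho⟩ _ (T + 1) ν hnext
  · have hmid : midLevel H q = a + len / 2 := by rw [midLevel, ha, hlen]
    have hne : (interval H q).2 ≠ 0 := hlen ▸ hz
    refine (good_if_pos (T := T + (n * 5 + 6)) (by rw [e10]; exact hz) ?_).mono (by omega)
    refine (good_seq (T := T + (n * 5 + 4) + 1) ?_).mono (by omega)
    refine good_reg hR₆ (v := midLevel H q) (by norm_num) (by norm_num) (by norm_num) ?_ (by omega)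
      fun m₇ hR₇ => ?_
    · simp only [RamExpr.eval, hR₆.reg 10 (by norm_num), hR₆.reg 9 (by norm_num), h10', h9', hmid]
    have hfor := triple_forPoints (check := check) (i := i) (H := H) hI.numPoints hrows (by omega)
        hSV
      (p := markProg) (fun J => heavyF pth n H c (marksPartial pth n H c h q J) (2 * (q + 1)))
      (IntervalRegs H q) (fun R v hv => by simpa [IntervalRegs] using hv) (fun _ => o₀) (c := 2)
      (fun J hJ => triple_mark hI hrows (by omega) (by omega) hq hne hJ o₀)
    rw [marksPartial_zero, hs.marks_succ hq hne] at hfor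
    refine (hfor m₇ o ⟨_, hR₇, by simpa using h0', by simpa using h2', ?_, ho⟩ _ (T + 1) ν ?_).mono
      (by omega)
    · exact ⟨by simpa using h8', by simp, by simpa [ha] using h9', by simpa [hlen] using h10'⟩
    · rintro m' o' ⟨R', hR', h1, h2, h3, h4⟩
      exact hnext m' o' ⟨R', hR', h1, h2, h3.1, h4⟩

theorem heavyF_start : setF (overlay (trieF pth (fun _ => n) (fun _ => n)) fun f r l =>
      if f = 4 then nodeF pth n (fun u => c u = true) r l else 0) 7 0 1 H =
    heavyF pth n H c (marks pth n H h 1) (2 * 1) := by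
  unfold heavyF
  rw [setF_overlay (by norm_num), marks_one]
  congr 1
  funext f r l
  unfold setF
  by_cases h4 : f = 4
  · simp [h4]
  · by_cases h7 : f = 7
    · subst h7
      by_cases hrl : r = 0 ∧ l = 1
      · simp [hrl.1, hrl.2, interval_one]
      · have : ¬ (r = 0 ∧ 1 ≤ l ∧ l < 2) := fun ⟨h1, h2, h3⟩ => hrl ⟨h1, by omega⟩
        simp only [hrl, this, and_false, if_false]
        simp
    · by_cases h6 : f = 6
      · subst h6
        have : (r = 0 ∧ 1 ≤ l ∧ l < 2) → (interval H l).1 = 0 := fun ⟨h1, h2, h3⟩ => by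
          obtain rfl : l = 1 := by omega
          rw [interval_one]
        simp
        exact fun h1 h2 h3 => (this ⟨h1, h2, by omega⟩).symm
      · simp [h4, h7, h6]

theorem triple_heavy (hs : HeavySpec pth n H c h) (hI : TreeInput I i H n pth)
    (hrows : sh.rows = n + 1) (hHW : 4 * H + 4 ≤ sh.W) (hSV : S ≤ V) (o₀ : List (ℕ × ℕ)) :
    Triple check I S V heavyProg
      (At S V sh i H (overlay (trieF pth (fun _ => n) (fun _ => n)) fun f r l =>
        if f = 4 then nodeF pth n (fun u => c u = true) r l else 0) (fun _ => True) o₀)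
      (At S V sh i H (heavyF pth n H c (nodeF pth n h) (2 * (2 * H + 1))) (fun _ => True) o₀)
      (2 * H * (n * 5 + 21) + 5) := by
  have hloop := Triple.loop (check := check) (I := I) (S := S) (V := V)
    (e := .sub (.add (.mul (.lit 2) (rg 2)) (.lit 1)) (rg 8)) (p := intervalProg)
    (fun x => At S V sh i H (heavyF pth n H c (marks pth n H h (x + 1)) (2 * (x + 1)))
      (fun R => R 8 = x + 1) o₀) (c := n * 5 + 20) (2 * H)
    (by
      rintro x hx m o ⟨R, hR, _, h2, h8, _⟩
      simp only [RamExpr.eval, hR.reg 8 (by norm_num), hR.reg 2 (by norm_num), h8, h2]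
      omega)
    (fun x hx => triple_interval hs hI hrows hHW hSV (by omega) (by omega) o₀)
  rw [marks_end hI.length_lt] at hloop
  rintro m o ⟨R, hR, hR0, hR2, _, ho⟩ K T ν hK
  have hW := hR.W_lt (by omega)
  have hmul : 2 * H * (n * 5 + 20 + 1) = 2 * H * (n * 5 + 21) := rfl
  refine (good_seq (T := T + (2 * H * (n * 5 + 21) + 3) + 1) ?_).mono (by omega)
  refine good_cell hR (f := 7) (r := 0) (l := 1) (v := H) rfl rfl rfl (by norm_num) (by omega)
    (by omega) ((hR.eval_rg (by norm_num)).trans hR2) (by omega) fun m₁ hR₁ => ?_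
  rw [heavyF_start (h := h)] at hR₁
  refine (good_seq (T := T + (2 * H * (n * 5 + 21) + 1) + 1) ?_).mono (by omega)
  refine good_reg hR₁ (v := 1) (by norm_num) (by norm_num) (by norm_num) rfl (by omega)
    fun m₂ hR₂ => ?_
  refine hloop m₂ o ⟨_, hR₂, by simpa using hR0, by simpa using hR2, by simp, ho⟩ K T ν ?_
  rintro m' o' ⟨R', hR', h1, h2, h3, h4⟩
  exact hK _ _ ⟨R', hR', h1, h2, trivial, h4⟩

end

section

/-! ### Output of the heavy nodes -/

theorem nodeLabel_take_succ {p : List ℕ} {l : ℕ} (hl : l < p.length) :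
    nodeLabel (p.take (l + 1)) = 2 * nodeLabel (p.take l) + (pathBranch p l - 1) := by
  rw [← List.take_append_getElem hl, nodeLabel, List.foldl_append, pathBranch,
    List.getElem?_eq_getElem hl]
  rfl

theorem nodeLabel_lt {p : List ℕ} (hp : ∀ l, pathBranch p l ≤ 2) {l : ℕ} (hl : l ≤ p.length) :
    1 ≤ nodeLabel (p.take l) ∧ nodeLabel (p.take l) < 2 ^ (l + 1) := by
  induction l with
  | zero => simp [nodeLabel]
  | succ l ih =>
    have h1 := ih (by omega)
    have h2 := hp l
    rw [nodeLabel_take_succ (by omega), pow_succ]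
    omega

/-- The heavy nodes among the first `l` nodes of the path `p` of tree `i`. -/
def emitted (i : ℕ) (h : List ℕ → Prop) (p : List ℕ) : ℕ → List (ℕ × ℕ)
  | 0 => []
  | l + 1 => by
    classical
    exact emitted i h p l ++ if h (p.take l) then [(i, nodeLabel (p.take l))] else []

theorem mem_emitted {i : ℕ} {h : List ℕ → Prop} {p : List ℕ} {l : ℕ} {x : ℕ × ℕ} :
    x ∈ emitted i h p l ↔ ∃ l' < l, h (p.take l') ∧ x = (i, nodeLabel (p.take l')) := by
  induction l with
  | zero => simp [emitted]
  | succ l ih =>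
    rw [emitted, List.mem_append, ih]
    constructor
    · rintro (⟨l', h1, h2⟩ | hx)
      · exact ⟨l', by omega, h2⟩
      · split_ifs at hx with hh
        · exact ⟨l, by omega, hh, by simpa using hx⟩
        · simp at hx
    · rintro ⟨l', h1, h2, h3⟩
      rcases Nat.lt_or_ge l' l with hlt | hge
      · exact Or.inl ⟨l', hlt, h2, h3⟩
      · obtain rfl : l' = l := by omega
        right
        rw [if_pos h2, h3]; simp

/-- The heavy nodes on the paths `pth 1, …, pth J` of tree `i`. -/
def emittedAll (i : ℕ) (h : List ℕ → Prop) (pth : ℕ → List ℕ) : ℕ → List (ℕ × ℕ)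
  | 0 => []
  | J + 1 => emittedAll i h pth J ++ emitted i h (pth (J + 1)) ((pth (J + 1)).length + 1)

theorem mem_emittedAll {i : ℕ} {h : List ℕ → Prop} {pth : ℕ → List ℕ} {J : ℕ} {x : ℕ × ℕ} :
    x ∈ emittedAll i h pth J ↔
      ∃ y, 1 ≤ y ∧ y ≤ J ∧ ∃ u, u <+: pth y ∧ h u ∧ x = (i, nodeLabel u) := by
  induction J with
  | zero =>
    simp only [emittedAll, List.not_mem_nil, false_iff]
    rintro ⟨y, h1, h2, _⟩
    omega
  | succ J ih =>
    rw [emittedAll, List.mem_append, ih, mem_emitted]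
    constructor
    · rintro (⟨y, h1, h2, h3⟩ | ⟨l, h1, h2, h3⟩)
      · exact ⟨y, h1, by omega, h3⟩
      · exact ⟨J + 1, by omega, le_rfl, _, List.take_prefix _ _, h2, h3⟩
    · rintro ⟨y, h1, h2, u, hu, hh, hx⟩
      rcases Nat.lt_or_ge J y with hlt | hge
      · obtain rfl : y = J + 1 := by omega
        have hut := List.prefix_iff_eq_take.1 hu
        have hlen := hu.length_le
        exact Or.inr ⟨u.length, by omega, by rw [← hut]; exact ⟨hh, hx⟩⟩
      · exact Or.inl ⟨y, h1, hge, u, hu, hh, hx⟩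

/-- Output the node at level (register `5`) of the path of the current point, if it is heavy, and
proceed to the next level. -/
def emitStep : RamProg := progs
  [.ifElse (nodeE 5 (rg 5)) (.emit (rg 0) (rg 11)) skip,
   .store (.lit 11) (.add (.mul (.lit 2) (rg 11)) (.sub branchE (.lit 1))),
   .store (.lit 5) (.add (rg 5) (.lit 1))]

/-- Output the heavy nodes on the path of the current point. -/
def emitPath : RamProg := progs
  [.store (.lit 5) (.lit 0), .store (.lit 11) (.lit 1),
   .loop (.mem (cellE (.lit 0) (rg 4) (rg 5))) emitStep]

/-- Output all heavy nodes, possibly several times. -/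
def emitProg : RamProg := forPoints emitPath

variable {pth : ℕ → List ℕ} {n H : ℕ} {h : List ℕ → Prop} {G : ℕ → ℕ → ℕ → ℕ}
variable {check : ℕ → PMF Bool} {I : RamInput} {S V T : ℕ} {sh : Shape} {i : ℕ}

theorem triple_emitStep (hI : TreeInput I i H n pth) (hrows : sh.rows = n + 1) (hHW : H < sh.W)
    (hSV : S ≤ V) (h2V : 2 ^ (H + 1) ≤ V) (hG : ∀ r l, G 5 r l = nodeF pth n h r l) {J l : ℕ}
    (hJ : J < n) (hl : l ≤ (pth (J + 1)).length) (o₀ : List (ℕ × ℕ)) :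
    Triple check I S V emitStep
      (At S V sh i H (overlay (trieF pth (fun _ => n) (fun _ => n)) G)
        (fun R => R 4 = J + 1 ∧ R 5 = l ∧ R 11 = nodeLabel ((pth (J + 1)).take l))
        (o₀ ++ emitted i h (pth (J + 1)) l))
      (At S V sh i H (overlay (trieF pth (fun _ => n) (fun _ => n)) G)
        (fun R => R 4 = J + 1 ∧ R 5 = l + 1 ∧ (l + 1 ≤ (pth (J + 1)).length →
          R 11 = nodeLabel ((pth (J + 1)).take (l + 1))))
        (o₀ ++ emitted i h (pth (J + 1)) (l + 1))) 6 := by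
  classical
  rintro m o ⟨R, hR, h0, h2, ⟨h4, h5, h11⟩, ho⟩ K T ν hK
  have hlen := hI.length_lt (J + 1) (by omega) (by omega)
  have hW := hR.W_lt (by omega)
  have hbin := hI.binary (J + 1) (by omega) (by omega)
  have hlab := nodeLabel_lt hbin hl
  have hb := hbin l
  have hpow : 2 ^ (l + 1) * 2 ≤ V := by
    rw [← pow_succ]
    exact (Nat.pow_le_pow_right (by norm_num) (by omega)).trans h2V
  have e5 : (rg 5).eval I m = l := (hR.eval_rg (by norm_num)).trans h5
  have hcond : (nodeE 5 (rg 5)).eval I m ≠ 0 ↔ h ((pth (J + 1)).take l) := by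
    rw [hR.eval_nodeE hrows h4 (by omega) (by omega) (by omega) e5 (by norm_num) (by norm_num), hG]
    refine (nodeF_rep_ne_zero (by omega) (by omega)).trans ?_
    simp [hl]
  have hrest : ∀ m', At S V sh i H (overlay (trieF pth (fun _ => n) (fun _ => n)) G)
        (fun R => R 4 = J + 1 ∧ R 5 = l ∧ R 11 = nodeLabel ((pth (J + 1)).take l))
        (o₀ ++ emitted i h (pth (J + 1)) (l + 1)) m' (o₀ ++ emitted i h (pth (J + 1)) (l + 1)) →
      Good check I S V (T + 3) ν
        ⟨.seq (.store (.lit 11) (.add (.mul (.lit 2) (rg 11)) (.sub branchE (.lit 1))))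
          (.store (.lit 5) (.add (rg 5) (.lit 1))) :: K, m',
          o₀ ++ emitted i h (pth (J + 1)) (l + 1)⟩ := by
    rintro m' ⟨R', hR', h0, h2, ⟨h4, h5, h11⟩, _⟩
    have eb := eval_branchE hI hR' h0 h4 h5 (by omega) (by omega)
    refine good_seq (T := T + 1 + 1) ?_
    refine good_reg hR' (v := 2 * nodeLabel ((pth (J + 1)).take l) +
        (pathBranch (pth (J + 1)) l - 1))
      (by norm_num) (by norm_num) (by norm_num) ?_ (by omega) fun m₁ hR₁ => ?_
    · simp only [RamExpr.eval, hR'.reg 11 (by norm_num), h11, eb]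
    refine good_reg hR₁ (v := l + 1) (by norm_num) (by norm_num) (by norm_num) ?_ (by omega)
      fun m₂ hR₂ => ?_
    · simp only [RamExpr.eval, hR₁.reg 5 (by norm_num)]
      simpa using h5
    refine hK _ _ ⟨_, hR₂, by simpa using h0, by simpa using h2, ⟨by simpa using h4, by simp, ?_⟩,
        rfl⟩
    intro hl'
    rw [nodeLabel_take_succ hl']
    simp
  have hsucc : emitted i h (pth (J + 1)) (l + 1) = emitted i h (pth (J + 1)) l ++
      if h ((pth (J + 1)).take l) then [(i, nodeLabel ((pth (J + 1)).take l))] else [] := rfl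
  refine good_seq (T := T + 3 + 1 + 1) ?_
  by_cases hh : h ((pth (J + 1)).take l)
  · refine good_if_pos (hcond.2 hh) ?_
    refine good_emit ((hR.eval_rg (by norm_num)).trans h0) ((hR.eval_rg (by norm_num)).trans h11) ?_
    rw [if_pos hh] at hsucc
    rw [ho, List.append_assoc, ← hsucc]
    exact hrest m ⟨R, hR, h0, h2, ⟨h4, h5, h11⟩, rfl⟩
  · refine good_if_neg (not_not.1 (hcond.not.2 hh)) ?_
    rw [if_neg hh, List.append_nil] at hsucc
    rw [ho, ← hsucc]
    refine triple_skip (C := fun R => R 4 = J + 1 ∧ R 5 = l ∧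
      R 11 = nodeLabel ((pth (J + 1)).take l)) (by omega) (fun R v hv => by simpa using hv) m _
      ⟨R, hR, h0, h2, ⟨h4, h5, h11⟩, rfl⟩ _ (T + 3) ν ?_
    intro m' o' hm'
    obtain ⟨R', _, _, _, _, rfl⟩ := hm'
    rename_i a b c d
    exact hrest m' ⟨R', a, b, c, d, rfl⟩

theorem triple_emitPath (hI : TreeInput I i H n pth) (hrows : sh.rows = n + 1) (hHW : H < sh.W)
    (hSV : S ≤ V) (h2V : 2 ^ (H + 1) ≤ V) (hG : ∀ r l, G 5 r l = nodeF pth n h r l) {J : ℕ}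
    (hJ : J < n) (o₀ : List (ℕ × ℕ)) :
    Triple check I S V emitPath
      (At S V sh i H (overlay (trieF pth (fun _ => n) (fun _ => n)) G)
        (fun R => True ∧ R 4 = J + 1) o₀)
      (At S V sh i H (overlay (trieF pth (fun _ => n) (fun _ => n)) G)
        (fun R => True ∧ R 4 = J + 1)
        (o₀ ++ emitted i h (pth (J + 1)) ((pth (J + 1)).length + 1))) (7 * H + 5) := by
  have hlen := hI.length_lt (J + 1) (by omega) (by omega)
  have hloop := Triple.loop (check := check) (I := I) (S := S) (V := V)
    (e := .mem (cellE (.lit 0) (rg 4) (rg 5))) (p := emitStep)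
    (fun l => At S V sh i H (overlay (trieF pth (fun _ => n) (fun _ => n)) G)
        (fun R => R 4 = J + 1 ∧ R 5 = l ∧ (l ≤ (pth (J + 1)).length →
          R 11 = nodeLabel ((pth (J + 1)).take l)))
        (o₀ ++ emitted i h (pth (J + 1)) l)) (c := 6) ((pth (J + 1)).length + 1)
    (by
      rintro l hl m o ⟨R, hR, h0, h2, ⟨h4, h5, _⟩, _⟩
      rw [hR.eval_rep hrows h4 (by omega) (by omega) (by omega)
          ((hR.eval_rg (by norm_num)).trans h5),
        rep_ne_zero (by omega)]
      omega)
    (fun l hl => (triple_emitStep hI hrows hHW hSV h2V hG hJ (by omega) o₀).mono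
      (fun m o ⟨R, hR, h0, h2, ⟨h4, h5, h11⟩, ho⟩ =>
        ⟨R, hR, h0, h2, ⟨h4, h5, h11 (by omega)⟩, ho⟩) (fun _ _ h => h) le_rfl)
  rintro m o ⟨R, hR, h0, h2, ⟨_, h4⟩, ho⟩ K T ν hK
  have hW := hR.W_lt (by omega)
  refine (good_seq (T := T + (((pth (J + 1)).length + 1) * (6 + 1) + 1) + 1 + 1 + 1) ?_).mono
    (by omega)
  refine good_reg hR (by norm_num) (by norm_num) (by norm_num) (v := 0) rfl (by omega)
    fun m₁ hR₁ => ?_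
  refine good_seq ?_
  refine good_reg hR₁ (by norm_num) (by norm_num) (by norm_num) (v := 1) rfl (by omega)
    fun m₂ hR₂ => ?_
  refine hloop m₂ o ⟨_, hR₂, by simpa using h0, by simpa using h2,
    ⟨by simpa using h4, by simp, by simp [nodeLabel]⟩, by simpa [emitted] using ho⟩ K T ν ?_
  rintro m' o' ⟨R', hR', h0', h2', ⟨h4', _⟩, ho'⟩
  exact hK _ _ ⟨R', hR', h0', h2', ⟨trivial, h4'⟩, ho'⟩

theorem triple_emit (hI : TreeInput I i H n pth) (hrows : sh.rows = n + 1) (hHW : H < sh.W)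
    (hSV : S ≤ V) (h2V : 2 ^ (H + 1) ≤ V) (hG : ∀ r l, G 5 r l = nodeF pth n h r l)
    (o₀ : List (ℕ × ℕ)) :
    Triple check I S V emitProg
      (At S V sh i H (overlay (trieF pth (fun _ => n) (fun _ => n)) G) (fun _ => True) o₀)
      (At S V sh i H (overlay (trieF pth (fun _ => n) (fun _ => n)) G) (fun _ => True)
        (o₀ ++ emittedAll i h pth n)) (n * (7 * H + 8) + 3) := by
  have := triple_forPoints (check := check) (i := i) (H := H) hI.numPoints hrows (by omega) hSV
    (fun _ => overlay (trieF pth (fun _ => n) (fun _ => n)) G) (fun _ => True)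
      (fun _ _ _ => trivial)
    (fun J => o₀ ++ emittedAll i h pth J) (c := 7 * H + 5)
    (fun J hJ => by
      have := triple_emitPath (check := check) hI hrows hHW hSV h2V hG hJ
          (o₀ ++ emittedAll i h pth J)
      rwa [List.append_assoc] at this)
  change Triple check I S V emitProg _ _ _ at this
  simpa [emittedAll] using this

/-! ### One tree -/

theorem good_store {ν : PMF (Set (ℕ × ℕ))} {m : ℕ → ℕ} {o : List (ℕ × ℕ)} {K : List RamProg}
    {a e : RamExpr} {addr v : ℕ} (hm : MemOk S V m) (ha : a.eval I m = addr) (he : e.eval I m = v)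
    (h : Good check I S V T ν ⟨K, Function.update m addr v, o⟩) :
    Good check I S V (T + 1) ν ⟨.store a e :: K, m, o⟩ :=
  Good.of_step (c := ⟨.store a e :: K, m, o⟩) hm (by rw [ramStep, ha, he]) h

/-- A state between the treatment of two trees: tree `i` is next, and the memory from cell `base`
on has not been used. -/
structure Idle (S V base i : ℕ) (m : ℕ → ℕ) : Prop where
  tree : m 0 = i
  reg_base : m 1 = base
  fresh : ∀ a, base ≤ a → m a = 0
  ok : MemOk S V m
  base_le : 16 ≤ base

/-- Treat the tree whose number is in register `0`.  The table has `4 * H + 4` columns, because the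
intervals that are entered into row `0` have numbers up to `4 * H + 1`. -/
def treeProg : RamProg := progs
  [.store (.lit 2) (.height (rg 0)),
   .store (.lit 3) (.add (.mul (.lit 4) (rg 2)) (.lit 4)),
   trieProg, coinsProg, heavyProg, emitProg,
   .store (.lit 1) (.add (rg 1) (.mul (.lit 8) (.mul (.add .numPoints (.lit 1)) (rg 3)))),
   .store (.lit 0) (.add (rg 0) (.lit 1))]

/-- The number of steps for one tree. -/
def treeTime (n H : ℕ) : ℕ :=
  n * (12 * H + 13) + (n + 1) * (4 * H + 4) * 4 + 2 * H * (n * 5 + 21) + n * (7 * H + 8) + 30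

/-- The treatment of one tree: afterwards the heavy nodes for random coins `c` have been added to
the output, and the memory behind the table is ready for the next tree. -/
theorem good_tree (hI : TreeInput I i H n pth) (hH : 0 < H) (hSV : S ≤ V) (h2V : 2 ^ (H + 1) ≤ V)
    (hcheck : check 0 = PMF.pure false) {us : List (List ℕ)} (hus : us.Nodup)
    (hmem : ∀ x, 1 ≤ x → x ≤ n → ∀ l, (pth x).take l ∈ us) {h : (List ℕ → Bool) → List ℕ → Prop}
    (hs : ∀ c, (∀ u, pathCount pth n u = 0 → c u = false) → HeavySpec pth n H c (h c))
    {base : ℕ} (hS : base + 8 * ((n + 1) * (4 * H + 4)) < S) {m : ℕ → ℕ} {o : List (ℕ × ℕ)}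
    (hm : Idle S V base i m) {K : List RamProg} {rest : (List ℕ → Bool) → PMF (Set (ℕ × ℕ))}
    (hiV : i + 1 < V)
    (hK : ∀ c m' o', (∀ u, pathCount pth n u = 0 → c u = false) →
      Idle S V (base + 8 * ((n + 1) * (4 * H + 4))) (i + 1) m' →
      (∀ p, p ∈ o' ↔ p ∈ o ∨ ∃ u, h c u ∧ p = (i, nodeLabel u)) →
      Good check I S V T (rest c) ⟨K, m', o'⟩) :
    Good check I S V (T + treeTime n H)
      ((coins (fun u => check (pathCount pth n u)) us).bind rest) ⟨treeProg :: K, m, o⟩ := by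
  have hb := hm.base_le
  have hbig : 4 * H + 4 ≤ (n + 1) * (4 * H + 4) := Nat.le_mul_of_pos_left _ (by omega)
  have hVS : base + 8 * ((n + 1) * (4 * H + 4)) < V := hS.trans_le hSV
  obtain ⟨sh, hsh⟩ : ∃ sh : Shape, sh = ⟨base, 4 * H + 4, n + 1⟩ := ⟨_, rfl⟩
  have hWsh : sh.W = 4 * H + 4 := by rw [hsh]
  have hrows : sh.rows = n + 1 := by rw [hsh]
  have hbsh : sh.base = base := by rw [hsh]
  obtain ⟨T₁, hT₁⟩ : ∃ T₁, T₁ = T + 3 + (n * (7 * H + 8) + 3) + 1 +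
    (2 * H * (n * 5 + 21) + 5) + 1 + ((n + 1) * sh.W * 4 + 3) + 1 + (n * (12 * H + 13) + 3) + 1 :=
    ⟨_, rfl⟩
  refine (good_seq (T := T₁ + 1 + 1 + 1) ?_).mono (by rw [hT₁, hWsh, treeTime]; omega)
  refine good_store (addr := 2) (v := H) hm.ok rfl ?_ (good_seq ?_)
  · simp only [RamExpr.eval, hm.tree, hI.height]
  have hok := hm.ok.update (a := 2) (v := H) (by omega) (by omega)
  refine good_store (addr := 3) (v := 4 * H + 4) hok rfl ?_ ?_
  · simp only [RamExpr.eval, Function.update_self]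
  -- the memory is now set up for this tree
  have hstart : At S V sh i H (fun _ _ _ => 0) (fun _ => True) o
      (Function.update (Function.update m 2 H) 3 (4 * H + 4)) o := by
    have hz : ∀ a, base ≤ a → Function.update (Function.update m 2 H) 3 (4 * H + 4) a = 0 :=
      fun a ha => by
        rw [Function.update_of_ne (by omega), Function.update_of_ne (by omega), hm.fresh a ha]
    refine ⟨Function.update (Function.update m 2 H) 3 (4 * H + 4), ⟨fun _ _ => rfl, ?_, ?_,
      hok.update (by omega) (by omega), by omega, by rw [hbsh, hrows, hWsh]; exact hS.le, ?_, ?_⟩,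
      ?_, ?_, trivial, rfl⟩
    · intro f _ r _ l _
      exact hz _ (by rw [Shape.cell, hbsh]; omega)
    · intro a ha
      exact hz _ (by omega)
    · simp [hm.reg_base, hbsh]
    · simp [hWsh]
    · simp [hm.tree]
    · simp
  rw [hT₁]
  refine good_seq ?_
  refine triple_trie hI hrows (by omega) hH hSV (by omega) o _ o hstart _ _ _ fun m₂ o₂ hm₂ => ?_
  refine good_seq ?_
  have ho₂ : o₂ = o := by obtain ⟨_, _, _, _, _, h⟩ := hm₂; exact h
  refine good_coins hI hrows (by omega) hH (by rw [hWsh]; omega) (by omega) hcheck hus o hmem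
    (fun c hc m₃ o₃ hm₃ => ?_) hm₂
  refine good_seq ?_
  refine triple_heavy (hs c hc) hI hrows (by omega) hSV o _ _ hm₃ _ _ _ fun m₄ o₄ hm₄ => ?_
  refine good_seq ?_
  refine triple_emit hI hrows (by omega) hSV h2V (h := h c) (fun r l => by simp) o _ _ hm₄ _ _ _
    fun m₅ o₅ hm₅ => ?_
  obtain ⟨R, hR, h0, h2, _, ho⟩ := hm₅
  -- step to the next tree
  have hS' : sh.base + 8 * (sh.rows * sh.W) = base + 8 * ((n + 1) * (4 * H + 4)) := by
    rw [hbsh, hrows, hWsh]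
  refine good_seq (T := T + 1 + 1) ?_
  obtain ⟨base', hbase'⟩ : ∃ b, b = base + 8 * ((n + 1) * (4 * H + 4)) := ⟨_, rfl⟩
  rw [← hbase'] at hS hS' hVS hK
  have e0 : m₅ 0 = i := (hR.reg 0 (by norm_num)).trans h0
  have e1 : m₅ 1 = base := (hR.reg 1 (by norm_num)).trans (hR.reg_base.trans hbsh)
  have e3 : m₅ 3 = 4 * H + 4 := (hR.reg 3 (by norm_num)).trans (hR.reg_W.trans hWsh)
  have hok₅ := hR.ok.update (a := 1) (v := base') (by omega) (by omega)
  refine good_store (addr := 1) (v := base') hR.ok rfl ?_ ?_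
  · simp only [RamExpr.eval, e1, e3, hI.numPoints, hbase']
  refine good_store (addr := 0) (v := i + 1) hok₅ rfl ?_ ?_
  · simp [RamExpr.eval, e0]
  refine hK c _ o₅ hc ⟨by simp, by simp, fun a ha => ?_, hok₅.update (by omega) hiV, by omega⟩
    fun p => ?_
  · rw [Function.update_of_ne (by omega), Function.update_of_ne (by omega), hR.fresh a (by omega)]
  · rw [ho, List.mem_append, mem_emittedAll]
    refine or_congr_right ⟨?_, ?_⟩
    · rintro ⟨y, _, _, u, _, hu, hp⟩
      exact ⟨u, hu, hp⟩
    · rintro ⟨u, hu, hp⟩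
      obtain ⟨x, hx, hxn, hux⟩ := (hs c hc).visited u hu
      exact ⟨x, hx, hxn, u, hux, hu, hp⟩

end

section

/-! ### The recursion satisfies the equations of the machine -/

variable {X : Type*}

theorem heavyAt_mem_length {T : DataTree X} {c : List ℕ → Bool} {a len : ℕ} {A B : List ℕ → Prop}
    {u : List ℕ} (h : heavyAt T c a len A B u) : u ∈ T.nodes ∧ u.length < a + len := by
  induction len using Nat.strong_induction_on generalizing a A B with
  | _ len ih =>
    rw [heavyAt] at h
    split_ifs at h with h0 h1 h2
    · exact ⟨(ih _ (by omega) h).1, by omega⟩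
    · exact ⟨h.1, by omega⟩
    · have := ih _ (by omega) h
      exact ⟨this.1, by omega⟩

/-- In each interval of levels, the heavy nodes are obtained from those next to the interval. -/
theorem heavyNodes_interval (T : DataTree X) (c : List ℕ → Bool) (q : ℕ) (hq : 1 ≤ q) :
    (interval T.height q).2 ≠ 0 → ∃ A B : List ℕ → Prop,
      (∀ u, (interval T.height q).1 ≤ u.length →
        u.length < (interval T.height q).1 + (interval T.height q).2 →
        (heavyNodes T c u ↔
          heavyAt T c (interval T.height q).1 (interval T.height q).2 A B u)) ∧
      (∀ w, B w ↔ w.length = (interval T.height q).1 + (interval T.height q).2 ∧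
        heavyNodes T c w) ∧
      (∀ w, ((interval T.height q).1 = 0 → A w) ∧ (0 < (interval T.height q).1 →
        w.length = (interval T.height q).1 - 1 → (A w ↔ heavyNodes T c w))) := by
  refine interval_induction (P := fun q => (interval T.height q).2 ≠ 0 → ∃ A B : List ℕ → Prop,
      (∀ u, (interval T.height q).1 ≤ u.length →
        u.length < (interval T.height q).1 + (interval T.height q).2 →
        (heavyNodes T c u ↔
          heavyAt T c (interval T.height q).1 (interval T.height q).2 A B u)) ∧
      (∀ w, B w ↔ w.length = (interval T.height q).1 + (interval T.height q).2 ∧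
        heavyNodes T c w) ∧
      (∀ w, ((interval T.height q).1 = 0 → A w) ∧ (0 < (interval T.height q).1 →
        w.length = (interval T.height q).1 - 1 → (A w ↔ heavyNodes T c w)))) ?_
    (fun q hq ih => ?_) (fun q hq ih => ?_) q hq
  · rw [interval_one]
    intro _
    refine ⟨fun _ => True, fun _ => False, fun u _ _ => Iff.rfl, fun w => ?_, fun w => ?_⟩
    · simp only [zero_add, false_iff, not_and]
      intro h1 h2
      have := T.length_lt_height (heavyAt_mem_length h2).1
      omega
    · simp
  · rw [interval_left _ hq]
    dsimp only
    intro h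
    have hne : (interval T.height q).2 ≠ 0 := by omega
    obtain ⟨A, B, h1, h2, h3⟩ := ih hne
    rw [heavyAt_of_ne_zero T c _ hne] at h1
    beta_reduce at h1
    refine ⟨A, midHeavy T c (interval T.height q).1
      ((interval T.height q).1 + (interval T.height q).2 / 2) A B, fun u hu hul => ?_, fun w => ?_,
        h3⟩
    · rw [h1 u hu (by omega), if_pos hul]
    · constructor
      · intro hw
        have hl := hw.2.1
        refine ⟨hl, (h1 w (by omega) (by omega)).2 ?_⟩
        rwa [if_neg (by omega), if_pos hl]
      · rintro ⟨hl, hw⟩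
        rwa [h1 w (by omega) (by omega), if_neg (by omega), if_pos hl] at hw
  · rw [interval_right _ hq]
    dsimp only
    intro h
    have hne : (interval T.height q).2 ≠ 0 := by omega
    obtain ⟨A, B, h1, h2, h3⟩ := ih hne
    rw [heavyAt_of_ne_zero T c _ hne] at h1
    beta_reduce at h1
    refine ⟨midHeavy T c (interval T.height q).1
      ((interval T.height q).1 + (interval T.height q).2 / 2) A B, B, fun u hu hul => ?_,
      fun w => ?_, fun w => ⟨fun h => absurd h (by omega), fun _ hl => ?_⟩⟩
    · rw [h1 u (by omega) (by omega), if_neg (by omega), if_neg (by omega)]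
    · rw [h2 w]
      have : (interval T.height q).1 + (interval T.height q).2 / 2 + 1 +
        ((interval T.height q).2 - (interval T.height q).2 / 2 - 1) =
        (interval T.height q).1 + (interval T.height q).2 := by omega
      rw [this]
    · rw [h1 w (by omega) (by omega), if_neg (by omega), if_pos (by omega)]

theorem pathCount_le {pth : ℕ → List ℕ} {n : ℕ} (u : List ℕ) : pathCount pth n u ≤ n := by
  refine (Finset.card_filter_le _ _).trans ?_
  simp

theorem pathCount_anti {pth : ℕ → List ℕ} {n : ℕ} {u w : List ℕ} (h : u <+: w) :
    pathCount pth n w ≤ pathCount pth n u := by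
  classical
  exact Finset.card_le_card (Finset.monotone_filter_right _ fun y _ hy => h.trans hy)

/-- The outcome of the recursion satisfies the equations that the program solves. No node outside
the paths is heavy, as its coin is `false`. -/
theorem heavySpec_heavyNodes (T : DataTree X) {pth : ℕ → List ℕ} {n : ℕ} {c : List ℕ → Bool}
    (hp : ∀ x, 1 ≤ x → x ≤ n → pth x ∈ T.nodes)
    (hc : ∀ u, pathCount pth n u = 0 → c u = false) :
    HeavySpec pth n T.height c (heavyNodes T c) where
  visited w hw := by
    have hmem := heavyAt_mem_length hw
    have hacc := heavyAt_accurate (T := T) (c := c) (cnt := fun u => (pathCount pth n u : ℝ))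
      (lo := 0) (hi := n + 1) (a := 0) (len := T.height) (A := fun _ => True) (B := fun _ => False)
      (fun u w h => by exact_mod_cast pathCount_anti h) (fun _ h => h.elim) (fun _ h => h.elim)
      (fun _ _ _ h => absurd trivial h)
      (fun u _ _ _ _ => ⟨fun hu => ?_, fun _ => by
        exact_mod_cast Nat.lt_succ_of_le (pathCount_le u)⟩)
      hmem.1 (Nat.zero_le _) hmem.2
    · have h1 := hacc.1 hw
      exact pathCount_ne_zero.1 (by exact_mod_cast h1.ne')
    · have h1 : pathCount pth n u ≠ 0 := fun h => by simp [hc u h] at hu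
      exact_mod_cast Nat.pos_of_ne_zero h1
  eq q hq h0 x hx hxn hl := by
    obtain ⟨A, B, h1, h2, h3⟩ := heavyNodes_interval T c q hq h0
    have hlen : ((pth x).take (midLevel T.height q)).length = midLevel T.height q := by simp [hl]
    rw [h1 _ (by rw [hlen]; unfold midLevel; omega) (by rw [hlen]; unfold midLevel; omega),
      heavyAt_of_ne_zero T c _ h0]
    dsimp only
    rw [if_neg (by rw [hlen]; unfold midLevel; omega), if_pos (by rw [hlen]; rfl)]
    have hnode : (pth x).take (midLevel T.height q) ∈ T.nodes :=
      T.mem_of_prefix (hp x hx hxn) (List.take_prefix _ _)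
    have htake : ((pth x).take (midLevel T.height q)).take ((interval T.height q).1 - 1) =
        (pth x).take ((interval T.height q).1 - 1) := by
      rw [List.take_take, min_eq_left (by unfold midLevel; omega)]
    unfold midHeavy
    rw [htake]
    have hA : A ((pth x).take ((interval T.height q).1 - 1)) ↔ ((interval T.height q).1 = 0 ∨
        heavyNodes T c ((pth x).take ((interval T.height q).1 - 1))) := by
      obtain ⟨h4, h5⟩ := h3 ((pth x).take ((interval T.height q).1 - 1))
      rcases Nat.eq_zero_or_pos (interval T.height q).1 with h | h
      · exact ⟨fun _ => Or.inl h, fun _ => h4 h⟩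
      · rw [h5 h (by rw [List.length_take, min_eq_left]; unfold midLevel at hl; omega)]
        simp [h.ne']
    have hlen' : ((pth x).take (midLevel T.height q)).length =
        (interval T.height q).1 + (interval T.height q).2 / 2 := hlen
    simp only [hnode, hlen', true_and, hA, h2, and_assoc]

/-! ### The input of the machine -/

/-- The path to the leaf of the `x`-th data point, counted from `1`. -/
def dataPath (T : DataTree X) (D : List X) (x : ℕ) : List ℕ :=
  match D[x - 1]? with
  | none => []
  | some d => T.leafOf d

theorem dataPath_eq (T : DataTree X) {D : List X} {x : ℕ} (hx : 1 ≤ x) (hxn : x ≤ D.length) :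
    dataPath T D x = T.leafOf (D[x - 1]'(by omega)) := by
  rw [dataPath, List.getElem?_eq_getElem (by omega)]

/-- The counts in the trie are the counts of the nodes. -/
theorem count_eq_pathCount (T : DataTree X) (D : List X) (u : List ℕ) :
    T.count D u = pathCount (dataPath T D) D.length u := by
  classical
  induction D using List.reverseRecOn with
  | nil => simp [DataTree.count, pathCount]
  | append_singleton D d ih =>
    have hins : Finset.Icc 1 (D.length + 1) = insert (D.length + 1) (Finset.Icc 1 D.length) := by
      ext y; simp only [Finset.mem_insert, Finset.mem_Icc]; omega
    have hcongr : (Finset.Icc 1 D.length).filter (fun y => u <+: dataPath T (D ++ [d]) y) =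
        (Finset.Icc 1 D.length).filter fun y => u <+: dataPath T D y := by
      refine Finset.filter_congr fun y hy => ?_
      rw [Finset.mem_Icc] at hy
      rw [dataPath_eq T hy.1 (by simp; omega), dataPath_eq T hy.1 hy.2,
        List.getElem_append_left]
    have hlast : dataPath T (D ++ [d]) (D.length + 1) = T.leafOf d := by
      rw [dataPath_eq T (by omega) (by simp)]
      simp
    have ih' := ih
    unfold DataTree.count pathCount at ih' ⊢
    rw [List.countP_append, ih', List.length_append, List.length_singleton, hins,
      Finset.filter_insert, hcongr, hlast]
    by_cases h : u <+: T.leafOf d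
    · rw [if_pos h, Finset.card_insert_of_notMem (by simp)]
      simp [h]
    · rw [if_neg h]
      simp [h]

theorem treeInput_ramInput {k : ℕ} (T : Fin k → DataTree X) (D : List X) (i : Fin k)
    (hT : (T i).IsBinary) :
    TreeInput (ramInput T D) i (T i).height D.length (dataPath (T i) D) where
  numPoints := rfl
  height := by simp [ramInput]
  branch x hx hxn l := by
    rw [dataPath_eq _ hx hxn]
    simp only [ramInput, i.2, dif_pos]
    rw [List.getElem?_eq_getElem (by omega)]
    rfl
  binary x hx hxn l := by
    rw [dataPath_eq _ hx hxn]
    unfold pathBranch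
    by_cases hl : l < ((T i).leafOf D[x - 1]).length
    · rw [List.getElem?_eq_getElem hl]
      have := hT _ ((T i).leafOf_mem D[x - 1]) _ (List.getElem_mem hl)
      dsimp only; omega
    · rw [List.getElem?_eq_none (not_lt.1 hl)]
      simp
  length_lt x hx hxn := by
    rw [dataPath_eq _ hx hxn]
    exact (T i).length_lt_height ((T i).leafOf_mem _)

/-! ### The forest -/

theorem mem_heavySet_update {k : ℕ} {T : Fin k → DataTree X} {M : Fin k → Marking} {i : Fin k}
    (hM : M i = fun _ => none) (c : List ℕ → Bool) (p : ℕ × ℕ) :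
    p ∈ heavySet T (Function.update M i (finalMarking (T i) c)) ↔
      p ∈ heavySet T M ∨ ∃ u, heavyNodes (T i) c u ∧ p = ((i : ℕ), nodeLabel u) := by
  classical
  have hfin : ∀ u, (u ∈ (T i).nodes ∧ finalMarking (T i) c u = some Label.heavy) ↔
      heavyNodes (T i) c u := fun u => by
    unfold finalMarking markBy
    constructor
    · rintro ⟨h1, h2⟩
      rw [if_pos h1] at h2
      by_contra hn
      rw [if_neg hn] at h2
      simp at h2
    · intro h
      have h1 := (heavyAt_mem_length h).1
      exact ⟨h1, by rw [if_pos h1, if_pos h]⟩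
  unfold heavySet
  simp only [Set.mem_ofPred_eq]
  constructor
  · rintro ⟨j, u, h1, h2, h3⟩
    by_cases hj : j = i
    · subst hj
      rw [Function.update_self] at h2
      exact Or.inr ⟨u, (hfin u).1 ⟨h1, h2⟩, h3⟩
    · rw [Function.update_of_ne hj] at h2
      exact Or.inl ⟨j, u, h1, h2, h3⟩
  · rintro (⟨j, u, h1, h2, h3⟩ | ⟨u, h1, h2⟩)
    · have hj : j ≠ i := by
        rintro rfl
        rw [hM] at h2
        simp at h2
      exact ⟨j, u, h1, by rwa [Function.update_of_ne hj], h3⟩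
    · have := (hfin u).2 h1
      exact ⟨i, u, this.1, by rw [Function.update_self]; exact this.2, h2⟩

/-- Treat all trees from the number in register `0` on. -/
def forestLoop : RamProg := .loop (.sub .numTrees (rg 0)) treeProg

/-- The program. -/
def forestProg : RamProg := .seq (.store (.lit 1) (.lit 16)) forestLoop

theorem treeTime_mono (n : ℕ) {H h : ℕ} (hH : H ≤ h) : treeTime n H ≤ treeTime n h := by
  unfold treeTime
  gcongr

/-- The loop over the trees: the trees from number `i` on remain to be treated, and the output so
far consists of the heavy nodes of the marking `M` of the earlier ones. -/
theorem good_forestLoop {k h : ℕ} (T : Fin k → DataTree X) (D : List X) {check : ℕ → PMF Bool}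
    {S V : ℕ} (hh : ∀ i, (T i).height ≤ h) (hbin : ∀ i, (T i).IsBinary) (hSV : S ≤ V)
    (h2V : 2 ^ (h + 1) ≤ V) (hkV : k < V) (hcheck : check 0 = PMF.pure false) (d : ℕ) :
    ∀ (i base : ℕ) (m : ℕ → ℕ) (o : List (ℕ × ℕ)) (M : Fin k → Marking), i + d = k →
      base + d * (8 * ((D.length + 1) * (4 * h + 4))) < S → Idle S V base i m →
      (∀ j : Fin k, i ≤ j → M j = fun _ => none) → (∀ p, p ∈ o ↔ p ∈ heavySet T M) →
      Good check (ramInput T D) S V (d * (treeTime D.length h + 1) + 1)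
        ((sampleAll (fun i => markHeavyHitters (T i) D check [] (T i).height (fun _ => none))
          ((List.finRange k).drop i) M).map (heavySet T)) ⟨[forestLoop], m, o⟩ := by
  induction d with
  | zero =>
    intro i base m o M hi hS hm hM ho
    have hnil : (List.finRange k).drop i = [] := List.drop_eq_nil_of_le (by simp; omega)
    have hset : heavySet T M = {p | p ∈ o} := by
      ext p; exact (ho p).symm
    rw [hnil, sampleAll_nil, PMF.pure_map, hset]
    refine (good_loop_neg ?_ (Good.of_halted hm.ok)).mono (by omega)
    simp only [RamExpr.eval, hm.tree, ramInput]
    omega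
  | succ d ih =>
    intro i base m o M hi hS hm hM ho
    have hik : i < k := by omega
    obtain ⟨j, hj⟩ : ∃ j : Fin k, j = ⟨i, hik⟩ := ⟨_, rfl⟩
    have hji : (j : ℕ) = i := by rw [hj]
    have hcons : (List.finRange k).drop i = j :: (List.finRange k).drop (i + 1) := by
      rw [List.drop_eq_getElem_cons (by simpa using hik), List.getElem_finRange, hj]
      rfl
    have hp : ∀ x, 1 ≤ x → x ≤ D.length → dataPath (T j) D x ∈ (T j).nodes := fun x hx hxn => by
      rw [dataPath_eq _ hx hxn]; exact (T j).leafOf_mem _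
    have hI := treeInput_ramInput T D j (hbin j)
    rw [hji] at hI
    have hsize : 8 * ((D.length + 1) * (4 * (T j).height + 4)) ≤
        8 * ((D.length + 1) * (4 * h + 4)) := by
      have := hh j
      gcongr
    have hS' : base + 8 * ((D.length + 1) * (4 * (T j).height + 4)) +
        d * (8 * ((D.length + 1) * (4 * h + 4))) < S := by
      rw [Nat.succ_mul] at hS; omega
    rw [hcons, sampleAll_cons, markHeavyHitters_eq_coins, PMF.bind_bind, PMF.map_bind]
    simp only [PMF.pure_bind, count_eq_pathCount]
    refine (good_loop_pos (T := d * (treeTime D.length h + 1) + 1 + treeTime D.length (T j).height)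
      ?_ ?_).mono ?_
    · simp only [RamExpr.eval, hm.tree, ramInput]
      omega
    · refine good_tree hI ((T j).one_le_height) hSV
        ((Nat.pow_le_pow_right (by norm_num) (by have := hh j; omega)).trans h2V) hcheck
        (nodup_nodeList (T j)) (fun x hx hxn l => take_leafOf_mem (T j) (hp x hx hxn) l)
        (fun c hc => heavySpec_heavyNodes (T j) hp hc) (by omega) hm (by omega)
        fun c m' o' hc hm' ho' => ?_
      have hMj := hM j (by omega)
      refine ih (i + 1) _ m' o' (Function.update M j (finalMarking (T j) c)) (by omega)
        hS' hm' ?_ ?_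
      · intro j' hj'
        rw [Function.update_of_ne (by rintro rfl; omega)]
        exact hM j' (by omega)
      · intro p
        rw [ho', mem_heavySet_update hMj, ho, hji]
    · have := treeTime_mono D.length (hh j)
      rw [Nat.succ_mul]; omega

theorem out_length_le {check : ℕ → PMF Bool} {I : RamInput} (t : ℕ) (c : RamConfig) :
    ∀ c' ∈ (ramRun check I t c).support, c'.out.length ≤ c.out.length + t := by
  induction t generalizing c with
  | zero =>
    intro c' hc'
    rw [ramRun, PMF.mem_support_pure_iff] at hc'
    rw [hc']; omega
  | succ t ih =>
    intro c' hc'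
    rw [ramRun, PMF.mem_support_bind_iff] at hc'
    obtain ⟨c₁, hc₁, hc'⟩ := hc'
    have h1 := ih c₁ c' hc'
    have h2 : c₁.out.length ≤ c.out.length + 1 := by
      obtain ⟨K, m, o⟩ := c
      rcases K with _ | ⟨p, K⟩
      · rw [ramStep, PMF.mem_support_pure_iff] at hc₁
        simp [hc₁]
      · cases p with
        | check a e =>
          rw [ramStep, PMF.mem_support_bind_iff] at hc₁
          obtain ⟨b, _, hb⟩ := hc₁
          rw [PMF.mem_support_pure_iff] at hb
          simp [hb]
        | _ =>
          rw [ramStep, PMF.mem_support_pure_iff] at hc₁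
          simp [hc₁]
    omega

theorem ramRun_add {check : ℕ → PMF Bool} {I : RamInput} (s t : ℕ) (c : RamConfig) :
    ramRun check I (s + t) c = (ramRun check I s c).bind (ramRun check I t) := by
  induction s generalizing c with
  | zero => rw [Nat.zero_add, ramRun, PMF.pure_bind]
  | succ s ih =>
    rw [Nat.succ_add, ramRun, ramRun, PMF.bind_bind]
    congr 1
    funext c'
    exact ih c'

theorem Good.out_length_le {check : ℕ → PMF Bool} {I : RamInput} {S V T : ℕ}
    {ν : PMF (Set (ℕ × ℕ))} {c : RamConfig} (h : Good check I S V T ν c) (t : ℕ) :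
    ∀ c' ∈ (ramRun check I t c).support, c'.out.length ≤ c.out.length + T := by
  intro c' hc'
  rcases Nat.le_total t T with hle | hle
  · exact (HeavyHitters.out_length_le t c c' hc').trans (by omega)
  · obtain ⟨s, rfl⟩ := Nat.exists_eq_add_of_le hle
    rw [ramRun_add, PMF.mem_support_bind_iff] at hc'
    obtain ⟨c₁, hc₁, hc'⟩ := hc'
    have h1 := h.halt T le_rfl c₁ hc₁
    obtain ⟨K, m, o⟩ := c₁
    dsimp only at h1
    subst h1
    rw [ramRun_halted, PMF.mem_support_pure_iff] at hc'
    rw [hc']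
    exact HeavyHitters.out_length_le T c _ hc₁

/-- The steps and the memory cells for all trees, with some slack in the constant. -/
theorem forestTime_le {k n h : ℕ} (hk : 1 ≤ k) (hn : 1 ≤ n) (hh : 1 ≤ h) :
    k * (treeTime n h + 1) + 3 ≤ 1000 * (k * n * h) ∧
      16 + k * (8 * ((n + 1) * (4 * h + 4))) < 1000 * (k * n * h) := by
  obtain ⟨k, rfl⟩ := Nat.exists_eq_add_of_le hk
  obtain ⟨n, rfl⟩ := Nat.exists_eq_add_of_le hn
  obtain ⟨h, rfl⟩ := Nat.exists_eq_add_of_le hh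
  unfold treeTime
  constructor
  · ring_nf
    nlinarith [Nat.zero_le (k * n), Nat.zero_le (k * h), Nat.zero_le (n * h),
      Nat.zero_le (k * n * h)]
  · ring_nf
    nlinarith [Nat.zero_le (k * n), Nat.zero_le (k * h), Nat.zero_le (n * h),
      Nat.zero_le (k * n * h)]

/-- The program simulates the algorithm within the required bounds. -/
theorem forestProg_correct {k h : ℕ} (T : Fin k → DataTree X) (D : List X) {σ τ Δ : ℝ}
    (hk : 1 ≤ k) (hh : ∀ i, (T i).height ≤ h) (hbin : ∀ i, (T i).IsBinary) (hD : D ≠ [])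
    (hτ : 1 + Δ ≤ τ) :
    RunsWithin forestProg (gaussianSparseThreshold σ τ Δ) (ramInput T D)
      (1000 * (k * D.length * h)) (1000 * (k * D.length * h))
      (1000 * (h + Nat.log 2 (k * D.length) + 1)) ∧
    (ramRun (gaussianSparseThreshold σ τ Δ) (ramInput T D) (1000 * (k * D.length * h))
        (ramInit forestProg)).map (fun c => {p | p ∈ c.out}) =
      (buildForest σ τ Δ T D).map (heavySet T) := by
  have hn : 1 ≤ D.length := List.length_pos_iff.2 hD
  have hh1 : 1 ≤ h := ((T ⟨0, hk⟩).one_le_height).trans (hh _)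
  obtain ⟨htime, hspace⟩ := forestTime_le hk hn hh1
  obtain ⟨S, hS⟩ : ∃ S, S = 1000 * (k * D.length * h) := ⟨_, rfl⟩
  obtain ⟨V, hV⟩ : ∃ V, V = 2 ^ (1000 * (h + Nat.log 2 (k * D.length) + 1)) := ⟨_, rfl⟩
  have hSV : S ≤ V := by
    have h1 : k * D.length ≤ 2 ^ (Nat.log 2 (k * D.length) + 1) :=
      (Nat.lt_pow_succ_log_self (by norm_num) _).le
    have h2 : h ≤ 2 ^ h := Nat.lt_two_pow_self.le
    have h3 : 1000 ≤ 2 ^ 10 := by norm_num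
    calc S = 1000 * (k * D.length * h) := hS
      _ ≤ 2 ^ 10 * (2 ^ (Nat.log 2 (k * D.length) + 1) * 2 ^ h) := by gcongr
      _ = 2 ^ (10 + (Nat.log 2 (k * D.length) + 1 + h)) := by rw [← pow_add, ← pow_add]
      _ ≤ V := by
        rw [hV]
        exact Nat.pow_le_pow_right (by norm_num) (by omega)
  have h2V : 2 ^ (h + 1) ≤ V := by
    rw [hV]
    exact Nat.pow_le_pow_right (by norm_num) (by omega)
  have hkS : k < S := by
    have : k ≤ k * (8 * ((D.length + 1) * (4 * h + 4))) :=
      Nat.le_mul_of_pos_right _ (by positivity)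
    omega
  have hcheck : gaussianSparseThreshold σ τ Δ 0 = PMF.pure false :=
    gaussianSparseThreshold_of_le (by push_cast; linarith)
  have hok : MemOk S V fun _ => 0 := fun a =>
    ⟨fun h => absurd rfl h, Nat.zero_lt_of_lt (hkS.trans_le hSV)⟩
  have hgood : Good (gaussianSparseThreshold σ τ Δ) (ramInput T D) S V S
      ((buildForest σ τ Δ T D).map (heavySet T)) (ramInit forestProg) := by
    have hloop := good_forestLoop T D (S := S) (V := V) hh hbin hSV h2V (by omega) hcheck k 0 16
      (Function.update (fun _ => 0) 1 16) [] (fun _ _ => none) (by omega) (by omega)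
      ⟨by simp, by simp, fun a ha => by rw [Function.update_of_ne (by omega)],
        hok.update (by omega) (by omega), le_rfl⟩ (fun _ _ => rfl) (fun p => by simp [heavySet])
    rw [List.drop_zero, ← buildForest_eq_sampleAll] at hloop
    have h1 : Good (gaussianSparseThreshold σ τ Δ) (ramInput T D) S V _ _
        ⟨[.store (.lit 1) (.lit 16), forestLoop], fun _ => 0, []⟩ :=
      good_store hok rfl rfl hloop
    exact (good_seq (K := []) h1).mono (by omega)
  rw [← hS]
  refine ⟨⟨hgood.halt S le_rfl, fun t c hc => ⟨?_, ?_⟩⟩, hgood.law S le_rfl⟩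
  · rw [← hV]
    exact hgood.ok t c hc
  · have := hgood.out_length_le t c hc
    simpa [ramInit] using this

end

end HeavyHitters

end

theorem mainTheorem1 :
    -- privacy
    (∀ {X : Type*} (k h : ℕ) (T : Fin k → DataTree X) (σ τ Δ ε δ : ℝ),
      1 ≤ k → (∀ i, (T i).height ≤ h) → 0 < σ → 0 ≤ ε →
      DeltaCondition σ Δ ε δ (k * (1 + Nat.log 2 h)) →
      IsDP (buildForest σ τ Δ T) ε δ) ∧
    -- accuracy
    (∀ {X : Type*} (k h : ℕ) (T : Fin k → DataTree X) (D : List X) (σ τ Δ β α : ℝ),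
      1 ≤ k → (∀ i, (T i).height ≤ h) → D ≠ [] → 0 < σ → 0 ≤ Δ → 0 < β → 1 + Δ ≤ τ →
      α = σ * √(2 * Real.log (2 * k * D.length * (Nat.clog 2 (h + 1) : ℕ) / β)) →
      ENNReal.ofReal (1 - β) ≤ (buildForest σ τ Δ T D).toOuterMeasure
        {M | ∀ i, ∀ u ∈ (T i).nodes,
          (((T i).count D u : ℝ) ≤ τ - α → M i u = some Label.light) ∧
          (τ + α ≤ ((T i).count D u : ℝ) → M i u = some Label.heavy)}) ∧
    -- running time and space of the variant that returns the heavy nodes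
    (∃ (prog : RamProg) (C : ℕ),
      ∀ {X : Type*} (k h : ℕ) (T : Fin k → DataTree X) (D : List X) (σ τ Δ : ℝ),
        1 ≤ k → (∀ i, (T i).height ≤ h) → (∀ i, (T i).IsBinary) → D ≠ [] →
        0 < σ → 1 + Δ ≤ τ →
        RunsWithin prog (gaussianSparseThreshold σ τ Δ) (ramInput T D)
          (C * (k * D.length * h)) (C * (k * D.length * h))
          (C * (h + Nat.log 2 (k * D.length) + 1)) ∧
        (ramRun (gaussianSparseThreshold σ τ Δ) (ramInput T D) (C * (k * D.length * h))
            (ramInit prog)).map (fun c => {p | p ∈ c.out}) =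
          (buildForest σ τ Δ T D).map (heavySet T)) := by
  refine ⟨fun k h T σ τ Δ ε δ _ hh hσ hε hδ => buildForest_isDP k h T σ τ Δ ε δ hh hσ hε hδ,
    fun k h T D σ τ Δ β α hk hh hD hσ hΔ hβ hτ hα =>
      buildForest_accuracy k h T D σ τ Δ β α hk hh hD hσ hΔ hβ hτ hα, forestProg, 1000,
    fun k h T D σ τ Δ hk hh hbin hD _ hτ => forestProg_correct T D hk hh hbin hD hτ⟩
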